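/- Let $d\ge 0$, and let $g=(g_{ij})$ be a smooth Riemannian metric on coordinate space $\mathbb R^d$, $L=(L^{ij})$ a smooth matrix field and $U$ a smooth function. Write $\sqrt g=\sqrt{\det(g_{ij})}$, $d\mu(x)=dx^1\cdots dx^d$, $dv=\sqrt g\,d\mu$, $B^{ij}=\tfrac12(L^{ij}+L^{ji})$ and $$F^i=\frac1{\sqrt g}\,\partial_k\big(\sqrt g\,L^{ik}\big)-L^{ik}\partial_kU .$$ Assume that $B$ is uniformly positive definite and bounded together with all its derivatives, and that all derivatives of $F$ of order $\ge 1$ are bounded. Let $G(x|x_0;t)\ge 0$ be a Green's function (transition probability) of the covariant Fokker–Planck operator $$\hat L_{\rm FP}\,p=\frac1{\sqrt g}\,\partial_i\big(\sqrt g\,L^{ij}(\partial_j p+(\partial_jU)\,p)\big),$$ that is, for every $x_0$, $G$ is a nonnegative solution, of class $C^2$ in $(t,x)$, of $\partial_tG=\hat L_{\rm FP}G$ for $t>0$, its mass $\int G\,dv$ is finite and bounded on bounded time intervals, and $\int fG(\cdot|x_0;t)\,dv\to f(x_0)$ as $t\to0^+$ for all continuous compactly supported $f$. For a kernel $p(x|x_0;\Delta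 t)$ (a density with respect to $d\mu(x)$) and $\Delta x=x-x_0$, its moments are $\int\Delta x^{i_1}\cdots\Delta x^{i_M}\,p(x|x_0;\Delta t)\,d\mu(x)$, $M\ge0$. Two kernels are *equivalent* if for every $x_0$ each of their moments exists for all small $\Delta t>0$ and the moments differ by $o(\Delta t)$ as $\Delta t\to0^+$. A kernel $p$ is a *representation* of $G$ if, for all $x_0$, $t>0$ and all indices, the moment $\int (x_N-x_0)^{i_1}\cdots(x_N-x_0)^{i_M}\prod_{k=0}^{N-1}p(x_{k+1}|x_k;t/N)\,d\mu(x_1)\cdots d\mu(x_N)$ converges absolutely for all large $N$ and tends, as $N\to\infty$, to the corresponding (absolutely convergent) moment of $G(x|x_0;t)\,dv(x)$. Then the following hold. 1. The moments of $G(x|x_0;\Delta t)\,dv(x)$ satisfy $\langle1\rangle=1+O(\Delta t^2)$, $\langle\Delta x^i\rangle=F^i(x_0)\Delta t+O(\Delta t^2)$, $\langle\Delta x^i\Delta x^j\rangle=2B^{ij}(x_0)\Delta t+O(\Delta t^2)$, and all moments of order $M\ge3$ are $O(\Delta t^2)$. 2. (Gaussian representation.) The kernel $$\frac{e^{-A^0}}{\sqrt{(4\pi\Delta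 t)^d\det B(x_0)}},\qquad A^0=\big[\Delta x^i-\Delta t\,F^i(x_0)\big]\frac{B^{-1}_{ij}(x_0)}{4\Delta t}\big[\Delta x^j-\Delta t\,F^j(x_0)\big],$$ has all moments, total mass $1$, mean $\langle\Delta x\rangle=F(x_0)\Delta t$ and covariance $2B(x_0)\Delta t$; it is a representation of $G$ and is equivalent to $G\sqrt g$. 3. (One-parameter family.) For every $\alpha\in[0,1]$, with $x_\alpha=x_0+\alpha\Delta x$, the kernel $e^{-A^\alpha}/\sqrt{(4\pi\Delta t)^d\det B(x_\alpha)}$ with $$A^\alpha=\big[\Delta x^i-\Delta t(F^i-2\alpha\partial_kB^{ik})(x_\alpha)\big]\frac{B^{-1}_{ij}(x_\alpha)}{4\Delta t}\big[\Delta x^j-\Delta t(F^j-2\alpha\partial_lB^{jl})(x_\alpha)\big]+\alpha(\partial_iF^i)(x_\alpha)\Delta t-\alpha^2(\partial_i\partial_jB^{ij})(x_\alpha)\Delta t$$ is a representation of $G$, and is equivalent to $G\sqrt g$ and to the Gaussian kernel. 4. (Two-parameter family.) For all $\alpha_1,\alpha_2\in[0,1]$, with $x_{\alpha_r}=x_0+\alpha_r\Delta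 x$, the kernel $e^{-A^{\alpha_1,\alpha_2}}/\sqrt{(4\pi\Delta t)^d\det B(x_{\alpha_1})}$ with $$A^{\alpha_1,\alpha_2}=\alpha_2\,\partial_iF^i(x_{\alpha_2})\Delta t-\alpha_1^2\,\partial_i\partial_jB^{ij}(x_{\alpha_1})\Delta t+w^i\,\frac{B^{-1}_{ij}(x_{\alpha_1})}{4\Delta t}\,w^j,\qquad w^i=\Delta x^i-F^i(x_{\alpha_2})\Delta t+2\alpha_1\partial_kB^{ik}(x_{\alpha_1})\Delta t,$$ is a representation of $G$, and is equivalent to $G\sqrt g$ and to the Gaussian kernel. Moreover, any two kernels of the one-parameter family are equivalent, and so are any two kernels of the two-parameter family. -/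

import Mathlib

open MeasureTheory Filter Topology Asymptotics
open scoped ContDiff

noncomputable section

namespace CovariantFP

/-- Coordinate space of dimension `d`; its `volume` is `dμ(x) = dx¹ ⋯ dxᵈ`. -/
abbrev Coord (d : ℕ) : Type := Fin d → ℝ

/-- The partial derivative `∂ᵢ f` at `x`. -/
def pd {d : ℕ} (i : Fin d) (f : Coord d → ℝ) (x : Coord d) : ℝ :=
  fderiv ℝ f x (Pi.single i 1)

/-- `√g(x)`, where `g(x) = det (g_{ij}(x))`; the invariant volume is `dv = √g dμ`. -/
def sqrtDet {d : ℕ} (g : Coord d → Matrix (Fin d) (Fin d) ℝ) (x : Coord d) : ℝ :=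
  Real.sqrt (g x).det

/-- The covariant Fokker–Planck operator
`p ↦ g^{-1/2} ∂ᵢ (√g L^{ij} (∂ⱼ p + (∂ⱼ U) p))`. -/
def fokkerPlanck {d : ℕ} (g L : Coord d → Matrix (Fin d) (Fin d) ℝ) (U : Coord d → ℝ)
    (p : Coord d → ℝ) (x : Coord d) : ℝ :=
  (sqrtDet g x)⁻¹ *
    ∑ i, ∑ j, pd i (fun y => sqrtDet g y * L y i j * (pd j p y + pd j U y * p y)) x

/-- The drift `Fⁱ = g^{-1/2} ∂ₖ (√g L^{ik}) - L^{ik} ∂ₖ U`. -/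
def drift {d : ℕ} (g L : Coord d → Matrix (Fin d) (Fin d) ℝ) (U : Coord d → ℝ)
    (i : Fin d) (x : Coord d) : ℝ :=
  (sqrtDet g x)⁻¹ * ∑ k, pd k (fun y => sqrtDet g y * L y i k) x - ∑ k, L x i k * pd k U x

/-- `B`, the symmetric part of `L`. -/
def symPart {d : ℕ} (L : Coord d → Matrix (Fin d) (Fin d) ℝ) (x : Coord d) :
    Matrix (Fin d) (Fin d) ℝ :=
  (1 / 2 : ℝ) • (L x + (L x).transpose)

/-- Standing assumptions: `g` is a smooth Riemannian metric, `L` and `U` are smooth, `B` is uniformly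
positive definite and bounded together with all its derivatives, and all derivatives of order at
least one of the drift `F` are bounded (so `F` itself may grow linearly). -/
structure RegularCoefficients {d : ℕ} (g L : Coord d → Matrix (Fin d) (Fin d) ℝ)
    (U : Coord d → ℝ) : Prop where
  smooth_g : ∀ i j, ContDiff ℝ ∞ (fun x => g x i j)
  smooth_L : ∀ i j, ContDiff ℝ ∞ (fun x => L x i j)
  smooth_U : ContDiff ℝ ∞ U
  posDef_g : ∀ x, (g x).PosDef
  elliptic : ∃ c : ℝ, 0 < c ∧ ∀ (x : Coord d) (v : Fin d → ℝ),
    c * ∑ i, v i ^ 2 ≤ ∑ i, ∑ j, v i * symPart L x i j * v j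
  bounded_B : ∀ (i j : Fin d) (n : ℕ), ∃ C : ℝ, ∀ x,
    ‖iteratedFDeriv ℝ n (fun y => symPart L y i j) x‖ ≤ C
  bounded_F : ∀ (i : Fin d) (n : ℕ), 1 ≤ n → ∃ C : ℝ, ∀ x,
    ‖iteratedFDeriv ℝ n (drift g L U i) x‖ ≤ C

/-- `G t x₀ x = G(x | x₀; t)` is the Green's function `e^{t L_FP} δ(x, x₀)` of the Fokker–Planck
equation: for each `x₀`, a nonnegative classical solution of `∂ₜ G = L_FP G` for `t > 0`, whose total
mass with respect to `dv` is finite and bounded on bounded time intervals, and which converges to the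
covariant delta function at `x₀` as `t → 0+`. -/
structure IsGreenFunction {d : ℕ} (g L : Coord d → Matrix (Fin d) (Fin d) ℝ) (U : Coord d → ℝ)
    (G : ℝ → Coord d → Coord d → ℝ) : Prop where
  nonneg : ∀ x₀ t x, 0 < t → 0 ≤ G t x₀ x
  regular : ∀ x₀, ContDiffOn ℝ 2 (fun z : ℝ × Coord d => G z.1 x₀ z.2)
    (Set.Ioi (0 : ℝ) ×ˢ Set.univ)
  equation : ∀ x₀ t x, 0 < t →
    HasDerivAt (fun s => G s x₀ x) (fokkerPlanck g L U (G t x₀) x) t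
  integrable : ∀ x₀ t, 0 < t → Integrable (fun x => sqrtDet g x * G t x₀ x)
  mass_bounded : ∀ x₀ (T : ℝ), ∃ C : ℝ, ∀ t, 0 < t → t ≤ T →
    ∫ x, sqrtDet g x * G t x₀ x ≤ C
  initial : ∀ x₀ (f : Coord d → ℝ), Continuous f → HasCompactSupport f →
    Tendsto (fun t => ∫ x, f x * (sqrtDet g x * G t x₀ x)) (𝓝[>] 0) (𝓝 (f x₀))

/-- A time-slice transition density `p Δt x₀ x`, from `x₀` to `x` in time `Δt`, with respect to
`dμ(x)`. -/
abbrev SliceKernel (d : ℕ) : Type := ℝ → Coord d → Coord d → ℝ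

/-- The exact transition probability: the density of `dv(x) G(x | x₀; Δt)` with respect to
`dμ(x)`. -/
def exactKernel {d : ℕ} (g : Coord d → Matrix (Fin d) (Fin d) ℝ)
    (G : ℝ → Coord d → Coord d → ℝ) : SliceKernel d :=
  fun t x₀ x => sqrtDet g x * G t x₀ x

/-- The interpolation point `x_α = x₀ + α (x - x₀)`. -/
def interp {d : ℕ} (α : ℝ) (x₀ x : Coord d) : Coord d := x₀ + α • (x - x₀)

/-- `wᵀ B(z)⁻¹ w / (4 Δt)`. -/
def kinetic {d : ℕ} (L : Coord d → Matrix (Fin d) (Fin d) ℝ) (t : ℝ) (z : Coord d)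
    (w : Fin d → ℝ) : ℝ :=
  ∑ i, ∑ j, w i * ((symPart L z)⁻¹ i j / (4 * t)) * w j

/-- The prefactor `1 / √((4π Δt)ᵈ det B(z))`. -/
def prefactor {d : ℕ} (L : Coord d → Matrix (Fin d) (Fin d) ℝ) (t : ℝ) (z : Coord d) : ℝ :=
  1 / Real.sqrt ((4 * Real.pi * t) ^ d * (symPart L z).det)

/-- The Gaussian time-slice action `A⁰`. -/
def action0 {d : ℕ} (g L : Coord d → Matrix (Fin d) (Fin d) ℝ) (U : Coord d → ℝ)
    (t : ℝ) (x₀ x : Coord d) : ℝ :=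
  kinetic L t x₀ (fun i => (x i - x₀ i) - t * drift g L U i x₀)

/-- The time-slice action `A^α`; all functions are evaluated at `x_α`. -/
def actionOne {d : ℕ} (g L : Coord d → Matrix (Fin d) (Fin d) ℝ) (U : Coord d → ℝ)
    (α t : ℝ) (x₀ x : Coord d) : ℝ :=
  kinetic L t (interp α x₀ x) (fun i => (x i - x₀ i) -
      t * (drift g L U i (interp α x₀ x)
        - 2 * α * ∑ k, pd k (fun y => symPart L y i k) (interp α x₀ x)))
    + α * (∑ i, pd i (drift g L U i) (interp α x₀ x)) * t
    - α ^ 2 * (∑ i, ∑ j, pd i (pd j (fun y => symPart L y i j)) (interp α x₀ x)) * t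

/-- The time-slice action `A^{α₁,α₂}`; `B` is evaluated at `x_{α₁}` and `F` at `x_{α₂}`. -/
def actionTwo {d : ℕ} (g L : Coord d → Matrix (Fin d) (Fin d) ℝ) (U : Coord d → ℝ)
    (α₁ α₂ t : ℝ) (x₀ x : Coord d) : ℝ :=
  α₂ * (∑ i, pd i (drift g L U i) (interp α₂ x₀ x)) * t
    - α₁ ^ 2 * (∑ i, ∑ j, pd i (pd j (fun y => symPart L y i j)) (interp α₁ x₀ x)) * t
    + kinetic L t (interp α₁ x₀ x) (fun i => (x i - x₀ i)
      - drift g L U i (interp α₂ x₀ x) * t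
      + 2 * α₁ * (∑ k, pd k (fun y => symPart L y i k) (interp α₁ x₀ x)) * t)

/-- The Gaussian kernel. -/
def gaussianKernel {d : ℕ} (g L : Coord d → Matrix (Fin d) (Fin d) ℝ) (U : Coord d → ℝ) :
    SliceKernel d :=
  fun t x₀ x => prefactor L t x₀ * Real.exp (-action0 g L U t x₀ x)

/-- The `α`-kernel. -/
def alphaKernel {d : ℕ} (g L : Coord d → Matrix (Fin d) (Fin d) ℝ) (U : Coord d → ℝ) (α : ℝ) :
    SliceKernel d :=
  fun t x₀ x => prefactor L t (interp α x₀ x) * Real.exp (-actionOne g L U α t x₀ x)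

/-- The `(α₁, α₂)`-kernel. -/
def twoAlphaKernel {d : ℕ} (g L : Coord d → Matrix (Fin d) (Fin d) ℝ) (U : Coord d → ℝ)
    (α₁ α₂ : ℝ) : SliceKernel d :=
  fun t x₀ x => prefactor L t (interp α₁ x₀ x) * Real.exp (-actionTwo g L U α₁ α₂ t x₀ x)

/-- The monomial `Δx^{i₁} ⋯ Δx^{i_M}` with `Δx = x - x₀`. -/
def monomial {d M : ℕ} (I : Fin M → Fin d) (x₀ x : Coord d) : ℝ :=
  ∏ k, (x (I k) - x₀ (I k))

/-- The moment `⟨Δx^{i₁} ⋯ Δx^{i_M}⟩` of a time-slice kernel. -/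
def moment {d M : ℕ} (p : SliceKernel d) (t : ℝ) (x₀ : Coord d) (I : Fin M → Fin d) : ℝ :=
  ∫ x, monomial I x₀ x * p t x₀ x

/-- Two time-slice kernels are equivalent: from every initial point all moments exist for small `Δt`
and agree up to order `Δt`, that is, with an error `o(Δt)`. -/
def MomentEquivalent {d : ℕ} (p q : SliceKernel d) : Prop :=
  ∀ (x₀ : Coord d) (M : ℕ) (I : Fin M → Fin d),
    (∀ᶠ t in 𝓝[>] (0 : ℝ), Integrable (fun x => monomial I x₀ x * p t x₀ x) ∧
      Integrable (fun x => monomial I x₀ x * q t x₀ x)) ∧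
    (fun t => moment p t x₀ I - moment q t x₀ I) =o[𝓝[>] (0 : ℝ)] (fun t => t)

/-- The weight `∏ₖ p(x_{k+1} | x_k; Δt)` of the discretized path `x₀, γ 0, …, γ N`, which consists of
`N + 1` slices. -/
def pathWeight {d : ℕ} (p : SliceKernel d) (N : ℕ) (dt : ℝ) (x₀ : Coord d)
    (γ : Fin (N + 1) → Coord d) : ℝ :=
  ∏ k : Fin (N + 1), p dt ((Fin.cons x₀ γ : Fin (N + 2) → Coord d) k.castSucc) (γ k)

/-- A time-slice kernel `p` represents the transition density `q`: for every `t > 0` and `x₀`, all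
moments of the displacement over time `t`, computed from the time-slicing path integral with `N + 1`
slices of duration `t / (N + 1)`, converge to the exact moments in the continuum limit. -/
def IsRepresentation {d : ℕ} (p q : SliceKernel d) : Prop :=
  ∀ (x₀ : Coord d) (t : ℝ), 0 < t → ∀ (M : ℕ) (I : Fin M → Fin d),
    Integrable (fun x => monomial I x₀ x * q t x₀ x) ∧
    (∀ᶠ N : ℕ in atTop, Integrable (fun γ : Fin (N + 1) → Coord d =>
      monomial I x₀ (γ (Fin.last N)) * pathWeight p N (t / (N + 1)) x₀ γ)) ∧
    Tendsto (fun N : ℕ => ∫ γ : Fin (N + 1) → Coord d,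
      monomial I x₀ (γ (Fin.last N)) * pathWeight p N (t / (N + 1)) x₀ γ) atTop
      (𝓝 (moment q t x₀ I))

end CovariantFP

end

noncomputable section

namespace CovariantFP

/-! ### Families of smooth functions with uniform bounds on all derivatives -/

/-! Everything is governed by the backward operator `gen`, the adjoint of the Fokker–Planck operator
with respect to `dv`. Both the exact transition density and each time-slice kernel advance a test
function `f` over a short time `Δt` to `f + Δt · gen f` up to an error `o(Δt)`. Equivalence of
kernels is this statement for monomials, and representation is its accumulation over many slices.

The exact density. Integration by parts and the initial condition make the Green's function a weak
solution: `∫ f q_t = f(x₀) + ∫₀ᵗ ∫ gen f q_r dr` for compactly supported `f`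
(`IsGreenFunction.weakSolution`). To insert monomials one needs moment bounds. They come from
Grönwall's inequality for bounded truncations of a polynomial weight, uniform in the truncation,
followed by Fatou's lemma (`WeakSolution.moment_bound`). The test functions may then grow
polynomially, and applying the identity twice gives the `O(t²)` expansion `WeakSolution.expansion`,
hence the exact moments.

The kernels. The Gaussian kernel is the member `(0, 0)` of the two-parameter family and the
`α`-kernel is its member `(α, α)`, so one computation suffices. Put `Δt = s²` and centre `x` at the
point `x₀ + m` where the shifted displacement `w` vanishes. With `x = x₀ + m + sη` the kernel
becomes a Gaussian in `η` whose covariance is taken at a point moved by `αsη`, times the exponential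
of a small term (`sliceKernel_peak`). Expanding in `s` and integrating against Gaussian moments, the
correction terms in the action are exactly those that give total mass `1 + O(s³)`. The shift `-2α
∂ₖB^{ik}` of the drift compensates the bias created by the moving covariance
(`Admissible.exists_slice_moments`). The outcome is `IsConsistent`: moments of order zero, one and
two match up to `O(s³)`, and weighted moments are under control. Second-order Taylor expansion then
gives consistency with `gen` (`IsConsistent.stepOp_sub_gen_bound`).

From local to global. The usual telescoping argument compares the iterates with the solution of the
backward equation and needs bounds for its derivatives. In place of this parabolic regularity theory
an auxiliary scheme is used, a random walk with steps `hF ± √h b_r`, where the fields `b_r` come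
from a smooth factorization of `B` (`Admissible.exists_sum_of_squares`). Its iterates are averages
of `f` over compositions of smooth maps. The derivatives of these compositions are controlled by a
homogeneous Lyapunov function that grows by a factor `1 + O(h)` per step, so all derivatives of the
iterates are polynomially bounded uniformly in `h` (`growth_walk_iterate`,
`Admissible.exists_scheme`).

Both the iterated kernel and the exact expectation are then compared with the walk. Each comparison
has local errors `O(s³)` over `t/s²` steps and is therefore within `O(s)`. The difference of the two
tends to zero (`IsConsistent.tendsto_iterate`). No existence, uniqueness or regularity theorem for
the parabolic equation enters. Fubini's theorem identifies the path integral with the iterated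
operator (`IsConsistent.integral_path`). -/

/-- The family `u` is smooth and, for each order, its derivatives are bounded by a constant if
`j = 0` and by a polynomial if `j = 1`, uniformly over the family. -/
def Growth {ι : Type*} {d : ℕ} (j : ℕ) (u : ι → Coord d → ℝ) : Prop :=
  (∀ i, ContDiff ℝ ∞ (u i)) ∧
    ∀ n : ℕ, ∃ (C : ℝ) (k : ℕ), ∀ i x, ‖iteratedFDeriv ℝ n (u i) x‖ ≤ C * (1 + ‖x‖) ^ (j * k)

variable {ι κ : Type*} {d : ℕ} {j : ℕ}

lemma one_le_one_add_norm (x : Coord d) : 1 ≤ 1 + ‖x‖ := by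
  linarith [norm_nonneg x]

lemma one_le_weight (x : Coord d) (k : ℕ) : 1 ≤ (1 + ‖x‖) ^ k :=
  one_le_pow₀ (one_le_one_add_norm x)

lemma weight_mono (x : Coord d) {k l : ℕ} (h : k ≤ l) : (1 + ‖x‖) ^ k ≤ (1 + ‖x‖) ^ l :=
  pow_le_pow_right₀ (one_le_one_add_norm x) h

/-- Up to any finite order, the derivatives admit a common bound. -/
lemma Growth.bound {u : ι → Coord d → ℝ} (hu : Growth j u) (N : ℕ) :
    ∃ (C : ℝ) (k : ℕ), 0 ≤ C ∧ ∀ n ≤ N, ∀ i x,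
      ‖iteratedFDeriv ℝ n (u i) x‖ ≤ C * (1 + ‖x‖) ^ (j * k) := by
  induction N with
  | zero =>
    obtain ⟨C, k, h⟩ := hu.2 0
    refine ⟨|C|, k, abs_nonneg C, fun n hn i x => ?_⟩
    obtain rfl : n = 0 := by omega
    exact (h i x).trans (by gcongr; exact le_abs_self C)
  | succ N ih =>
    obtain ⟨C₁, k₁, h0, h₁⟩ := ih
    obtain ⟨C, k, h⟩ := hu.2 (N + 1)
    refine ⟨C₁ + |C|, k₁ + k, by positivity, fun n hn i x => ?_⟩
    have e1 : (1 + ‖x‖) ^ (j * k₁) ≤ (1 + ‖x‖) ^ (j * (k₁ + k)) :=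
      weight_mono x (Nat.mul_le_mul_left _ (by omega))
    have e2 : (1 + ‖x‖) ^ (j * k) ≤ (1 + ‖x‖) ^ (j * (k₁ + k)) :=
      weight_mono x (Nat.mul_le_mul_left _ (by omega))
    have e3 : 0 ≤ (1 + ‖x‖) ^ (j * (k₁ + k)) := by positivity
    rcases Nat.lt_or_ge N n with hlt | hle
    · obtain rfl : n = N + 1 := by omega
      calc _ ≤ C * (1 + ‖x‖) ^ (j * k) := h i x
        _ ≤ |C| * (1 + ‖x‖) ^ (j * (k₁ + k)) := by gcongr; exact le_abs_self C
        _ ≤ _ := by nlinarith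
    · calc _ ≤ C₁ * (1 + ‖x‖) ^ (j * k₁) := h₁ n hle i x
        _ ≤ C₁ * (1 + ‖x‖) ^ (j * (k₁ + k)) := by gcongr
        _ ≤ _ := by nlinarith [mul_nonneg (abs_nonneg C) e3]

lemma Growth.mono {u : ι → Coord d → ℝ} (hu : Growth 0 u) : Growth j u := by
  refine ⟨hu.1, fun n => ?_⟩
  obtain ⟨C, k, h⟩ := hu.2 n
  exact ⟨C, 0, by simpa using h⟩

lemma Growth.comp_index {u : ι → Coord d → ℝ} (hu : Growth j u) (f : κ → ι) :
    Growth j (fun i => u (f i)) := by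
  refine ⟨fun i => hu.1 _, fun n => ?_⟩
  obtain ⟨C, k, h⟩ := hu.2 n
  exact ⟨C, k, fun i => h _⟩

lemma Growth.const (c : ℝ) : Growth j (fun (_ : ι) (_ : Coord d) => c) := by
  refine ⟨fun i => contDiff_const, fun n => ⟨|c|, 0, fun i x => ?_⟩⟩
  rcases n with _ | n
  · simp [norm_iteratedFDeriv_zero]
  · rw [iteratedFDeriv_const_of_ne (Nat.succ_ne_zero n)]; simp

lemma Growth.const_bdd {c : ι → ℝ} {K : ℝ} (hc : ∀ i, |c i| ≤ K) :
    Growth j (fun (i : ι) (_ : Coord d) => c i) := by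
  refine ⟨fun i => contDiff_const, fun n => ⟨|K|, 0, fun i x => ?_⟩⟩
  rcases n with _ | n
  · simpa [norm_iteratedFDeriv_zero] using (hc i).trans (le_abs_self K)
  · rw [iteratedFDeriv_const_of_ne (Nat.succ_ne_zero n)]; simp

lemma Growth.add {u v : ι → Coord d → ℝ} (hu : Growth j u) (hv : Growth j v) :
    Growth j (fun i x => u i x + v i x) := by
  refine ⟨fun i => (hu.1 i).add (hv.1 i), fun n => ?_⟩
  obtain ⟨C, k, hC, h⟩ := hu.bound n
  obtain ⟨D, l, hD, g⟩ := hv.bound n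
  refine ⟨C + D, k + l, fun i x => ?_⟩
  have e : iteratedFDeriv ℝ n (fun x => u i x + v i x) x
      = iteratedFDeriv ℝ n (u i) x + iteratedFDeriv ℝ n (v i) x :=
    iteratedFDeriv_add_apply (f := u i) (g := v i)
      ((hu.1 i).of_le (by exact_mod_cast le_top)).contDiffAt
      ((hv.1 i).of_le (by exact_mod_cast le_top)).contDiffAt
  rw [e]
  have e1 := weight_mono x (Nat.mul_le_mul_left j (show k ≤ k + l by omega))
  have e2 := weight_mono x (Nat.mul_le_mul_left j (show l ≤ k + l by omega))
  calc _ ≤ _ := norm_add_le _ _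
    _ ≤ C * (1 + ‖x‖) ^ (j * k) + D * (1 + ‖x‖) ^ (j * l) :=
      add_le_add (h n le_rfl i x) (g n le_rfl i x)
    _ ≤ C * (1 + ‖x‖) ^ (j * (k + l)) + D * (1 + ‖x‖) ^ (j * (k + l)) := by gcongr
    _ = _ := by ring

lemma Growth.mul {u v : ι → Coord d → ℝ} (hu : Growth j u) (hv : Growth j v) :
    Growth j (fun i x => u i x * v i x) := by
  refine ⟨fun i => (hu.1 i).mul (hv.1 i), fun n => ?_⟩
  obtain ⟨C, k, hC, h⟩ := hu.bound n
  obtain ⟨D, l, hD, g⟩ := hv.bound n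
  refine ⟨∑ m ∈ Finset.range (n + 1), (n.choose m : ℝ) * C * D, k + l, fun i x => ?_⟩
  refine (norm_iteratedFDeriv_mul_le (hu.1 i) (hv.1 i) x (n := n)
    (by exact_mod_cast le_top)).trans ?_
  rw [Finset.sum_mul]
  refine Finset.sum_le_sum fun m hm => ?_
  have hm' : m ≤ n := by simpa [Nat.lt_succ_iff] using hm
  calc _ ≤ (n.choose m : ℝ) * (C * (1 + ‖x‖) ^ (j * k)) * (D * (1 + ‖x‖) ^ (j * l)) := by
        gcongr
        · exact h m hm' i x
        · exact g (n - m) (Nat.sub_le _ _) i x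
    _ = _ := by rw [Nat.mul_add, pow_add]; ring

lemma Growth.const_mul {u : ι → Coord d → ℝ} (c : ℝ) (hu : Growth j u) :
    Growth j (fun i x => c * u i x) := (Growth.const c).mul hu

lemma Growth.neg {u : ι → Coord d → ℝ} (hu : Growth j u) :
    Growth j (fun i x => -u i x) := by simpa using hu.const_mul (-1)

lemma Growth.sub {u v : ι → Coord d → ℝ} (hu : Growth j u) (hv : Growth j v) :
    Growth j (fun i x => u i x - v i x) := by simpa [sub_eq_add_neg] using hu.add hv.neg

lemma Growth.sum {α : Type*} (s : Finset α) {u : α → ι → Coord d → ℝ}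
    (hu : ∀ a ∈ s, Growth j (u a)) : Growth j (fun i x => ∑ a ∈ s, u a i x) := by
  classical
  induction s using Finset.induction_on with
  | empty => simpa using Growth.const 0
  | insert a s ha ih =>
    simp only [Finset.sum_insert ha]
    exact (hu a (by simp)).add (ih fun b hb => hu b (by simp [hb]))

lemma Growth.prod {α : Type*} (s : Finset α) {u : α → ι → Coord d → ℝ}
    (hu : ∀ a ∈ s, Growth j (u a)) : Growth j (fun i x => ∏ a ∈ s, u a i x) := by
  classical
  induction s using Finset.induction_on with
  | empty => simpa using Growth.const 1
  | insert a s ha ih =>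
    simp only [Finset.prod_insert ha]
    exact (hu a (by simp)).mul (ih fun b hb => hu b (by simp [hb]))

lemma norm_single_one (i : Fin d) : ‖(Pi.single i 1 : Coord d)‖ = 1 := by
  simp [Pi.norm_single]

lemma contDiff_pd {f : Coord d → ℝ} (hf : ContDiff ℝ ∞ f) (i : Fin d) : ContDiff ℝ ∞ (pd i f) := by
  have : ContDiff ℝ ∞ (fderiv ℝ f) := hf.fderiv_right (by exact_mod_cast le_top)
  exact this.clm_apply contDiff_const

lemma norm_iteratedFDeriv_pd_le {f : Coord d → ℝ} (hf : ContDiff ℝ ∞ f) (i : Fin d) (n : ℕ)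
    (x : Coord d) : ‖iteratedFDeriv ℝ n (pd i f) x‖ ≤ ‖iteratedFDeriv ℝ (n + 1) f x‖ := by
  have h1 : ContDiff ℝ ∞ (fderiv ℝ f) := hf.fderiv_right (by exact_mod_cast le_top)
  have := norm_iteratedFDeriv_clm_apply_const (f := fderiv ℝ f) (c := (Pi.single i 1 : Coord d))
    (x := x) (n := n) (N := ∞) h1.contDiffAt (by exact_mod_cast le_top)
  rw [norm_single_one, one_mul, norm_iteratedFDeriv_fderiv] at this
  exact this

lemma Growth.pd {u : ι → Coord d → ℝ} (hu : Growth j u) (a : Fin d) :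
    Growth j (fun i => pd a (u i)) := by
  refine ⟨fun i => contDiff_pd (hu.1 i) a, fun n => ?_⟩
  obtain ⟨C, k, h⟩ := hu.2 (n + 1)
  exact ⟨C, k, fun i x => (norm_iteratedFDeriv_pd_le (hu.1 i) a n x).trans (h i x)⟩

lemma Growth.coord (a : Fin d) : Growth 1 (fun (_ : ι) (x : Coord d) => x a) := by
  have hlin : (fun x : Coord d => x a) = ContinuousLinearMap.proj (R := ℝ) a := rfl
  refine ⟨fun i => by fun_prop, fun n => ?_⟩
  obtain ⟨C, hC⟩ : ∃ C, C = ‖(ContinuousLinearMap.proj (R := ℝ) (φ := fun _ : Fin d => ℝ) a)‖ :=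
    ⟨_, rfl⟩
  have hf : fderiv ℝ (fun x : Coord d => x a) =
      fun _ => ContinuousLinearMap.proj (R := ℝ) (φ := fun _ : Fin d => ℝ) a := by
    rw [hlin]; ext1 x; exact ContinuousLinearMap.fderiv _
  refine ⟨1 + C, 1, fun i x => ?_⟩
  have hC0 : 0 ≤ C := hC ▸ norm_nonneg _
  rcases n with _ | _ | n
  · rw [norm_iteratedFDeriv_zero]
    have := norm_le_pi_norm x a
    have := norm_nonneg x
    simp only [one_mul, pow_one]
    nlinarith
  · rw [← norm_iteratedFDeriv_fderiv, hf, norm_iteratedFDeriv_zero, ← hC]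
    have := norm_nonneg x
    simp only [one_mul, pow_one]
    nlinarith
  · rw [← norm_iteratedFDeriv_fderiv, hf, iteratedFDeriv_const_of_ne (Nat.succ_ne_zero n)]
    simp only [Pi.zero_apply, norm_zero]
    positivity

/-- Composition of a bounded family with values in a compact interval with a smooth function. -/
lemma Growth.comp_real {u : ι → Coord d → ℝ} (hu : Growth 0 u) {φ : ℝ → ℝ} {a b : ℝ}
    {t : Set ℝ} (ht : IsOpen t) (hab : Set.Icc a b ⊆ t) (hφ : ContDiffOn ℝ ∞ φ t)
    (hr : ∀ i x, u i x ∈ Set.Icc a b) : Growth 0 (fun i x => φ (u i x)) := by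
  refine ⟨fun i => ?_, fun n => ?_⟩
  · rw [← contDiffOn_univ]
    exact hφ.comp (hu.1 i).contDiffOn (fun x _ => hab (hr i x))
  · obtain ⟨C, k, hC, h⟩ := hu.bound n
    -- The inner family takes values in a fixed compact interval, so continuity alone bounds every
    -- derivative of `φ` there, uniformly over the family.
    have hb : ∀ m : ℕ, ∃ K, ∀ y ∈ Set.Icc a b, ‖iteratedFDerivWithin ℝ m φ t y‖ ≤ K := fun m =>
      isCompact_Icc.exists_bound_of_continuousOn
        ((hφ.continuousOn_iteratedFDerivWithin (m := m) (by exact_mod_cast le_top)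
          ht.uniqueDiffOn).mono hab)
    choose K hK using hb
    -- The Faà di Bruno estimate wants inner derivatives of order `m` bounded by `D ^ m`. Since `m ≥
    -- 1`, a common bound `C` yields this with `D = 1 + C`.
    refine ⟨n.factorial * (∑ m ∈ Finset.range (n + 1), |K m|) * (1 + C) ^ n, 0, fun i x => ?_⟩
    have := norm_iteratedFDeriv_comp_le' (𝕜 := ℝ) (g := φ) (f := u i) (n := n) (N := ∞) (t := t)
      (by rintro _ ⟨y, rfl⟩; exact hab (hr i y)) ht.uniqueDiffOn hφ (hu.1 i)
      (by exact_mod_cast le_top) x (C := ∑ m ∈ Finset.range (n + 1), |K m|) (D := 1 + C)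
      (fun m hm => ((hK m _ (hr i x)).trans (le_abs_self _)).trans
        (Finset.single_le_sum (f := fun m => |K m|) (fun _ _ => abs_nonneg _)
          (by simp; omega)))
      (fun m hm hmn => ?_)
    · simpa [Function.comp_def] using this
    · have := h m hmn i x
      simp only [zero_mul, pow_zero, mul_one] at this
      calc _ ≤ C := this
        _ ≤ (1 + C) ^ 1 := by linarith
        _ ≤ (1 + C) ^ m := pow_le_pow_right₀ (by linarith) hm

lemma Growth.exists_bound {u : ι → Coord d → ℝ} (hu : Growth 0 u) :
    ∃ C, 0 ≤ C ∧ ∀ i x, |u i x| ≤ C := by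
  obtain ⟨C, k, hC, h⟩ := hu.bound 0
  refine ⟨C, hC, fun i x => ?_⟩
  simpa [norm_iteratedFDeriv_zero] using h 0 le_rfl i x

lemma Growth.inv {u : ι → Coord d → ℝ} (hu : Growth 0 u) {c : ℝ} (hc : 0 < c)
    (h : ∀ i x, c ≤ u i x) : Growth 0 (fun i x => (u i x)⁻¹) := by
  obtain ⟨C, -, hC⟩ := hu.exists_bound
  exact hu.comp_real (φ := fun y => y⁻¹) (a := c) (b := C) (t := Set.Ioi 0) isOpen_Ioi
    (fun y hy => lt_of_lt_of_le hc hy.1)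
    (fun y hy => (contDiffAt_inv ℝ (ne_of_gt hy)).contDiffWithinAt)
    (fun i x => ⟨h i x, (le_abs_self _).trans (hC i x)⟩)

lemma Growth.sqrt {u : ι → Coord d → ℝ} (hu : Growth 0 u) {c : ℝ} (hc : 0 < c)
    (h : ∀ i x, c ≤ u i x) : Growth 0 (fun i x => Real.sqrt (u i x)) := by
  obtain ⟨C, -, hC⟩ := hu.exists_bound
  exact hu.comp_real (φ := Real.sqrt) (a := c) (b := C) (t := Set.Ioi 0) isOpen_Ioi
    (fun y hy => lt_of_lt_of_le hc hy.1)
    (fun y hy => (Real.contDiffAt_sqrt (ne_of_gt hy)).contDiffWithinAt)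
    (fun i x => ⟨h i x, (le_abs_self _).trans (hC i x)⟩)

/-- Bounds on values and partial derivatives up to order four. -/
lemma Growth.abs_le {u : ι → Coord d → ℝ} (hu : Growth j u) :
    ∃ (C : ℝ) (k : ℕ), 0 ≤ C ∧ ∀ i x, |u i x| ≤ C * (1 + ‖x‖) ^ (j * k) := by
  obtain ⟨C, k, hC, h⟩ := hu.bound 0
  refine ⟨C, k, hC, fun i x => ?_⟩
  simpa [norm_iteratedFDeriv_zero] using h 0 le_rfl i x

/-! ### Calculus of partial derivatives and Taylor's formula -/

lemma pd_add {f g : Coord d → ℝ} {x : Coord d} (hf : DifferentiableAt ℝ f x)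
    (hg : DifferentiableAt ℝ g x) (i : Fin d) :
    pd i (fun y => f y + g y) x = pd i f x + pd i g x := by
  simp [pd, fderiv_fun_add hf hg]

lemma pd_sub {f g : Coord d → ℝ} {x : Coord d} (hf : DifferentiableAt ℝ f x)
    (hg : DifferentiableAt ℝ g x) (i : Fin d) :
    pd i (fun y => f y - g y) x = pd i f x - pd i g x := by
  simp [pd, fderiv_fun_sub hf hg]

lemma pd_mul {f g : Coord d → ℝ} {x : Coord d} (hf : DifferentiableAt ℝ f x)
    (hg : DifferentiableAt ℝ g x) (i : Fin d) :
    pd i (fun y => f y * g y) x = pd i f x * g x + f x * pd i g x := by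
  simp [pd, fderiv_fun_mul hf hg]; ring

lemma pd_mul_const {f : Coord d → ℝ} {x : Coord d} (hf : DifferentiableAt ℝ f x) (c : ℝ)
    (i : Fin d) : pd i (fun y => f y * c) x = pd i f x * c := by
  simp [pd, fderiv_mul_const hf]; ring

lemma pd_const_mul {f : Coord d → ℝ} {x : Coord d} (hf : DifferentiableAt ℝ f x) (c : ℝ)
    (i : Fin d) : pd i (fun y => c * f y) x = c * pd i f x := by
  simp [pd, fderiv_const_mul hf]

lemma pd_const (c : ℝ) (i : Fin d) (x : Coord d) : pd i (fun _ => c) x = 0 := by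
  simp [pd]

lemma pd_sum {α : Type*} (s : Finset α) {f : α → Coord d → ℝ} {x : Coord d}
    (hf : ∀ a ∈ s, DifferentiableAt ℝ (f a) x) (i : Fin d) :
    pd i (fun y => ∑ a ∈ s, f a y) x = ∑ a ∈ s, pd i (f a) x := by
  simp [pd, fderiv_fun_sum hf]

lemma pd_coord (i k : Fin d) (x : Coord d) :
    pd i (fun y => y k) x = if i = k then 1 else 0 := by
  have : fderiv ℝ (fun y : Coord d => y k) x
      = ContinuousLinearMap.proj (R := ℝ) (φ := fun _ : Fin d => ℝ) k :=
    ContinuousLinearMap.fderiv (ContinuousLinearMap.proj (R := ℝ) (φ := fun _ : Fin d => ℝ) k)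
  simp [pd, this, Pi.single_apply, eq_comm]

lemma fderiv_eq_sum_pd {f : Coord d → ℝ} (x y : Coord d) :
    fderiv ℝ f x y = ∑ i, pd i f x * y i := by
  conv_lhs => rw [pi_eq_sum_univ' y]
  rw [map_sum]
  refine Finset.sum_congr rfl fun i _ => ?_
  rw [map_smul, smul_eq_mul, mul_comm]
  rfl

lemma pd_comm {f : Coord d → ℝ} (hf : ContDiff ℝ 2 f) (i k : Fin d) (x : Coord d) :
    pd i (pd k f) x = pd k (pd i f) x := by
  have hd : DifferentiableAt ℝ (fderiv ℝ f) x :=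
    ((hf.fderiv_right (m := 1) (by norm_num)).differentiable (by norm_num)).differentiableAt
  have e : ∀ a b : Fin d, pd a (pd b f) x
      = fderiv ℝ (fderiv ℝ f) x (Pi.single a 1) (Pi.single b 1) := by
    intro a b
    unfold pd
    rw [fderiv_clm_apply hd (by fun_prop)]
    simp
  rw [e, e]
  exact (hf.contDiffAt.isSymmSndFDerivAt (by simp)) _ _

lemma iteratedFDeriv_two_eq_sum_pd {f : Coord d → ℝ} (hf : ContDiff ℝ ∞ f) (x y : Coord d) :
    iteratedFDeriv ℝ 2 f x (fun _ => y) = ∑ i, ∑ k, pd i (pd k f) x * y i * y k := by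
  have hd : DifferentiableAt ℝ (fderiv ℝ f) x :=
    ((hf.fderiv_right (m := ∞) (by exact_mod_cast le_top)).differentiable
      (by norm_num)).differentiableAt
  have e : ∀ z, fderiv ℝ (fderiv ℝ f) x z y = ∑ i, pd i (fun w => fderiv ℝ f w y) x * z i := by
    intro z
    rw [← fderiv_eq_sum_pd, fderiv_clm_apply hd (by fun_prop)]
    simp
  rw [iteratedFDeriv_two_apply, e]
  refine Finset.sum_congr rfl fun i _ => ?_
  have : (fun w => fderiv ℝ f w y) = fun w => ∑ k, pd k f w * y k := by
    ext w; exact fderiv_eq_sum_pd w y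
  rw [this]
  rw [pd_sum _ fun k _ => ((contDiff_pd hf k).differentiable (by norm_num) x).mul_const _,
    Finset.sum_mul]
  refine Finset.sum_congr rfl fun k _ => ?_
  rw [pd_mul_const ((contDiff_pd hf k).differentiable (by norm_num) x)]
  ring

/-- Taylor's formula with a bound on the remainder. -/
lemma taylor_bound {f : Coord d → ℝ} (hf : ContDiff ℝ ∞ f) {x y : Coord d} {n : ℕ} {K : ℝ}
    (hK : ∀ t ∈ Set.Icc (0 : ℝ) 1, ‖iteratedFDeriv ℝ (n + 1) f (x + t • y)‖ ≤ K) :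
    |f (x + y) - ∑ k ∈ Finset.range (n + 1),
      (k.factorial : ℝ)⁻¹ * iteratedFDeriv ℝ k f x (fun _ => y)| ≤ K * ‖y‖ ^ (n + 1) := by
  have h := map_add_eq_sum_add_integral_iteratedFDeriv (f := f) (x := x) (y := y) (n := n)
    (fun t _ => hf.contDiffAt.of_le (by exact_mod_cast le_top))
  simp only [smul_eq_mul] at h
  rw [h, add_sub_cancel_left, abs_mul]
  have h1 : |((n.factorial : ℝ))⁻¹| ≤ 1 := by
    rw [abs_of_nonneg (by positivity)]
    exact inv_le_one_of_one_le₀ (by exact_mod_cast n.factorial_pos)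
  have h2 : |∫ t in (0 : ℝ)..1, (1 - t) ^ n * iteratedFDeriv ℝ (n + 1) f (x + t • y) (fun _ => y)|
      ≤ K * ‖y‖ ^ (n + 1) := by
    have := intervalIntegral.norm_integral_le_of_norm_le_const (a := (0 : ℝ)) (b := 1)
      (f := fun t => (1 - t) ^ n * iteratedFDeriv ℝ (n + 1) f (x + t • y) (fun _ => y))
      (C := K * ‖y‖ ^ (n + 1)) (fun t ht => ?_)
    · simpa using this
    · rw [Set.uIoc_of_le zero_le_one] at ht
      rw [norm_mul]
      have a1 : ‖(1 - t) ^ n‖ ≤ 1 := by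
        rw [norm_pow]
        refine pow_le_one₀ (norm_nonneg _) ?_
        rw [Real.norm_eq_abs, abs_le]; constructor <;> linarith [ht.1, ht.2]
      have a2 : ‖iteratedFDeriv ℝ (n + 1) f (x + t • y) (fun _ => y)‖ ≤ K * ‖y‖ ^ (n + 1) := by
        refine ((iteratedFDeriv ℝ (n + 1) f (x + t • y)).le_opNorm _).trans ?_
        simp only [Finset.prod_const, Finset.card_univ, Fintype.card_fin]
        gcongr
        exact hK t ⟨ht.1.le, ht.2⟩
      calc _ ≤ 1 * (K * ‖y‖ ^ (n + 1)) := by gcongr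
        _ = _ := one_mul _
  have h3 : 0 ≤ K * ‖y‖ ^ (n + 1) := (abs_nonneg _).trans h2
  calc _ ≤ 1 * (K * ‖y‖ ^ (n + 1)) := by gcongr
    _ = _ := one_mul _

lemma taylor_zero {f : Coord d → ℝ} (hf : ContDiff ℝ ∞ f) {x y : Coord d} {K : ℝ}
    (hK : ∀ t ∈ Set.Icc (0 : ℝ) 1, ‖iteratedFDeriv ℝ 1 f (x + t • y)‖ ≤ K) :
    |f (x + y) - f x| ≤ K * ‖y‖ := by
  simpa using taylor_bound hf (n := 0) hK

lemma taylor_one {f : Coord d → ℝ} (hf : ContDiff ℝ ∞ f) {x y : Coord d} {K : ℝ}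
    (hK : ∀ t ∈ Set.Icc (0 : ℝ) 1, ‖iteratedFDeriv ℝ 2 f (x + t • y)‖ ≤ K) :
    |f (x + y) - f x - ∑ i, pd i f x * y i| ≤ K * ‖y‖ ^ 2 := by
  have := taylor_bound hf (n := 1) hK
  simpa [Finset.sum_range_succ, fderiv_eq_sum_pd, sub_sub] using this

lemma taylor_two {f : Coord d → ℝ} (hf : ContDiff ℝ ∞ f) {x y : Coord d} {K : ℝ}
    (hK : ∀ t ∈ Set.Icc (0 : ℝ) 1, ‖iteratedFDeriv ℝ 3 f (x + t • y)‖ ≤ K) :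
    |f (x + y) - f x - ∑ i, pd i f x * y i - (1 / 2) * ∑ i, ∑ k, pd i (pd k f) x * y i * y k|
      ≤ K * ‖y‖ ^ 3 := by
  have := taylor_bound hf (n := 2) hK
  simpa [Finset.sum_range_succ, fderiv_eq_sum_pd, sub_sub, iteratedFDeriv_two_eq_sum_pd hf,
    Nat.factorial] using this

/-! ### The coefficients and the backward operator -/

/-- Diffusion matrix `B` and drift `F` as in the standing assumptions. -/
structure Admissible (B : Coord d → Matrix (Fin d) (Fin d) ℝ) (F : Fin d → Coord d → ℝ) :
    Prop where
  symm : ∀ x i k, B x i k = B x k i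
  elliptic : ∃ c : ℝ, 0 < c ∧ ∀ (x : Coord d) (v : Fin d → ℝ),
    c * ∑ i, v i ^ 2 ≤ ∑ i, ∑ k, v i * B x i k * v k
  growth_B : ∀ i k, Growth 0 (fun (_ : Unit) x => B x i k)
  growth_F : ∀ i, Growth 1 (fun (_ : Unit) => F i)
  growth_pd_F : ∀ i k, Growth 0 (fun (_ : Unit) => pd k (F i))
  linear_F : ∃ C, 0 ≤ C ∧ ∀ i x, |F i x| ≤ C * (1 + ‖x‖)
  bounded_F : ∀ i (n : ℕ), 1 ≤ n → ∃ C, ∀ x, ‖iteratedFDeriv ℝ n (F i) x‖ ≤ C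

/-- The backward operator `f ↦ B^{ij} ∂ᵢ ∂ⱼ f + Fⁱ ∂ᵢ f`. -/
def gen (B : Coord d → Matrix (Fin d) (Fin d) ℝ) (F : Fin d → Coord d → ℝ) (f : Coord d → ℝ)
    (x : Coord d) : ℝ :=
  ∑ i, ∑ k, B x i k * pd i (pd k f) x + ∑ i, F i x * pd i f x

lemma symPart_symm (L : Coord d → Matrix (Fin d) (Fin d) ℝ) (x : Coord d) (i k : Fin d) :
    symPart L x i k = symPart L x k i := by
  simp [symPart, add_comm]

section Regular

variable {g L : Coord d → Matrix (Fin d) (Fin d) ℝ} {U : Coord d → ℝ}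

lemma contDiff_det {A : Coord d → Matrix (Fin d) (Fin d) ℝ}
    (hA : ∀ i k, ContDiff ℝ ∞ (fun x => A x i k)) : ContDiff ℝ ∞ (fun x => (A x).det) := by
  simp only [Matrix.det_apply]
  refine ContDiff.sum fun σ _ => ?_
  refine ContDiff.const_smul _ (contDiff_prod fun i _ => hA _ _)

lemma sqrtDet_pos (h : RegularCoefficients g L U) (x : Coord d) : 0 < sqrtDet g x :=
  Real.sqrt_pos.2 (h.posDef_g x).det_pos

lemma contDiff_sqrtDet (h : RegularCoefficients g L U) : ContDiff ℝ ∞ (sqrtDet g) := by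
  rw [contDiff_iff_contDiffAt]
  intro x
  exact (contDiff_det h.smooth_g).contDiffAt.sqrt (h.posDef_g x).det_pos.ne'

lemma contDiff_drift (h : RegularCoefficients g L U) (i : Fin d) :
    ContDiff ℝ ∞ (drift g L U i) := by
  have h1 := contDiff_sqrtDet h
  have h2 : ContDiff ℝ ∞ fun x => (sqrtDet g x)⁻¹ := h1.inv fun x => (sqrtDet_pos h x).ne'
  refine (h2.mul (ContDiff.sum fun k _ => contDiff_pd (h1.mul (h.smooth_L i k)) k)).sub
    (ContDiff.sum fun k _ => (h.smooth_L i k).mul (contDiff_pd h.smooth_U k))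

lemma contDiff_symPart (h : RegularCoefficients g L U) (i k : Fin d) :
    ContDiff ℝ ∞ (fun x => symPart L x i k) := by
  simp only [symPart, Matrix.smul_apply, Matrix.add_apply, Matrix.transpose_apply, smul_eq_mul]
  exact contDiff_const.mul ((h.smooth_L i k).add (h.smooth_L k i))

/-- From here on, only `B` and `F` matter, except in the duality formula. The one growth bound that
has to be derived is that of `F` itself: its bounded first derivative, integrated from the origin,
gives linear growth. -/
lemma RegularCoefficients.admissible (h : RegularCoefficients g L U) :
    Admissible (symPart L) (drift g L U) where
  symm := symPart_symm L
  elliptic := h.elliptic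
  growth_B i k := ⟨fun _ => contDiff_symPart h i k, fun n => by
    obtain ⟨C, hC⟩ := h.bounded_B i k n
    exact ⟨C, 0, fun _ x => by simpa using hC x⟩⟩
  growth_F i := ⟨fun _ => contDiff_drift h i, fun n => by
    rcases n with _ | n
    · obtain ⟨C, hC⟩ := h.bounded_F i 1 le_rfl
      refine ⟨|drift g L U i 0| + C, 1, fun _ x => ?_⟩
      have := taylor_zero (contDiff_drift h i) (x := 0) (y := x) (K := C) (fun t _ => hC _)
      rw [norm_iteratedFDeriv_zero, Real.norm_eq_abs]
      rw [zero_add] at this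
      have h0 : 0 ≤ C := (norm_nonneg _).trans (hC 0)
      have h1 := abs_sub_abs_le_abs_sub (drift g L U i x) (drift g L U i 0)
      have h2 := mul_nonneg (abs_nonneg (drift g L U i 0)) (norm_nonneg x)
      simp only [one_mul, pow_one]
      nlinarith
    · obtain ⟨C, hC⟩ := h.bounded_F i (n + 1) (by omega)
      exact ⟨C, 0, fun _ x => by simpa using hC x⟩⟩
  growth_pd_F i k := ⟨fun _ => contDiff_pd (contDiff_drift h i) k, fun n => by
    obtain ⟨C, hC⟩ := h.bounded_F i (n + 1) (by omega)
    exact ⟨C, 0, fun _ x => by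
      simpa using (norm_iteratedFDeriv_pd_le (contDiff_drift h i) k n x).trans (hC x)⟩⟩
  linear_F := by
    have : ∀ i, ∃ C, 0 ≤ C ∧ ∀ x, |drift g L U i x| ≤ C * (1 + ‖x‖) := fun i => by
      obtain ⟨C, hC⟩ := h.bounded_F i 1 le_rfl
      have h0 : 0 ≤ C := (norm_nonneg _).trans (hC 0)
      refine ⟨|drift g L U i 0| + C, by positivity, fun x => ?_⟩
      have := taylor_zero (contDiff_drift h i) (x := 0) (y := x) (K := C) (fun t _ => hC _)
      rw [zero_add] at this
      have h1 := abs_sub_abs_le_abs_sub (drift g L U i x) (drift g L U i 0)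
      have h2 := mul_nonneg (abs_nonneg (drift g L U i 0)) (norm_nonneg x)
      nlinarith
    choose C h0 hC using this
    refine ⟨∑ i, C i, Finset.sum_nonneg fun i _ => h0 i, fun i x => (hC i x).trans ?_⟩
    gcongr
    exact Finset.single_le_sum (fun i _ => h0 i) (Finset.mem_univ i)
  bounded_F := h.bounded_F

end Regular

section Gen

variable {B : Coord d → Matrix (Fin d) (Fin d) ℝ} {F : Fin d → Coord d → ℝ}

lemma Admissible.contDiff_F (h : Admissible B F) (i : Fin d) : ContDiff ℝ ∞ (F i) :=
  (h.growth_F i).1 ()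

lemma Admissible.contDiff_B (h : Admissible B F) (i k : Fin d) :
    ContDiff ℝ ∞ (fun x => B x i k) := (h.growth_B i k).1 ()

lemma Admissible.bound_B (h : Admissible B F) : ∃ C, 0 ≤ C ∧ ∀ x i k, |B x i k| ≤ C := by
  choose C h0 hC using fun i k => (h.growth_B i k).exists_bound
  refine ⟨∑ i, ∑ k, C i k, Finset.sum_nonneg fun i _ => Finset.sum_nonneg fun k _ => h0 i k,
    fun x i k => (hC i k () x).trans ?_⟩
  exact (Finset.single_le_sum (f := fun k => C i k) (fun k _ => h0 i k) (Finset.mem_univ k)).trans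
    (Finset.single_le_sum (f := fun i => ∑ k, C i k)
      (fun i _ => Finset.sum_nonneg fun k _ => h0 i k) (Finset.mem_univ i))

lemma Admissible.growth_gen (h : Admissible B F) {u : ι → Coord d → ℝ} (hu : Growth 1 u) :
    Growth 1 (fun i => gen B F (u i)) := by
  refine Growth.add (Growth.sum _ fun i _ => Growth.sum _ fun k _ => ?_)
    (Growth.sum _ fun i _ => ?_)
  · exact ((h.growth_B i k).mono.comp_index (fun _ => ())).mul ((hu.pd k).pd i)
  · exact ((h.growth_F i).comp_index (fun _ => ())).mul (hu.pd i)

lemma Admissible.contDiff_gen (h : Admissible B F) {f : Coord d → ℝ} (hf : ContDiff ℝ ∞ f) :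
    ContDiff ℝ ∞ (gen B F f) := by
  refine ContDiff.add (ContDiff.sum fun i _ => ContDiff.sum fun k _ => ?_)
    (ContDiff.sum fun i _ => ?_)
  · exact (h.contDiff_B i k).mul (contDiff_pd (contDiff_pd hf k) i)
  · exact (h.contDiff_F i).mul (contDiff_pd hf i)

/-- The backward operator is controlled by the first and second partial derivatives. -/
lemma Admissible.exists_gen_bound (h : Admissible B F) : ∃ K, 0 ≤ K ∧
    ∀ (f : Coord d → ℝ) (x : Coord d) (W : ℝ), 0 ≤ W →
      (∀ i, (1 + ‖x‖) * |pd i f x| ≤ W) → (∀ i k, |pd i (pd k f) x| ≤ W) →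
      |gen B F f x| ≤ K * W := by
  obtain ⟨C, hC0, hC⟩ := h.bound_B
  obtain ⟨D, hD0, hD⟩ := h.linear_F
  refine ⟨d * d * C + d * D, by positivity, fun f x W hW h1 h2 => ?_⟩
  have e1 : |∑ i, ∑ k, B x i k * pd i (pd k f) x| ≤ ∑ _i : Fin d, ∑ _k : Fin d, C * W := by
    refine (Finset.abs_sum_le_sum_abs _ _).trans (Finset.sum_le_sum fun i _ => ?_)
    refine (Finset.abs_sum_le_sum_abs _ _).trans (Finset.sum_le_sum fun k _ => ?_)
    rw [abs_mul]
    exact mul_le_mul (hC x i k) (h2 i k) (abs_nonneg _) hC0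
  have e2 : |∑ i, F i x * pd i f x| ≤ ∑ _i : Fin d, D * W := by
    refine (Finset.abs_sum_le_sum_abs _ _).trans (Finset.sum_le_sum fun i _ => ?_)
    rw [abs_mul]
    calc _ ≤ D * (1 + ‖x‖) * |pd i f x| := by gcongr; exact hD i x
      _ = D * ((1 + ‖x‖) * |pd i f x|) := by ring
      _ ≤ _ := by gcongr; exact h1 i
  refine (abs_add_le _ _).trans ((add_le_add e1 e2).trans (le_of_eq ?_))
  simp
  ring

lemma pd_pd_mul {f g : Coord d → ℝ} (hf : ContDiff ℝ ∞ f) (hg : ContDiff ℝ ∞ g) (i k : Fin d)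
    (x : Coord d) : pd i (pd k (fun y => f y * g y)) x =
      pd i (pd k f) x * g x + pd k f x * pd i g x + (pd i f x * pd k g x + f x * pd i (pd k g) x) := by
  have df := hf.differentiable (by norm_num)
  have dg := hg.differentiable (by norm_num)
  have e : pd k (fun y => f y * g y) = fun y => pd k f y * g y + f y * pd k g y := by
    ext y; exact pd_mul (df y) (dg y) k
  have dpf := (contDiff_pd hf k).differentiable (by norm_num)
  have dpg := (contDiff_pd hg k).differentiable (by norm_num)
  rw [e, pd_add (f := fun y => pd k f y * g y) (g := fun y => f y * pd k g y)
    ((dpf x).mul (dg x)) ((df x).mul (dpg x)), pd_mul (dpf x) (dg x),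
    pd_mul (df x) (dpg x)]

end Gen

/-! ### A smooth square root of the diffusion matrix -/

/-- A bounded matrix field that is uniformly positive definite on the coordinates in `S` and vanishes
outside is a sum of squares of bounded vector fields. -/
lemma exists_sum_of_squares_aux (S : Finset (Fin d)) :
    ∀ B : Coord d → Matrix (Fin d) (Fin d) ℝ, (∀ x i k, B x i k = B x k i) →
    (∀ i k, Growth 0 (fun (_ : Unit) x => B x i k)) →
    (∀ x i k, i ∉ S → B x i k = 0) →
    (∃ c : ℝ, 0 < c ∧ ∀ (x : Coord d) (v : Fin d → ℝ),
      c * ∑ i ∈ S, v i ^ 2 ≤ ∑ i, ∑ k, v i * B x i k * v k) →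
    ∃ σ : Fin d → Fin d → Coord d → ℝ, (∀ r i, Growth 0 (fun (_ : Unit) => σ r i)) ∧
      ∀ x i k, ∑ r ∈ S, σ r i x * σ r k x = B x i k := by
  induction S using Finset.induction_on with
  | empty =>
    intro B _ _ h0 _
    refine ⟨fun _ _ _ => 0, fun _ _ => Growth.const 0, fun x i k => ?_⟩
    simp [h0 x i k (by simp)]
  | insert s S hs ih =>
    intro B hsymm hgr h0 ⟨c, hc, hell⟩
    -- Elimination of one coordinate, as in a Cholesky factorization. Testing ellipticity on the
    -- basis vector `s` keeps the pivot away from zero, so that its inverse and its square root are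
    -- smooth with bounded derivatives.
    have hss : ∀ x, c ≤ B x s s := fun x => by
      have h := hell x (Pi.single s 1)
      have e1 : ∑ i ∈ insert s S, (Pi.single s (1 : ℝ) : Fin d → ℝ) i ^ 2 = 1 := by
        rw [Finset.sum_insert hs, Finset.sum_eq_zero]
        · simp
        · intro i hi
          have : i ≠ s := fun h => hs (h ▸ hi)
          simp [this]
      have e2 : ∑ i, ∑ k, (Pi.single s (1 : ℝ) : Fin d → ℝ) i * B x i k *
          (Pi.single s (1 : ℝ) : Fin d → ℝ) k = B x s s := by
        simp [Pi.single_apply]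
      rw [e1, e2] at h
      linarith
    have hne : ∀ x, B x s s ≠ 0 := fun x => (hc.trans_le (hss x)).ne'
    have hinv : Growth 0 (fun (_ : Unit) x => (B x s s)⁻¹) := (hgr s s).inv hc fun _ x => hss x
    -- The Schur complement of the pivot: row and column `s` vanish, and the rank-one matrix removed
    -- is the square of column `s` divided by the square root of the pivot.
    let B' : Coord d → Matrix (Fin d) (Fin d) ℝ :=
      fun x => Matrix.of fun i k => B x i k - B x i s * B x k s * (B x s s)⁻¹
    have hB' : ∀ x i k, B' x i k = B x i k - B x i s * B x k s * (B x s s)⁻¹ := fun _ _ _ => rfl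
    obtain ⟨σ, hσ, hσ'⟩ := ih B' (fun x i k => by rw [hB', hB', hsymm x i k]; ring)
      (fun i k => (hgr i k).sub (((hgr i s).mul (hgr k s)).mul hinv))
      (fun x i k hi => by
        rw [hB']
        by_cases his : i = s
        · subst his
          rw [hsymm x k i]
          field_simp [hne x]
          ring
        · rw [h0 x i k (by simp [his, hi]), h0 x i s (by simp [his, hi])]; ring)
      ⟨c, hc, fun x v => by
        set b : ℝ := ∑ i, v i * B x i s with hb
        -- This shift of the coordinate `s` minimizes the quadratic form of `B`, and the minimum is
        -- the quadratic form of the Schur complement. Hence the complement inherits ellipticity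
        -- with the same constant `c`.
        set t : ℝ := -(b * (B x s s)⁻¹) with ht
        have hbt : b = -(t * B x s s) := by
          rw [ht]; field_simp [hne x]
        let w : Fin d → ℝ := fun i => v i + t * (Pi.single s (1 : ℝ) : Fin d → ℝ) i
        have hw := hell x w
        have e1 : ∑ i ∈ S, v i ^ 2 ≤ ∑ i ∈ insert s S, w i ^ 2 := by
          rw [Finset.sum_insert hs]
          have : ∑ i ∈ S, w i ^ 2 = ∑ i ∈ S, v i ^ 2 := Finset.sum_congr rfl fun i hi => by
            have : i ≠ s := fun h => hs (h ▸ hi)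
            simp [w, this]
          rw [this]
          nlinarith [sq_nonneg (w s)]
        have e2 : ∑ i, ∑ k, w i * B x i k * w k
            = ∑ i, ∑ k, v i * B x i k * v k + 2 * t * b + t ^ 2 * B x s s := by
          have : ∀ i k, w i * B x i k * w k = v i * B x i k * v k
              + t * (v i * B x i k * (Pi.single s (1 : ℝ) : Fin d → ℝ) k)
              + t * ((Pi.single s (1 : ℝ) : Fin d → ℝ) i * B x i k * v k)
              + t ^ 2 * ((Pi.single s (1 : ℝ) : Fin d → ℝ) i * B x i k *
                (Pi.single s (1 : ℝ) : Fin d → ℝ) k) := fun i k => by simp only [w]; ring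
          simp only [this, Finset.sum_add_distrib, ← Finset.mul_sum]
          have f1 : ∑ i, ∑ k, v i * B x i k * (Pi.single s (1 : ℝ) : Fin d → ℝ) k = b := by
            simp [Pi.single_apply, hb]
          have f2 : ∑ i, ∑ k, (Pi.single s (1 : ℝ) : Fin d → ℝ) i * B x i k * v k = b := by
            rw [Finset.sum_comm]
            simp [Pi.single_apply, hb]
            exact Finset.sum_congr rfl fun i _ => by rw [hsymm x s i]; ring
          have f3 : ∑ i, ∑ k, (Pi.single s (1 : ℝ) : Fin d → ℝ) i * B x i k *
              (Pi.single s (1 : ℝ) : Fin d → ℝ) k = B x s s := by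
            simp [Pi.single_apply]
          rw [f1, f2, f3]; ring
        have e3 : ∑ i, ∑ k, v i * B' x i k * v k
            = ∑ i, ∑ k, v i * B x i k * v k - b ^ 2 * (B x s s)⁻¹ := by
          have : ∀ i k, v i * B' x i k * v k = v i * B x i k * v k
              - (v i * B x i s) * (v k * B x k s) * (B x s s)⁻¹ := fun i k => by rw [hB']; ring
          simp only [this, Finset.sum_sub_distrib, ← Finset.sum_mul]
          rw [hb, sq, Finset.sum_mul_sum]
        have e4 : 2 * t * b + t ^ 2 * B x s s = -(b ^ 2 * (B x s s)⁻¹) := by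
          rw [ht]; field_simp [hne x]; ring
        calc c * ∑ i ∈ S, v i ^ 2 ≤ c * ∑ i ∈ insert s S, w i ^ 2 := by gcongr
          _ ≤ _ := hw
          _ = _ := by rw [e2, e3, add_assoc, e4]; ring⟩
    have hsq : Growth 0 (fun (_ : Unit) x => (Real.sqrt (B x s s))⁻¹) := by
      refine ((hgr s s).sqrt hc fun _ x => hss x).inv (Real.sqrt_pos.2 hc) fun _ x => ?_
      exact Real.sqrt_le_sqrt (hss x)
    refine ⟨fun r i x => if r = s then B x i s * (Real.sqrt (B x s s))⁻¹ else σ r i x, ?_, ?_⟩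
    · intro r i
      by_cases hr : r = s
      · simpa [hr] using (hgr i s).mul hsq
      · simpa [hr] using hσ r i
    · intro x i k
      rw [Finset.sum_insert hs]
      have : ∑ r ∈ S, ((if r = s then B x i s * (Real.sqrt (B x s s))⁻¹ else σ r i x) *
          (if r = s then B x k s * (Real.sqrt (B x s s))⁻¹ else σ r k x)) = B' x i k := by
        rw [← hσ' x i k]
        exact Finset.sum_congr rfl fun r hr => by
          have : r ≠ s := fun h => hs (h ▸ hr)
          simp [this]
      rw [this, hB']
      have hp : (Real.sqrt (B x s s))⁻¹ * (Real.sqrt (B x s s))⁻¹ = (B x s s)⁻¹ := by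
        rw [← mul_inv, Real.mul_self_sqrt (hc.le.trans (hss x))]
      simp only [if_true]
      linear_combination (B x i s * B x k s) * hp

lemma Admissible.exists_sum_of_squares {B : Coord d → Matrix (Fin d) (Fin d) ℝ}
    {F : Fin d → Coord d → ℝ} (h : Admissible B F) :
    ∃ σ : Fin d → Fin d → Coord d → ℝ, (∀ r i, Growth 0 (fun (_ : Unit) => σ r i)) ∧
      ∀ x i k, ∑ r, σ r i x * σ r k x = B x i k :=
  exists_sum_of_squares_aux Finset.univ B h.symm h.growth_B (fun x i k hi => by simp at hi)
    h.elliptic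

/-! ### Regularity of an approximating random walk -/

/-- An explicit second-order remainder for a power. The induction multiplies the remainder by `u +
δ` and picks up the new term `n u^(n-1) δ²`. It serves the Lyapunov estimates of both the walk and
the kernels. -/
lemma abs_add_pow_sub_le (u δ : ℝ) {n : ℕ} (hn : 2 ≤ n) :
    |(u + δ) ^ n - u ^ n - n * u ^ (n - 1) * δ| ≤ n ^ 2 * δ ^ 2 * (|u| + |δ|) ^ (n - 2) := by
  induction n, hn using Nat.le_induction with
  | base =>
    have : (u + δ) ^ 2 - u ^ 2 - (2 : ℕ) * u ^ (2 - 1) * δ = δ ^ 2 := by norm_num; ring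
    rw [this, abs_of_nonneg (sq_nonneg δ)]
    norm_num
    nlinarith [sq_nonneg δ]
  | succ n hn ih =>
    obtain ⟨m, rfl⟩ := Nat.exists_eq_add_of_le hn
    simp only [show 2 + m + 1 - 1 = m + 2 by omega, show 2 + m + 1 - 2 = m + 1 by omega,
      show 2 + m - 1 = m + 1 by omega, show 2 + m - 2 = m by omega] at ih ⊢
    have e : (u + δ) ^ (2 + m + 1) - u ^ (2 + m + 1) - (2 + m + 1 : ℕ) * u ^ (m + 2) * δ
        = (u + δ) * ((u + δ) ^ (2 + m) - u ^ (2 + m) - (2 + m : ℕ) * u ^ (m + 1) * δ)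
          + (2 + m : ℕ) * u ^ (m + 1) * δ ^ 2 := by push_cast; ring
    rw [e]
    have h1 : |u + δ| ≤ |u| + |δ| := abs_add_le _ _
    have h2 : |u| ^ (m + 1) ≤ (|u| + |δ|) ^ (m + 1) := by
      gcongr; linarith [abs_nonneg δ]
    have h3 : 0 ≤ (|u| + |δ|) ^ (m + 1) := by positivity
    calc _ ≤ |u + δ| * |(u + δ) ^ (2 + m) - u ^ (2 + m) - (2 + m : ℕ) * u ^ (m + 1) * δ|
          + (2 + m : ℕ) * |u| ^ (m + 1) * δ ^ 2 := by
          refine (abs_add_le _ _).trans (le_of_eq ?_)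
          rw [abs_mul, abs_mul, abs_mul, abs_pow, abs_of_nonneg (sq_nonneg δ), Nat.abs_cast]
      _ ≤ (|u| + |δ|) * ((2 + m : ℕ) ^ 2 * δ ^ 2 * (|u| + |δ|) ^ m)
          + (2 + m : ℕ) * (|u| + |δ|) ^ (m + 1) * δ ^ 2 := by gcongr
      _ = ((2 + m : ℕ) ^ 2 + (2 + m : ℕ) : ℝ) * (δ ^ 2 * (|u| + |δ|) ^ (m + 1)) := by ring
      _ ≤ ((2 + m + 1 : ℕ) : ℝ) ^ 2 * (δ ^ 2 * (|u| + |δ|) ^ (m + 1)) := by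
          gcongr; push_cast; nlinarith
      _ = _ := by ring

/-- One step of a symmetric walk increases even moments by a factor `1 + O(h)`. -/
lemma even_moment_step (q : ℕ) : ∃ C, 0 ≤ C ∧ ∀ u a b h : ℝ, 0 ≤ h → h ≤ 1 →
    ((u + h * a + Real.sqrt h * b) ^ (2 * q) + (u + h * a - Real.sqrt h * b) ^ (2 * q)) / 2
      ≤ u ^ (2 * q) + C * h * (u ^ (2 * q) + a ^ (2 * q) + b ^ (2 * q)) := by
  rcases Nat.eq_zero_or_pos q with rfl | hq
  · exact ⟨0, le_rfl, fun u a b h _ _ => by norm_num⟩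
  set n := 2 * q with hn
  have hn2 : 2 ≤ n := by omega
  have hev : Even n := ⟨q, by omega⟩
  refine ⟨n + n ^ 2 * 4 * 3 ^ (n - 2), by positivity, fun u a b h h0 h1 => ?_⟩
  set s := Real.sqrt h with hs
  have hs0 : 0 ≤ s := Real.sqrt_nonneg h
  have hs2 : s ^ 2 = h := Real.sq_sqrt h0
  have hs1 : s ≤ 1 := Real.sqrt_le_one.2 h1
  -- A single scale `M` makes all terms homogeneous of degree `n`, and evenness of `n` bounds `M ^
  -- n` by the sum of the three powers. The increments are of size `√h M`, so their squares are of
  -- order `h`.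
  set M := max |u| (max |a| |b|) with hM
  have hu : |u| ≤ M := le_max_left _ _
  have ha : |a| ≤ M := (le_max_left _ _).trans (le_max_right _ _)
  have hb : |b| ≤ M := (le_max_right _ _).trans (le_max_right _ _)
  have hM0 : 0 ≤ M := (abs_nonneg u).trans hu
  have key : ∀ δ, |δ| ≤ 2 * s * M →
      (u + δ) ^ n ≤ u ^ n + n * u ^ (n - 1) * δ + n ^ 2 * 4 * 3 ^ (n - 2) * h * M ^ n := by
    intro δ hδ
    have h3 := abs_add_pow_sub_le u δ hn2
    have h4 : |u| + |δ| ≤ 3 * M := by nlinarith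
    have h5 : δ ^ 2 ≤ 4 * h * M ^ 2 := by
      rw [← sq_abs δ, ← hs2]
      calc |δ| ^ 2 ≤ (2 * s * M) ^ 2 := by gcongr
        _ = _ := by ring
    have h6 : (n : ℝ) ^ 2 * δ ^ 2 * (|u| + |δ|) ^ (n - 2)
        ≤ n ^ 2 * (4 * h * M ^ 2) * (3 * M) ^ (n - 2) := by gcongr
    have h7 : (n : ℝ) ^ 2 * (4 * h * M ^ 2) * (3 * M) ^ (n - 2)
        = n ^ 2 * 4 * 3 ^ (n - 2) * h * M ^ n := by
      obtain ⟨m, hm⟩ := Nat.exists_eq_add_of_le hn2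
      rw [hm, show 2 + m - 2 = m by omega, mul_pow, pow_add]; ring
    have := (abs_le.1 h3).2
    linarith
  have b1 : |h * a + s * b| ≤ 2 * s * M := by
    refine (abs_add_le _ _).trans ?_
    rw [abs_mul, abs_mul, abs_of_nonneg h0, abs_of_nonneg hs0]
    have : h * |a| ≤ s * M := by
      rw [← hs2]
      calc s ^ 2 * |a| = s * (s * |a|) := by ring
        _ ≤ s * (1 * M) := by gcongr
        _ = s * M := by ring
    nlinarith
  have b2 : |h * a - s * b| ≤ 2 * s * M := by
    refine (abs_sub _ _).trans ?_
    rw [abs_mul, abs_mul, abs_of_nonneg h0, abs_of_nonneg hs0]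
    have : h * |a| ≤ s * M := by
      rw [← hs2]
      calc s ^ 2 * |a| = s * (s * |a|) := by ring
        _ ≤ s * (1 * M) := by gcongr
        _ = s * M := by ring
    nlinarith
  have k1 := key _ b1
  have k2 := key _ b2
  have hMn : M ^ n ≤ u ^ n + a ^ n + b ^ n := by
    have e1 := hev.pow_nonneg u
    have e2 := hev.pow_nonneg a
    have e3 := hev.pow_nonneg b
    rcases max_choice |u| (max |a| |b|) with h' | h'
    · rw [hM, h', hev.pow_abs]; linarith
    · rcases max_choice |a| |b| with h'' | h''
      · rw [hM, h', h'', hev.pow_abs]; linarith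
      · rw [hM, h', h'', hev.pow_abs]; linarith
  have hlin : u ^ (n - 1) * a ≤ M ^ n := by
    calc _ ≤ |u ^ (n - 1) * a| := le_abs_self _
      _ = |u| ^ (n - 1) * |a| := by rw [abs_mul, abs_pow]
      _ ≤ M ^ (n - 1) * M := by gcongr
      _ = M ^ n := by rw [← pow_succ]; congr 1; omega
  have hc : (n + n ^ 2 * 4 * 3 ^ (n - 2) : ℝ) * h * M ^ n
      ≤ (n + n ^ 2 * 4 * 3 ^ (n - 2)) * h * (u ^ n + a ^ n + b ^ n) := by gcongr
  -- Only the drift part of the linear term survives: averaging over the two signs cancels the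
  -- contributions of `±√h b`, which would be too large.
  have hl2 : (n : ℝ) * h * (u ^ (n - 1) * a) ≤ n * h * M ^ n := by gcongr
  have e1 : u + h * a + s * b = u + (h * a + s * b) := by ring
  have e2 : u + h * a - s * b = u + (h * a - s * b) := by ring
  rw [e1, e2]
  linarith

/-! ### Lyapunov functions for the derivatives of composed maps -/

/-- Smooth functions of at most linear growth with bounded derivatives. -/
structure LinearGrowth (φ : Coord d → ℝ) : Prop where
  smooth : ContDiff ℝ ∞ φ
  deriv_bdd : ∀ n : ℕ, 1 ≤ n → ∃ C, ∀ x, ‖iteratedFDeriv ℝ n φ x‖ ≤ C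
  linear : ∃ C, 0 ≤ C ∧ ∀ x, |φ x| ≤ C * (1 + ‖x‖)

lemma LinearGrowth.deriv_bound {φ : Coord d → ℝ} (h : LinearGrowth φ) (N : ℕ) :
    ∃ C, 0 ≤ C ∧ ∀ n, 1 ≤ n → n ≤ N → ∀ x, ‖iteratedFDeriv ℝ n φ x‖ ≤ C := by
  have := fun n : ℕ => h.deriv_bdd (n + 1) (by omega)
  choose C hC using this
  refine ⟨∑ m ∈ Finset.range N, |C m|, Finset.sum_nonneg fun _ _ => abs_nonneg _,
    fun n h1 hn x => ?_⟩
  obtain ⟨m, rfl⟩ : ∃ m, n = m + 1 := ⟨n - 1, by omega⟩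
  exact ((hC m x).trans (le_abs_self _)).trans (Finset.single_le_sum (f := fun m => |C m|)
    (fun _ _ => abs_nonneg _) (by simp; omega))

/-- Multilinear expansion in the standard basis. It replaces the operator norm, which is not smooth
enough for even-power estimates, by finitely many real coordinates. -/
lemma norm_multilinear_le_sum {i : ℕ}
    (m : ContinuousMultilinearMap ℝ (fun _ : Fin i => Coord d) ℝ) :
    ‖m‖ ≤ ∑ v : Fin i → Fin d, |m (fun l => Pi.single (v l) 1)| := by
  refine ContinuousMultilinearMap.opNorm_le_bound (Finset.sum_nonneg fun _ _ => abs_nonneg _)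
    fun w => ?_
  have e : w = fun l => ∑ k, w l k • (Pi.single k 1 : Coord d) := by
    funext l
    exact pi_eq_sum_univ' (w l)
  have e2 : m w = ∑ v : Fin i → Fin d, (∏ l, w l (v l)) * m (fun l => Pi.single (v l) 1) := by
    conv_lhs => rw [e]
    have := m.toMultilinearMap.map_sum (fun l k => w l k • (Pi.single k 1 : Coord d))
    refine this.trans (Finset.sum_congr rfl fun v _ => ?_)
    have := m.toMultilinearMap.map_smul_univ (fun l => w l (v l))
      (fun l => (Pi.single (v l) 1 : Coord d))
    exact this
  rw [e2, Finset.sum_mul]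
  refine (norm_sum_le _ _).trans (Finset.sum_le_sum fun v _ => ?_)
  rw [norm_mul, mul_comm, norm_prod]
  refine mul_le_mul_of_nonneg_left ?_ (abs_nonneg _)
  exact Finset.prod_le_prod (fun _ _ => norm_nonneg _) fun l _ => norm_le_pi_norm (w l) (v l)

/-- The coordinate `c` of the `i`-th derivative of `X` in coordinate directions `v`. -/
def jetCoord (X : Coord d → Coord d) (i : ℕ) (c : Fin d) (v : Fin i → Fin d) (x : Coord d) : ℝ :=
  iteratedFDeriv ℝ i (fun y => X y c) x (fun l => Pi.single (v l) 1)

/-- A homogeneous Lyapunov function for the derivatives of order `1, …, n` of a map. -/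
def jetEnergy (n : ℕ) (X : Coord d → Coord d) (x : Coord d) : ℝ :=
  ∑ i ∈ Finset.Icc 1 n, ∑ c, ∑ v : Fin i → Fin d, jetCoord X i c v x ^ (2 * (n.factorial / i))

lemma jetCoord_pow_nonneg (n : ℕ) (X : Coord d → Coord d) (x : Coord d) (i : ℕ) (c : Fin d)
    (v : Fin i → Fin d) : 0 ≤ jetCoord X i c v x ^ (2 * (n.factorial / i)) :=
  (even_two_mul _).pow_nonneg _

lemma jetEnergy_nonneg (n : ℕ) (X : Coord d → Coord d) (x : Coord d) : 0 ≤ jetEnergy n X x :=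
  Finset.sum_nonneg fun _ _ => Finset.sum_nonneg fun _ _ => Finset.sum_nonneg fun _ _ =>
    jetCoord_pow_nonneg ..

lemma jetCoord_pow_le (n : ℕ) (X : Coord d → Coord d) (x : Coord d) {i : ℕ}
    (hi : i ∈ Finset.Icc 1 n) (c : Fin d) (v : Fin i → Fin d) :
    jetCoord X i c v x ^ (2 * (n.factorial / i)) ≤ jetEnergy n X x := by
  refine le_trans ?_ (Finset.single_le_sum (f := fun i => ∑ c, ∑ v : Fin i → Fin d,
    jetCoord X i c v x ^ (2 * (n.factorial / i))) (fun _ _ => Finset.sum_nonneg fun _ _ =>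
      Finset.sum_nonneg fun _ _ => jetCoord_pow_nonneg ..) hi)
  refine le_trans ?_ (Finset.single_le_sum (f := fun c => ∑ v : Fin i → Fin d,
    jetCoord X i c v x ^ (2 * (n.factorial / i))) (fun _ _ =>
      Finset.sum_nonneg fun _ _ => jetCoord_pow_nonneg ..) (Finset.mem_univ c))
  exact Finset.single_le_sum (f := fun v : Fin i → Fin d =>
    jetCoord X i c v x ^ (2 * (n.factorial / i))) (fun _ _ => jetCoord_pow_nonneg ..)
    (Finset.mem_univ v)

/-- The scale of the derivatives of order up to `n`. -/
def jetScale (n : ℕ) (X : Coord d → Coord d) (x : Coord d) : ℝ :=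
  jetEnergy n X x ^ ((1 : ℝ) / (2 * n.factorial : ℕ))

lemma jetScale_nonneg (n : ℕ) (X : Coord d → Coord d) (x : Coord d) : 0 ≤ jetScale n X x :=
  Real.rpow_nonneg (jetEnergy_nonneg n X x) _

lemma jetScale_pow (n : ℕ) (X : Coord d → Coord d) (x : Coord d) :
    jetScale n X x ^ (2 * n.factorial) = jetEnergy n X x := by
  have : 2 * n.factorial ≠ 0 := by positivity
  rw [jetScale, one_div, Real.rpow_inv_natCast_pow (jetEnergy_nonneg n X x) this]

/-- A derivative of order `i` is given weight `i`. Raising it to the power `2 · n!/i` makes every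
summand of `jetEnergy` homogeneous of the common degree `2 · n!`; the division is exact because `1 ≤
i ≤ n`. -/
lemma scale_exponent {n i : ℕ} (hi : i ∈ Finset.Icc 1 n) :
    i * (2 * (n.factorial / i)) = 2 * n.factorial := by
  rw [Finset.mem_Icc] at hi
  have := Nat.mul_div_cancel' (Nat.dvd_factorial (by omega) hi.2)
  calc _ = 2 * (i * (n.factorial / i)) := by ring
    _ = _ := by rw [this]

lemma exponent_ne_zero {n i : ℕ} (hi : i ∈ Finset.Icc 1 n) : 2 * (n.factorial / i) ≠ 0 := by
  intro h
  have := scale_exponent hi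
  rw [h, mul_zero] at this
  have := n.factorial_pos
  omega

lemma abs_jetCoord_le (n : ℕ) (X : Coord d → Coord d) (x : Coord d) {i : ℕ}
    (hi : i ∈ Finset.Icc 1 n) (c : Fin d) (v : Fin i → Fin d) :
    |jetCoord X i c v x| ≤ jetScale n X x ^ i := by
  have h : |jetCoord X i c v x| ^ (2 * (n.factorial / i))
      ≤ (jetScale n X x ^ i) ^ (2 * (n.factorial / i)) := by
    rw [(even_two_mul _).pow_abs, ← pow_mul, scale_exponent hi, jetScale_pow]
    exact jetCoord_pow_le n X x hi c v
  exact (pow_le_pow_iff_left₀ (abs_nonneg _) (pow_nonneg (jetScale_nonneg n X x) _)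
    (exponent_ne_zero hi)).1 h

/-- The factor `d ^ i` counts the coordinate directions. The bound has the form `D ^ i` required by
the Faà di Bruno estimate. -/
lemma norm_iteratedFDeriv_le_jetScale {n : ℕ} {X : Coord d → Coord d} (hX : ContDiff ℝ ∞ X)
    (x : Coord d) {i : ℕ} (hi : i ∈ Finset.Icc 1 n) :
    ‖iteratedFDeriv ℝ i X x‖ ≤ (d * jetScale n X x) ^ i := by
  have h0 := jetScale_nonneg n X x
  refine ContinuousMultilinearMap.opNorm_le_bound (by positivity) fun w => ?_
  refine (pi_norm_le_iff_of_nonneg (by positivity)).2 fun c => ?_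
  have e : iteratedFDeriv ℝ i X x w c = iteratedFDeriv ℝ i (fun y => X y c) x w := by
    have := (ContinuousLinearMap.proj (R := ℝ) (φ := fun _ : Fin d => ℝ) c).iteratedFDeriv_comp_left
      (f := X) (x := x) (i := i) (n := ∞) hX.contDiffAt (by exact_mod_cast le_top)
    have h2 : (fun y => X y c)
      = (ContinuousLinearMap.proj (R := ℝ) (φ := fun _ : Fin d => ℝ) c) ∘ X := rfl
    rw [h2, this]; rfl
  rw [e]
  refine (ContinuousMultilinearMap.le_opNorm _ _).trans ?_
  gcongr
  refine (norm_multilinear_le_sum _).trans ?_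
  calc _ ≤ ∑ _v : Fin i → Fin d, jetScale n X x ^ i :=
        Finset.sum_le_sum fun v _ => abs_jetCoord_le n X x hi c v
    _ = _ := by simp [mul_pow]

lemma iteratedFDeriv_sub_const {φ : Coord d → ℝ} (hφ : ContDiff ℝ ∞ φ) (c : ℝ) {i : ℕ}
    (hi : 1 ≤ i) (x : Coord d) :
    iteratedFDeriv ℝ i (fun y => φ y - c) x = iteratedFDeriv ℝ i φ x := by
  have e := iteratedFDeriv_sub_apply (𝕜 := ℝ) (i := i) (f := φ) (g := fun _ => c) (x := x)
    (hφ.of_le (by exact_mod_cast le_top)).contDiffAt contDiff_const.contDiffAt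
  rw [iteratedFDeriv_const_of_ne (by omega), Pi.zero_apply, sub_zero] at e
  exact e

/-- In Faà di Bruno's formula each term of the `i`-th derivative of `φ ∘ X` is a product of
derivatives of `X` whose orders add up to `i`, so it scales like the `i`-th power of the jet scale.
Thus, although the formula is nonlinear in the jet, it respects the weights of `jetEnergy`. -/
lemma norm_iteratedFDeriv_comp_le_jetScale {φ : Coord d → ℝ} (hφ : LinearGrowth φ) (n : ℕ) :
    ∃ C, 0 ≤ C ∧ ∀ X : Coord d → Coord d, ContDiff ℝ ∞ X → ∀ x, ∀ i ∈ Finset.Icc 1 n,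
      ‖iteratedFDeriv ℝ i (fun y => φ (X y)) x‖ ≤ C * jetScale n X x ^ i := by
  obtain ⟨C, hC0, hC⟩ := hφ.deriv_bound n
  refine ⟨∑ i ∈ Finset.Icc 1 n, i.factorial * C * d ^ i, by positivity,
    fun X hX x i hi => ?_⟩
  have hi' := Finset.mem_Icc.1 hi
  -- The estimate also asks for a bound on the outer function itself, which may grow. Subtracting
  -- its value at `X x` makes the order-zero term vanish and leaves the derivatives unchanged.
  have h := norm_iteratedFDeriv_comp_le (𝕜 := ℝ) (g := fun y => φ y - φ (X x)) (f := X) (n := i)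
    (N := ∞) (hφ.smooth.sub contDiff_const) hX (by exact_mod_cast le_top) x (C := C)
    (D := d * jetScale n X x) (fun l hl => ?_) (fun l h1 hl =>
      norm_iteratedFDeriv_le_jetScale hX x (Finset.mem_Icc.2 ⟨h1, by omega⟩))
  · have e : iteratedFDeriv ℝ i ((fun y => φ y - φ (X x)) ∘ X) x
        = iteratedFDeriv ℝ i (fun y => φ (X y)) x := by
      have h3 : ContDiff ℝ ∞ (φ ∘ X) := hφ.smooth.comp hX
      exact iteratedFDeriv_sub_const h3 (φ (X x)) hi'.1 x
    rw [e] at h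
    refine h.trans ?_
    rw [mul_pow, ← mul_assoc]
    refine mul_le_mul_of_nonneg_right ?_ (pow_nonneg (jetScale_nonneg n X x) _)
    exact Finset.single_le_sum (f := fun i : ℕ => (i.factorial : ℝ) * C * d ^ i)
      (fun _ _ => by positivity) hi
  · rcases Nat.eq_zero_or_pos l with rfl | hl0
    · simpa [norm_iteratedFDeriv_zero] using hC0
    · rw [iteratedFDeriv_sub_const hφ.smooth _ hl0]
      exact hC l hl0 (by omega) _

/-- A step of the walk: drift `h F` and a displacement `e √h b`. -/
def stepMap (F b : Fin d → Coord d → ℝ) (h e : ℝ) (x : Coord d) : Coord d :=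
  fun i => x i + h * F i x + e * (Real.sqrt h * b i x)

lemma contDiff_stepMap {F b : Fin d → Coord d → ℝ} (hF : ∀ i, ContDiff ℝ ∞ (F i))
    (hb : ∀ i, ContDiff ℝ ∞ (b i)) (h e : ℝ) : ContDiff ℝ ∞ (stepMap F b h e) := by
  rw [contDiff_pi]
  intro i
  have := hF i
  have := hb i
  unfold stepMap
  fun_prop

lemma iteratedFDeriv_add_smul_add_smul {i : ℕ} {p q r : Coord d → ℝ} (hp : ContDiff ℝ ∞ p)
    (hq : ContDiff ℝ ∞ q) (hr : ContDiff ℝ ∞ r) (s t : ℝ) (x : Coord d) :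
    iteratedFDeriv ℝ i (fun y => p y + s * q y + t * r y) x = iteratedFDeriv ℝ i p x
      + s • iteratedFDeriv ℝ i q x + t • iteratedFDeriv ℝ i r x := by
  have hle : (i : ℕ∞ω) ≤ ∞ := by exact_mod_cast le_top
  have h1 : ContDiffAt ℝ i p x := (hp.of_le hle).contDiffAt
  have h2 : ContDiffAt ℝ i q x := (hq.of_le hle).contDiffAt
  have h3 : ContDiffAt ℝ i r x := (hr.of_le hle).contDiffAt
  have e1 : (fun y => p y + s * q y + t * r y) = (p + s • q) + t • r := by
    ext y; simp
  rw [e1, iteratedFDeriv_add_apply (f := p + s • q) (g := t • r)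
    (h1.add (h2.const_smul s)) (h3.const_smul t),
    iteratedFDeriv_add_apply (f := p) (g := s • q) h1 (h2.const_smul s),
    iteratedFDeriv_const_smul_apply h2, iteratedFDeriv_const_smul_apply h3]

lemma jetCoord_stepMap {F b : Fin d → Coord d → ℝ} (hF : ∀ i, ContDiff ℝ ∞ (F i))
    (hb : ∀ i, ContDiff ℝ ∞ (b i)) (h e : ℝ) {X : Coord d → Coord d} (hX : ContDiff ℝ ∞ X)
    (i : ℕ) (c : Fin d) (v : Fin i → Fin d) (x : Coord d) :
    jetCoord (fun y => stepMap F b h e (X y)) i c v x = jetCoord X i c v x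
      + h * iteratedFDeriv ℝ i (fun y => F c (X y)) x (fun l => Pi.single (v l) 1)
      + e * (Real.sqrt h * iteratedFDeriv ℝ i (fun y => b c (X y)) x
        (fun l => Pi.single (v l) 1)) := by
  have e1 : (fun y => stepMap F b h e (X y) c) =
      fun y => X y c + h * F c (X y) + (e * Real.sqrt h) * b c (X y) := by
    ext y; simp only [stepMap]; ring
  rw [jetCoord, e1, iteratedFDeriv_add_smul_add_smul (p := fun y => X y c)
    (q := fun y => F c (X y)) (r := fun y => b c (X y)) (contDiff_pi.1 hX c) ((hF c).comp hX)
    ((hb c).comp hX)]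
  simp [jetCoord]
  ring

/-- The even moment weight `1 + ∑ x_c^{2q}`. -/
def evenWeight (q : ℕ) (x : Coord d) : ℝ := 1 + ∑ c, x c ^ (2 * q)

lemma one_le_evenWeight (q : ℕ) (x : Coord d) : 1 ≤ evenWeight q x := by
  have : 0 ≤ ∑ c, x c ^ (2 * q) := Finset.sum_nonneg fun c _ => (even_two_mul q).pow_nonneg _
  rw [evenWeight]; linarith

lemma evenWeight_le (q : ℕ) (x : Coord d) : evenWeight q x ≤ (1 + d) * (1 + ‖x‖) ^ (2 * q) := by
  have h1 := one_le_weight x (2 * q)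
  have h2 : ∑ c, x c ^ (2 * q) ≤ ∑ _c : Fin d, (1 + ‖x‖) ^ (2 * q) :=
    Finset.sum_le_sum fun c _ => by
      rw [← (even_two_mul q).pow_abs]
      gcongr
      have := norm_le_pi_norm x c
      rw [Real.norm_eq_abs] at this
      linarith
  simp only [Finset.sum_const, Finset.card_univ, Fintype.card_fin, nsmul_eq_mul] at h2
  rw [evenWeight]
  linarith

lemma weight_le_evenWeight (q : ℕ) (x : Coord d) :
    (1 + ‖x‖) ^ (2 * q) ≤ 2 ^ (2 * q) * evenWeight q x := by
  have h : ‖x‖ ^ (2 * q) ≤ evenWeight q x := by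
    rcases isEmpty_or_nonempty (Fin d) with hd | hd
    · have : ‖x‖ = 0 := by simp [Pi.norm_def]
      rw [this]
      exact (pow_le_one₀ le_rfl zero_le_one).trans (one_le_evenWeight q x)
    · obtain ⟨c, hmax⟩ := Finite.exists_max (fun c => ‖x c‖)
      have hc : ‖x c‖ = ‖x‖ := le_antisymm (norm_le_pi_norm x c)
        ((pi_norm_le_iff_of_nonneg (norm_nonneg _)).2 hmax)
      rw [← hc, Real.norm_eq_abs, (even_two_mul q).pow_abs]
      have := Finset.single_le_sum (f := fun c => x c ^ (2 * q))
        (fun c _ => (even_two_mul q).pow_nonneg _) (Finset.mem_univ c)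
      rw [evenWeight]
      linarith
  rcases le_total ‖x‖ 1 with h1 | h1
  · calc (1 + ‖x‖) ^ (2 * q) ≤ 2 ^ (2 * q) := by gcongr; linarith
      _ ≤ _ := le_mul_of_one_le_right (by positivity) (one_le_evenWeight q x)
  · calc (1 + ‖x‖) ^ (2 * q) ≤ (2 * ‖x‖) ^ (2 * q) := by gcongr; linarith
      _ = 2 ^ (2 * q) * ‖x‖ ^ (2 * q) := by rw [mul_pow]
      _ ≤ _ := by gcongr

/-- `even_moment_step` in each coordinate. Linear growth makes the `2q`-th powers of drift and
displacement comparable with the weight itself. -/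
lemma evenWeight_step {F b : Fin d → Coord d → ℝ} (hF : ∀ i, LinearGrowth (F i))
    (hb : ∀ i, LinearGrowth (b i)) (q : ℕ) : ∃ C, 0 ≤ C ∧ ∀ h, 0 ≤ h → h ≤ 1 → ∀ x,
      (evenWeight q (stepMap F b h 1 x) + evenWeight q (stepMap F b h (-1) x)) / 2
        ≤ (1 + C * h) * evenWeight q x := by
  obtain ⟨C, hC0, hC⟩ := even_moment_step q
  choose D hD0 hD using fun i => (hF i).linear
  choose E hE0 hE using fun i => (hb i).linear
  have key : ∀ K : ℝ, 0 ≤ K → ∀ (x : Coord d) (y : ℝ), |y| ≤ K * (1 + ‖x‖) →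
      y ^ (2 * q) ≤ (2 * K) ^ (2 * q) * evenWeight q x := by
    intro K hK x y hy
    rw [← (even_two_mul q).pow_abs]
    calc |y| ^ (2 * q) ≤ (K * (1 + ‖x‖)) ^ (2 * q) := by gcongr
      _ = K ^ (2 * q) * (1 + ‖x‖) ^ (2 * q) := mul_pow ..
      _ ≤ K ^ (2 * q) * (2 ^ (2 * q) * evenWeight q x) := by
        gcongr; exact weight_le_evenWeight q x
      _ = _ := by rw [mul_pow]; ring
  refine ⟨∑ c, C * (1 + (2 * D c) ^ (2 * q) + (2 * E c) ^ (2 * q)),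
    Finset.sum_nonneg fun c _ => ?_, fun h h0 h1 x => ?_⟩
  · have := hD0 c; have := hE0 c; positivity
  have hx : ∀ c, x c ^ (2 * q) ≤ evenWeight q x := fun c => by
    have := Finset.single_le_sum (f := fun c => x c ^ (2 * q))
        (fun c _ => (even_two_mul q).pow_nonneg _) (Finset.mem_univ c)
    rw [evenWeight]
    linarith
  have e : (evenWeight q (stepMap F b h 1 x) + evenWeight q (stepMap F b h (-1) x)) / 2
      = 1 + ∑ c, ((x c + h * F c x + Real.sqrt h * b c x) ^ (2 * q)
        + (x c + h * F c x - Real.sqrt h * b c x) ^ (2 * q)) / 2 := by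
    simp only [evenWeight, stepMap]
    rw [← Finset.sum_div, Finset.sum_add_distrib]
    simp only [one_mul, neg_one_mul, ← sub_eq_add_neg]
    ring
  have hs : ∀ c ∈ Finset.univ, ((x c + h * F c x + Real.sqrt h * b c x) ^ (2 * q)
        + (x c + h * F c x - Real.sqrt h * b c x) ^ (2 * q)) / 2
      ≤ x c ^ (2 * q) + C * (1 + (2 * D c) ^ (2 * q) + (2 * E c) ^ (2 * q)) *
        (h * evenWeight q x) := fun c _ => by
    refine (hC _ _ _ h h0 h1).trans ?_
    have k1 := key (D c) (hD0 c) x _ (hD c x)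
    have k2 := key (E c) (hE0 c) x _ (hE c x)
    have : C * h * (x c ^ (2 * q) + F c x ^ (2 * q) + b c x ^ (2 * q)) ≤
        C * h * (evenWeight q x + (2 * D c) ^ (2 * q) * evenWeight q x
          + (2 * E c) ^ (2 * q) * evenWeight q x) := by
      gcongr; exact hx c
    linarith
  rw [e]
  refine (add_le_add_right (Finset.sum_le_sum hs) 1).trans (le_of_eq ?_)
  rw [Finset.sum_add_distrib, ← Finset.sum_mul, add_mul, one_mul]
  simp only [evenWeight]
  ring

/-- By linearity of differentiation, each jet coordinate of a step has the form `u + hA ± √h A'`,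
with `A`, `A'` derivatives of `F ∘ X` and `b ∘ X`. By homogeneity their powers are at most a
constant times the energy, so `even_moment_step` applies coordinate by coordinate and the estimate
closes. -/
lemma jetEnergy_step {F b : Fin d → Coord d → ℝ} (hF : ∀ i, LinearGrowth (F i))
    (hb : ∀ i, LinearGrowth (b i)) (n : ℕ) : ∃ C, 0 ≤ C ∧ ∀ h, 0 ≤ h → h ≤ 1 →
      ∀ X : Coord d → Coord d, ContDiff ℝ ∞ X → ∀ x,
      (jetEnergy n (fun y => stepMap F b h 1 (X y)) x
        + jetEnergy n (fun y => stepMap F b h (-1) (X y)) x) / 2 ≤ (1 + C * h) * jetEnergy n X x := by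
  choose C hC0 hC using even_moment_step
  choose D hD0 hD using fun i => norm_iteratedFDeriv_comp_le_jetScale (hF i) n
  choose E hE0 hE using fun i => norm_iteratedFDeriv_comp_le_jetScale (hb i) n
  have hFs := fun i => (hF i).smooth
  have hbs := fun i => (hb i).smooth
  let p : ℕ → ℕ := fun i => n.factorial / i
  have key : ∀ (K : ℝ), 0 ≤ K → ∀ (X : Coord d → Coord d) (x : Coord d), ∀ i ∈ Finset.Icc 1 n,
      ∀ (m : ContinuousMultilinearMap ℝ (fun _ : Fin i => Coord d) ℝ) (v : Fin i → Fin d),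
      ‖m‖ ≤ K * jetScale n X x ^ i →
      m (fun l => Pi.single (v l) 1) ^ (2 * p i) ≤ K ^ (2 * p i) * jetEnergy n X x := by
    intro K hK X x i hi m v hm
    have h1 : |m (fun l => Pi.single (v l) 1)| ≤ K * jetScale n X x ^ i := by
      refine (m.le_opNorm _).trans ?_
      simpa [norm_single_one] using hm
    rw [← (even_two_mul _).pow_abs]
    calc _ ≤ (K * jetScale n X x ^ i) ^ (2 * p i) := by gcongr
      _ = _ := by rw [mul_pow, ← pow_mul, scale_exponent hi, jetScale_pow]
  refine ⟨∑ i ∈ Finset.Icc 1 n, ∑ c, ∑ _v : Fin i → Fin d,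
    C (p i) * (1 + D c ^ (2 * p i) + E c ^ (2 * p i)), ?_, fun h h0 h1 X hX x => ?_⟩
  · refine Finset.sum_nonneg fun i _ => Finset.sum_nonneg fun c _ => Finset.sum_nonneg fun v _ => ?_
    have := hC0 (p i); have := hD0 c; have := hE0 c; positivity
  have hs : ∀ i ∈ Finset.Icc 1 n, ∀ c, ∀ v : Fin i → Fin d,
      (jetCoord (fun y => stepMap F b h 1 (X y)) i c v x ^ (2 * p i)
        + jetCoord (fun y => stepMap F b h (-1) (X y)) i c v x ^ (2 * p i)) / 2
      ≤ jetCoord X i c v x ^ (2 * p i) + C (p i) * (1 + D c ^ (2 * p i) + E c ^ (2 * p i)) *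
        (h * jetEnergy n X x) := by
    intro i hi c v
    rw [jetCoord_stepMap hFs hbs h _ hX, jetCoord_stepMap hFs hbs h _ hX]
    have k1 := key (D c) (hD0 c) X x i hi _ v (hD c X hX x i hi)
    have k2 := key (E c) (hE0 c) X x i hi _ v (hE c X hX x i hi)
    have k3 := jetCoord_pow_le n X x hi c v
    set A := iteratedFDeriv ℝ i (fun y => F c (X y)) x (fun l => Pi.single (v l) 1)
    set A' := iteratedFDeriv ℝ i (fun y => b c (X y)) x (fun l => Pi.single (v l) 1)
    have := hC (p i) (jetCoord X i c v x) A A' h h0 h1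
    rw [one_mul, neg_one_mul, ← sub_eq_add_neg]
    refine this.trans ?_
    have h4 : C (p i) * h * (jetCoord X i c v x ^ (2 * p i) + A ^ (2 * p i) + A' ^ (2 * p i)) ≤
        C (p i) * h * (jetEnergy n X x + D c ^ (2 * p i) * jetEnergy n X x
          + E c ^ (2 * p i) * jetEnergy n X x) := by
      have := hC0 (p i)
      gcongr
    linarith
  have e : (jetEnergy n (fun y => stepMap F b h 1 (X y)) x
        + jetEnergy n (fun y => stepMap F b h (-1) (X y)) x) / 2
      = ∑ i ∈ Finset.Icc 1 n, ∑ c, ∑ v : Fin i → Fin d,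
        (jetCoord (fun y => stepMap F b h 1 (X y)) i c v x ^ (2 * p i)
        + jetCoord (fun y => stepMap F b h (-1) (X y)) i c v x ^ (2 * p i)) / 2 := by
    simp only [jetEnergy, ← Finset.sum_div, Finset.sum_add_distrib]
    rfl
  rw [e]
  refine (Finset.sum_le_sum fun i hi => Finset.sum_le_sum fun c _ =>
    Finset.sum_le_sum fun v _ => hs i hi c v).trans (le_of_eq ?_)
  simp only [Finset.sum_add_distrib, ← Finset.sum_mul]
  simp only [jetEnergy, p]
  ring

section Walk

variable {ρ : Type*} [Fintype ρ]

/-- One step of the random walk which chooses a vector field `± b r` uniformly. -/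
def walk (F : Fin d → Coord d → ℝ) (b : ρ → Fin d → Coord d → ℝ) (h : ℝ) (v : Coord d → ℝ)
    (x : Coord d) : ℝ :=
  (Fintype.card ρ : ℝ)⁻¹ * ∑ r, (v (stepMap F (b r) h 1 x) + v (stepMap F (b r) h (-1) x)) / 2

lemma contDiff_walk {F : Fin d → Coord d → ℝ} {b : ρ → Fin d → Coord d → ℝ}
    (hF : ∀ i, ContDiff ℝ ∞ (F i)) (hb : ∀ r i, ContDiff ℝ ∞ (b r i)) (h : ℝ)
    {v : Coord d → ℝ} (hv : ContDiff ℝ ∞ v) : ContDiff ℝ ∞ (walk F b h v) := by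
  refine contDiff_const.mul (ContDiff.sum fun r _ => ?_)
  exact ((hv.comp (contDiff_stepMap hF (hb r) h 1)).add
    (hv.comp (contDiff_stepMap hF (hb r) h (-1)))).div_const 2

variable {F : Fin d → Coord d → ℝ} {b : ρ → Fin d → Coord d → ℝ}

/-- The combined Lyapunov function of a map and its derivatives. -/
def jetWeight (q n : ℕ) (X : Coord d → Coord d) (x : Coord d) : ℝ :=
  evenWeight q (X x) + jetEnergy n X x

lemma jetWeight_step (hF : ∀ i, LinearGrowth (F i)) (hb : ∀ r i, LinearGrowth (b r i))
    (q n : ℕ) : ∃ C, 0 ≤ C ∧ ∀ h, 0 ≤ h → h ≤ 1 →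
      ∀ X : Coord d → Coord d, ContDiff ℝ ∞ X → ∀ x r,
      (jetWeight q n (fun y => stepMap F (b r) h 1 (X y)) x
        + jetWeight q n (fun y => stepMap F (b r) h (-1) (X y)) x) / 2
        ≤ (1 + C * h) * jetWeight q n X x := by
  choose C hC0 hC using fun r => evenWeight_step hF (hb r) q
  choose D hD0 hD using fun r => jetEnergy_step hF (hb r) n
  refine ⟨∑ r, (C r + D r), Finset.sum_nonneg fun r _ => add_nonneg (hC0 r) (hD0 r),
    fun h h0 h1 X hX x r => ?_⟩
  have h2 := hC r h h0 h1 (X x)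
  have h3 := hD r h h0 h1 X hX x
  have h4 : C r + D r ≤ ∑ r, (C r + D r) := Finset.single_le_sum (f := fun r => C r + D r)
    (fun r _ => add_nonneg (hC0 r) (hD0 r)) (Finset.mem_univ r)
  have h5 := one_le_evenWeight q (X x)
  have h6 := jetEnergy_nonneg n X x
  set S := ∑ r, (C r + D r)
  have a1 : (1 + C r * h) * evenWeight q (X x) ≤ (1 + S * h) * evenWeight q (X x) := by
    gcongr; linarith [hD0 r]
  have a2 : (1 + D r * h) * jetEnergy n X x ≤ (1 + S * h) * jetEnergy n X x := by
    gcongr; linarith [hC0 r]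
  simp only [jetWeight]
  linarith

/-- Faà di Bruno bounds the derivative by a product of a polynomial weight of `X x` and a power of
the jet scale. The product is split into a sum because `jetWeight` is additive. -/
lemma norm_iteratedFDeriv_comp_le_jetWeight {f : Coord d → ℝ}
    (hf : Growth 1 (fun _ : Unit => f)) (n : ℕ) : ∃ (K : ℝ) (q : ℕ), 0 ≤ K ∧
      ∀ X : Coord d → Coord d, ContDiff ℝ ∞ X → ∀ x,
        ‖iteratedFDeriv ℝ n (fun y => f (X y)) x‖ ≤ K * jetWeight q n X x := by
  obtain ⟨C, k, hC0, hC⟩ := hf.bound n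
  refine ⟨n.factorial * C * d ^ n * (2 ^ (2 * k) + 2), k, by positivity, fun X hX x => ?_⟩
  have h := norm_iteratedFDeriv_comp_le (𝕜 := ℝ) (g := f) (f := X) (n := n)
    (N := ∞) (hf.1 ()) hX (by exact_mod_cast le_top) x
    (C := C * (1 + ‖X x‖) ^ k) (D := d * jetScale n X x)
    (fun l hl => by simpa using hC l hl () (X x)) (fun l h1 hl =>
      norm_iteratedFDeriv_le_jetScale hX x (Finset.mem_Icc.2 ⟨h1, by omega⟩))
  refine h.trans ?_
  set τ := jetScale n X x
  have hτ : 0 ≤ τ := jetScale_nonneg n X x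
  have h1 : (1 + ‖X x‖) ^ k * τ ^ n ≤ (1 + ‖X x‖) ^ (2 * k) + τ ^ (2 * n) := by
    have e1 : (1 + ‖X x‖) ^ (2 * k) = ((1 + ‖X x‖) ^ k) ^ 2 := by rw [← pow_mul, mul_comm]
    have e2 : τ ^ (2 * n) = (τ ^ n) ^ 2 := by rw [← pow_mul, mul_comm]
    rw [e1, e2]
    nlinarith [sq_nonneg ((1 + ‖X x‖) ^ k - τ ^ n), sq_nonneg ((1 + ‖X x‖) ^ k),
      sq_nonneg (τ ^ n)]
  -- The energy is the power `2 · n!` of the scale, and `n ≤ n!`; the summand `1` covers scales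
  -- below one.
  have h2 : τ ^ (2 * n) ≤ 1 + jetEnergy n X x := by
    rw [← jetScale_pow]
    rcases le_total τ 1 with h' | h'
    · have := pow_le_one₀ (n := 2 * n) hτ h'
      have : 0 ≤ τ ^ (2 * n.factorial) := by positivity
      change τ ^ (2 * n) ≤ 1 + τ ^ (2 * n.factorial)
      linarith
    · have := pow_le_pow_right₀ h' (Nat.mul_le_mul_left 2 (Nat.self_le_factorial n))
      change τ ^ (2 * n) ≤ 1 + τ ^ (2 * n.factorial)
      linarith
  have h3 := weight_le_evenWeight k (X x)
  have h4 := one_le_evenWeight k (X x)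
  have h5 := jetEnergy_nonneg n X x
  have h6 : (1 + ‖X x‖) ^ k * τ ^ n ≤ (2 ^ (2 * k) + 2) * jetWeight k n X x := by
    have : 0 ≤ (2 : ℝ) ^ (2 * k) * jetEnergy n X x := by positivity
    simp only [jetWeight]
    linarith
  calc _ = n.factorial * C * d ^ n * ((1 + ‖X x‖) ^ k * τ ^ n) := by rw [mul_pow]; ring
    _ ≤ n.factorial * C * d ^ n * ((2 ^ (2 * k) + 2) * jetWeight k n X x) := by gcongr
    _ = _ := by ring

/-- Stability of the walk in all derivatives. An iterate is an average of `f` over compositions of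
step maps. Each step multiplies the averaged jet weight by at most `1 + Ch`, and `l` steps with `l h
≤ T` cost at most `exp (C T)`. -/
lemma growth_walk_iterate [Nonempty ρ] (hF : ∀ i, LinearGrowth (F i)) (hb : ∀ r i, LinearGrowth (b r i))
    {f : Coord d → ℝ} (hf : Growth 1 (fun _ : Unit => f)) (T : ℝ) :
    Growth 1 (fun (p : {p : ℝ × ℕ // 0 ≤ p.1 ∧ p.1 ≤ 1 ∧ p.2 * p.1 ≤ T}) =>
      (walk F b p.1.1)^[p.1.2] f) := by
  have hFs := fun i => (hF i).smooth
  have hbs := fun r i => (hb r i).smooth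
  have hsm : ∀ (h : ℝ) (l : ℕ), ContDiff ℝ ∞ ((walk F b h)^[l] f) := by
    intro h l
    induction l with
    | zero => exact hf.1 ()
    | succ l ih =>
      rw [Function.iterate_succ_apply']
      exact contDiff_walk hFs hbs h ih
  refine ⟨fun p => hsm _ _, fun n => ?_⟩
  obtain ⟨K, q, hK0, hK⟩ := norm_iteratedFDeriv_comp_le_jetWeight hf n
  obtain ⟨C, hC0, hC⟩ := jetWeight_step hF hb q n
  -- The statement is made for an arbitrary inner map `X`, so that the induction can absorb one step
  -- of the walk into `X`. Only at the end is `X` the identity.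
  have key : ∀ h, 0 ≤ h → h ≤ 1 → ∀ l : ℕ, ∀ X : Coord d → Coord d, ContDiff ℝ ∞ X → ∀ x,
      ‖iteratedFDeriv ℝ n (fun y => (walk F b h)^[l] f (X y)) x‖
        ≤ K * (1 + C * h) ^ l * jetWeight q n X x := by
    intro h h0 h1 l
    induction l with
    | zero => intro X hX x; simpa using hK X hX x
    | succ l ih =>
      intro X hX x
      set u := (walk F b h)^[l] f with hu
      have hus : ContDiff ℝ ∞ u := hsm h l
      have hXe : ∀ r e, ContDiff ℝ ∞ (fun y => stepMap F (b r) h e (X y)) := fun r e =>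
        (contDiff_stepMap hFs (hbs r) h e).comp hX
      have huX : ∀ r e, ContDiff ℝ ∞ (fun y => u (stepMap F (b r) h e (X y))) := fun r e =>
        hus.comp (hXe r e)
      have hle : (n : ℕ∞ω) ≤ ∞ := by exact_mod_cast le_top
      have e1 : (fun y => (walk F b h)^[l + 1] f (X y)) = fun y => (Fintype.card ρ : ℝ)⁻¹ *
          ∑ r, (2 : ℝ)⁻¹ * (u (stepMap F (b r) h 1 (X y)) + u (stepMap F (b r) h (-1) (X y))) := by
        ext y
        rw [Function.iterate_succ_apply', walk]
        congr 1
        exact Finset.sum_congr rfl fun r _ => by rw [hu]; ring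
      have e2 : iteratedFDeriv ℝ n (fun y => (walk F b h)^[l + 1] f (X y)) x
          = (Fintype.card ρ : ℝ)⁻¹ • ∑ r, (2 : ℝ)⁻¹ •
            (iteratedFDeriv ℝ n (fun y => u (stepMap F (b r) h 1 (X y))) x
            + iteratedFDeriv ℝ n (fun y => u (stepMap F (b r) h (-1) (X y))) x) := by
        rw [e1]
        have c1 : ∀ r, ContDiff ℝ n (fun y => u (stepMap F (b r) h 1 (X y))
            + u (stepMap F (b r) h (-1) (X y))) := fun r =>
          ((huX r 1).add (huX r (-1))).of_le hle
        have c2 : ∀ r, ContDiff ℝ n (fun y => (2 : ℝ)⁻¹ * (u (stepMap F (b r) h 1 (X y))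
            + u (stepMap F (b r) h (-1) (X y)))) := fun r => contDiff_const.mul (c1 r)
        have s1 := iteratedFDeriv_const_smul_apply (𝕜 := ℝ) (i := n) (x := x)
          (a := (Fintype.card ρ : ℝ)⁻¹) (f := fun y =>
          ∑ r, (2 : ℝ)⁻¹ * (u (stepMap F (b r) h 1 (X y)) + u (stepMap F (b r) h (-1) (X y))))
          (ContDiff.sum fun r _ => c2 r).contDiffAt
        refine s1.trans ?_
        congr 1
        rw [iteratedFDeriv_fun_sum_apply fun r _ => (c2 r).contDiffAt]
        refine Finset.sum_congr rfl fun r _ => ?_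
        have s2 := iteratedFDeriv_const_smul_apply (𝕜 := ℝ) (i := n) (x := x)
          (a := (2 : ℝ)⁻¹) (f := fun y => u (stepMap F (b r) h 1 (X y))
            + u (stepMap F (b r) h (-1) (X y))) (c1 r).contDiffAt
        refine s2.trans ?_
        congr 1
        exact iteratedFDeriv_add_apply (f := fun y => u (stepMap F (b r) h 1 (X y)))
          (g := fun y => u (stepMap F (b r) h (-1) (X y)))
          ((huX r 1).of_le hle).contDiffAt ((huX r (-1)).of_le hle).contDiffAt
      rw [e2, norm_smul, Real.norm_of_nonneg (by positivity)]
      have hcard : (0 : ℝ) < Fintype.card ρ := by exact_mod_cast Fintype.card_pos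
      rw [inv_mul_le_iff₀ hcard]
      refine (norm_sum_le _ _).trans ?_
      have hr : ∀ r ∈ (Finset.univ : Finset ρ), ‖(2 : ℝ)⁻¹ •
            (iteratedFDeriv ℝ n (fun y => u (stepMap F (b r) h 1 (X y))) x
            + iteratedFDeriv ℝ n (fun y => u (stepMap F (b r) h (-1) (X y))) x)‖
          ≤ K * (1 + C * h) ^ (l + 1) * jetWeight q n X x := by
        intro r _
        rw [norm_smul, Real.norm_of_nonneg (by positivity)]
        have i1 := ih _ (hXe r 1) x
        have i2 := ih _ (hXe r (-1)) x
        have i3 := hC h h0 h1 X hX x r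
        have i4 := norm_add_le (iteratedFDeriv ℝ n (fun y => u (stepMap F (b r) h 1 (X y))) x)
          (iteratedFDeriv ℝ n (fun y => u (stepMap F (b r) h (-1) (X y))) x)
        have i5 : K * (1 + C * h) ^ l * ((jetWeight q n (fun y => stepMap F (b r) h 1 (X y)) x
            + jetWeight q n (fun y => stepMap F (b r) h (-1) (X y)) x) / 2)
            ≤ K * (1 + C * h) ^ l * ((1 + C * h) * jetWeight q n X x) := by gcongr
        rw [pow_succ]
        linarith
      refine (Finset.sum_le_sum hr).trans (le_of_eq ?_)
      simp
  have hco : ∀ (c : Fin d) , ∃ (D : ℝ) (k : ℕ), 0 ≤ D ∧ ∀ i ≤ n, ∀ x : Coord d,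
      ‖iteratedFDeriv ℝ i (fun y : Coord d => y c) x‖ ≤ D * (1 + ‖x‖) ^ k := fun c => by
    obtain ⟨D, k, h0, h⟩ := (Growth.coord (ι := Unit) c).bound n
    exact ⟨D, k, h0, fun i hi x => by simpa using h i hi () x⟩
  choose D k hD0 hD using hco
  -- The initial value of the Lyapunov function: for the identity it is polynomially bounded.
  have hid : ∃ (A : ℝ) (m : ℕ), 0 ≤ A ∧ ∀ x, jetWeight q n (id : Coord d → Coord d) x
      ≤ A * (1 + ‖x‖) ^ m := by
    let D' := ∑ c, D c
    obtain ⟨k', hk'⟩ : ∃ k', k' = ∑ c, k c := ⟨_, rfl⟩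
    have hD' : 0 ≤ D' := Finset.sum_nonneg fun c _ => hD0 c
    let N := 2 * n.factorial
    refine ⟨(1 + d) + ∑ i ∈ Finset.Icc 1 n, ∑ _c : Fin d, ∑ _v : Fin i → Fin d, (1 + D') ^ N,
      2 * q + k' * N, by positivity, fun x => ?_⟩
    rw [jetWeight, jetEnergy, add_mul, Finset.sum_mul]
    refine add_le_add ((evenWeight_le q x).trans ?_) (Finset.sum_le_sum fun i hi => ?_)
    · gcongr
      · exact one_le_one_add_norm x
      · omega
    · rw [Finset.sum_mul]
      refine Finset.sum_le_sum fun c _ => ?_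
      rw [Finset.sum_mul]
      refine Finset.sum_le_sum fun v _ => ?_
      have hi' := Finset.mem_Icc.1 hi
      have b1 : |jetCoord id i c v x| ≤ (1 + D') * (1 + ‖x‖) ^ k' := by
        have s1 : |jetCoord id i c v x| ≤ ‖iteratedFDeriv ℝ i (fun y : Coord d => y c) x‖ := by
          refine ((iteratedFDeriv ℝ i (fun y : Coord d => y c) x).le_opNorm _).trans ?_
          simp [norm_single_one]
        refine s1.trans ((hD c i hi'.2 x).trans ?_)
        have s2 : D c ≤ D' := Finset.single_le_sum (f := D) (fun c _ => hD0 c) (Finset.mem_univ c)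
        have s3 : k c ≤ k' := hk' ▸ Finset.single_le_sum (f := k) (fun c _ => Nat.zero_le _)
          (Finset.mem_univ c)
        gcongr
        · linarith
        · exact one_le_one_add_norm x
      have b2 : 1 ≤ (1 + D') * (1 + ‖x‖) ^ k' := by
        have := one_le_weight x k'
        nlinarith
      rw [← (even_two_mul _).pow_abs]
      calc _ ≤ ((1 + D') * (1 + ‖x‖) ^ k') ^ (2 * (n.factorial / i)) := by gcongr
        _ ≤ ((1 + D') * (1 + ‖x‖) ^ k') ^ N :=
          pow_le_pow_right₀ b2 (Nat.mul_le_mul_left 2 (Nat.div_le_self _ _))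
        _ = (1 + D') ^ N * (1 + ‖x‖) ^ (k' * N) := by rw [mul_pow, ← pow_mul (1 + ‖x‖)]
        _ ≤ _ := by
          gcongr
          · exact one_le_one_add_norm x
          · omega
  obtain ⟨A, m, hA0, hA⟩ := hid
  refine ⟨K * Real.exp (C * T) * A, m, fun p x => ?_⟩
  obtain ⟨⟨h, l⟩, h0, h1, hT⟩ := p
  simp only at h0 h1 hT ⊢
  have h2 := key h h0 h1 l id contDiff_id x
  have h3 : (1 + C * h) ^ l ≤ Real.exp (C * T) := by
    calc (1 + C * h) ^ l ≤ (Real.exp (C * h)) ^ l := by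
          gcongr
          linarith [Real.add_one_le_exp (C * h)]
      _ = Real.exp (l * (C * h)) := by rw [Real.exp_nat_mul]
      _ ≤ Real.exp (C * T) := by
          apply Real.exp_le_exp.2
          nlinarith
  refine h2.trans ?_
  calc _ ≤ K * Real.exp (C * T) * (A * (1 + ‖x‖) ^ m) := by
        have h4 : 0 ≤ jetWeight q n (id : Coord d → Coord d) x :=
          add_nonneg (zero_le_one.trans (one_le_evenWeight q _)) (jetEnergy_nonneg n _ x)
        gcongr
        exact hA x
    _ = _ := by rw [one_mul]; ring

end Walk

/-! ### Taylor expansions of families of polynomial growth -/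

lemma weight_add_le (x y : Coord d) (k : ℕ) :
    (1 + ‖x + y‖) ^ k ≤ (1 + ‖x‖) ^ k * (1 + ‖y‖) ^ k := by
  rw [← mul_pow]
  gcongr
  have := norm_add_le x y
  nlinarith [mul_nonneg (norm_nonneg x) (norm_nonneg y)]

lemma weight_segment_le (x y : Coord d) (k : ℕ) {t : ℝ} (ht : t ∈ Set.Icc (0 : ℝ) 1) :
    (1 + ‖x + t • y‖) ^ k ≤ (1 + ‖x‖) ^ k * (1 + ‖y‖) ^ k := by
  refine (weight_add_le x (t • y) k).trans ?_
  have : ‖t • y‖ ≤ ‖y‖ := by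
    rw [norm_smul, Real.norm_of_nonneg ht.1]
    exact mul_le_of_le_one_left (norm_nonneg y) ht.2
  gcongr

lemma Growth.iteratedFDeriv_segment {u : ι → Coord d → ℝ} (hu : Growth 1 u) (n : ℕ) :
    ∃ (C : ℝ) (k : ℕ), 0 ≤ C ∧ ∀ i x y, ∀ t ∈ Set.Icc (0 : ℝ) 1,
      ‖iteratedFDeriv ℝ n (u i) (x + t • y)‖ ≤ C * (1 + ‖x‖) ^ k * (1 + ‖y‖) ^ k := by
  obtain ⟨C, k, hC, h⟩ := hu.bound n
  refine ⟨C, k, hC, fun i x y t ht => (h n le_rfl i _).trans ?_⟩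
  rw [one_mul, mul_assoc]
  gcongr
  exact weight_segment_le x y k ht

lemma Growth.taylor_two {u : ι → Coord d → ℝ} (hu : Growth 1 u) :
    ∃ (C : ℝ) (k : ℕ), 0 ≤ C ∧ ∀ i x y,
      |u i (x + y) - u i x - ∑ a, CovariantFP.pd a (u i) x * y a
        - (1 / 2) * ∑ a, ∑ b, CovariantFP.pd a (CovariantFP.pd b (u i)) x * y a * y b|
        ≤ C * (1 + ‖x‖) ^ k * (1 + ‖y‖) ^ k * ‖y‖ ^ 3 := by
  obtain ⟨C, k, hC, h⟩ := hu.iteratedFDeriv_segment 3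
  exact ⟨C, k, hC, fun i x y => CovariantFP.taylor_two (hu.1 i) (h i x y)⟩

/-! ### Consistency of the walk -/

lemma Growth.linearGrowth {φ : Coord d → ℝ} (h : Growth 0 (fun _ : Unit => φ)) :
    LinearGrowth φ where
  smooth := h.1 ()
  deriv_bdd n _ := by
    obtain ⟨C, k, hC⟩ := h.2 n
    exact ⟨C, fun x => by simpa using hC () x⟩
  linear := by
    obtain ⟨C, h0, hC⟩ := h.exists_bound
    refine ⟨C, h0, fun x => (hC () x).trans ?_⟩
    exact le_mul_of_one_le_right h0 (one_le_one_add_norm x)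

section

variable {B : Coord d → Matrix (Fin d) (Fin d) ℝ} {F : Fin d → Coord d → ℝ}

lemma Admissible.linearGrowth_F (h : Admissible B F) (i : Fin d) : LinearGrowth (F i) where
  smooth := h.contDiff_F i
  deriv_bdd := h.bounded_F i
  linear := by
    obtain ⟨C, h0, hC⟩ := h.linear_F
    exact ⟨C, h0, hC i⟩

/-- Second-order Taylor expansion at `x`: the drift gives the first-order part of `gen`, the mean of
the squares of the fields gives the second-order part, and the cubic remainder is of order `h√h`
because the increments are of order `√h`. -/
lemma walk_consistent {ρ : Type*} [Fintype ρ] [Nonempty ρ] {b : ρ → Fin d → Coord d → ℝ}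
    (hF : ∀ i, LinearGrowth (F i)) (hb : ∀ r i, LinearGrowth (b r i))
    (hB : ∀ x i k, (Fintype.card ρ : ℝ)⁻¹ * ∑ r, (1 / 2) * (b r i x * b r k x) = B x i k)
    {u : ι → Coord d → ℝ} (hu : Growth 1 u) :
    ∃ (C : ℝ) (k : ℕ), 0 ≤ C ∧ ∀ i h x, 0 ≤ h → h ≤ 1 →
      |walk F b h (u i) x - u i x - h * gen B F (u i) x|
        ≤ C * (h * Real.sqrt h) * (1 + ‖x‖) ^ k := by
  obtain ⟨C, k, hC0, hC⟩ := hu.taylor_two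
  have hlin : ∃ D, 0 ≤ D ∧ (∀ i x, |F i x| ≤ D * (1 + ‖x‖)) ∧
      ∀ r i x, |b r i x| ≤ D * (1 + ‖x‖) := by
    choose D hD0 hD using fun i => (hF i).linear
    choose E hE0 hE using fun r i => (hb r i).linear
    refine ⟨∑ i, D i + ∑ r, ∑ i, E r i, ?_, fun i x => (hD i x).trans ?_,
      fun r i x => (hE r i x).trans ?_⟩
    · exact add_nonneg (Finset.sum_nonneg fun i _ => hD0 i)
        (Finset.sum_nonneg fun r _ => Finset.sum_nonneg fun i _ => hE0 r i)
    · gcongr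
      refine le_add_of_le_of_nonneg (Finset.single_le_sum (fun i _ => hD0 i) (Finset.mem_univ i))
        (Finset.sum_nonneg fun r _ => Finset.sum_nonneg fun i _ => hE0 r i)
    · gcongr
      refine le_add_of_nonneg_of_le (Finset.sum_nonneg fun i _ => hD0 i) ?_
      exact (Finset.single_le_sum (f := fun i => E r i) (fun i _ => hE0 r i)
        (Finset.mem_univ i)).trans (Finset.single_le_sum (f := fun r => ∑ i, E r i)
        (fun r _ => Finset.sum_nonneg fun i _ => hE0 r i) (Finset.mem_univ r))
  obtain ⟨D, hD0, hDF, hDb⟩ := hlin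
  -- The square of the drift also enters at second order, with prefactor `h²`. It is not part of
  -- `gen` and has to be counted as an error.
  have hpd : ∃ (P : ℝ) (l : ℕ), 0 ≤ P ∧ ∀ i x,
      |∑ a, ∑ c, pd a (pd c (u i)) x * F a x * F c x| ≤ P * (1 + ‖x‖) ^ l := by
    have : Growth 1 (fun i x => ∑ a, ∑ c, pd a (pd c (u i)) x * F a x * F c x * 1) := by
      refine Growth.sum _ fun a _ => Growth.sum _ fun c _ => ?_
      have gF : ∀ a, Growth 1 (fun _ : ι => F a) := fun a => by
        refine ⟨fun _ => (hF a).smooth, fun n => ?_⟩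
        rcases n with _ | n
        · exact ⟨D, 1, fun _ x => by
            rw [norm_iteratedFDeriv_zero]; simpa using hDF a x⟩
        · obtain ⟨K, hK⟩ := (hF a).deriv_bdd (n + 1) (by omega)
          exact ⟨K, 0, fun _ x => by simpa using hK x⟩
      exact ((((hu.pd c).pd a).mul (gF a)).mul (gF c)).mul (Growth.const 1)
    obtain ⟨P, l, h0, h⟩ := this.abs_le
    exact ⟨P, l, h0, fun i x => by simpa using h i x⟩
  obtain ⟨P, l, hP0, hP⟩ := hpd
  refine ⟨C * (1 + 2 * D) ^ k * (2 * D) ^ 3 + P, (k + (k + 3)) + l, by positivity,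
    fun i h x h0 h1 => ?_⟩
  set s := Real.sqrt h with hs
  have hs0 : 0 ≤ s := Real.sqrt_nonneg h
  have hs2 : s ^ 2 = h := Real.sq_sqrt h0
  have hs1 : s ≤ 1 := Real.sqrt_le_one.2 h1
  let δ : ρ → ℝ → Coord d := fun r e a => h * F a x + e * (s * b r a x)
  have hδ : ∀ r e, |e| = 1 → ‖δ r e‖ ≤ 2 * D * s * (1 + ‖x‖) := by
    intro r e he
    have hn := norm_nonneg x
    refine (pi_norm_le_iff_of_nonneg (by positivity)).2 fun a => ?_
    refine (abs_add_le _ _).trans ?_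
    rw [abs_mul, abs_mul, abs_mul, he, abs_of_nonneg h0, abs_of_nonneg hs0, one_mul]
    have e1 : h * |F a x| ≤ s * (D * (1 + ‖x‖)) := by
      rw [← hs2]
      calc s ^ 2 * |F a x| = s * (s * |F a x|) := by ring
        _ ≤ s * (1 * (D * (1 + ‖x‖))) := by gcongr; exact hDF a x
        _ = _ := by ring
    have e2 : s * |b r a x| ≤ s * (D * (1 + ‖x‖)) := by gcongr; exact hDb r a x
    linarith
  have hstep : ∀ r e, stepMap F (b r) h e x = x + δ r e := by
    intro r e; ext a; simp only [stepMap, δ, Pi.add_apply, ← hs]; ring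
  let T : Coord d → ℝ := fun y => ∑ a, pd a (u i) x * y a
        + (1 / 2) * ∑ a, ∑ c, pd a (pd c (u i)) x * y a * y c
  have hrem : ∀ r e, |e| = 1 → |u i (x + δ r e) - u i x - T (δ r e)|
      ≤ (C * (1 + 2 * D) ^ k * (2 * D) ^ 3) * (h * s) * (1 + ‖x‖) ^ (k + (k + 3)) := by
    intro r e he
    have e1 := hC i x (δ r e)
    rw [sub_sub] at e1
    refine e1.trans ?_
    have e2 := hδ r e he
    have hn := norm_nonneg x
    have e3 : 1 + ‖δ r e‖ ≤ (1 + 2 * D) * (1 + ‖x‖) := by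
      have : 2 * D * s * (1 + ‖x‖) ≤ 2 * D * 1 * (1 + ‖x‖) := by gcongr
      linarith
    calc _ ≤ C * (1 + ‖x‖) ^ k * ((1 + 2 * D) * (1 + ‖x‖)) ^ k
          * (2 * D * s * (1 + ‖x‖)) ^ 3 := by gcongr
      _ = _ := by rw [← hs2, mul_pow (1 + 2 * D), pow_add, pow_add]; ring
  -- Averaging over the two signs removes the terms odd in `√h`, namely the linear one in `b r` and
  -- the mixed one with `F` and `b r`.
  have hT : ∀ r, (T (δ r 1) + T (δ r (-1))) / 2 = h * ∑ a, F a x * pd a (u i) x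
      + (1 / 2) * h ^ 2 * ∑ a, ∑ c, pd a (pd c (u i)) x * F a x * F c x
      + h * ∑ a, ∑ c, pd a (pd c (u i)) x * ((1 / 2) * (b r a x * b r c x)) := by
    intro r
    simp only [T, δ]
    have a1 : ∑ a, pd a (u i) x * (h * F a x + 1 * (s * b r a x))
        + ∑ a, pd a (u i) x * (h * F a x + -1 * (s * b r a x))
        = 2 * (h * ∑ a, F a x * pd a (u i) x) := by
      rw [← Finset.sum_add_distrib, Finset.mul_sum, Finset.mul_sum]
      exact Finset.sum_congr rfl fun a _ => by ring
    have a2 : ∑ a, ∑ c, pd a (pd c (u i)) x * (h * F a x + 1 * (s * b r a x))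
          * (h * F c x + 1 * (s * b r c x))
        + ∑ a, ∑ c, pd a (pd c (u i)) x * (h * F a x + -1 * (s * b r a x))
          * (h * F c x + -1 * (s * b r c x))
        = 2 * (h ^ 2 * ∑ a, ∑ c, pd a (pd c (u i)) x * F a x * F c x)
          + 4 * (h * ∑ a, ∑ c, pd a (pd c (u i)) x * ((1 / 2) * (b r a x * b r c x))) := by
      simp only [← Finset.sum_add_distrib, Finset.mul_sum]
      refine Finset.sum_congr rfl fun a _ => Finset.sum_congr rfl fun c _ => ?_
      rw [← hs2]; ring
    linarith
  have hgen : (Fintype.card ρ : ℝ)⁻¹ * ∑ r, (T (δ r 1) + T (δ r (-1))) / 2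
      = h * gen B F (u i) x
        + (1 / 2) * h ^ 2 * ∑ a, ∑ c, pd a (pd c (u i)) x * F a x * F c x := by
    have hcard : (Fintype.card ρ : ℝ) ≠ 0 := by
      exact_mod_cast Fintype.card_ne_zero
    simp only [hT, Finset.sum_add_distrib, Finset.sum_const, Finset.card_univ, nsmul_eq_mul]
    have a3 : (Fintype.card ρ : ℝ)⁻¹ * ∑ r, h * ∑ a, ∑ c, pd a (pd c (u i)) x *
        ((1 / 2) * (b r a x * b r c x)) = h * ∑ a, ∑ c, B x a c * pd a (pd c (u i)) x := by
      simp only [← hB]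
      rw [← Finset.mul_sum, Finset.sum_comm, mul_left_comm]
      congr 1
      rw [Finset.mul_sum]
      refine Finset.sum_congr rfl fun a _ => ?_
      rw [Finset.sum_comm, Finset.mul_sum]
      refine Finset.sum_congr rfl fun c _ => ?_
      rw [← Finset.mul_sum]
      ring
    rw [mul_add, mul_add, a3, gen]
    field_simp
    ring
  have hw : walk F b h (u i) x - u i x - h * gen B F (u i) x
      = (Fintype.card ρ : ℝ)⁻¹ * ∑ r, ((u i (x + δ r 1) - u i x - T (δ r 1))
        + (u i (x + δ r (-1)) - u i x - T (δ r (-1)))) / 2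
        + (1 / 2) * h ^ 2 * ∑ a, ∑ c, pd a (pd c (u i)) x * F a x * F c x := by
    have hcard : (Fintype.card ρ : ℝ) ≠ 0 := by
      exact_mod_cast Fintype.card_ne_zero
    have a4 : ∑ r, ((u i (x + δ r 1) - u i x - T (δ r 1))
        + (u i (x + δ r (-1)) - u i x - T (δ r (-1)))) / 2
        = ∑ r, (u i (x + δ r 1) + u i (x + δ r (-1))) / 2 - Fintype.card ρ * u i x
          - ∑ r, (T (δ r 1) + T (δ r (-1))) / 2 := by
      have : ∀ r, ((u i (x + δ r 1) - u i x - T (δ r 1))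
        + (u i (x + δ r (-1)) - u i x - T (δ r (-1)))) / 2
        = (u i (x + δ r 1) + u i (x + δ r (-1))) / 2 - u i x - (T (δ r 1) + T (δ r (-1))) / 2 :=
        fun r => by ring
      simp only [this, Finset.sum_sub_distrib, Finset.sum_const, Finset.card_univ, nsmul_eq_mul]
    rw [a4, mul_sub, hgen, mul_sub, inv_mul_cancel_left₀ hcard, walk]
    simp only [hstep]
    ring
  rw [hw]
  have hn := one_le_one_add_norm x
  set R := (C * (1 + 2 * D) ^ k * (2 * D) ^ 3) with hR
  have hR0 : 0 ≤ R := by positivity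
  have f1 : |(Fintype.card ρ : ℝ)⁻¹ * ∑ r, ((u i (x + δ r 1) - u i x - T (δ r 1))
        + (u i (x + δ r (-1)) - u i x - T (δ r (-1)))) / 2|
      ≤ R * (h * s) * (1 + ‖x‖) ^ (k + (k + 3)) := by
    have hcard : (0 : ℝ) < Fintype.card ρ := by exact_mod_cast Fintype.card_pos
    rw [abs_mul, abs_of_nonneg (by positivity), inv_mul_le_iff₀ hcard]
    refine (Finset.abs_sum_le_sum_abs _ _).trans ?_
    refine (Finset.sum_le_sum fun r _ => (?_ : _ ≤ R * (h * s) * (1 + ‖x‖) ^ (k + (k + 3)))).trans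
      (le_of_eq (by simp))
    rw [abs_div, abs_two]
    have g1 := hrem r 1 (by simp)
    have g2 := hrem r (-1) (by simp)
    have g3 := abs_add_le (u i (x + δ r 1) - u i x - T (δ r 1))
      (u i (x + δ r (-1)) - u i x - T (δ r (-1)))
    linarith
  have f2 : |(1 / 2) * h ^ 2 * ∑ a, ∑ c, pd a (pd c (u i)) x * F a x * F c x|
      ≤ P * (h * s) * (1 + ‖x‖) ^ l := by
    rw [abs_mul, abs_of_nonneg (by positivity)]
    have : (1 / 2) * h ^ 2 ≤ h * s := by
      have : h ≤ s := by rw [← hs2]; nlinarith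
      nlinarith
    calc _ ≤ (h * s) * (P * (1 + ‖x‖) ^ l) := by gcongr; exact hP i x
      _ = _ := by ring
  have w1 : (1 + ‖x‖) ^ (k + (k + 3)) ≤ (1 + ‖x‖) ^ (k + (k + 3) + l) := weight_mono x (by omega)
  have w2 : (1 + ‖x‖) ^ l ≤ (1 + ‖x‖) ^ (k + (k + 3) + l) := weight_mono x (by omega)
  calc _ ≤ _ := abs_add_le _ _
    _ ≤ R * (h * s) * (1 + ‖x‖) ^ (k + (k + 3)) + P * (h * s) * (1 + ‖x‖) ^ l := add_le_add f1 f2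
    _ ≤ R * (h * s) * (1 + ‖x‖) ^ (k + (k + 3) + l)
      + P * (h * s) * (1 + ‖x‖) ^ (k + (k + 3) + l) := by gcongr
    _ = _ := by ring

/-- There is an approximation scheme which is consistent with the backward operator, whose iterates
have polynomially bounded derivatives, uniformly in the time step. -/
lemma Admissible.exists_scheme (h : Admissible B F) :
    ∃ R : ℝ → (Coord d → ℝ) → Coord d → ℝ,
      (∀ f : Coord d → ℝ, Growth 1 (fun _ : Unit => f) → ∀ T : ℝ,
        Growth 1 (fun (p : {p : ℝ × ℕ // 0 ≤ p.1 ∧ p.1 ≤ 1 ∧ p.2 * p.1 ≤ T}) =>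
          (R p.1.1)^[p.1.2] f)) ∧
      ∀ (ι : Type) (u : ι → Coord d → ℝ), Growth 1 u → ∃ (C : ℝ) (k : ℕ), 0 ≤ C ∧
        ∀ i h x, 0 ≤ h → h ≤ 1 → |R h (u i) x - u i x - h * gen B F (u i) x|
          ≤ C * (h * Real.sqrt h) * (1 + ‖x‖) ^ k := by
  obtain ⟨σ, hσ, hσB⟩ := h.exists_sum_of_squares
  -- The extra index carries the zero field and keeps the index set nonempty when `d = 0`. The
  -- factor `√(2m)` compensates the mean over `m` fields and the `1/2` of the Taylor expansion.
  let m : ℝ := Fintype.card (Option (Fin d))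
  have hm : 0 < m := by simp only [m]; exact_mod_cast Fintype.card_pos
  let b : Option (Fin d) → Fin d → Coord d → ℝ := fun r i x =>
    r.elim 0 fun r => Real.sqrt (2 * m) * σ r i x
  have hb : ∀ r i, LinearGrowth (b r i) := by
    rintro (_ | r) i
    · exact (Growth.const 0 : Growth 0 (fun (_ : Unit) (_ : Coord d) => (0 : ℝ))).linearGrowth
    · exact ((hσ r i).const_mul (Real.sqrt (2 * m))).linearGrowth
  refine ⟨walk F b, fun f hf T => growth_walk_iterate h.linearGrowth_F hb hf T,
    fun ι u hu => walk_consistent h.linearGrowth_F hb (fun x i k => ?_) hu⟩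
  rw [Fintype.sum_option]
  have : ∀ r, (1 / 2) * (b (some r) i x * b (some r) k x) = m * (σ r i x * σ r k x) := fun r => by
    have := Real.mul_self_sqrt (show 0 ≤ 2 * m by positivity)
    simp only [b, Option.elim_some]
    linear_combination ((1 / 2) * (σ r i x * σ r k x)) * this
  simp only [this, ← Finset.mul_sum, hσB]
  simp only [b, Option.elim_none, mul_zero, zero_add]
  exact inv_mul_cancel_left₀ hm.ne' _

end

/-! ### The weak form of the Fokker–Planck equation -/

/-- A nonnegative weak solution of the forward equation with bounded mass which starts at `x₀`. -/
structure WeakSolution (B : Coord d → Matrix (Fin d) (Fin d) ℝ) (F : Fin d → Coord d → ℝ)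
    (x₀ : Coord d) (q : ℝ → Coord d → ℝ) : Prop where
  nonneg : ∀ t, 0 < t → ∀ x, 0 ≤ q t x
  cont : ContinuousOn (fun z : ℝ × Coord d => q z.1 z.2) (Set.Ioi (0 : ℝ) ×ˢ Set.univ)
  integrable : ∀ t, 0 < t → Integrable (q t)
  mass : ∀ T, ∃ C, 0 ≤ C ∧ ∀ t, 0 < t → t ≤ T → ∫ x, q t x ≤ C
  weak : ∀ f : Coord d → ℝ, ContDiff ℝ ∞ f → HasCompactSupport f → ∀ t, 0 < t →
    IntervalIntegrable (fun r => ∫ x, gen B F f x * q r x) volume 0 t ∧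
    ∫ x, f x * q t x = f x₀ + ∫ r in (0 : ℝ)..t, ∫ x, gen B F f x * q r x

lemma hasCompactSupport_pd {f : Coord d → ℝ} (hf : HasCompactSupport f) (i : Fin d) :
    HasCompactSupport (pd i f) :=
  hf.fderiv_apply (𝕜 := ℝ) _

lemma continuous_pd {f : Coord d → ℝ} (hf : ContDiff ℝ 1 f) (i : Fin d) : Continuous (pd i f) :=
  (hf.continuous_fderiv (by norm_num)).clm_apply continuous_const

lemma integral_mul_pd {f h : Coord d → ℝ} (hf : ContDiff ℝ 1 f) (hc : HasCompactSupport f)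
    (hh : ContDiff ℝ 1 h) (i : Fin d) :
    ∫ x, f x * pd i h x = -∫ x, pd i f x * h x := by
  refine integral_mul_fderiv_eq_neg_fderiv_mul_of_integrable ?_ ?_ ?_
    (fun x _ => hf.differentiable (by norm_num) x) (fun x _ => hh.differentiable (by norm_num) x)
  · exact ((continuous_pd hf i).mul hh.continuous).integrable_of_hasCompactSupport
      (hasCompactSupport_pd hc i).mul_right
  · exact (hf.continuous.mul (continuous_pd hh i)).integrable_of_hasCompactSupport hc.mul_right
  · exact (hf.continuous.mul hh.continuous).integrable_of_hasCompactSupport hc.mul_right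

lemma contDiff_pd_one {f : Coord d → ℝ} (hf : ContDiff ℝ 2 f) (i : Fin d) :
    ContDiff ℝ 1 (pd i f) :=
  (hf.fderiv_right (by norm_num)).clm_apply contDiff_const

section

variable {g L : Coord d → Matrix (Fin d) (Fin d) ℝ} {U : Coord d → ℝ}

/-- Divergence form of the backward operator. Symmetry of second derivatives means that only the
symmetric part of `L` acts on them, and the definition of the drift supplies exactly the derivatives
of `√g L` and the `U`-term. -/
lemma sqrtDet_mul_gen (h : RegularCoefficients g L U) {f : Coord d → ℝ} (hf : ContDiff ℝ ∞ f)
    (x : Coord d) : sqrtDet g x * gen (symPart L) (drift g L U) f x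
      = ∑ i, ∑ k, (pd k (fun y => pd i f y * (sqrtDet g y * L y i k)) x
        - pd i f x * (sqrtDet g x * L x i k) * pd k U x) := by
  have hs := contDiff_sqrtDet h
  have hne := (sqrtDet_pos h x).ne'
  have e1 : ∀ i k, pd k (fun y => pd i f y * (sqrtDet g y * L y i k)) x
      = pd k (pd i f) x * (sqrtDet g x * L x i k)
        + pd i f x * pd k (fun y => sqrtDet g y * L y i k) x := fun i k =>
    pd_mul ((contDiff_pd hf i).differentiable (by norm_num) x)
      ((hs.mul (h.smooth_L i k)).differentiable (by norm_num) x) k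
  have e2 : ∀ i, sqrtDet g x * (drift g L U i x * pd i f x)
      = ∑ k, (pd i f x * pd k (fun y => sqrtDet g y * L y i k) x
        - pd i f x * (sqrtDet g x * L x i k) * pd k U x) := by
    intro i
    rw [Finset.sum_sub_distrib, ← Finset.mul_sum, drift]
    have : ∑ k, pd i f x * (sqrtDet g x * L x i k) * pd k U x
        = pd i f x * sqrtDet g x * ∑ k, L x i k * pd k U x := by
      rw [Finset.mul_sum]; exact Finset.sum_congr rfl fun k _ => by ring
    rw [this]
    field_simp
  have e3 : ∑ i, ∑ k, symPart L x i k * pd i (pd k f) x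
      = ∑ i, ∑ k, L x i k * pd k (pd i f) x := by
    have hsym : ∀ i k, pd i (pd k f) x = pd k (pd i f) x := fun i k =>
      pd_comm (contDiff_infty.1 hf 2) i k x
    have : ∀ i k, symPart L x i k * pd i (pd k f) x
        = (1 / 2) * (L x i k * pd k (pd i f) x) + (1 / 2) * (L x k i * pd i (pd k f) x) := by
      intro i k
      simp only [symPart, Matrix.smul_apply, Matrix.add_apply, Matrix.transpose_apply, smul_eq_mul]
      rw [hsym i k]; ring
    simp only [this, Finset.sum_add_distrib, ← Finset.mul_sum]
    rw [Finset.sum_comm (f := fun i k => L x k i * pd i (pd k f) x)]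
    ring
  rw [gen, mul_add, Finset.mul_sum Finset.univ (fun i => drift g L U i x * pd i f x), e3]
  simp only [e1, e2]
  rw [Finset.mul_sum, ← Finset.sum_add_distrib]
  refine Finset.sum_congr rfl fun i _ => ?_
  rw [Finset.mul_sum, ← Finset.sum_add_distrib]
  exact Finset.sum_congr rfl fun k _ => by ring

/-- Duality between the Fokker–Planck operator and the backward operator. -/
lemma integral_mul_fokkerPlanck (h : RegularCoefficients g L U) {f p : Coord d → ℝ}
    (hf : ContDiff ℝ ∞ f) (hc : HasCompactSupport f) (hp : ContDiff ℝ 2 p) :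
    ∫ x, f x * (sqrtDet g x * fokkerPlanck g L U p x)
      = ∫ x, gen (symPart L) (drift g L U) f x * (sqrtDet g x * p x) := by
  have hs : ContDiff ℝ ∞ (sqrtDet g) := contDiff_sqrtDet h
  have h1 : ∀ {φ : Coord d → ℝ}, ContDiff ℝ ∞ φ → ContDiff ℝ 1 φ := fun hφ =>
    hφ.of_le (by exact_mod_cast le_top)
  have hp1 : ContDiff ℝ 1 p := hp.of_le (by norm_num)
  have ha : ∀ i k, ContDiff ℝ 1 (fun y => pd i f y * (sqrtDet g y * L y i k)) := fun i k =>
    h1 ((contDiff_pd hf i).mul (hs.mul (h.smooth_L i k)))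
  have hac : ∀ i k, HasCompactSupport (fun y => pd i f y * (sqrtDet g y * L y i k)) := fun i k =>
    (hasCompactSupport_pd hc i).mul_right
  have hH : ∀ i k, ContDiff ℝ 1
      (fun y => sqrtDet g y * L y i k * (pd k p y + pd k U y * p y)) := fun i k =>
    (h1 (hs.mul (h.smooth_L i k))).mul ((contDiff_pd_one hp k).add
      ((h1 (contDiff_pd h.smooth_U k)).mul hp1))
  have e1 : ∀ x, f x * (sqrtDet g x * fokkerPlanck g L U p x)
      = ∑ i, ∑ k, f x * pd i (fun y => sqrtDet g y * L y i k * (pd k p y + pd k U y * p y)) x := by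
    intro x
    rw [fokkerPlanck, mul_inv_cancel_left₀ (sqrtDet_pos h x).ne', Finset.mul_sum]
    exact Finset.sum_congr rfl fun i _ => Finset.mul_sum ..
  have e2 : ∀ x, gen (symPart L) (drift g L U) f x * (sqrtDet g x * p x)
      = ∑ i, ∑ k, (pd k (fun y => pd i f y * (sqrtDet g y * L y i k)) x * p x
        - pd i f x * (sqrtDet g x * L x i k) * (pd k U x * p x)) := by
    intro x
    have := sqrtDet_mul_gen h hf x
    calc _ = (sqrtDet g x * gen (symPart L) (drift g L U) f x) * p x := by ring
      _ = _ := by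
        rw [this, Finset.sum_mul]
        refine Finset.sum_congr rfl fun i _ => ?_
        rw [Finset.sum_mul]
        exact Finset.sum_congr rfl fun k _ => by ring
  simp only [e1, e2]
  have i1 : ∀ i k, Integrable fun x =>
      f x * pd i (fun y => sqrtDet g y * L y i k * (pd k p y + pd k U y * p y)) x := fun i k =>
    (hf.continuous.mul (continuous_pd (hH i k) i)).integrable_of_hasCompactSupport hc.mul_right
  have i2 : ∀ i k, Integrable fun x =>
      pd k (fun y => pd i f y * (sqrtDet g y * L y i k)) x * p x := fun i k =>
    ((continuous_pd (ha i k) k).mul hp.continuous).integrable_of_hasCompactSupport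
      (hasCompactSupport_pd (hac i k) k).mul_right
  have i3 : ∀ i k, Integrable fun x =>
      pd i f x * (sqrtDet g x * L x i k) * (pd k U x * p x) := fun i k =>
    ((ha i k).continuous.mul ((continuous_pd (h1 h.smooth_U) k).mul
      hp.continuous)).integrable_of_hasCompactSupport (hac i k).mul_right
  have i4 : ∀ i k, Integrable fun x =>
      pd i f x * (sqrtDet g x * L x i k) * pd k p x := fun i k =>
    ((ha i k).continuous.mul (continuous_pd hp1 k)).integrable_of_hasCompactSupport
      (hac i k).mul_right
  have i5 : ∀ i k, Integrable fun x =>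
      pd k (fun y => pd i f y * (sqrtDet g y * L y i k)) x * p x
        - pd i f x * (sqrtDet g x * L x i k) * (pd k U x * p x) := fun i k =>
    (i2 i k).sub (i3 i k)
  rw [integral_finsetSum _ fun i _ => integrable_finsetSum _ fun k _ => i1 i k,
    integral_finsetSum _ fun i _ => integrable_finsetSum _ fun k _ => i5 i k]
  refine Finset.sum_congr rfl fun i _ => ?_
  rw [integral_finsetSum _ fun k _ => i1 i k, integral_finsetSum _ fun k _ => i5 i k]
  refine Finset.sum_congr rfl fun k _ => ?_
  rw [integral_mul_pd (h1 hf) hc (hH i k) i, integral_sub (i2 i k) (i3 i k)]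
  have e3 : ∀ x, pd i f x * (sqrtDet g x * L x i k * (pd k p x + pd k U x * p x))
      = pd i f x * (sqrtDet g x * L x i k) * pd k p x
        + pd i f x * (sqrtDet g x * L x i k) * (pd k U x * p x) := fun x => by ring
  simp only [e3]
  rw [integral_add (i4 i k) (i3 i k), integral_mul_pd (ha i k) (hac i k) hp1 k]
  ring

variable {G : ℝ → Coord d → Coord d → ℝ}

lemma IsGreenFunction.contDiff_slice (hG : IsGreenFunction g L U G) (x₀ : Coord d) {t : ℝ}
    (ht : 0 < t) : ContDiff ℝ 2 (G t x₀) := by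
  rw [← contDiffOn_univ]
  exact (hG.regular x₀).comp (f := fun x : Coord d => (t, x)) (by fun_prop)
    (fun x _ => ⟨ht, trivial⟩)

lemma continuous_gen (h : RegularCoefficients g L U) {f : Coord d → ℝ} (hf : ContDiff ℝ ∞ f) :
    Continuous (gen (symPart L) (drift g L U) f) :=
  (h.admissible.contDiff_gen hf).continuous

lemma hasCompactSupport_gen {B : Coord d → Matrix (Fin d) (Fin d) ℝ} {F : Fin d → Coord d → ℝ}
    {f : Coord d → ℝ} (hc : HasCompactSupport f) : HasCompactSupport (gen B F f) := by
  refine hc.mono' fun x hx => ?_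
  by_contra hn
  apply hx
  have h1 : ∀ i, pd i f x = 0 := fun i => by
    have := fderiv_of_notMem_tsupport (𝕜 := ℝ) hn
    simp [pd, this]
  have h2 : ∀ i k, pd i (pd k f) x = 0 := fun i k => by
    have hn' : x ∉ tsupport (pd k f) := fun h' => hn (tsupport_fderiv_apply_subset ℝ _ h')
    have := fderiv_of_notMem_tsupport (𝕜 := ℝ) hn'
    simp [pd] at this ⊢
    simp [this]
  simp [gen, h1, h2]

/-- Differentiation under the integral sign, followed by duality. Compact support of `f` confines
the domination to a compact set of space-time away from `t = 0`. -/
lemma hasDerivAt_integral_green (h : RegularCoefficients g L U) (hG : IsGreenFunction g L U G)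
    (x₀ : Coord d) {f : Coord d → ℝ} (hf : ContDiff ℝ ∞ f) (hc : HasCompactSupport f) {t : ℝ}
    (ht : 0 < t) :
    HasDerivAt (fun s => ∫ x, f x * exactKernel g G s x₀ x)
      (∫ x, gen (symPart L) (drift g L U) f x * exactKernel g G t x₀ x) t := by
  have hs : ContDiff ℝ ∞ (sqrtDet g) := contDiff_sqrtDet h
  have hopen : IsOpen (Set.Ioi (0 : ℝ) ×ˢ (Set.univ : Set (Coord d))) :=
    isOpen_Ioi.prod isOpen_univ
  let Z : ℝ × Coord d → ℝ := fun z => G z.1 x₀ z.2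
  have hfd : ContinuousOn (fun z => fderiv ℝ Z z (1, 0)) (Set.Ioi (0 : ℝ) ×ˢ Set.univ) :=
    ((hG.regular x₀).continuousOn_fderiv_of_isOpen hopen (by norm_num)).clm_apply
      continuousOn_const
  -- The equation identifies the Fokker–Planck term with the time derivative of `G`, which is
  -- jointly continuous by `hG.regular`. This provides the uniform bound on the compact set.
  have hval : ∀ s x, 0 < s → fokkerPlanck g L U (G s x₀) x = fderiv ℝ Z (s, x) (1, 0) := by
    intro s x hs0
    have hd : DifferentiableAt ℝ Z (s, x) :=
      ((hG.regular x₀).contDiffAt (hopen.mem_nhds (Set.mk_mem_prod hs0 trivial))).differentiableAt (by norm_num)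
    have h1 : HasDerivAt (fun r : ℝ => Z (r, x)) (fderiv ℝ Z (s, x) (1, 0)) s := by
      have := hd.hasFDerivAt.comp_hasDerivAt (f := fun r : ℝ => (r, x)) s
        ((hasDerivAt_id s).prodMk (hasDerivAt_const s x))
      exact this
    exact (hG.equation x₀ s x hs0).unique h1
  obtain ⟨K, hK⟩ := (isCompact_Icc (a := t / 2) (b := 2 * t)).prod hc
    |>.exists_bound_of_continuousOn (hfd.mono fun z hz => ⟨by
      have := hz.1.1; simp only [Set.mem_Ioi]; linarith, trivial⟩)
  have hmain := hasDerivAt_integral_of_dominated_loc_of_deriv_le (μ := volume)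
    (F := fun s x => f x * exactKernel g G s x₀ x)
    (F' := fun s x => f x * (sqrtDet g x * fokkerPlanck g L U (G s x₀) x))
    (bound := fun x => |f x| * (sqrtDet g x * |K|)) (x₀ := t) (s := Set.Ioo (t / 2) (2 * t))
    (Ioo_mem_nhds (by linarith) (by linarith)) ?_ ?_ ?_ ?_ ?_ ?_
  · have := hmain.2
    rw [integral_mul_fokkerPlanck h hf hc (hG.contDiff_slice x₀ ht)] at this
    exact this
  · filter_upwards [Ioi_mem_nhds ht] with s hs0
    exact (hf.continuous.mul (hs.continuous.mul
      (hG.contDiff_slice x₀ hs0).continuous)).aestronglyMeasurable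
  · exact (hf.continuous.mul (hs.continuous.mul
      (hG.contDiff_slice x₀ ht).continuous)).integrable_of_hasCompactSupport hc.mul_right
  · have hm : Continuous fun x => fderiv ℝ Z (t, x) (1, 0) := by
      rw [← continuousOn_univ]
      exact hfd.comp (f := fun x : Coord d => (t, x)) (by fun_prop) (fun x _ => ⟨ht, trivial⟩)
    have := (hf.continuous.mul (hs.continuous.mul hm)).aestronglyMeasurable (μ := volume)
    refine this.congr (Eventually.of_forall fun x => ?_)
    simp only [Pi.mul_apply, hval t x ht]
  · refine Eventually.of_forall fun x s hs' => ?_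
    have hs0 : 0 < s := by linarith [hs'.1]
    rw [norm_mul, Real.norm_eq_abs, norm_mul, Real.norm_eq_abs (sqrtDet g x),
      abs_of_pos (sqrtDet_pos h x)]
    by_cases hx : x ∈ tsupport f
    · have := sqrtDet_pos h x
      gcongr
      rw [hval s x hs0]
      exact (hK (s, x) ⟨⟨hs'.1.le, hs'.2.le⟩, hx⟩).trans (le_abs_self K)
    · simp [image_eq_zero_of_notMem_tsupport hx]
  · exact (hf.continuous.abs.mul (hs.continuous.mul
      continuous_const)).integrable_of_hasCompactSupport hc.abs.mul_right
  · refine Eventually.of_forall fun x s hs' => ?_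
    have hs0 : 0 < s := by linarith [hs'.1]
    exact ((hG.equation x₀ s x hs0).const_mul (sqrtDet g x)).const_mul (f x)

end

lemma aestronglyMeasurable_integral {q : ℝ → Coord d → ℝ}
    (hq : ContinuousOn (fun z : ℝ × Coord d => q z.1 z.2) (Set.Ioi (0 : ℝ) ×ˢ Set.univ))
    {w : Coord d → ℝ} (hw : Continuous w) :
    AEStronglyMeasurable (fun r => ∫ x, w x * q r x) (volume.restrict (Set.Ioi (0 : ℝ))) := by
  have h1 : ContinuousOn (fun z : ℝ × Coord d => w z.2 * q z.1 z.2)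
      (Set.Ioi (0 : ℝ) ×ˢ Set.univ) := (hw.comp continuous_snd).continuousOn.mul hq
  have h2 := h1.aestronglyMeasurable (μ := (volume : Measure ℝ).prod (volume : Measure (Coord d)))
    (measurableSet_Ioi.prod MeasurableSet.univ)
  rw [← Measure.prod_restrict, Measure.restrict_univ] at h2
  exact h2.integral_prod_right'

/-- An integrand which is measurable on `(0, ∞)` and bounded on `(0, t]`. -/
lemma intervalIntegrable_of_bound {φ : ℝ → ℝ} {t C : ℝ} (ht : 0 ≤ t)
    (hm : AEStronglyMeasurable φ (volume.restrict (Set.Ioi (0 : ℝ))))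
    (hb : ∀ r, 0 < r → r ≤ t → |φ r| ≤ C) : IntervalIntegrable φ volume 0 t := by
  rw [intervalIntegrable_iff_integrableOn_Ioc_of_le ht]
  have hle : volume.restrict (Set.Ioc 0 t) ≤ volume.restrict (Set.Ioi (0 : ℝ)) :=
    Measure.restrict_mono (fun r (hr : r ∈ Set.Ioc 0 t) => hr.1) le_rfl
  refine Integrable.of_bound (hm.mono_measure hle) C ?_
  filter_upwards [ae_restrict_mem measurableSet_Ioc] with r hr using hb r hr.1 hr.2

/-- The fundamental theorem of calculus on `(0, t)`. The value at the left endpoint is the limit `f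
x₀` from the initial condition, and the mass bound makes the derivative integrable up to time zero.
-/
theorem IsGreenFunction.weakSolution {g L : Coord d → Matrix (Fin d) (Fin d) ℝ}
    {U : Coord d → ℝ} {G : ℝ → Coord d → Coord d → ℝ} (h : RegularCoefficients g L U)
    (hG : IsGreenFunction g L U G) (x₀ : Coord d) :
    WeakSolution (symPart L) (drift g L U) x₀ (fun t => exactKernel g G t x₀) := by
  have hs : ContDiff ℝ ∞ (sqrtDet g) := contDiff_sqrtDet h
  have hcont : ContinuousOn (fun z : ℝ × Coord d => exactKernel g G z.1 x₀ z.2)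
      (Set.Ioi (0 : ℝ) ×ˢ Set.univ) :=
    (hs.continuous.comp continuous_snd).continuousOn.mul (hG.regular x₀).continuousOn
  have hnn : ∀ t, 0 < t → ∀ x, 0 ≤ exactKernel g G t x₀ x := fun t ht x =>
    mul_nonneg (sqrtDet_pos h x).le (hG.nonneg x₀ t x ht)
  have hmass : ∀ T, ∃ C, 0 ≤ C ∧ ∀ t, 0 < t → t ≤ T → ∫ x, exactKernel g G t x₀ x ≤ C := by
    intro T
    obtain ⟨C, hC⟩ := hG.mass_bounded x₀ T
    exact ⟨|C|, abs_nonneg C, fun t h0 h1 => (hC t h0 h1).trans (le_abs_self C)⟩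
  refine ⟨hnn, hcont, fun t ht => hG.integrable x₀ t ht, hmass, fun f hf hc t ht => ?_⟩
  have hgc := continuous_gen h hf
  obtain ⟨K, hK⟩ := hgc.bounded_above_of_compact_support
    (hasCompactSupport_gen hc)
  obtain ⟨C, hC0, hC⟩ := hmass t
  have hb : ∀ r, 0 < r → r ≤ t →
      |∫ x, gen (symPart L) (drift g L U) f x * exactKernel g G r x₀ x| ≤ |K| * C := by
    intro r hr hrt
    have hint := hG.integrable x₀ r hr
    calc |∫ x, gen (symPart L) (drift g L U) f x * exactKernel g G r x₀ x|
          ≤ ∫ x, |K| * exactKernel g G r x₀ x := by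
          rw [← Real.norm_eq_abs]
          refine norm_integral_le_of_norm_le (hint.const_mul _) (Eventually.of_forall fun x => ?_)
          rw [norm_mul, Real.norm_of_nonneg (hnn r hr x)]
          exact mul_le_mul_of_nonneg_right ((hK x).trans (le_abs_self K)) (hnn r hr x)
      _ = |K| * ∫ x, exactKernel g G r x₀ x := integral_const_mul _ _
      _ ≤ _ := by gcongr; exact hC r hr hrt
  have hii := intervalIntegrable_of_bound ht.le (aestronglyMeasurable_integral hcont hgc) hb
  refine ⟨hii, ?_⟩
  have hd := fun s (hs : 0 < s) => hasDerivAt_integral_green h hG x₀ hf hc hs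
  have := intervalIntegral.integral_eq_sub_of_hasDerivAt_of_tendsto ht
    (fun s hs => hd s hs.1) hii (hG.initial x₀ f hf.continuous hc)
    ((hd t ht).continuousAt.tendsto.mono_left nhdsWithin_le_nhds)
  linarith

/-! ### Moments of weak solutions -/

lemma pd_comp_smul {f : Coord d → ℝ} (hf : Differentiable ℝ f) (c : ℝ) (i : Fin d) :
    pd i (fun x => f (c • x)) = fun x => c * pd i f (c • x) := by
  ext x
  have h1 : HasFDerivAt (fun x : Coord d => f (c • x))
      ((fderiv ℝ f (c • x)).comp (c • ContinuousLinearMap.id ℝ (Coord d))) x :=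
    (hf (c • x)).hasFDerivAt.comp x ((hasFDerivAt_id x).const_smul c)
  simp [pd, h1.fderiv]

/-- Dilations of one bump function. The factor `1/(n+1)` from the chain rule compensates the weight
`1 + ‖x‖`, so the drift term of `gen` applied to the cutoffs stays bounded although `F` may grow
linearly. -/
lemma exists_cutoff (d : ℕ) : ∃ (φ : ℕ → Coord d → ℝ) (C : ℝ), 0 ≤ C ∧
    (∀ n, ContDiff ℝ ∞ (φ n)) ∧ (∀ n, HasCompactSupport (φ n)) ∧
    (∀ n x, |φ n x| ≤ 1) ∧ (∀ n x i, (1 + ‖x‖) * |pd i (φ n) x| ≤ C) ∧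
    (∀ n x i k, |pd i (pd k (φ n)) x| ≤ C) ∧
    ∀ x, ∀ᶠ n in atTop, φ n =ᶠ[𝓝 x] fun _ => 1 := by
  let ψ : ContDiffBump (0 : Coord d) := ⟨1, 2, by norm_num, by norm_num⟩
  have hψ : ContDiff ℝ ∞ ψ := ψ.contDiff
  have hψc : HasCompactSupport ψ := ψ.hasCompactSupport
  have hb1 : ∀ i, ∃ C, ∀ x : Coord d, (1 + ‖x‖) * |pd i ψ x| ≤ C := fun i => by
    have hc : Continuous fun x : Coord d => (1 + ‖x‖) * |pd i ψ x| :=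
      (continuous_const.add continuous_norm).mul (contDiff_pd hψ i).continuous.abs
    obtain ⟨C, hC⟩ := hc.bounded_above_of_compact_support
      ((hasCompactSupport_pd hψc i).abs.mul_left)
    exact ⟨C, fun x => (le_abs_self _).trans (hC x)⟩
  have hb2 : ∀ i k, ∃ C, ∀ x : Coord d, |pd i (pd k ψ) x| ≤ C := fun i k => by
    obtain ⟨C, hC⟩ := (contDiff_pd (contDiff_pd hψ k) i).continuous.bounded_above_of_compact_support
      (hasCompactSupport_pd (hasCompactSupport_pd hψc k) i)
    exact ⟨C, hC⟩
  choose C hC using hb1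
  choose D hD using hb2
  have hC0 : ∀ i, 0 ≤ C i := fun i => le_trans (by positivity) (hC i 0)
  have hD0 : ∀ i k, 0 ≤ D i k := fun i k => (abs_nonneg _).trans (hD i k 0)
  let c : ℕ → ℝ := fun n => ((n : ℝ) + 1)⁻¹
  have hc0 : ∀ n, 0 < c n := fun n => by positivity
  have hc1 : ∀ n, c n ≤ 1 := fun n => inv_le_one_of_one_le₀ (by linarith [n.cast_nonneg (α := ℝ)])
  have hψd := hψ.differentiable (by norm_num)
  have hpd : ∀ n i, pd i (fun x => ψ (c n • x)) = fun x => c n * pd i ψ (c n • x) := fun n i =>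
    pd_comp_smul hψd _ _
  have hpp : ∀ n i k x, pd i (pd k (fun x => ψ (c n • x))) x
      = c n * (c n * pd i (pd k ψ) (c n • x)) := fun n i k x => by
    have hd1 := (contDiff_pd hψ k).differentiable (by norm_num)
    have hd2 : Differentiable ℝ fun x : Coord d => pd k ψ (c n • x) := by
      exact hd1.comp (differentiable_id.const_smul (c n))
    rw [hpd, pd_const_mul (hd2 x), pd_comp_smul hd1]
  refine ⟨fun n x => ψ (c n • x), ∑ i, C i + ∑ i, ∑ k, D i k, ?_, fun n => ?_, fun n => ?_,
    fun n x => ?_, fun n x i => ?_, fun n x i k => ?_, fun x => ?_⟩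
  · exact add_nonneg (Finset.sum_nonneg fun i _ => hC0 i)
      (Finset.sum_nonneg fun i _ => Finset.sum_nonneg fun k _ => hD0 i k)
  · exact hψ.comp (contDiff_id.const_smul (c n))
  · exact hψc.comp_smul (hc0 n).ne'
  · rw [abs_of_nonneg (ψ.nonneg' _)]; exact ψ.le_one
  · rw [hpd, abs_mul, abs_of_pos (hc0 n)]
    have h1 : (1 + ‖x‖) * (c n * |pd i ψ (c n • x)|) ≤ (1 + ‖c n • x‖) * |pd i ψ (c n • x)| := by
      rw [← mul_assoc]
      refine mul_le_mul_of_nonneg_right ?_ (abs_nonneg _)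
      rw [norm_smul, Real.norm_of_nonneg (hc0 n).le]
      nlinarith [hc1 n]
    refine h1.trans ((hC i _).trans ?_)
    exact le_add_of_le_of_nonneg (Finset.single_le_sum (fun i _ => hC0 i) (Finset.mem_univ i))
      (Finset.sum_nonneg fun i _ => Finset.sum_nonneg fun k _ => hD0 i k)
  · rw [hpp, abs_mul, abs_mul, abs_of_pos (hc0 n)]
    have h1 : c n * (c n * |pd i (pd k ψ) (c n • x)|) ≤ 1 * (1 * |pd i (pd k ψ) (c n • x)|) := by
      have := hc1 n; have := (hc0 n).le
      gcongr
    rw [one_mul, one_mul] at h1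
    refine h1.trans ((hD i k _).trans ?_)
    refine le_add_of_nonneg_of_le (Finset.sum_nonneg fun i _ => hC0 i) ?_
    exact (Finset.single_le_sum (f := fun k => D i k) (fun k _ => hD0 i k)
      (Finset.mem_univ k)).trans (Finset.single_le_sum (f := fun i => ∑ k, D i k)
      (fun i _ => Finset.sum_nonneg fun k _ => hD0 i k) (Finset.mem_univ i))
  · obtain ⟨N, hN⟩ := exists_nat_gt (‖x‖ + 1)
    filter_upwards [eventually_ge_atTop N] with n hn
    filter_upwards [Metric.ball_mem_nhds x one_pos] with y hy
    refine ψ.one_of_mem_closedBall ?_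
    rw [mem_closedBall_zero_iff, norm_smul, Real.norm_of_nonneg (hc0 n).le]
    change ((n : ℝ) + 1)⁻¹ * ‖y‖ ≤ 1
    rw [inv_mul_le_iff₀ (by positivity)]
    have h1 : ‖y‖ ≤ ‖x‖ + 1 := by
      have := norm_le_norm_add_norm_sub' y x
      rw [mem_ball_iff_norm] at hy
      linarith
    have h2 : (N : ℝ) ≤ n := by exact_mod_cast hn
    linarith

section Weak

variable {B : Coord d → Matrix (Fin d) (Fin d) ℝ} {F : Fin d → Coord d → ℝ} {x₀ : Coord d}
  {q : ℝ → Coord d → ℝ}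

lemma WeakSolution.continuous_slice (hq : WeakSolution B F x₀ q) {t : ℝ} (ht : 0 < t) :
    Continuous (q t) := by
  rw [← continuousOn_univ]
  exact hq.cont.comp (f := fun x : Coord d => (t, x)) (by fun_prop) (fun x _ => ⟨ht, trivial⟩)

/-- The weak form extends from compactly supported functions to functions dominated by an
integrable weight. -/
lemma WeakSolution.weak_of_dominated (h : Admissible B F) (hq : WeakSolution B F x₀ q)
    {f W : Coord d → ℝ} (hf : ContDiff ℝ ∞ f) (h0 : ∀ x, |f x| ≤ W x)
    (h1 : ∀ x i, (1 + ‖x‖) * |pd i f x| ≤ W x) (h2 : ∀ x i k, |pd i (pd k f) x| ≤ W x)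
    {t M : ℝ} (ht : 0 < t) (hW : ∀ r, 0 < r → r ≤ t → Integrable (fun x => W x * q r x) ∧
      ∫ x, W x * q r x ≤ M) :
    IntervalIntegrable (fun r => ∫ x, gen B F f x * q r x) volume 0 t ∧
    ∫ x, f x * q t x = f x₀ + ∫ r in (0 : ℝ)..t, ∫ x, gen B F f x * q r x := by
  obtain ⟨K, hK0, hK⟩ := h.exists_gen_bound
  obtain ⟨φ, C, hC0, hφs, hφc, hφ1, hφd, hφdd, hφe⟩ := exists_cutoff d
  have hWn : ∀ x, 0 ≤ W x := fun x => (abs_nonneg _).trans (h0 x)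
  have hgc : Continuous (gen B F f) := (h.contDiff_gen hf).continuous
  have hfs : ∀ n, ContDiff ℝ ∞ (fun x => f x * φ n x) := fun n => hf.mul (hφs n)
  have hgn : ∀ n, Continuous (gen B F (fun x => f x * φ n x)) := fun n =>
    (h.contDiff_gen (hfs n)).continuous
  have hgen : ∀ x, |gen B F f x| ≤ K * (1 + 3 * C) * W x := fun x => by
    refine (hK f x (W x) (hWn x) (h1 x) (h2 x)).trans ?_
    have := mul_nonneg hK0 (hWn x)
    nlinarith
  -- A domination that does not depend on `n`. By the Leibniz rule, a second derivative of the
  -- product has one term without derivatives of the cutoff and three with them; hence `1 + 3C`.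
  have hgenn : ∀ n x, |gen B F (fun x => f x * φ n x) x| ≤ K * (1 + 3 * C) * W x := fun n x => by
    have hd1 := hf.differentiable (by norm_num) x
    have hd2 := (hφs n).differentiable (by norm_num) x
    have hle : ∀ a : ℝ, 0 ≤ a → a ≤ (1 + ‖x‖) * a := fun a ha =>
      le_mul_of_one_le_left ha (one_le_one_add_norm x)
    have hw := hWn x
    have b0 := h0 x
    have c0 := hφ1 n x
    rw [mul_assoc]
    refine hK _ x _ (by positivity) (fun i => ?_) (fun i k => ?_)
    · rw [pd_mul hd1 hd2]
      have b1 := h1 x i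
      have c1 := hφd n x i
      calc (1 + ‖x‖) * |pd i f x * φ n x + f x * pd i (φ n) x|
          ≤ (1 + ‖x‖) * (|pd i f x| * |φ n x| + |f x| * |pd i (φ n) x|) := by
            gcongr
            refine (abs_add_le _ _).trans ?_
            rw [abs_mul, abs_mul]
        _ = ((1 + ‖x‖) * |pd i f x|) * |φ n x| + |f x| * ((1 + ‖x‖) * |pd i (φ n) x|) := by ring
        _ ≤ W x * 1 + W x * C := by gcongr
        _ ≤ _ := by nlinarith [mul_nonneg hC0 hw]
    · rw [pd_pd_mul hf (hφs n)]
      have b1 := fun i => (hle _ (abs_nonneg _)).trans (h1 x i)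
      have c1 := fun i => (hle _ (abs_nonneg _)).trans (hφd n x i)
      have b2 := h2 x i k
      have c2 := hφdd n x i k
      calc _ ≤ |pd i (pd k f) x| * |φ n x| + |pd k f x| * |pd i (φ n) x|
            + (|pd i f x| * |pd k (φ n) x| + |f x| * |pd i (pd k (φ n)) x|) := by
            refine (abs_add_le _ _).trans (add_le_add ((abs_add_le _ _).trans ?_)
              ((abs_add_le _ _).trans ?_))
            · rw [abs_mul, abs_mul]
            · rw [abs_mul, abs_mul]
        _ ≤ W x * 1 + W x * C + (W x * C + W x * C) := by
            have := b1 i; have := b1 k; have := c1 i; have := c1 k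
            gcongr
        _ = _ := by ring
  have hev : ∀ x, ∀ᶠ n in atTop, f x * φ n x = f x := fun x => by
    filter_upwards [hφe x] with n hn
    have e := hn.self_of_nhds
    simp only at e
    rw [e, mul_one]
  -- The cutoffs are eventually one in a neighbourhood of each point, so the derivatives in `gen`
  -- are eventually exact as well.
  have hevg : ∀ x, ∀ᶠ n in atTop, gen B F (fun x => f x * φ n x) x = gen B F f x := fun x => by
    filter_upwards [hφe x] with n hn
    have e0 : (fun x => f x * φ n x) =ᶠ[𝓝 x] f := by
      filter_upwards [hn] with y hy
      rw [hy, mul_one]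
    have e1 : ∀ k, pd k (fun x => f x * φ n x) =ᶠ[𝓝 x] pd k f := fun k => by
      filter_upwards [e0.fderiv (𝕜 := ℝ)] with y hy
      simp only [pd, hy]
    have e2 : ∀ i k, pd i (pd k (fun x => f x * φ n x)) x = pd i (pd k f) x := fun i k => by
      rw [pd, (e1 k).fderiv_eq, pd]
    have e3 : ∀ k, pd k (fun x => f x * φ n x) x = pd k f x := fun k => (e1 k).self_of_nhds
    simp only [gen, e2, e3]
  set A := K * (1 + 3 * C) with hA
  have hA0 : 0 ≤ A := by positivity
  have hbound : ∀ (w : Coord d → ℝ), (∀ x, |w x| ≤ A * W x) → ∀ r, 0 < r → r ≤ t →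
      |∫ x, w x * q r x| ≤ A * M := by
    intro w hw r hr hrt
    calc |∫ x, w x * q r x| ≤ ∫ x, A * (W x * q r x) := by
          rw [← Real.norm_eq_abs]
          refine norm_integral_le_of_norm_le ((hW r hr hrt).1.const_mul _)
            (Eventually.of_forall fun x => ?_)
          rw [norm_mul, Real.norm_of_nonneg (hq.nonneg r hr x), ← mul_assoc]
          exact mul_le_mul_of_nonneg_right (hw x) (hq.nonneg r hr x)
      _ = A * ∫ x, W x * q r x := integral_const_mul _ _
      _ ≤ _ := by gcongr; exact (hW r hr hrt).2
  have hlim : ∀ r, 0 < r → r ≤ t → Tendsto (fun n => ∫ x, gen B F (fun x => f x * φ n x) x * q r x)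
      atTop (𝓝 (∫ x, gen B F f x * q r x)) := by
    intro r hr hrt
    refine tendsto_integral_of_dominated_convergence (fun x => A * (W x * q r x))
      (fun n => ((hgn n).mul (hq.continuous_slice hr)).aestronglyMeasurable)
      ((hW r hr hrt).1.const_mul _) (fun n => Eventually.of_forall fun x => ?_)
      (Eventually.of_forall fun x => ?_)
    · rw [norm_mul, Real.norm_of_nonneg (hq.nonneg r hr x), ← mul_assoc]
      exact mul_le_mul_of_nonneg_right (hgenn n x) (hq.nonneg r hr x)
    · refine tendsto_const_nhds.congr' ?_
      filter_upwards [hevg x] with n hn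
      rw [hn]
  have hii : ∀ {w : Coord d → ℝ}, Continuous w → (∀ x, |w x| ≤ A * W x) →
      IntervalIntegrable (fun r => ∫ x, w x * q r x) volume 0 t := fun hw hb =>
    intervalIntegrable_of_bound ht.le (aestronglyMeasurable_integral hq.cont hw) (hbound _ hb)
  refine ⟨hii hgc hgen, ?_⟩
  have L1 : Tendsto (fun n => ∫ x, (f x * φ n x) * q t x) atTop (𝓝 (∫ x, f x * q t x)) := by
    refine tendsto_integral_of_dominated_convergence (fun x => W x * q t x)
      (fun n => ((hfs n).continuous.mul (hq.continuous_slice ht)).aestronglyMeasurable)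
      (hW t ht le_rfl).1 (fun n => Eventually.of_forall fun x => ?_)
      (Eventually.of_forall fun x => ?_)
    · rw [norm_mul, Real.norm_of_nonneg (hq.nonneg t ht x)]
      refine mul_le_mul_of_nonneg_right ?_ (hq.nonneg t ht x)
      rw [norm_mul, Real.norm_eq_abs, Real.norm_eq_abs]
      calc _ ≤ W x * 1 := by
            have := h0 x; have := hφ1 n x; have := hWn x; gcongr
        _ = W x := mul_one _
    · refine tendsto_const_nhds.congr' ?_
      filter_upwards [hev x] with n hn
      rw [hn]
  have L2 : Tendsto (fun n => ∫ r in (0 : ℝ)..t, ∫ x, gen B F (fun x => f x * φ n x) x * q r x)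
      atTop (𝓝 (∫ r in (0 : ℝ)..t, ∫ x, gen B F f x * q r x)) := by
    refine intervalIntegral.tendsto_integral_filter_of_dominated_convergence (fun _ => A * M)
      (Eventually.of_forall fun n => ?_) (Eventually.of_forall fun n =>
        Eventually.of_forall fun r hr => ?_) (by simp) (Eventually.of_forall fun r hr => ?_)
    · rw [Set.uIoc_of_le ht.le]
      exact ((intervalIntegrable_iff_integrableOn_Ioc_of_le ht.le).1
        (hii (hgn n) (hgenn n))).aestronglyMeasurable
    · rw [Set.uIoc_of_le ht.le] at hr
      exact hbound _ (hgenn n) r hr.1 hr.2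
    · rw [Set.uIoc_of_le ht.le] at hr
      exact hlim r hr.1 hr.2
  have L3 : Tendsto (fun n => f x₀ * φ n x₀) atTop (𝓝 (f x₀)) := by
    refine tendsto_const_nhds.congr' ?_
    filter_upwards [hev x₀] with n hn
    rw [hn]
  refine tendsto_nhds_unique L1 ((L3.add L2).congr fun n => ?_)
  exact ((hq.weak _ (hfs n) ((hφc n).mul_left) t ht).2).symm

/-- The constant one is annihilated by `gen` and dominated by the constant weight, whose integrals
are the bounded masses. Thus no mass escapes to infinity. -/
lemma WeakSolution.integral_eq_one (h : Admissible B F) (hq : WeakSolution B F x₀ q) {t : ℝ}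
    (ht : 0 < t) : ∫ x, q t x = 1 := by
  obtain ⟨C, hC0, hC⟩ := hq.mass t
  have hz : ∀ k, pd (d := d) k (fun _ => (1 : ℝ)) = fun _ => 0 := fun k => by
    ext x; exact pd_const _ _ _
  have := (hq.weak_of_dominated h (f := fun _ => 1) (W := fun _ => 1) contDiff_const
    (fun x => by simp) (fun x i => by simp [hz]) (fun x i k => by simp [hz, pd_const])
    ht (M := C) (fun r hr hrt => ⟨by simpa using hq.integrable r hr, by simpa using hC r hr hrt⟩)).2
  have hg : ∀ x, gen B F (fun _ => (1 : ℝ)) x = 0 := fun x => by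
    simp [gen, hz, pd_const]
  simpa [hg] using this

end Weak

/-! ### Uniform moment bounds by truncation, Grönwall and Fatou -/

/-- An integral form of Grönwall's inequality for bounded functions. -/
lemma gronwall_integral {m : ℝ → ℝ} {a K M T : ℝ} (hK : 0 < K) (ha : 0 ≤ a)
    (hm : ∀ t, 0 < t → t ≤ T → m t ≤ M)
    (hi : ∀ t, 0 < t → t ≤ T → IntervalIntegrable m volume 0 t)
    (h : ∀ t, 0 < t → t ≤ T → m t ≤ a + K * ∫ r in (0 : ℝ)..t, m r) {t : ℝ} (ht : 0 < t)
    (htT : t ≤ T) : m t ≤ 2 * a * Real.exp (2 * K * t) := by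
  -- With the doubled rate `2K`, inserting a bound with constant `S` returns one with constant `a +
  -- S/2`. Iterating from the a priori bound `M` contracts to `2a`; no continuity of `m` is needed.
  have step : ∀ S, 0 ≤ S → (∀ t, 0 < t → t ≤ T → m t ≤ S * Real.exp (2 * K * t)) →
      ∀ t, 0 < t → t ≤ T → m t ≤ (a + S / 2) * Real.exp (2 * K * t) := by
    intro S hS hb t ht htT
    have h1 : ∫ r in (0 : ℝ)..t, m r ≤ ∫ r in (0 : ℝ)..t, S * Real.exp (2 * K * r) :=
      intervalIntegral.integral_mono_on_of_le_Ioo ht.le (hi t ht htT)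
        (Continuous.intervalIntegrable (by fun_prop) _ _)
        fun r hr => hb r hr.1 (hr.2.le.trans htT)
    have h2 : ∫ r in (0 : ℝ)..t, S * Real.exp (2 * K * r)
        = S * ((2 * K)⁻¹ * (Real.exp (2 * K * t) - 1)) := by
      rw [intervalIntegral.integral_const_mul, intervalIntegral.integral_comp_mul_left
        (fun y => Real.exp y) (by positivity)]
      simp
    have h3 := h t ht htT
    have h4 : K * (S * ((2 * K)⁻¹ * (Real.exp (2 * K * t) - 1)))
        = S / 2 * (Real.exp (2 * K * t) - 1) := by field_simp
    have h5 : 1 ≤ Real.exp (2 * K * t) := Real.one_le_exp (by positivity)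
    have h6 : K * ∫ r in (0 : ℝ)..t, m r ≤ S / 2 * (Real.exp (2 * K * t) - 1) := by
      rw [← h4, ← h2]; gcongr
    nlinarith
  have hn : ∀ n : ℕ, ∀ t, 0 < t → t ≤ T →
      m t ≤ (2 * a + |M| / 2 ^ n) * Real.exp (2 * K * t) := by
    intro n
    induction n with
    | zero =>
      intro t ht htT
      have h5 : 1 ≤ Real.exp (2 * K * t) := Real.one_le_exp (by positivity)
      have h6 := (hm t ht htT).trans (le_abs_self M)
      have h7 : 0 ≤ |M| := abs_nonneg M
      simp only [pow_zero, div_one]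
      nlinarith
    | succ n ih =>
      intro t ht htT
      have := step _ (by positivity) ih t ht htT
      refine this.trans (le_of_eq ?_)
      rw [pow_succ]; field_simp; ring
  have hlim : Tendsto (fun n : ℕ => (2 * a + |M| / 2 ^ n) * Real.exp (2 * K * t)) atTop
      (𝓝 ((2 * a + 0) * Real.exp (2 * K * t))) := by
    refine Tendsto.mul_const _ (tendsto_const_nhds.add ?_)
    exact tendsto_const_nhds.div_atTop (tendsto_pow_atTop_atTop_of_one_lt one_lt_two)
  rw [add_zero] at hlim
  exact ge_of_tendsto' hlim fun n => hn n t ht htT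

/-- Positive functions with logarithmic derivatives of the order of a polynomial. -/
structure Tame (C : ℝ) (f : Coord d → ℝ) : Prop where
  smooth : ContDiff ℝ ∞ f
  pos : ∀ x, 0 < f x
  first : ∀ x i, (1 + ‖x‖) * |pd i f x| ≤ C * f x
  second : ∀ x i k, |pd i (pd k f) x| ≤ C * f x

lemma Tame.first' {C : ℝ} {f : Coord d → ℝ} (hf : Tame C f) (x : Coord d) (i : Fin d) :
    |pd i f x| ≤ C * f x :=
  (le_mul_of_one_le_left (abs_nonneg _) (one_le_one_add_norm x)).trans (hf.first x i)

lemma Tame.mul {C D : ℝ} {f g : Coord d → ℝ} (hC : 0 ≤ C) (hD : 0 ≤ D) (hf : Tame C f)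
    (hg : Tame D g) : Tame (C + D + 2 * C * D) (fun x => f x * g x) where
  smooth := hf.smooth.mul hg.smooth
  pos x := mul_pos (hf.pos x) (hg.pos x)
  first x i := by
    rw [pd_mul (hf.smooth.differentiable (by norm_num) x)
      (hg.smooth.differentiable (by norm_num) x)]
    have := hf.pos x; have := hg.pos x
    have h1 := hf.first x i
    have h2 := hg.first x i
    calc (1 + ‖x‖) * |pd i f x * g x + f x * pd i g x|
        ≤ (1 + ‖x‖) * (|pd i f x| * g x + f x * |pd i g x|) := by
          gcongr
          refine (abs_add_le _ _).trans ?_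
          rw [abs_mul, abs_mul, abs_of_pos (hf.pos x), abs_of_pos (hg.pos x)]
      _ = ((1 + ‖x‖) * |pd i f x|) * g x + f x * ((1 + ‖x‖) * |pd i g x|) := by ring
      _ ≤ (C * f x) * g x + f x * (D * g x) := by gcongr
      _ ≤ (C * f x) * g x + f x * (D * g x) + 2 * C * D * (f x * g x) :=
        le_add_of_nonneg_right (by positivity)
      _ = _ := by ring
  second x i k := by
    rw [pd_pd_mul hf.smooth hg.smooth]
    have := hf.pos x; have := hg.pos x
    have h1 := hf.first' x
    have h2 := hg.first' x
    have h3 := hf.second x i k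
    have h4 := hg.second x i k
    calc _ ≤ |pd i (pd k f) x| * g x + |pd k f x| * |pd i g x|
          + (|pd i f x| * |pd k g x| + f x * |pd i (pd k g) x|) := by
          refine (abs_add_le _ _).trans (add_le_add ((abs_add_le _ _).trans ?_)
            ((abs_add_le _ _).trans ?_))
          · rw [abs_mul, abs_mul, abs_of_pos (hg.pos x)]
          · rw [abs_mul, abs_mul, abs_of_pos (hf.pos x)]
      _ ≤ (C * f x) * g x + (C * f x) * (D * g x) + ((C * f x) * (D * g x) + f x * (D * g x)) := by
          have := h1 i; have := h1 k; have := h2 i; have := h2 k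
          gcongr
      _ = _ := by ring

lemma Tame.inv {C : ℝ} {f : Coord d → ℝ} (hC : 0 ≤ C) (hf : Tame C f) :
    Tame (C + 2 * C ^ 2) (fun x => (f x)⁻¹) := by
  have hne : ∀ x, f x ≠ 0 := fun x => (hf.pos x).ne'
  have hs : ContDiff ℝ ∞ (fun x => (f x)⁻¹) := hf.smooth.inv hne
  have hd : ∀ x, DifferentiableAt ℝ f x := fun x => hf.smooth.differentiable (by norm_num) x
  have hdi : ∀ x, DifferentiableAt ℝ (fun x => (f x)⁻¹) x := fun x =>
    hs.differentiable (by norm_num) x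
  have e1 : ∀ i, pd i (fun x => (f x)⁻¹) = fun x => -1 * (pd i f x * ((f x)⁻¹ * (f x)⁻¹)) := by
    intro i
    ext x
    have h1 : pd i (fun x => f x * (f x)⁻¹) x = 0 := by
      have : (fun x => f x * (f x)⁻¹) = fun _ => (1 : ℝ) := by
        ext y; exact mul_inv_cancel₀ (hne y)
      rw [this, pd_const]
    rw [pd_mul (hd x) (hdi x)] at h1
    have := hne x
    field_simp at h1 ⊢
    linarith
  have hinv : ∀ x, 0 < (f x)⁻¹ := fun x => inv_pos.2 (hf.pos x)
  have hff : ∀ x, f x * (f x)⁻¹ = 1 := fun x => mul_inv_cancel₀ (hne x)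
  refine ⟨hs, hinv, fun x i => ?_, fun x i k => ?_⟩
  · have h1 := hf.first x i
    have := hinv x
    rw [e1]
    calc (1 + ‖x‖) * |-1 * (pd i f x * ((f x)⁻¹ * (f x)⁻¹))|
        = ((1 + ‖x‖) * |pd i f x|) * ((f x)⁻¹ * (f x)⁻¹) := by
          rw [abs_mul, abs_mul, abs_of_pos (mul_pos (hinv x) (hinv x))]; simp; ring
      _ ≤ (C * f x) * ((f x)⁻¹ * (f x)⁻¹) := by gcongr
      _ = C * (f x)⁻¹ * (f x * (f x)⁻¹) := by ring
      _ = C * (f x)⁻¹ := by rw [hff, mul_one]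
      _ ≤ _ := by gcongr; nlinarith
  · have hdp : DifferentiableAt ℝ (pd k f) x :=
      (contDiff_pd hf.smooth k).differentiable (by norm_num) x
    have h1 := hf.first' x i
    have h2 := hf.first' x k
    have h3 := hf.second x i k
    have hp := hinv x
    have hp' := hf.pos x
    rw [e1, pd_const_mul (f := fun x => pd k f x * ((f x)⁻¹ * (f x)⁻¹))
      (hdp.mul ((hdi x).mul (hdi x))), pd_mul (g := fun x => (f x)⁻¹ * (f x)⁻¹) hdp
      ((hdi x).mul (hdi x)), pd_mul (hdi x) (hdi x), e1]
    set y := (f x)⁻¹ with hy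
    have hfy : f x * y = 1 := hff x
    have : -1 * (pd i (pd k f) x * (y * y) + pd k f x *
        (-1 * (pd i f x * (y * y)) * y + y * (-1 * (pd i f x * (y * y)))))
        = -(pd i (pd k f) x) * (y * y) + 2 * (pd k f x * pd i f x) * (y * y * y) := by ring
    rw [this]
    calc _ ≤ |pd i (pd k f) x| * (y * y) + 2 * (|pd k f x| * |pd i f x|) * (y * y * y) := by
          refine (abs_add_le _ _).trans (le_of_eq ?_)
          rw [abs_mul, abs_neg, abs_mul, abs_mul, abs_mul, abs_two, abs_mul (pd k f x), abs_of_pos (a := y) hp,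
            abs_of_pos (mul_pos (mul_pos hp hp) hp)]
      _ ≤ (C * f x) * (y * y) + 2 * ((C * f x) * (C * f x)) * (y * y * y) := by gcongr
      _ = C * y * (f x * y) + 2 * C ^ 2 * y * (f x * y) * (f x * y) := by ring
      _ = _ := by rw [hfy]; ring

lemma Tame.pow {C : ℝ} (hC : 0 ≤ C) (n : ℕ) : ∃ D, 0 ≤ D ∧ ∀ f : Coord d → ℝ, Tame C f →
    Tame D (fun x => f x ^ n) := by
  induction n with
  | zero =>
    have hz : ∀ k, pd (d := d) k (fun _ => (1 : ℝ)) = fun _ => 0 := fun k => by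
      ext x; exact pd_const _ _ _
    exact ⟨0, le_rfl, fun f _ => by
      simp only [pow_zero]
      exact ⟨contDiff_const, fun _ => one_pos, fun x i => by simp [hz],
        fun x i k => by simp [hz, pd_const]⟩⟩
  | succ n ih =>
    obtain ⟨D, hD, h⟩ := ih
    refine ⟨D + C + 2 * D * C, by positivity, fun f hf => ?_⟩
    simp only [pow_succ]
    exact (h f hf).mul hD hC hf

lemma pd_evenWeight_one (i : Fin d) :
    pd i (evenWeight (d := d) 1) = fun x => 2 * x i := by
  ext x
  have e : evenWeight (d := d) 1 = fun x => 1 + ∑ c, x c * x c := by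
    ext y; simp [evenWeight, sq]
  have hd : ∀ c, DifferentiableAt ℝ (fun y : Coord d => y c) x := fun c => by fun_prop
  rw [e, pd_add (by fun_prop) (by fun_prop), pd_const, pd_sum (f := fun c y => y c * y c) _ fun c _ => (hd c).mul (hd c)]
  simp only [pd_mul (hd _) (hd _), pd_coord]
  simp [Finset.sum_add_distrib]
  ring

lemma contDiff_evenWeight (q : ℕ) : ContDiff ℝ ∞ (evenWeight (d := d) q) := by
  unfold evenWeight
  fun_prop

/-- The constant does not depend on `a` and `b`, which makes the later truncation uniform in its
parameter. The value `8` is the `2` from differentiating a square times the `4` relating `(1 +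
‖x‖)²` to the weight. -/
lemma tame_affine_evenWeight {a b : ℝ} (ha : 0 ≤ a) (hb : 0 < b) :
    Tame 8 (fun x : Coord d => a + b * evenWeight 1 x) := by
  have hs := contDiff_evenWeight (d := d) 1
  have hd : ∀ x, DifferentiableAt ℝ (evenWeight (d := d) 1) x := fun x =>
    hs.differentiable (by norm_num) x
  have e1 : ∀ i, pd i (fun x : Coord d => a + b * evenWeight 1 x) = fun x => (b * 2) * x i := by
    intro i
    ext x
    rw [pd_add (by fun_prop) ((hd x).const_mul b), pd_const, pd_const_mul (hd x),
      pd_evenWeight_one]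
    ring
  have hw := fun x : Coord d => weight_le_evenWeight 1 x
  have h1 := fun x : Coord d => one_le_evenWeight 1 x
  refine ⟨contDiff_const.add (contDiff_const.mul hs), fun x => ?_, fun x i => ?_, fun x i k => ?_⟩
  · have := h1 x
    have : 0 < b * evenWeight 1 x := by positivity
    linarith
  · rw [e1, abs_mul, abs_of_pos (by positivity)]
    have h2 := norm_le_pi_norm x i
    rw [Real.norm_eq_abs] at h2
    have h3 := hw x
    norm_num at h3
    have h4 : (1 + ‖x‖) * |x i| ≤ (1 + ‖x‖) ^ 2 := by
      rw [sq]
      gcongr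
      linarith
    nlinarith
  · rw [e1]
    rw [pd_const_mul (f := fun x : Coord d => x k) (by fun_prop), pd_coord]
    have h2 := h1 x
    split_ifs
    · rw [mul_one, abs_of_pos (by positivity)]; nlinarith
    · simp; positivity

section Weak

variable {B : Coord d → Matrix (Fin d) (Fin d) ℝ} {F : Fin d → Coord d → ℝ} {x₀ : Coord d}
  {q : ℝ → Coord d → ℝ}

/-- A bounded regularization of a power of the quadratic weight. -/
def regWeight (m : ℕ) (ε : ℝ) (x : Coord d) : ℝ :=
  ((0 + 1 * evenWeight 1 x) * (1 + ε * evenWeight 1 x)⁻¹) ^ m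

/-- The point is the order of quantifiers: `D` is chosen before `ε`. Products, inverses and powers
of tame functions are tame with constants computed from the old ones alone. -/
lemma exists_tame_regWeight (d m : ℕ) : ∃ D, 0 ≤ D ∧ ∀ ε, 0 < ε →
    Tame D (regWeight (d := d) m ε) := by
  obtain ⟨D, hD, h⟩ := Tame.pow (d := d) (C := 8 + (8 + 2 * 8 ^ 2) + 2 * 8 * (8 + 2 * 8 ^ 2))
    (by norm_num) m
  refine ⟨D, hD, fun ε hε => h _ ?_⟩
  exact (tame_affine_evenWeight le_rfl one_pos).mul (by norm_num) (by norm_num)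
    ((tame_affine_evenWeight zero_le_one hε).inv (by norm_num))

lemma regWeight_le {m : ℕ} {ε : ℝ} (hε : 0 < ε) (x : Coord d) :
    regWeight m ε x ≤ evenWeight 1 x ^ m ∧ regWeight m ε x ≤ (ε⁻¹) ^ m := by
  have h1 := one_le_evenWeight 1 x
  have h2 : 0 < 1 + ε * evenWeight 1 x := by positivity
  unfold regWeight
  rw [zero_add, one_mul, ← div_eq_mul_inv]
  constructor
  · gcongr
    rw [div_le_iff₀ h2]
    nlinarith [mul_pos hε (zero_lt_one.trans_le h1)]
  · gcongr
    rw [div_le_iff₀ h2]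
    field_simp
    linarith

/-- Tameness gives `|gen f| ≤ k f` with `k` independent of `ε`, so the weak form leads to a Grönwall
inequality for the truncated moment. The crude bound `ε⁻ᵐ` only supplies finiteness; it does not
appear in the conclusion of Grönwall's lemma. -/
lemma WeakSolution.regWeight_bound (h : Admissible B F) (hq : WeakSolution B F x₀ q) (m : ℕ)
    (T : ℝ) : ∃ C, 0 ≤ C ∧ ∀ ε, 0 < ε → ∀ t, 0 < t → t ≤ T →
      Integrable (fun x => regWeight m ε x * q t x) ∧ ∫ x, regWeight m ε x * q t x ≤ C := by
  obtain ⟨K, hK0, hK⟩ := h.exists_gen_bound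
  obtain ⟨D, hD0, hD⟩ := exists_tame_regWeight d m
  obtain ⟨A, hA0, hA⟩ := hq.mass T
  set k := K * (1 + D) + 1 with hk
  have hk0 : 0 < k := by positivity
  have hr0 : 0 < evenWeight 1 x₀ ^ m := pow_pos (zero_lt_one.trans_le (one_le_evenWeight 1 x₀)) m
  refine ⟨2 * evenWeight 1 x₀ ^ m * Real.exp (2 * k * |T|), by positivity, fun ε hε t ht htT => ?_⟩
  have hf := hD ε hε
  set f : Coord d → ℝ := regWeight m ε with hfd
  have hint : ∀ r, 0 < r → Integrable (fun x => f x * q r x) := fun r hr =>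
    (hq.integrable r hr).bdd_mul (c := (ε⁻¹) ^ m) hf.smooth.continuous.aestronglyMeasurable
      (Eventually.of_forall fun x => by
        rw [Real.norm_of_nonneg (hf.pos x).le]; exact (regWeight_le hε x).2)
  have hbd : ∀ r, 0 < r → r ≤ T → |∫ x, f x * q r x| ≤ (ε⁻¹) ^ m * A := fun r hr hrT => by
    rw [abs_of_nonneg (integral_nonneg fun x => mul_nonneg (hf.pos x).le (hq.nonneg r hr x))]
    calc ∫ x, f x * q r x ≤ ∫ x, (ε⁻¹) ^ m * q r x :=
          integral_mono (hint r hr) ((hq.integrable r hr).const_mul _) fun x =>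
            mul_le_mul_of_nonneg_right (regWeight_le hε x).2 (hq.nonneg r hr x)
      _ = (ε⁻¹) ^ m * ∫ x, q r x := integral_const_mul _ _
      _ ≤ _ := by gcongr; exact hA r hr hrT
  have hii : ∀ r, 0 < r → r ≤ T → IntervalIntegrable (fun r => ∫ x, f x * q r x) volume 0 r :=
    fun r hr hrT => intervalIntegrable_of_bound hr.le
      (aestronglyMeasurable_integral hq.cont hf.smooth.continuous)
      fun s hs hsr => hbd s hs (hsr.trans hrT)
  refine ⟨hint t ht, ?_⟩
  have hgw : ∀ x, |gen B F f x| ≤ k * f x := fun x => by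
    have hfx := hf.pos x
    refine (hK f x ((1 + D) * f x) (by positivity) (fun i => (hf.first x i).trans ?_)
      (fun i l => (hf.second x i l).trans ?_)).trans ?_
    · nlinarith
    · nlinarith
    · rw [← mul_assoc]; gcongr; rw [hk]; linarith
  have hstep : ∀ t, 0 < t → t ≤ T → ∫ x, f x * q t x
      ≤ evenWeight 1 x₀ ^ m + k * ∫ r in (0 : ℝ)..t, ∫ x, f x * q r x := by
    intro t ht htT
    have hw := hq.weak_of_dominated h (f := f) (W := fun x => (1 + D) * f x) hf.smooth
      (fun x => by rw [abs_of_pos (hf.pos x)]; nlinarith [hf.pos x])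
      (fun x i => (hf.first x i).trans (by nlinarith [hf.pos x]))
      (fun x i l => (hf.second x i l).trans (by nlinarith [hf.pos x])) ht
      (M := (1 + D) * ((ε⁻¹) ^ m * A)) (fun r hr hrt => by
        simp only [mul_assoc]
        refine ⟨(hint r hr).const_mul _, ?_⟩
        rw [integral_const_mul]
        gcongr
        exact (le_abs_self _).trans (hbd r hr (hrt.trans htT)))
    rw [hw.2, ← intervalIntegral.integral_const_mul]
    refine add_le_add (regWeight_le hε x₀).1 ?_
    refine intervalIntegral.integral_mono_on_of_le_Ioo ht.le hw.1
      ((hii t ht htT).const_mul _) fun r hr => ?_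
    rw [← integral_const_mul]
    refine (le_abs_self _).trans ?_
    rw [← Real.norm_eq_abs]
    refine norm_integral_le_of_norm_le ((hint r hr.1).const_mul _)
      (Eventually.of_forall fun x => ?_)
    rw [norm_mul, Real.norm_of_nonneg (hq.nonneg r hr.1 x), ← mul_assoc]
    exact mul_le_mul_of_nonneg_right (hgw x) (hq.nonneg r hr.1 x)
  refine (gronwall_integral hk0 hr0.le (fun r hr hrT => (le_abs_self _).trans (hbd r hr hrT)) hii
    hstep ht htT).trans ?_
  have : t ≤ |T| := htT.trans (le_abs_self T)
  gcongr

/-- All moments of a weak solution are bounded on bounded time intervals. -/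
lemma WeakSolution.moment_bound (h : Admissible B F) (hq : WeakSolution B F x₀ q) (k : ℕ)
    (T : ℝ) : ∃ C, 0 ≤ C ∧ ∀ t, 0 < t → t ≤ T →
      Integrable (fun x => (1 + ‖x‖) ^ k * q t x) ∧ ∫ x, (1 + ‖x‖) ^ k * q t x ≤ C := by
  obtain ⟨C, hC0, hC⟩ := hq.regWeight_bound h k T
  have key : ∀ t, 0 < t → t ≤ T → Integrable (fun x => evenWeight 1 x ^ k * q t x) ∧
      ∫ x, evenWeight 1 x ^ k * q t x ≤ C := by
    intro t ht htT
    have hlim : ∀ x, Tendsto (fun n : ℕ => regWeight k (((n : ℝ) + 1)⁻¹) x * q t x) atTop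
        (𝓝 (evenWeight 1 x ^ k * q t x)) := fun x => by
      refine Tendsto.mul_const _ ?_
      have h1 : Tendsto (fun n : ℕ => ((n : ℝ) + 1)⁻¹) atTop (𝓝 0) := by
        simpa using tendsto_one_div_add_atTop_nhds_zero_nat (𝕜 := ℝ)
      have h2 : ContinuousAt (fun ε : ℝ => regWeight k ε x) 0 := by
        unfold regWeight
        have : (1 + (0 : ℝ) * evenWeight 1 x) ≠ 0 := by simp
        fun_prop (disch := assumption)
      have h3 := h2.tendsto.comp h1
      simpa [regWeight, Function.comp_def] using h3
    have hpos : ∀ (n : ℕ) x, 0 ≤ regWeight k (((n : ℝ) + 1)⁻¹) x * q t x := fun n x =>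
      mul_nonneg (by
        have := one_le_evenWeight 1 x
        unfold regWeight; positivity) (hq.nonneg t ht x)
    have hev : ∀ x, 0 ≤ evenWeight 1 x ^ k * q t x := fun x =>
      ge_of_tendsto' (hlim x) fun n => hpos n x
    have hm : AEStronglyMeasurable (fun x => evenWeight 1 x ^ k * q t x) :=
      (((contDiff_evenWeight 1).continuous.pow k).mul (hq.continuous_slice ht)).aestronglyMeasurable
    -- Fatou's lemma along `ε = 1/(n+1)` removes the truncation.
    have hf : ∫⁻ x, ENNReal.ofReal (evenWeight 1 x ^ k * q t x) ≤ ENNReal.ofReal C := by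
      calc ∫⁻ x, ENNReal.ofReal (evenWeight 1 x ^ k * q t x)
          = ∫⁻ x, liminf (fun n : ℕ => ENNReal.ofReal
              (regWeight k (((n : ℝ) + 1)⁻¹) x * q t x)) atTop := by
            refine lintegral_congr fun x => ?_
            exact ((ENNReal.continuous_ofReal.tendsto _).comp (hlim x)).liminf_eq.symm
        _ ≤ liminf (fun n : ℕ => ∫⁻ x, ENNReal.ofReal
              (regWeight k (((n : ℝ) + 1)⁻¹) x * q t x)) atTop := by
            refine lintegral_liminf_le' fun n => ?_
            exact (hC _ (by positivity) t ht htT).1.aestronglyMeasurable.aemeasurable.ennreal_ofReal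
        _ ≤ ENNReal.ofReal C := by
            refine liminf_le_of_le (by isBoundedDefault) fun b hb => ?_
            obtain ⟨n, hn⟩ := hb.exists
            refine hn.trans ?_
            rw [← ofReal_integral_eq_lintegral_ofReal (hC _ (by positivity) t ht htT).1
              (Eventually.of_forall (hpos n))]
            exact ENNReal.ofReal_le_ofReal (hC _ (by positivity) t ht htT).2
    have hi : Integrable (fun x => evenWeight 1 x ^ k * q t x) := by
      refine ⟨hm, ?_⟩
      rw [hasFiniteIntegral_iff_ofReal (Eventually.of_forall hev)]
      exact hf.trans_lt ENNReal.ofReal_lt_top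
    refine ⟨hi, ?_⟩
    rw [← ofReal_integral_eq_lintegral_ofReal hi (Eventually.of_forall hev)] at hf
    exact (ENNReal.ofReal_le_ofReal_iff hC0).1 hf
  have hle : ∀ x : Coord d, (1 + ‖x‖) ^ k ≤ 4 ^ k * evenWeight 1 x ^ k := fun x => by
    rw [← mul_pow]
    have h1 := weight_le_evenWeight 1 x
    have h2 := one_le_one_add_norm x
    gcongr
    norm_num at h1
    nlinarith
  refine ⟨4 ^ k * C, by positivity, fun t ht htT => ?_⟩
  obtain ⟨h1, h2⟩ := key t ht htT
  have hb : ∀ x, (1 + ‖x‖) ^ k * q t x ≤ 4 ^ k * (evenWeight 1 x ^ k * q t x) := fun x => by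
    rw [← mul_assoc]
    exact mul_le_mul_of_nonneg_right (hle x) (hq.nonneg t ht x)
  have hc : Continuous fun x : Coord d => (1 + ‖x‖) ^ k * q t x :=
    ((continuous_const.add continuous_norm).pow k).mul (hq.continuous_slice ht)
  have hi : Integrable (fun x => (1 + ‖x‖) ^ k * q t x) := by
    refine (h1.const_mul (4 ^ k)).mono' hc.aestronglyMeasurable (Eventually.of_forall fun x => ?_)
    rw [Real.norm_of_nonneg (mul_nonneg (by positivity) (hq.nonneg t ht x))]
    exact hb x
  refine ⟨hi, (integral_mono hi (h1.const_mul _) hb).trans ?_⟩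
  rw [integral_const_mul]
  gcongr

lemma WeakSolution.integrable_mul (h : Admissible B F) (hq : WeakSolution B F x₀ q)
    {f : Coord d → ℝ} (hf : Continuous f) {C : ℝ} {k : ℕ} (hC : ∀ x, |f x| ≤ C * (1 + ‖x‖) ^ k)
    {t : ℝ} (ht : 0 < t) : Integrable (fun x => f x * q t x) := by
  obtain ⟨D, -, hD⟩ := hq.moment_bound h k t
  refine ((hD t ht le_rfl).1.const_mul C).mono'
    (hf.mul (hq.continuous_slice ht)).aestronglyMeasurable (Eventually.of_forall fun x => ?_)
  rw [norm_mul, Real.norm_of_nonneg (hq.nonneg t ht x), ← mul_assoc]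
  exact mul_le_mul_of_nonneg_right (hC x) (hq.nonneg t ht x)

/-- Polynomially bounded functions have uniformly bounded expectations. -/
lemma WeakSolution.exists_abs_integral_le (h : Admissible B F) (hq : WeakSolution B F x₀ q)
    (k : ℕ) (T : ℝ) : ∃ D, 0 ≤ D ∧ ∀ (f : Coord d → ℝ) (C : ℝ), 0 ≤ C →
      (∀ x, |f x| ≤ C * (1 + ‖x‖) ^ k) → ∀ t, 0 < t → t ≤ T → |∫ x, f x * q t x| ≤ C * D := by
  obtain ⟨D, hD0, hD⟩ := hq.moment_bound h k T
  refine ⟨D, hD0, fun f C hC0 hC t ht htT => ?_⟩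
  calc |∫ x, f x * q t x| ≤ ∫ x, C * ((1 + ‖x‖) ^ k * q t x) := by
        rw [← Real.norm_eq_abs]
        refine norm_integral_le_of_norm_le ((hD t ht htT).1.const_mul C)
          (Eventually.of_forall fun x => ?_)
        rw [norm_mul, Real.norm_of_nonneg (hq.nonneg t ht x), ← mul_assoc]
        exact mul_le_mul_of_nonneg_right (hC x) (hq.nonneg t ht x)
    _ = C * ∫ x, (1 + ‖x‖) ^ k * q t x := integral_const_mul _ _
    _ ≤ C * D := by gcongr; exact (hD t ht htT).2

/-- The weak form holds for temperate functions. -/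
lemma WeakSolution.weak_of_growth (h : Admissible B F) (hq : WeakSolution B F x₀ q)
    {f : Coord d → ℝ} (hf : Growth 1 (fun _ : Unit => f)) {t : ℝ} (ht : 0 < t) :
    IntervalIntegrable (fun r => ∫ x, gen B F f x * q r x) volume 0 t ∧
    ∫ x, f x * q t x = f x₀ + ∫ r in (0 : ℝ)..t, ∫ x, gen B F f x * q r x := by
  obtain ⟨C0, k0, hC0, h0⟩ := hf.abs_le
  choose C1 k1 hC1 h1 using fun i => (hf.pd i).abs_le
  choose C2 k2 hC2 h2 using fun i k => ((hf.pd k).pd i).abs_le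
  simp only [one_mul] at h0 h1 h2
  set k := k0 + (∑ i, k1 i + 1) + ∑ i, ∑ l, k2 i l with hk
  set C := C0 + ∑ i, C1 i + ∑ i, ∑ l, C2 i l with hCd
  have hs1 : ∀ i, C1 i ≤ ∑ i, C1 i := fun i =>
    Finset.single_le_sum (f := C1) (fun i _ => hC1 i) (Finset.mem_univ i)
  have hs1' : ∀ i, k1 i ≤ ∑ i, k1 i := fun i =>
    Finset.single_le_sum (f := k1) (fun i _ => Nat.zero_le _) (Finset.mem_univ i)
  have hs2 : ∀ i l, C2 i l ≤ ∑ i, ∑ l, C2 i l := fun i l =>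
    (Finset.single_le_sum (f := fun l => C2 i l) (fun l _ => hC2 i l) (Finset.mem_univ l)).trans
    (Finset.single_le_sum (f := fun i => ∑ l, C2 i l)
      (fun i _ => Finset.sum_nonneg fun l _ => hC2 i l) (Finset.mem_univ i))
  have hs2' : ∀ i l, k2 i l ≤ ∑ i, ∑ l, k2 i l := fun i l =>
    (Finset.single_le_sum (f := fun l => k2 i l) (fun l _ => Nat.zero_le _)
      (Finset.mem_univ l)).trans
    (Finset.single_le_sum (f := fun i => ∑ l, k2 i l) (fun i _ => Nat.zero_le _)
      (Finset.mem_univ i))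
  have p1 : 0 ≤ ∑ i, C1 i := Finset.sum_nonneg fun i _ => hC1 i
  have p2 : 0 ≤ ∑ i, ∑ l, C2 i l :=
    Finset.sum_nonneg fun i _ => Finset.sum_nonneg fun l _ => hC2 i l
  have hCp : 0 ≤ C := by positivity
  obtain ⟨D, hD0, hD⟩ := hq.moment_bound h k t
  refine hq.weak_of_dominated h (W := fun x => C * (1 + ‖x‖) ^ k) (hf.1 ()) (fun x => ?_)
    (fun x i => ?_) (fun x i l => ?_) ht (M := C * D) fun r hr hrt => ?_
  · refine (h0 () x).trans (mul_le_mul (by linarith) (weight_mono x (by omega)) (by positivity) hCp)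
  · calc (1 + ‖x‖) * |pd i f x| ≤ (1 + ‖x‖) * (C1 i * (1 + ‖x‖) ^ k1 i) := by
          gcongr; exact h1 i () x
      _ = C1 i * (1 + ‖x‖) ^ (k1 i + 1) := by ring
      _ ≤ C * (1 + ‖x‖) ^ k := by
          refine mul_le_mul ?_ (weight_mono x ?_) (by positivity) hCp
          · have := hs1 i; linarith
          · have := hs1' i; omega
  · refine (h2 i l () x).trans (mul_le_mul ?_ (weight_mono x ?_) (by positivity) hCp)
    · have := hs2 i l; linarith
    · have := hs2' i l; omega
  · simp only [mul_assoc]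
    refine ⟨(hD r hr hrt).1.const_mul _, ?_⟩
    rw [integral_const_mul]
    gcongr
    exact (hD r hr hrt).2

/-- Second-order expansion in time of expectations, uniform over temperate families. -/
lemma WeakSolution.expansion (h : Admissible B F) (hq : WeakSolution B F x₀ q)
    {u : ι → Coord d → ℝ} (hu : Growth 1 u) (T : ℝ) : ∃ C, 0 ≤ C ∧ ∀ i,
      (∀ t, 0 < t → t ≤ T →
        |(∫ x, u i x * q t x) - u i x₀ - t * gen B F (u i) x₀| ≤ C * t ^ 2) ∧
      ∀ s t, 0 < s → 0 < t → s + t ≤ T →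
        |(∫ x, u i x * q (s + t) x) - (∫ x, u i x * q s x) - t * ∫ x, gen B F (u i) x * q s x|
          ≤ C * t ^ 2 := by
  have hg := h.growth_gen hu
  obtain ⟨C, k, hC0, hC⟩ := (h.growth_gen hg).abs_le
  simp only [one_mul] at hC
  obtain ⟨D, hD0, hD⟩ := hq.exists_abs_integral_le h k T
  refine ⟨C * D, by positivity, fun i => ?_⟩
  have w1 := fun {t : ℝ} (ht : 0 < t) => hq.weak_of_growth h (hu.comp_index fun _ : Unit => i) ht
  have w2 := fun {t : ℝ} (ht : 0 < t) => hq.weak_of_growth h (hg.comp_index fun _ : Unit => i) ht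
  have hb : ∀ r, 0 < r → r ≤ T → |∫ x, gen B F (gen B F (u i)) x * q r x| ≤ C * D :=
    fun r hr hrT => hD _ C hC0 (hC i) r hr hrT
  -- An integrand with a Lipschitz bound relative to a reference value at the left end. The
  -- Lipschitz constant is the bound on the expectation of `gen (gen u)`. The value `c` is separate
  -- because at `a = 0` the reference is `gen u` at `x₀`, not an integral against `q`.
  have lip : ∀ a b c : ℝ, 0 ≤ a → a ≤ b → b ≤ T → (∀ r, a < r → r ≤ b →
      |(∫ x, gen B F (u i) x * q r x) - c| ≤ C * D * (r - a)) →
      IntervalIntegrable (fun r => ∫ x, gen B F (u i) x * q r x) volume a b →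
      |(∫ r in a..b, ∫ x, gen B F (u i) x * q r x) - (b - a) * c| ≤ C * D * (b - a) ^ 2 := by
    intro a b c ha hab hbT hr hi
    have e : (∫ r in a..b, ∫ x, gen B F (u i) x * q r x) - (b - a) * c
        = ∫ r in a..b, ((∫ x, gen B F (u i) x * q r x) - c) := by
      rw [intervalIntegral.integral_sub hi intervalIntegrable_const]; simp
    rw [e, ← Real.norm_eq_abs]
    have := intervalIntegral.norm_integral_le_of_norm_le_const (a := a) (b := b)
      (f := fun r => (∫ x, gen B F (u i) x * q r x) - c) (C := C * D * (b - a)) fun r hr' => by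
        rw [Set.uIoc_of_le hab] at hr'
        refine (hr r hr'.1 hr'.2).trans ?_
        have := hr'.2
        gcongr
    rw [abs_of_nonneg (sub_nonneg.2 hab)] at this
    linarith [this]
  constructor
  · intro t ht htT
    have := lip 0 t (gen B F (u i) x₀) le_rfl ht.le htT (fun r hr hrt => ?_) (w1 ht).1
    · rw [(w1 ht).2]
      simpa using this
    · rw [(w2 hr).2, add_sub_cancel_left, ← Real.norm_eq_abs]
      have := intervalIntegral.norm_integral_le_of_norm_le_const (a := 0) (b := r)
        (f := fun r => ∫ x, gen B F (gen B F (u i)) x * q r x) (C := C * D) fun p hp => by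
          rw [Set.uIoc_of_le hr.le] at hp
          exact hb p hp.1 (hp.2.trans (hrt.trans htT))
      rwa [abs_of_nonneg (sub_nonneg.2 hr.le)] at this
  · intro s t hs ht hT
    have i1 := (w1 (add_pos hs ht)).1
    have hsub := intervalIntegral.integral_interval_sub_left i1 (w1 hs).1
    have i1' : IntervalIntegrable (fun r => ∫ x, gen B F (u i) x * q r x) volume s (s + t) :=
      i1.mono_set (by
        rw [Set.uIcc_of_le (by linarith), Set.uIcc_of_le (by linarith)]
        exact Set.Icc_subset_Icc hs.le le_rfl)
    have := lip s (s + t) (∫ x, gen B F (u i) x * q s x) hs.le (by linarith) hT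
      (fun r hr hrt => ?_) i1'
    · rw [(w1 (add_pos hs ht)).2, (w1 hs).2, add_sub_add_left_eq_sub, hsub]
      simpa using this
    · have hr0 := hs.trans hr
      rw [(w2 hr0).2, (w2 hs).2, add_sub_add_left_eq_sub,
        intervalIntegral.integral_interval_sub_left (w2 hr0).1 (w2 hs).1, ← Real.norm_eq_abs]
      have := intervalIntegral.norm_integral_le_of_norm_le_const (a := s) (b := r)
        (f := fun r => ∫ x, gen B F (gen B F (u i)) x * q r x) (C := C * D) fun p hp => by
          rw [Set.uIoc_of_le hr.le] at hp
          exact hb p (hs.trans hp.1) (hp.2.trans (hrt.trans hT))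
      rwa [abs_of_nonneg (sub_nonneg.2 hr.le)] at this

end Weak

/-! ### Moments of the exact kernel -/

lemma growth_monomial {M : ℕ} (I : Fin M → Fin d) (x₀ : Coord d) :
    Growth 1 (fun _ : Unit => monomial I x₀) :=
  Growth.prod _ fun _ _ => (Growth.coord _).sub (Growth.const _)

lemma pd_coord_sub (i k : Fin d) (x₀ : Coord d) :
    pd i (fun y : Coord d => y k - x₀ k) = fun _ => if i = k then 1 else 0 := by
  ext x
  rw [pd_sub (f := fun y : Coord d => y k) (by fun_prop) (by fun_prop), pd_coord, pd_const,
    sub_zero]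

section Gen

variable {B : Coord d → Matrix (Fin d) (Fin d) ℝ} {F : Fin d → Coord d → ℝ}

lemma gen_monomial_one (x₀ : Coord d) (i : Fin d) : gen B F (monomial ![i] x₀) x₀ = F i x₀ := by
  have e : monomial ![i] x₀ = fun y => y i - x₀ i := by ext y; simp [monomial]
  rw [gen, e]
  simp [pd_coord_sub, pd_const]

lemma gen_monomial_two (h : Admissible B F) (x₀ : Coord d) (i k : Fin d) :
    gen B F (monomial ![i, k] x₀) x₀ = 2 * B x₀ i k := by
  have e : monomial ![i, k] x₀ = fun y => (y i - x₀ i) * (y k - x₀ k) := by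
    ext y; simp [monomial, Fin.prod_univ_two]
  have hc : ∀ a : Fin d, ContDiff ℝ ∞ fun y : Coord d => y a - x₀ a := fun a => by fun_prop
  have hd : ∀ a : Fin d, DifferentiableAt ℝ (fun y : Coord d => y a - x₀ a) x₀ := fun a => by
    fun_prop
  rw [gen, e]
  simp only [pd_pd_mul (hc i) (hc k), pd_mul (hd i) (hd k), pd_coord_sub]
  simp [Finset.sum_add_distrib, mul_add, h.symm x₀ k i]
  ring

/-- The monomial vanishes to third order at `x₀`, while `gen` takes at most two derivatives. Two
factors are split off, and the remaining product still contains a factor that is zero at `x₀`. -/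
lemma gen_monomial_of_three_le {M : ℕ} (hM : 3 ≤ M) (I : Fin M → Fin d) (x₀ : Coord d) :
    gen B F (monomial I x₀) x₀ = 0 := by
  obtain ⟨n, rfl⟩ : ∃ n, M = n + 3 := ⟨M - 3, by omega⟩
  set R : Coord d → ℝ := fun y => ∏ k : Fin (n + 1), (y (I k.succ.succ) - x₀ (I k.succ.succ))
    with hR
  have e : monomial I x₀ = fun y => (y (I 0) - x₀ (I 0)) * ((y (I 1) - x₀ (I 1)) * R y) := by
    ext y
    simp only [monomial, hR, Fin.prod_univ_succ (n := n + 2), Fin.prod_univ_succ (n := n + 1)]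
    rfl
  have hR0 : R x₀ = 0 := by simp [hR]
  have hc : ∀ a : Fin d, ContDiff ℝ ∞ fun y : Coord d => y a - x₀ a := fun a => by fun_prop
  have hcR : ContDiff ℝ ∞ R := by rw [hR]; fun_prop
  have h1 : ∀ i, pd i (fun y => (y (I 1) - x₀ (I 1)) * R y) x₀ = 0 := fun i => by
    rw [pd_mul ((hc _).differentiable (by norm_num) _) (hcR.differentiable (by norm_num) _), hR0]
    simp
  have h2 : ∀ i, pd i (monomial I x₀) x₀ = 0 := fun i => by
    rw [e, pd_mul ((hc _).differentiable (by norm_num) _)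
      (((hc _).mul hcR).differentiable (by norm_num) _), h1]
    simp
  have h3 : ∀ i k, pd i (pd k (monomial I x₀)) x₀ = 0 := fun i k => by
    rw [e, pd_pd_mul (hc _) ((hc _).mul hcR), h1, h1]
    simp
  simp [gen, h2, h3]

end Gen

lemma WeakSolution.moment_expansion {B : Coord d → Matrix (Fin d) (Fin d) ℝ}
    {F : Fin d → Coord d → ℝ} {x₀ : Coord d} {q : ℝ → Coord d → ℝ} (h : Admissible B F)
    (hq : WeakSolution B F x₀ q) {M : ℕ} (I : Fin M → Fin d) :
    (fun t => (∫ x, monomial I x₀ x * q t x) - monomial I x₀ x₀ - t * gen B F (monomial I x₀) x₀)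
      =O[𝓝[>] (0 : ℝ)] (fun t => t ^ 2) := by
  obtain ⟨C, hC0, hC⟩ := hq.expansion h (growth_monomial I x₀) 1
  refine IsBigO.of_bound C ?_
  have h1 : ∀ᶠ t : ℝ in 𝓝[>] 0, t < 1 := eventually_nhdsWithin_of_eventually_nhds
    (eventually_lt_nhds zero_lt_one)
  filter_upwards [self_mem_nhdsWithin, h1] with t ht ht1
  rw [Real.norm_eq_abs, Real.norm_of_nonneg (sq_nonneg t)]
  exact (hC ()).1 t ht ht1.le

/-- The moments of the exact transition probability. -/
theorem exactKernel_moments {g L : Coord d → Matrix (Fin d) (Fin d) ℝ} {U : Coord d → ℝ}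
    (hreg : RegularCoefficients g L U) {G : ℝ → Coord d → Coord d → ℝ}
    (hG : IsGreenFunction g L U G) (x₀ : Coord d) :
    (fun t => moment (exactKernel g G) t x₀ ![] - 1) =O[𝓝[>] (0 : ℝ)] (fun t => t ^ 2) ∧
    (∀ i, (fun t => moment (exactKernel g G) t x₀ ![i] - t * drift g L U i x₀)
      =O[𝓝[>] (0 : ℝ)] (fun t => t ^ 2)) ∧
    (∀ i j, (fun t => moment (exactKernel g G) t x₀ ![i, j] - 2 * t * symPart L x₀ i j)
      =O[𝓝[>] (0 : ℝ)] (fun t => t ^ 2)) ∧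
    (∀ M : ℕ, 3 ≤ M → ∀ I : Fin M → Fin d,
      (fun t => moment (exactKernel g G) t x₀ I) =O[𝓝[>] (0 : ℝ)] (fun t => t ^ 2)) := by
  have h := hreg.admissible
  have hq := hG.weakSolution hreg x₀
  have hm := fun (M : ℕ) (I : Fin M → Fin d) => hq.moment_expansion h I
  refine ⟨?_, fun i => ?_, fun i k => ?_, fun M hM I => ?_⟩
  · refine (isBigO_zero (fun t : ℝ => t ^ 2) _).congr' ?_ EventuallyEq.rfl
    filter_upwards [self_mem_nhdsWithin] with t ht
    have := hq.integral_eq_one h ht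
    simp [moment, monomial, this]
  · refine (hm 1 ![i]).congr_left fun t => ?_
    rw [gen_monomial_one]
    simp [moment, monomial]
  · refine (hm 2 ![i, k]).congr_left fun t => ?_
    rw [gen_monomial_two h]
    simp [moment, monomial, Fin.prod_univ_two]
    ring
  · refine (hm M I).congr_left fun t => ?_
    rw [gen_monomial_of_three_le hM]
    have : monomial I x₀ x₀ = 0 := by
      rw [monomial]
      exact Finset.prod_eq_zero (Finset.mem_univ ⟨0, by omega⟩) (sub_self _)
    simp [moment, this]

/-! ### Gaussian densities -/

lemma exists_weight_le_exp (k : ℕ) {c : ℝ} (hc : 0 < c) :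
    ∃ D, 0 ≤ D ∧ ∀ r : ℝ, 0 ≤ r → (1 + r) ^ k ≤ D * Real.exp (c * r ^ 2) := by
  refine ⟨(2 / c) ^ k * k.factorial * Real.exp c, by positivity, fun r hr => ?_⟩
  have h1 : (c * (1 + r ^ 2)) ^ k / k.factorial ≤ Real.exp (c * (1 + r ^ 2)) :=
    Real.pow_div_factorial_le_exp _ (by positivity) k
  have hf : (0 : ℝ) < k.factorial := by positivity
  have h2 : 1 + r ≤ 2 * (1 + r ^ 2) := by nlinarith [sq_nonneg (r - 1)]
  calc (1 + r) ^ k ≤ (2 * (1 + r ^ 2)) ^ k := by gcongr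
    _ = (2 / c) ^ k * k.factorial * ((c * (1 + r ^ 2)) ^ k / k.factorial) := by
        rw [mul_pow, mul_pow, div_pow]; field_simp
    _ ≤ (2 / c) ^ k * k.factorial * Real.exp (c * (1 + r ^ 2)) := by gcongr
    _ = _ := by rw [mul_add, mul_one, Real.exp_add]; ring

lemma integrable_weight_mul_exp (d k : ℕ) {c : ℝ} (hc : 0 < c) :
    Integrable (fun y : Coord d => (1 + ‖y‖) ^ k * Real.exp (-(c * ‖y‖ ^ 2))) := by
  obtain ⟨D, hD0, hD⟩ := exists_weight_le_exp (k + (d + 1)) hc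
  have h1 : Integrable (fun y : Coord d => (1 + ‖y‖) ^ (-((d + 1 : ℕ) : ℝ))) :=
    integrable_one_add_norm (by simp)
  refine (h1.const_mul D).mono' (by fun_prop) (Eventually.of_forall fun y => ?_)
  have hy := one_le_one_add_norm y
  have hp : 0 < (1 + ‖y‖) ^ (d + 1) := by positivity
  rw [Real.norm_of_nonneg (by positivity), Real.rpow_neg (by positivity), Real.rpow_natCast,
    Real.exp_neg, ← div_eq_mul_inv, ← div_eq_mul_inv, div_le_div_iff₀ (Real.exp_pos _) hp, ← pow_add]
  exact hD _ (norm_nonneg y)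

/-- The centered Gaussian density with covariance `2 t A`. -/
def gaussianDensity (A : Matrix (Fin d) (Fin d) ℝ) (t : ℝ) (w : Fin d → ℝ) : ℝ :=
  1 / Real.sqrt ((4 * Real.pi * t) ^ d * A.det) *
    Real.exp (-∑ i, ∑ j, w i * (A⁻¹ i j / (4 * t)) * w j)

lemma quadForm_eq_dotProduct (A : Matrix (Fin d) (Fin d) ℝ) (w : Fin d → ℝ) :
    ∑ i, ∑ j, w i * (A i j / (4 * 1)) * w j = (w ⬝ᵥ A.mulVec w) / 4 := by
  simp only [dotProduct, Matrix.mulVec, Finset.sum_div, Finset.mul_sum]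
  refine Finset.sum_congr rfl fun i _ => Finset.sum_congr rfl fun j _ => ?_
  ring

lemma exists_eq_transpose_mul_self {A : Matrix (Fin d) (Fin d) ℝ} (hA : A.PosDef) :
    ∃ S : Matrix (Fin d) (Fin d) ℝ, A = S.transpose * S := by
  open scoped MatrixOrder in
  have h := CStarAlgebra.nonneg_iff_eq_star_mul_self.1 hA.posSemidef.nonneg
  obtain ⟨S, hS⟩ := h
  exact ⟨S, by simpa [Matrix.star_eq_conjTranspose, Matrix.conjTranspose_eq_transpose_of_trivial]
    using hS⟩

/-- Writing `A = SᵀS` and substituting `w = Sᵀξ` diagonalizes the form into `|ξ|²/4`. The integral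
splits into one-dimensional Gaussians, and the Jacobian `|det S|` is the square root of `det A`. -/
lemma integral_exp_quadForm {A : Matrix (Fin d) (Fin d) ℝ} (hA : A.PosDef) :
    ∫ w : Fin d → ℝ, Real.exp (-∑ i, ∑ j, w i * (A⁻¹ i j / (4 * 1)) * w j)
      = Real.sqrt ((4 * Real.pi * 1) ^ d * A.det) := by
  obtain ⟨S, hS⟩ := exists_eq_transpose_mul_self hA
  have hdet : A.det = S.det ^ 2 := by rw [hS, Matrix.det_mul, Matrix.det_transpose, sq]
  have hS0 : S.det ≠ 0 := fun h0 => by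
    have := hA.det_pos; rw [hdet, h0] at this; simp at this
  have hT0 : S.transpose.det ≠ 0 := by rwa [Matrix.det_transpose]
  have hmap := Real.map_matrix_volume_pi_eq_smul_volume_pi hT0
  have hinv : ∀ ξ : Fin d → ℝ, ∑ i, ∑ j, (S.transpose.mulVec ξ) i * (A⁻¹ i j / (4 * 1))
      * (S.transpose.mulVec ξ) j = ∑ i, (1 / 4) * ξ i ^ 2 := fun ξ => by
    have e : S * A⁻¹ * S.transpose = 1 := by
      rw [hS, Matrix.mul_inv_rev, ← Matrix.mul_assoc,
        Matrix.mul_nonsing_inv _ (isUnit_iff_ne_zero.2 hS0), Matrix.one_mul,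
        Matrix.nonsing_inv_mul _ (isUnit_iff_ne_zero.2 hT0)]
    rw [quadForm_eq_dotProduct, Matrix.mulVec_mulVec, Matrix.mulVec_transpose,
      ← Matrix.dotProduct_mulVec, Matrix.mulVec_mulVec, ← Matrix.mul_assoc, e, Matrix.one_mulVec]
    simp only [dotProduct, Finset.sum_div]
    refine Finset.sum_congr rfl fun i _ => ?_
    ring
  have h1 : ∫ ξ : Fin d → ℝ, Real.exp (-∑ i, (1 / 4) * ξ i ^ 2)
      = Real.sqrt (4 * Real.pi) ^ d := by
    have e : ∀ ξ : Fin d → ℝ, Real.exp (-∑ i, (1 / 4) * ξ i ^ 2)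
        = ∏ i, Real.exp (-(1 / 4) * ξ i ^ 2) := fun ξ => by
      rw [← Real.exp_sum, ← Finset.sum_neg_distrib]; simp [neg_mul]
    simp only [e]
    rw [integral_fintype_prod_volume_eq_pow (fun x : ℝ => Real.exp (-(1 / 4) * x ^ 2)),
      integral_gaussian]
    simp [div_eq_mul_inv, mul_comm]
  have h2 := integral_map (μ := volume) (φ := Matrix.toLin' S.transpose)
    (f := fun w : Fin d → ℝ => Real.exp (-∑ i, ∑ j, w i * (A⁻¹ i j / (4 * 1)) * w j))
    (LinearMap.continuous_of_finiteDimensional _).aemeasurable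
    (by fun_prop)
  simp only [Matrix.toLin'_apply, hinv] at h2
  rw [h1, hmap, integral_smul_measure, Matrix.det_transpose] at h2
  have hpos : 0 < |S.det| := abs_pos.2 hS0
  rw [ENNReal.toReal_ofReal (abs_nonneg _), abs_inv, smul_eq_mul, inv_mul_eq_iff_eq_mul₀ hpos.ne']
    at h2
  have hr : Real.sqrt (4 * Real.pi) ^ 2 = 4 * Real.pi := Real.sq_sqrt (by positivity)
  rw [h2, hdet, mul_one]
  symm
  rw [Real.sqrt_eq_iff_mul_self_eq (by positivity) (by positivity)]
  calc (4 * Real.pi) ^ d * S.det ^ 2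
      = |S.det| ^ 2 * (Real.sqrt (4 * Real.pi) ^ 2) ^ d := by rw [hr, sq_abs, mul_comm]
    _ = _ := by ring

lemma integral_gaussianDensity {A : Matrix (Fin d) (Fin d) ℝ} (hA : A.PosDef) :
    ∫ w, gaussianDensity A 1 w = 1 := by
  unfold gaussianDensity
  rw [integral_const_mul, integral_exp_quadForm hA]
  have : 0 < Real.sqrt ((4 * Real.pi * 1) ^ d * A.det) :=
    Real.sqrt_pos.2 (mul_pos (by positivity) hA.det_pos)
  exact one_div_mul_cancel this.ne'

/-- Parabolic scaling, by which every later computation takes place at unit time. -/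
lemma gaussianDensity_smul (A : Matrix (Fin d) (Fin d) ℝ) {s : ℝ} (hs : 0 < s) (w : Fin d → ℝ) :
    s ^ d * gaussianDensity A (s ^ 2) (s • w) = gaussianDensity A 1 w := by
  have e1 : Real.sqrt ((4 * Real.pi * s ^ 2) ^ d * A.det)
      = s ^ d * Real.sqrt ((4 * Real.pi * 1) ^ d * A.det) := by
    rw [mul_one, mul_pow (4 * Real.pi), ← pow_mul, mul_comm 2 d, pow_mul, mul_comm (_ ^ d),
      mul_assoc, Real.sqrt_mul (by positivity), Real.sqrt_sq (by positivity)]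
  have e2 : ∑ i, ∑ j, (s • w) i * (A⁻¹ i j / (4 * s ^ 2)) * (s • w) j
      = ∑ i, ∑ j, w i * (A⁻¹ i j / (4 * 1)) * w j := by
    refine Finset.sum_congr rfl fun i _ => Finset.sum_congr rfl fun j _ => ?_
    simp only [Pi.smul_apply, smul_eq_mul]
    field_simp
  rw [gaussianDensity, gaussianDensity, e1, e2, ← mul_assoc]
  congr 1
  field_simp

lemma continuous_gaussianDensity (A : Matrix (Fin d) (Fin d) ℝ) (t : ℝ) :
    Continuous (gaussianDensity A t) := by
  unfold gaussianDensity
  fun_prop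

lemma gaussianDensity_nonneg (A : Matrix (Fin d) (Fin d) ℝ) (t : ℝ) (w : Fin d → ℝ) :
    0 ≤ gaussianDensity A t w := by
  unfold gaussianDensity
  positivity

lemma integrable_mul_gaussianDensity {A : Matrix (Fin d) (Fin d) ℝ} {c : ℝ} (hc : 0 < c)
    (h : ∀ w : Fin d → ℝ, c * ‖w‖ ^ 2 ≤ ∑ i, ∑ j, w i * (A⁻¹ i j / (4 * 1)) * w j)
    {f : Coord d → ℝ} (hf : Continuous f) {C : ℝ} {k : ℕ} (hC : ∀ x, |f x| ≤ C * (1 + ‖x‖) ^ k) :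
    Integrable (fun w => f w * gaussianDensity A 1 w) := by
  refine ((integrable_weight_mul_exp d k hc).const_mul
    (C * (1 / Real.sqrt ((4 * Real.pi * 1) ^ d * A.det)))).mono'
    (hf.mul (continuous_gaussianDensity A 1)).aestronglyMeasurable
    (Eventually.of_forall fun w => ?_)
  rw [norm_mul, Real.norm_of_nonneg (gaussianDensity_nonneg A 1 w)]
  calc ‖f w‖ * gaussianDensity A 1 w
      ≤ (C * (1 + ‖w‖) ^ k) * (1 / Real.sqrt ((4 * Real.pi * 1) ^ d * A.det)
        * Real.exp (-(c * ‖w‖ ^ 2))) := by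
        unfold gaussianDensity
        gcongr
        · exact (abs_nonneg _).trans (hC w)
        · exact hC w
        · exact h w
    _ = _ := by ring

lemma pd_gaussianDensity {A : Matrix (Fin d) (Fin d) ℝ} (hs : ∀ i k, A⁻¹ i k = A⁻¹ k i)
    (k : Fin d) : pd k (gaussianDensity A 1)
      = fun w => -(1 / 2) * ∑ l, A⁻¹ k l * (w l * gaussianDensity A 1 w) := by
  ext w
  have hd : ∀ c, DifferentiableAt ℝ (fun y : Coord d => y c) w := fun c => by fun_prop
  have hq : pd k (fun w : Coord d => ∑ i, ∑ j, w i * (A⁻¹ i j / (4 * 1)) * w j) w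
      = (1 / 2) * ∑ l, A⁻¹ k l * w l := by
    rw [pd_sum (f := fun i w => ∑ j, w i * (A⁻¹ i j / (4 * 1)) * w j) _ (fun i _ => by fun_prop)]
    have e : ∀ i, pd k (fun w : Coord d => ∑ j, w i * (A⁻¹ i j / (4 * 1)) * w j) w
        = ∑ j, ((if k = i then 1 else 0) * (A⁻¹ i j / (4 * 1)) * w j
          + w i * (A⁻¹ i j / (4 * 1)) * (if k = j then 1 else 0)) := fun i => by
      rw [pd_sum (f := fun j w => w i * (A⁻¹ i j / (4 * 1)) * w j) _ (fun j _ => by fun_prop)]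
      refine Finset.sum_congr rfl fun j _ => ?_
      rw [pd_mul (f := fun w : Coord d => w i * (A⁻¹ i j / (4 * 1))) (by fun_prop) (hd j),
        pd_mul_const (hd i), pd_coord, pd_coord]
    simp only [e, Finset.sum_add_distrib]
    simp only [ite_mul, mul_ite, one_mul, zero_mul, mul_zero, mul_one, Finset.sum_ite_irrel,
      Finset.sum_const_zero, Finset.sum_ite_eq, Finset.mem_univ, if_true]
    rw [← Finset.sum_add_distrib, Finset.mul_sum]
    refine Finset.sum_congr rfl fun l _ => ?_
    rw [hs l k]; ring
  set Q := fun w : Coord d => ∑ i, ∑ j, w i * (A⁻¹ i j / (4 * 1)) * w j with hQ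
  have hQd : DifferentiableAt ℝ Q w := by rw [hQ]; fun_prop
  have h1 : HasFDerivAt (fun w => Real.exp (-Q w)) (Real.exp (-Q w) • -fderiv ℝ Q w) w :=
    hQd.hasFDerivAt.neg.exp
  have h2 : HasFDerivAt (gaussianDensity A 1) ((1 / Real.sqrt ((4 * Real.pi * 1) ^ d * A.det)) •
      (Real.exp (-Q w) • -fderiv ℝ Q w)) w := h1.const_mul _
  have h3 : fderiv ℝ Q w (Pi.single k 1) = (1 / 2) * ∑ l, A⁻¹ k l * w l := hq
  rw [pd, h2.fderiv]
  simp only [smul_apply, neg_apply, h3, smul_eq_mul,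
    gaussianDensity, ← mul_assoc, ← Finset.sum_mul]
  ring

lemma differentiable_gaussianDensity (A : Matrix (Fin d) (Fin d) ℝ) :
    Differentiable ℝ (gaussianDensity A 1) := by
  unfold gaussianDensity
  fun_prop

/-- Mean and covariance of the Gaussian density, by integration by parts. -/
lemma gaussianDensity_moments {A : Matrix (Fin d) (Fin d) ℝ} (hA : A.PosDef) {c : ℝ} (hc : 0 < c)
    (h : ∀ w : Fin d → ℝ, c * ‖w‖ ^ 2 ≤ ∑ i, ∑ j, w i * (A⁻¹ i j / (4 * 1)) * w j) :
    (∀ i, ∫ w, w i * gaussianDensity A 1 w = 0) ∧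
    ∀ i k, ∫ w, w i * w k * gaussianDensity A 1 w = 2 * A i k := by
  have hu : IsUnit A.det := isUnit_iff_ne_zero.2 hA.det_pos.ne'
  have hsA : ∀ i k, A i k = A k i := fun i k => by
    have := hA.isHermitian.apply k i
    simpa using this
  have hs : ∀ i k, A⁻¹ i k = A⁻¹ k i := fun i k => by
    have := hA.inv.isHermitian.apply k i
    simpa using this
  have hinv : ∀ v : Fin d → ℝ, ∀ i, ∑ k, A i k * ∑ l, A⁻¹ k l * v l = v i := fun v i => by
    have : A.mulVec (A⁻¹.mulVec v) = v := by
      rw [Matrix.mulVec_mulVec, Matrix.mul_nonsing_inv _ hu, Matrix.one_mulVec]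
    exact congrFun this i
  have hi1 : ∀ i, Integrable (fun w : Coord d => w i * gaussianDensity A 1 w) := fun i =>
    integrable_mul_gaussianDensity hc h (C := 1) (k := 1) (by fun_prop) fun x => by
      have := norm_le_pi_norm x i
      rw [Real.norm_eq_abs] at this
      linarith
  have hi2 : ∀ i k, Integrable (fun w : Coord d => w i * w k * gaussianDensity A 1 w) := fun i k =>
    integrable_mul_gaussianDensity hc h (C := 1) (k := 2) (by fun_prop) fun x => by
      have h1 := norm_le_pi_norm x i
      have h2 := norm_le_pi_norm x k
      rw [Real.norm_eq_abs] at h1 h2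
      have := norm_nonneg x
      rw [one_mul, abs_mul, sq]
      gcongr <;> linarith
  have hi0 : Integrable (fun w : Coord d => gaussianDensity A 1 w) := by
    simpa using integrable_mul_gaussianDensity hc h (f := fun _ => 1) (C := 1) (k := 0)
      continuous_const (by simp)
  have hd := differentiable_gaussianDensity A
  have ex1 : ∀ k, ∫ w, pd k (gaussianDensity A 1) w
      = -(1 / 2) * ∑ l, A⁻¹ k l * ∫ w, w l * gaussianDensity A 1 w := fun k => by
    rw [pd_gaussianDensity hs, integral_const_mul,
      integral_finsetSum _ fun l _ => (hi1 l).const_mul _]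
    simp only [integral_const_mul]
  have ex2 : ∀ i k, ∫ w, w i * pd k (gaussianDensity A 1) w
      = -(1 / 2) * ∑ l, A⁻¹ k l * ∫ w, w i * w l * gaussianDensity A 1 w := fun i k => by
    have e : ∀ w : Coord d, w i * pd k (gaussianDensity A 1) w
        = -(1 / 2) * ∑ l, A⁻¹ k l * (w i * w l * gaussianDensity A 1 w) := fun w => by
      rw [pd_gaussianDensity hs]
      simp only [Finset.mul_sum]
      exact Finset.sum_congr rfl fun l _ => by ring
    simp only [e]
    rw [integral_const_mul, integral_finsetSum _ fun l _ => (hi2 i l).const_mul _]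
    simp only [integral_const_mul]
  have hip1 : ∀ k, Integrable (fun w => pd k (gaussianDensity A 1) w) := fun k => by
    rw [pd_gaussianDensity hs]
    exact (integrable_finsetSum _ fun l _ => (hi1 l).const_mul _).const_mul _
  have hip2 : ∀ i k, Integrable (fun w => w i * pd k (gaussianDensity A 1) w) := fun i k => by
    rw [pd_gaussianDensity hs]
    have := (integrable_finsetSum Finset.univ fun l _ =>
      (hi2 i l).const_mul (A⁻¹ k l)).const_mul (-(1 / 2))
    refine this.congr (Eventually.of_forall fun w => ?_)
    simp only [Finset.mul_sum]
    exact Finset.sum_congr rfl fun l _ => by ring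
  -- The gradient of the density is `-A⁻¹w/2` times the density. Integrating it against `1` and `wᵢ`
  -- by parts gives linear equations for the first and second moments, solved by multiplying with
  -- `A`.
  have ibp1 : ∀ k, ∫ w, pd k (gaussianDensity A 1) w = 0 := fun k => by
    have := integral_mul_fderiv_eq_neg_fderiv_mul_of_integrable (μ := volume)
      (f := fun _ : Coord d => (1 : ℝ)) (g := gaussianDensity A 1) (v := Pi.single k 1)
      (by simp) (by simpa [pd] using hip1 k) (by simpa using hi0) (fun x _ => by fun_prop)
      (fun x _ => hd x)
    simpa [pd] using this
  have ibp2 : ∀ i k, ∫ w, w i * pd k (gaussianDensity A 1) w = -(if k = i then 1 else 0) :=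
    fun i k => by
      have hp : ∀ x, fderiv ℝ (fun w : Coord d => w i) x (Pi.single k 1)
        = if k = i then 1 else 0 := fun x => pd_coord k i x
      have := integral_mul_fderiv_eq_neg_fderiv_mul_of_integrable (μ := volume)
        (f := fun w : Coord d => w i) (g := gaussianDensity A 1) (v := Pi.single k 1)
        (by simp only [hp]; exact hi0.const_mul _) (hip2 i k) (hi1 i) (fun x _ => by fun_prop)
        (fun x _ => hd x)
      simp only [hp] at this
      rw [integral_const_mul, integral_gaussianDensity hA, mul_one] at this
      exact this
  refine ⟨fun i => ?_, fun i k => ?_⟩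
  · rw [← hinv (fun l => ∫ w, w l * gaussianDensity A 1 w) i]
    refine Finset.sum_eq_zero fun k _ => ?_
    have := (ex1 k).symm.trans (ibp1 k)
    have h0 : ∑ l, A⁻¹ k l * ∫ w, w l * gaussianDensity A 1 w = 0 := by linarith
    rw [h0, mul_zero]
  · rw [← hinv (fun l => ∫ w, w i * w l * gaussianDensity A 1 w) k]
    have h0 : ∀ m, ∑ l, A⁻¹ m l * ∫ w, w i * w l * gaussianDensity A 1 w
        = 2 * if m = i then 1 else 0 := fun m => by
      have := (ex2 i m).symm.trans (ibp2 i m)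
      linarith
    simp only [h0]
    simp [hsA i k]
    ring

/-! ### The family of Gaussian densities -/

lemma Growth.det {A : ι → Coord d → Matrix (Fin d) (Fin d) ℝ}
    (hA : ∀ i k, Growth j (fun a x => A a x i k)) : Growth j (fun a x => (A a x).det) := by
  simp only [Matrix.det_apply, Units.smul_def, zsmul_eq_mul]
  refine Growth.sum _ fun σ _ => ?_
  exact (Growth.prod _ fun i _ => hA (σ i) i).const_mul _

/-- Here the outer function varies with the index, so compactness cannot bound its derivatives. It
is enough to bound them at the values actually taken. -/
lemma Growth.comp_family {u : ι → Coord d → ℝ} (hu : Growth 0 u) {φ : ι → ℝ → ℝ}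
    (hφ : ∀ i, ContDiff ℝ ∞ (φ i))
    (hb : ∀ n : ℕ, ∃ C, ∀ i x, ‖iteratedFDeriv ℝ n (φ i) (u i x)‖ ≤ C) :
    Growth 0 (fun i x => φ i (u i x)) := by
  refine ⟨fun i => (hφ i).comp (hu.1 i), fun n => ?_⟩
  obtain ⟨C, k, hC, h⟩ := hu.bound n
  choose K hK using hb
  refine ⟨n.factorial * (∑ m ∈ Finset.range (n + 1), |K m|) * (1 + C) ^ n, 0, fun i x => ?_⟩
  have := norm_iteratedFDeriv_comp_le (𝕜 := ℝ) (g := φ i) (f := u i) (n := n) (N := ∞)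
    (hφ i) (hu.1 i) (by exact_mod_cast le_top) x (C := ∑ m ∈ Finset.range (n + 1), |K m|) (D := 1 + C)
    (fun m hm => ((hK m i x).trans (le_abs_self _)).trans
      (Finset.single_le_sum (f := fun m => |K m|) (fun _ _ => abs_nonneg _)
        (by simp; omega)))
    (fun m hm hmn => ?_)
  · simpa [Function.comp_def] using this
  · have := h m hmn i x
    simp only [zero_mul, pow_zero, mul_one] at this
    calc _ ≤ C := this
      _ ≤ (1 + C) ^ 1 := by linarith
      _ ≤ (1 + C) ^ m := pow_le_pow_right₀ (by linarith) hm

/-! ### Quantitative consequences of ellipticity for inverse and determinant -/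

section Elliptic

variable {A : Matrix (Fin d) (Fin d) ℝ} {c : ℝ}

lemma posDef_of_elliptic (hs : ∀ i k, A i k = A k i) (hc : 0 < c)
    (h : ∀ v : Fin d → ℝ, c * ∑ i, v i ^ 2 ≤ ∑ i, ∑ k, v i * A i k * v k) : A.PosDef := by
  refine Matrix.PosDef.of_dotProduct_mulVec_pos ?_ fun v hv => ?_
  · ext i k
    simpa using hs k i
  · have e : star v ⬝ᵥ A.mulVec v = ∑ i, ∑ k, v i * A i k * v k := by
      simp [dotProduct, Matrix.mulVec, Finset.mul_sum, mul_assoc]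
    rw [e]
    refine lt_of_lt_of_le (mul_pos hc ?_) (h v)
    obtain ⟨i, hi⟩ := Function.ne_iff.1 hv
    exact Finset.sum_pos' (fun i _ => sq_nonneg _)
      ⟨i, Finset.mem_univ i, sq_pos_of_ne_zero hi⟩

/-- Ellipticity is tested on the `k`-th column of the inverse, where the quadratic form equals the
diagonal entry `A⁻¹ k k`. This bounds that entry by `1/c` first, and then the whole column. -/
lemma abs_inv_apply_le (hs : ∀ i k, A i k = A k i) (hc : 0 < c)
    (h : ∀ v : Fin d → ℝ, c * ∑ i, v i ^ 2 ≤ ∑ i, ∑ k, v i * A i k * v k) (i k : Fin d) :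
    |A⁻¹ i k| ≤ c⁻¹ := by
  have hA := posDef_of_elliptic hs hc h
  have e : A * A⁻¹ = 1 := Matrix.mul_nonsing_inv _ (isUnit_iff_ne_zero.2 hA.det_pos.ne')
  have h1 := h fun l => A⁻¹ l k
  have h2 : ∑ i, ∑ l, A⁻¹ i k * A i l * A⁻¹ l k = A⁻¹ k k := by
    have : ∀ i, ∑ l, A⁻¹ i k * A i l * A⁻¹ l k = A⁻¹ i k * (A * A⁻¹) i k := fun i => by
      simp only [Matrix.mul_apply, Finset.mul_sum, mul_assoc]
    simp [this, e, Matrix.one_apply]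
  rw [h2] at h1
  have h3 : ∀ i, c * A⁻¹ i k ^ 2 ≤ A⁻¹ k k := fun i => by
    refine le_trans ?_ h1
    gcongr
    exact Finset.single_le_sum (f := fun l => A⁻¹ l k ^ 2) (fun l _ => sq_nonneg _)
      (Finset.mem_univ i)
  have h4 : c * A⁻¹ k k ≤ 1 := by
    have := h3 k
    have h0 : 0 ≤ A⁻¹ k k := le_trans (by positivity) this
    by_contra hn
    nlinarith
  have h5 : (c * A⁻¹ i k) ^ 2 ≤ 1 ^ 2 := by
    have := h3 i
    nlinarith
  have h6 : |c * A⁻¹ i k| ≤ 1 := abs_le_of_sq_le_sq h5 zero_le_one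
  rw [abs_mul, abs_of_pos hc] at h6
  rw [inv_eq_one_div c]
  exact (le_div_iff₀' hc).2 h6

/-- With `v = A⁻¹w` the form `w · A⁻¹w` is `v · Av ≥ c|v|²`, while the bound on the entries of `A`
controls `w = Av` by `v`. The `+ 1` keeps the denominator positive in degenerate cases. -/
lemma quadForm_inv_ge (hs : ∀ i k, A i k = A k i) (hc : 0 < c)
    (h : ∀ v : Fin d → ℝ, c * ∑ i, v i ^ 2 ≤ ∑ i, ∑ k, v i * A i k * v k) {K : ℝ}
    (hK : ∀ i k, |A i k| ≤ K) (w : Fin d → ℝ) :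
    c / (4 * (K ^ 2 * d + 1)) * ‖w‖ ^ 2 ≤ ∑ i, ∑ j, w i * (A⁻¹ i j / (4 * 1)) * w j := by
  have hA := posDef_of_elliptic hs hc h
  set v := A⁻¹.mulVec w with hv
  have hw : A.mulVec v = w := by
    rw [hv, Matrix.mulVec_mulVec, Matrix.mul_nonsing_inv _ (isUnit_iff_ne_zero.2 hA.det_pos.ne'),
      Matrix.one_mulVec]
  have hwi : ∀ i, w i = ∑ k, A i k * v k := fun i => by
    conv_lhs => rw [← hw]
    rfl
  have h1 : ∑ i, ∑ k, v i * A i k * v k = w ⬝ᵥ v := by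
    simp only [dotProduct, hwi, Finset.sum_mul]
    exact Finset.sum_congr rfl fun i _ => Finset.sum_congr rfl fun k _ => by ring
  have hS0 : 0 ≤ ∑ i, v i ^ 2 := Finset.sum_nonneg fun i _ => sq_nonneg _
  have h2 : ∀ i, w i ^ 2 ≤ K ^ 2 * d * ∑ i, v i ^ 2 := fun i => by
    have a1 : |w i| ≤ K * ∑ k, |v k| := by
      rw [hwi, Finset.mul_sum]
      refine (Finset.abs_sum_le_sum_abs _ _).trans (Finset.sum_le_sum fun k _ => ?_)
      rw [abs_mul]
      have := hK i k
      gcongr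
    have a2 : (∑ k, |v k|) ^ 2 ≤ d * ∑ k, v k ^ 2 := by
      simpa using sq_sum_le_card_mul_sum_sq (s := Finset.univ) (f := fun k => |v k|)
    calc w i ^ 2 = |w i| ^ 2 := (sq_abs _).symm
      _ ≤ (K * ∑ k, |v k|) ^ 2 := by gcongr
      _ = K ^ 2 * (∑ k, |v k|) ^ 2 := by ring
      _ ≤ K ^ 2 * (d * ∑ k, v k ^ 2) := by gcongr
      _ = _ := by ring
  have h3 : ‖w‖ ^ 2 ≤ (K ^ 2 * d + 1) * ∑ i, v i ^ 2 := by
    have : ‖w‖ ≤ Real.sqrt ((K ^ 2 * d + 1) * ∑ i, v i ^ 2) := by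
      refine (pi_norm_le_iff_of_nonneg (Real.sqrt_nonneg _)).2 fun i => ?_
      refine Real.abs_le_sqrt ((h2 i).trans ?_)
      nlinarith
    calc ‖w‖ ^ 2 ≤ Real.sqrt ((K ^ 2 * d + 1) * ∑ i, v i ^ 2) ^ 2 := by gcongr
      _ = _ := Real.sq_sqrt (by positivity)
  rw [quadForm_eq_dotProduct, ← hv]
  have h4 := h v
  rw [h1] at h4
  have h5 : 0 < K ^ 2 * d + 1 := by positivity
  calc c / (4 * (K ^ 2 * d + 1)) * ‖w‖ ^ 2
      ≤ c / (4 * (K ^ 2 * d + 1)) * ((K ^ 2 * d + 1) * ∑ i, v i ^ 2) := by gcongr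
    _ = (c * ∑ i, v i ^ 2) / 4 := by field_simp
    _ ≤ _ := by gcongr

end Elliptic

section Density

variable {B : Coord d → Matrix (Fin d) (Fin d) ℝ} {F : Fin d → Coord d → ℝ}

lemma Admissible.posDef (h : Admissible B F) (x : Coord d) : (B x).PosDef := by
  obtain ⟨c, hc, hB⟩ := h.elliptic
  exact posDef_of_elliptic (h.symm x) hc (hB x)

lemma Admissible.exists_quadForm_ge (h : Admissible B F) : ∃ κ : ℝ, 0 < κ ∧
    ∀ x (w : Fin d → ℝ), κ * ‖w‖ ^ 2 ≤ ∑ i, ∑ j, w i * ((B x)⁻¹ i j / (4 * 1)) * w j := by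
  obtain ⟨c, hc, hB⟩ := h.elliptic
  obtain ⟨K, hK0, hK⟩ := h.bound_B
  exact ⟨_, by positivity, fun x => quadForm_inv_ge (h.symm x) hc (hB x) (hK x)⟩

/-- The bounded entries of the inverse bound its determinant from above by the Leibniz formula. -/
lemma Admissible.exists_det_ge (h : Admissible B F) : ∃ c : ℝ, 0 < c ∧ ∀ x, c ≤ (B x).det := by
  obtain ⟨c, hc, hB⟩ := h.elliptic
  refine ⟨(d.factorial * (c⁻¹) ^ d)⁻¹, by positivity, fun x => ?_⟩
  have h1 := Matrix.det_le (abv := AbsoluteValue.abs) (A := (B x)⁻¹) (x := c⁻¹)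
    fun i k => abs_inv_apply_le (h.symm x) hc (hB x) i k
  rw [Matrix.det_nonsing_inv, Ring.inverse_eq_inv'] at h1
  have hp := (h.posDef x).det_pos
  rw [inv_le_comm₀ (by positivity) hp]
  simpa [abs_of_pos hp] using h1

lemma Admissible.growth_det (h : Admissible B F) :
    Growth 0 (fun (_ : Unit) x => (B x).det) :=
  Growth.det fun i k => h.growth_B i k

/-- Cramer's rule reduces the claim to determinants and to the reciprocal of a determinant that is
bounded below. -/
lemma Admissible.growth_inv (h : Admissible B F) (i k : Fin d) :
    Growth 0 (fun (_ : Unit) x => (B x)⁻¹ i k) := by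
  obtain ⟨c, hc, hd⟩ := h.exists_det_ge
  have e : (fun (_ : Unit) x => (B x)⁻¹ i k)
      = fun (_ : Unit) x => ((B x).det)⁻¹ * ((B x).updateRow k (Pi.single i 1)).det := by
    ext _ x
    rw [Matrix.inv_def, Matrix.smul_apply, Matrix.adjugate_apply, Ring.inverse_eq_inv', smul_eq_mul]
  rw [e]
  refine (h.growth_det.inv hc fun _ x => hd x).mul (Growth.det fun a b => ?_)
  by_cases hak : a = k
  · subst hak
    simpa using Growth.const (Pi.single (M := fun _ => ℝ) i (1 : ℝ) b)
  · simpa [Matrix.updateRow_ne hak] using h.growth_B a b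

/-- The Gaussian densities, weighted by a Gaussian, form a bounded smooth family. -/
lemma Admissible.growth_gaussianDensity (h : Admissible B F) {κ : ℝ} (hκ : 0 < κ)
    (hq : ∀ x (w : Fin d → ℝ), 2 * κ * ‖w‖ ^ 2
      ≤ ∑ i, ∑ j, w i * ((B x)⁻¹ i j / (4 * 1)) * w j) :
    Growth 0 (fun (η : Coord d) z =>
      Real.exp (κ * ‖η‖ ^ 2) * gaussianDensity (B z) 1 η) := by
  obtain ⟨c, hc, hd⟩ := h.exists_det_ge
  have hn : Growth 0 (fun (_ : Unit) z => (Real.sqrt ((4 * Real.pi * 1) ^ d * (B z).det))⁻¹) := by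
    have hc' : 0 < (4 * Real.pi * 1) ^ d * c := by positivity
    refine ((h.growth_det.const_mul ((4 * Real.pi * 1) ^ d)).sqrt hc' fun _ x => ?_).inv
      (Real.sqrt_pos.2 hc') fun _ x => Real.sqrt_le_sqrt ?_
    · exact mul_le_mul_of_nonneg_left (hd x) (by positivity)
    · exact mul_le_mul_of_nonneg_left (hd x) (by positivity)
  have hθ : ∀ (i : Fin d) (η : Coord d), |η i / ‖η‖| ≤ 1 := fun i η => by
    rw [abs_div, abs_norm]
    exact div_le_one_of_le₀ (by simpa using norm_le_pi_norm η i) (norm_nonneg η)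
  -- The exponent is written as `-‖η‖²` times a function of `z` that depends on `η` only through its
  -- direction. That function is bounded with all its derivatives uniformly in `η`, and the large
  -- factor `‖η‖²` moves into the outer exponential. At `η = 0` the direction is zero by convention
  -- and the prefactor vanishes.
  have hu : Growth 0 (fun (η : Coord d) z =>
      (∑ i, ∑ j, (η i / ‖η‖) * ((B z)⁻¹ i j / (4 * 1)) * (η j / ‖η‖)) - κ) := by
    refine (Growth.sum _ fun i _ => Growth.sum _ fun j _ => ?_).sub (Growth.const κ)
    refine ((Growth.const_bdd (hθ i)).mul ?_).mul (Growth.const_bdd (hθ j))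
    simp only [div_eq_mul_inv]
    exact ((h.growth_inv i j).comp_index fun _ => ()).mul (Growth.const _)
  have hmul : ∀ (η z : Coord d), ‖η‖ ^ 2 *
      ((∑ i, ∑ j, (η i / ‖η‖) * ((B z)⁻¹ i j / (4 * 1)) * (η j / ‖η‖)) - κ)
      = (∑ i, ∑ j, η i * ((B z)⁻¹ i j / (4 * 1)) * η j) - κ * ‖η‖ ^ 2 := fun η z => by
    rw [mul_sub, mul_comm (‖η‖ ^ 2) κ, Finset.mul_sum]
    congr 1
    refine Finset.sum_congr rfl fun i _ => ?_
    rw [Finset.mul_sum]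
    refine Finset.sum_congr rfl fun k _ => ?_
    rcases eq_or_ne ‖η‖ 0 with h0 | h0
    · have : η = 0 := norm_eq_zero.1 h0
      subst this
      simp
    · field_simp
  have hφ := hu.comp_family (φ := fun η y => Real.exp ((-‖η‖ ^ 2) * y))
    (fun η => by fun_prop) fun n => by
      -- Each derivative of the outer exponential costs a factor `‖η‖²`. For `η ≠ 0` half of the
      -- quadratic form remains after the weight `exp (κ‖η‖²)` is removed, and `r^n exp (-κ r) ≤
      -- n!/κ^n` with `r = ‖η‖²` absorbs these factors.
      refine ⟨n.factorial / κ ^ n + 1, fun η z => ?_⟩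
      rw [norm_iteratedFDeriv_eq_norm_iteratedDeriv, iteratedDeriv_exp_const_mul, norm_mul,
        norm_pow, norm_neg, Real.norm_of_nonneg (sq_nonneg ‖η‖), Real.norm_of_nonneg
        (Real.exp_pos _).le, neg_mul, hmul]
      have h1 := hq z η
      have h2 := Real.pow_div_factorial_le_exp (κ * ‖η‖ ^ 2) (by positivity) n
      have hf : (0 : ℝ) < n.factorial := by positivity
      calc (‖η‖ ^ 2) ^ n * Real.exp (-((∑ i, ∑ j, η i * ((B z)⁻¹ i j / (4 * 1)) * η j)
            - κ * ‖η‖ ^ 2)) ≤ (‖η‖ ^ 2) ^ n * Real.exp (-(κ * ‖η‖ ^ 2)) := by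
            gcongr; linarith
        _ = (n.factorial / κ ^ n) * ((κ * ‖η‖ ^ 2) ^ n / n.factorial)
            * Real.exp (-(κ * ‖η‖ ^ 2)) := by rw [mul_pow]; field_simp
        _ ≤ (n.factorial / κ ^ n) * Real.exp (κ * ‖η‖ ^ 2) * Real.exp (-(κ * ‖η‖ ^ 2)) := by
            gcongr
        _ = n.factorial / κ ^ n := by rw [mul_assoc, ← Real.exp_add]; simp
        _ ≤ _ := by linarith
  have := (hn.comp_index fun _ : Coord d => ()).mul hφ
  refine cast ?_ this
  congr 1
  ext η z
  rw [neg_mul, hmul, gaussianDensity, neg_sub, sub_eq_add_neg, Real.exp_add, one_div]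
  ring

end Density

/-! ### Pointwise expansion of the time-slice kernels -/

/-- Bounds for a bounded family, its Taylor expansions and its partial derivatives. -/
lemma Growth.exists_uniform_taylor {u : ι → Coord d → ℝ} (hu : Growth 0 u) : ∃ K, 0 ≤ K ∧
    (∀ i x, |u i x| ≤ K) ∧ (∀ i x y, |u i (x + y) - u i x| ≤ K * ‖y‖) ∧
    (∀ i x y, |u i (x + y) - u i x - ∑ a, CovariantFP.pd a (u i) x * y a
      - (1 / 2) * ∑ a, ∑ b, CovariantFP.pd a (CovariantFP.pd b (u i)) x * y a * y b|
        ≤ K * ‖y‖ ^ 3) ∧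
    (∀ i a x, |CovariantFP.pd a (u i) x| ≤ K) ∧
    ∀ i a b x, |CovariantFP.pd a (CovariantFP.pd b (u i)) x| ≤ K := by
  obtain ⟨K, k, hK0, hK⟩ := hu.bound 3
  simp only [zero_mul, pow_zero, mul_one] at hK
  have h0 : ∀ (f : Coord d → ℝ) x, |f x| = ‖iteratedFDeriv ℝ 0 f x‖ := fun f x => by
    rw [norm_iteratedFDeriv_zero, Real.norm_eq_abs]
  refine ⟨K, hK0, fun i x => ?_, fun i x y => ?_, fun i x y => ?_, fun i a x => ?_,
    fun i a b x => ?_⟩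
  · rw [h0]; exact hK 0 (by norm_num) i x
  · exact CovariantFP.taylor_zero (hu.1 i) fun t _ => hK 1 (by norm_num) i _
  · exact CovariantFP.taylor_two (hu.1 i) fun t _ => hK 3 le_rfl i _
  · rw [h0]
    exact (norm_iteratedFDeriv_pd_le (hu.1 i) a 0 x).trans (hK 1 (by norm_num) i x)
  · rw [h0]
    exact (norm_iteratedFDeriv_pd_le (contDiff_pd (hu.1 i) b) a 0 x).trans
      ((norm_iteratedFDeriv_pd_le (hu.1 i) b 1 x).trans (hK 2 (by norm_num) i x))

/-- The vector field `∂ₖ B^{ik}`. -/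
def divB (B : Coord d → Matrix (Fin d) (Fin d) ℝ) (i : Fin d) (x : Coord d) : ℝ :=
  ∑ k, pd k (fun y => B y i k) x

/-- The variation of `F - 2 α ∂B` along a displacement, where `F` and `∂B` are evaluated at
different interpolation points. -/
def driftShift (B : Coord d → Matrix (Fin d) (Fin d) ℝ) (F : Fin d → Coord d → ℝ) (α β : ℝ)
    (z w y : Coord d) (k : Fin d) : ℝ :=
  (F k (w + β • y) - F k w) - 2 * α * (divB B k (z + α • y) - divB B k z)

/-- The linearization of `driftShift`. -/
def driftShiftLin (B : Coord d → Matrix (Fin d) (Fin d) ℝ) (F : Fin d → Coord d → ℝ) (α β : ℝ)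
    (z w η : Coord d) (k : Fin d) : ℝ :=
  ∑ l, η l * (β * pd l (F k) w - 2 * α ^ 2 * pd l (divB B k) z)

/-- The potential term of the time-slice action. -/
def slicePot (B : Coord d → Matrix (Fin d) (Fin d) ℝ) (F : Fin d → Coord d → ℝ) (α β : ℝ)
    (z w : Coord d) : ℝ :=
  β * (∑ i, pd i (F i) w) - α ^ 2 * (∑ i, ∑ j, pd i (pd j (fun y => B y i j)) z)

/-- The logarithm of the ratio of the time-slice kernel and the Gaussian density. -/
def sliceExp (B : Coord d → Matrix (Fin d) (Fin d) ℝ) (F : Fin d → Coord d → ℝ) (α β s : ℝ)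
    (z w η : Coord d) : ℝ :=
  ∑ i, ∑ j, (s * (η i * (B (z + α • s • η))⁻¹ i j * driftShift B F α β z w (s • η) j)
    + s * (η j * (B (z + α • s • η))⁻¹ i j * driftShift B F α β z w (s • η) i)
    - s ^ 2 * (driftShift B F α β z w (s • η) i * (B (z + α • s • η))⁻¹ i j
      * driftShift B F α β z w (s • η) j)) / 4
    - s ^ 2 * slicePot B F α β (z + α • s • η) (w + β • s • η)

/-- The leading coefficient of `sliceExp`. -/
def sliceExpLead (B : Coord d → Matrix (Fin d) (Fin d) ℝ) (F : Fin d → Coord d → ℝ) (α β : ℝ)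
    (z w η : Coord d) : ℝ :=
  ∑ i, ∑ j, (η i * (B z)⁻¹ i j * driftShiftLin B F α β z w η j
    + η j * (B z)⁻¹ i j * driftShiftLin B F α β z w η i) / 4 - slicePot B F α β z w

section Slice

variable {B : Coord d → Matrix (Fin d) (Fin d) ℝ} {F : Fin d → Coord d → ℝ} {α β : ℝ}

lemma Admissible.growth_divB (h : Admissible B F) (k : Fin d) :
    Growth 0 (fun (_ : Unit) => divB B k) :=
  Growth.sum _ fun l _ => (h.growth_B k l).pd l

lemma norm_smul_le_of_mem {a : ℝ} (ha : a ∈ Set.Icc (0 : ℝ) 1) (y : Coord d) :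
    ‖a • y‖ ≤ ‖y‖ := by
  rw [norm_smul, Real.norm_of_nonneg ha.1]
  exact mul_le_of_le_one_left (norm_nonneg y) ha.2

/-- Only differences of `F` occur, so its bounded derivatives suffice and the constants are uniform
in the base points, even where `F` is large. -/
lemma Admissible.exists_driftShift_bound (h : Admissible B F) (hα : α ∈ Set.Icc (0 : ℝ) 1)
    (hβ : β ∈ Set.Icc (0 : ℝ) 1) : ∃ C, 0 ≤ C ∧ ∀ s, 0 ≤ s → ∀ z w η k,
      |driftShift B F α β z w (s • η) k| ≤ C * (s * ‖η‖) ∧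
      |driftShift B F α β z w (s • η) k - s * driftShiftLin B F α β z w η k|
        ≤ C * (s * ‖η‖) ^ 2 := by
  have hF1 : ∃ K, 0 ≤ K ∧ ∀ k x, ‖iteratedFDeriv ℝ 1 (F k) x‖ ≤ K ∧
      ‖iteratedFDeriv ℝ 2 (F k) x‖ ≤ K := by
    choose C1 hC1 using fun k => h.bounded_F k 1 le_rfl
    choose C2 hC2 using fun k => h.bounded_F k 2 (by norm_num)
    have p1 : ∀ k, 0 ≤ C1 k := fun k => (norm_nonneg _).trans (hC1 k 0)
    have p2 : ∀ k, 0 ≤ C2 k := fun k => (norm_nonneg _).trans (hC2 k 0)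
    have q1 := Finset.sum_nonneg fun k (_ : k ∈ Finset.univ) => p1 k
    have q2 := Finset.sum_nonneg fun k (_ : k ∈ Finset.univ) => p2 k
    refine ⟨∑ k, C1 k + ∑ k, C2 k, by positivity, fun k x => ⟨(hC1 k x).trans ?_,
      (hC2 k x).trans ?_⟩⟩
    · have := Finset.single_le_sum (fun k _ => p1 k) (Finset.mem_univ k)
      linarith
    · have := Finset.single_le_sum (fun k _ => p2 k) (Finset.mem_univ k)
      linarith
  have hH1 : ∃ K, 0 ≤ K ∧ ∀ k x, ‖iteratedFDeriv ℝ 1 (divB B k) x‖ ≤ K ∧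
      ‖iteratedFDeriv ℝ 2 (divB B k) x‖ ≤ K := by
    choose C l h0 hC using fun k => (h.growth_divB k).bound 2
    simp only [zero_mul, pow_zero, mul_one] at hC
    refine ⟨∑ k, C k, Finset.sum_nonneg fun k _ => h0 k, fun k x => ?_⟩
    have := Finset.single_le_sum (fun k _ => h0 k) (Finset.mem_univ k)
    exact ⟨(hC k 1 (by norm_num) () x).trans this, (hC k 2 le_rfl () x).trans this⟩
  obtain ⟨K, hK0, hK⟩ := hF1
  obtain ⟨J, hJ0, hJ⟩ := hH1
  refine ⟨K + 2 * J, by positivity, fun s hs z w η k => ?_⟩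
  have hn : ‖s • η‖ = s * ‖η‖ := by rw [norm_smul, Real.norm_of_nonneg hs]
  have hnα : ‖α • s • η‖ ≤ s * ‖η‖ := hn ▸ norm_smul_le_of_mem hα _
  have hnβ : ‖β • s • η‖ ≤ s * ‖η‖ := hn ▸ norm_smul_le_of_mem hβ _
  have hp : 0 ≤ s * ‖η‖ := by positivity
  have hα2 : |2 * α| ≤ 2 := by rw [abs_of_nonneg (by linarith [hα.1])]; linarith [hα.2]
  constructor
  · have f1 := taylor_zero (h.contDiff_F k) (x := w) (y := β • s • η) fun t _ => (hK k _).1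
    have f2 := taylor_zero ((h.growth_divB k).1 ()) (x := z) (y := α • s • η)
      fun t _ => (hJ k _).1
    calc |driftShift B F α β z w (s • η) k|
        ≤ |F k (w + β • s • η) - F k w|
          + |2 * α| * |divB B k (z + α • s • η) - divB B k z| := by
          rw [← abs_mul]; exact abs_sub _ _
      _ ≤ K * (s * ‖η‖) + 2 * (J * (s * ‖η‖)) := by
          have f1' := f1.trans (mul_le_mul_of_nonneg_left hnβ hK0)
          have f2' := f2.trans (mul_le_mul_of_nonneg_left hnα hJ0)
          gcongr
      _ = _ := by ring
  · have f1 := taylor_one (h.contDiff_F k) (x := w) (y := β • s • η) fun t _ => (hK k _).2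
    have f2 := taylor_one ((h.growth_divB k).1 ()) (x := z) (y := α • s • η)
      fun t _ => (hJ k _).2
    have e : driftShift B F α β z w (s • η) k - s * driftShiftLin B F α β z w η k
        = (F k (w + β • s • η) - F k w - ∑ a, pd a (F k) w * (β • s • η) a)
          - 2 * α * (divB B k (z + α • s • η) - divB B k z
            - ∑ a, pd a (divB B k) z * (α • s • η) a) := by
      have e1 : s * driftShiftLin B F α β z w η k = ∑ a, pd a (F k) w * (β • s • η) a
          - 2 * α * ∑ a, pd a (divB B k) z * (α • s • η) a := by
        rw [driftShiftLin, Finset.mul_sum, Finset.mul_sum, ← Finset.sum_sub_distrib]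
        refine Finset.sum_congr rfl fun a _ => ?_
        simp only [Pi.smul_apply, smul_eq_mul]
        ring
      rw [e1, driftShift]
      ring
    rw [e]
    refine (abs_sub _ _).trans ?_
    rw [abs_mul]
    have f1' := f1.trans (mul_le_mul_of_nonneg_left (pow_le_pow_left₀ (norm_nonneg _) hnβ 2) hK0)
    have f2' := f2.trans (mul_le_mul_of_nonneg_left (pow_le_pow_left₀ (norm_nonneg _) hnα 2) hJ0)
    calc _ ≤ K * (s * ‖η‖) ^ 2 + 2 * (J * (s * ‖η‖) ^ 2) := by gcongr
      _ = _ := by ring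

lemma Admissible.exists_slicePot_bound (h : Admissible B F) (hα : α ∈ Set.Icc (0 : ℝ) 1)
    (hβ : β ∈ Set.Icc (0 : ℝ) 1) : ∃ C, 0 ≤ C ∧ ∀ s, 0 ≤ s → ∀ z w η,
      |slicePot B F α β z w| ≤ C ∧
      |slicePot B F α β (z + α • s • η) (w + β • s • η) - slicePot B F α β z w|
        ≤ C * (s * ‖η‖) := by
  have g1 : Growth 0 (fun (_ : Unit) x => ∑ i, pd i (F i) x) :=
    Growth.sum _ fun i _ => h.growth_pd_F i i
  have g2 : Growth 0 (fun (_ : Unit) x => ∑ i, ∑ j, pd i (pd j (fun y => B y i j)) x) :=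
    Growth.sum _ fun i _ => Growth.sum _ fun k _ => ((h.growth_B i k).pd k).pd i
  obtain ⟨K, hK0, hK1, hK2, -⟩ := g1.exists_uniform_taylor
  obtain ⟨J, hJ0, hJ1, hJ2, -⟩ := g2.exists_uniform_taylor
  refine ⟨K + J, by positivity, fun s hs z w η => ?_⟩
  have hn : ‖s • η‖ = s * ‖η‖ := by rw [norm_smul, Real.norm_of_nonneg hs]
  have hnα : ‖α • s • η‖ ≤ s * ‖η‖ := hn ▸ norm_smul_le_of_mem hα _
  have hnβ : ‖β • s • η‖ ≤ s * ‖η‖ := hn ▸ norm_smul_le_of_mem hβ _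
  have hα2 : |α ^ 2| ≤ 1 := by
    rw [abs_of_nonneg (sq_nonneg α)]; exact pow_le_one₀ hα.1 hα.2
  have hβ2 : |β| ≤ 1 := by rw [abs_of_nonneg hβ.1]; exact hβ.2
  have key : ∀ a b A C : ℝ, |a| ≤ A → |b| ≤ C → 0 ≤ A → 0 ≤ C → |β * a - α ^ 2 * b| ≤ A + C := by
    intro a b A C ha hb hA hC
    refine (abs_sub _ _).trans ?_
    rw [abs_mul, abs_mul]
    calc |β| * |a| + |α ^ 2| * |b| ≤ 1 * A + 1 * C := by gcongr
      _ = A + C := by ring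
  constructor
  · exact key _ _ _ _ (hK1 () w) (hJ1 () z) hK0 hJ0
  · have e : slicePot B F α β (z + α • s • η) (w + β • s • η) - slicePot B F α β z w
        = β * ((∑ i, pd i (F i) (w + β • s • η)) - ∑ i, pd i (F i) w)
          - α ^ 2 * ((∑ i, ∑ j, pd i (pd j (fun y => B y i j)) (z + α • s • η))
            - ∑ i, ∑ j, pd i (pd j (fun y => B y i j)) z) := by
      rw [slicePot, slicePot]; ring
    rw [e, add_mul]
    exact key _ _ _ _ ((hK2 () w _).trans (mul_le_mul_of_nonneg_left hnβ hK0))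
      ((hJ2 () z _).trans (mul_le_mul_of_nonneg_left hnα hJ0)) (by positivity) (by positivity)

/-- Replacing the shift by its linearization and the inverse matrix by its value at the base point
one after the other: each replacement costs one extra power of `s r`. -/
lemma abs_triple_sub_le {C s r a q q' δ δ' : ℝ} (hC : 0 ≤ C) (hs : 0 ≤ s) (hr : 0 ≤ r)
    (ha : |a| ≤ r) (hq' : |q'| ≤ C) (hqq : |q' - q| ≤ C * (s * r))
    (hδ' : |δ'| ≤ C * r) (hδ : |δ - s * δ'| ≤ C * (s * r) ^ 2) :
    |s * (a * q' * δ) - s ^ 2 * (a * q * δ')| ≤ 2 * C ^ 2 * (s * r) ^ 3 := by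
  have e : s * (a * q' * δ) - s ^ 2 * (a * q * δ')
      = s * a * q' * (δ - s * δ') + s ^ 2 * a * (q' - q) * δ' := by ring
  rw [e]
  refine (abs_add_le _ _).trans ?_
  simp only [abs_mul, abs_pow, abs_of_nonneg hs]
  calc s * |a| * |q'| * |δ - s * δ'| + s ^ 2 * |a| * |q' - q| * |δ'|
      ≤ s * r * C * (C * (s * r) ^ 2) + s ^ 2 * r * (C * (s * r)) * (C * r) := by gcongr
    _ = _ := by ring

/-- Comparing the two bounds of `exists_driftShift_bound`, dividing by `s` and letting `s` be small
yields the bound on the linear part with the same constant. -/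
lemma Admissible.exists_driftShiftLin_bound (h : Admissible B F) (hα : α ∈ Set.Icc (0 : ℝ) 1)
    (hβ : β ∈ Set.Icc (0 : ℝ) 1) : ∃ C, 0 ≤ C ∧ ∀ z w η k,
      |driftShiftLin B F α β z w η k| ≤ C * ‖η‖ := by
  obtain ⟨C, hC0, hC⟩ := h.exists_driftShift_bound hα hβ
  refine ⟨C, hC0, fun z w η k => ?_⟩
  refine le_of_forall_pos_le_add fun ε hε => ?_
  have hp : 0 < C * ‖η‖ ^ 2 + 1 := by positivity
  set s := ε / (C * ‖η‖ ^ 2 + 1) with hs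
  have hs0 : 0 < s := by positivity
  obtain ⟨h1, h2⟩ := hC s hs0.le z w η k
  have h3 : s * |driftShiftLin B F α β z w η k| ≤ C * (s * ‖η‖) + C * (s * ‖η‖) ^ 2 := by
    rw [← abs_of_pos hs0, ← abs_mul, abs_of_pos hs0]
    rw [abs_le] at h1 h2 ⊢
    constructor <;> linarith [h1.1, h1.2, h2.1, h2.2]
  have h4 : s * (C * ‖η‖ ^ 2) ≤ ε := by
    have : s * (C * ‖η‖ ^ 2 + 1) = ε := by rw [hs]; field_simp
    nlinarith
  have h5 : s * |driftShiftLin B F α β z w η k| ≤ s * (C * ‖η‖ + ε) := by nlinarith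
  exact le_of_mul_le_mul_left h5 hs0

/-- Uniform bounds for the ingredients of the exponent. -/
lemma Admissible.exists_slice_bounds (h : Admissible B F) (hα : α ∈ Set.Icc (0 : ℝ) 1)
    (hβ : β ∈ Set.Icc (0 : ℝ) 1) : ∃ C, 0 ≤ C ∧ ∀ s, 0 ≤ s → ∀ z w η,
      (∀ k, |driftShift B F α β z w (s • η) k| ≤ C * (s * ‖η‖)) ∧
      (∀ k, |driftShift B F α β z w (s • η) k - s * driftShiftLin B F α β z w η k|
        ≤ C * (s * ‖η‖) ^ 2) ∧
      (∀ k, |driftShiftLin B F α β z w η k| ≤ C * ‖η‖) ∧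
      (∀ i k, |(B z)⁻¹ i k| ≤ C) ∧
      (∀ i k, |(B (z + α • s • η))⁻¹ i k - (B z)⁻¹ i k| ≤ C * (s * ‖η‖)) ∧
      |slicePot B F α β z w| ≤ C ∧
      |slicePot B F α β (z + α • s • η) (w + β • s • η) - slicePot B F α β z w|
        ≤ C * (s * ‖η‖) := by
  obtain ⟨C1, hC10, hC1⟩ := h.exists_driftShift_bound hα hβ
  obtain ⟨C2, hC20, hC2⟩ := h.exists_slicePot_bound hα hβ
  obtain ⟨C3, hC30, hC3⟩ := h.exists_driftShiftLin_bound hα hβ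
  choose K hK0 hKa hKb _ _ using fun i k => (h.growth_inv i k).exists_uniform_taylor
  have hKs : ∀ i k, K i k ≤ ∑ i, ∑ k, K i k := fun i k =>
    (Finset.single_le_sum (f := fun k => K i k) (fun k _ => hK0 i k) (Finset.mem_univ k)).trans
    (Finset.single_le_sum (f := fun i => ∑ k, K i k)
      (fun i _ => Finset.sum_nonneg fun k _ => hK0 i k) (Finset.mem_univ i))
  have hS0 : 0 ≤ ∑ i, ∑ k, K i k :=
    Finset.sum_nonneg fun i _ => Finset.sum_nonneg fun k _ => hK0 i k
  set S := ∑ i, ∑ k, K i k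
  refine ⟨C1 + C2 + C3 + S, by positivity, fun s hs z w η => ?_⟩
  have hn : ‖α • s • η‖ ≤ s * ‖η‖ := by
    refine (norm_smul_le_of_mem hα _).trans (le_of_eq ?_)
    rw [norm_smul, Real.norm_of_nonneg hs]
  refine ⟨fun k => ((hC1 s hs z w η k).1).trans ?_, fun k => ((hC1 s hs z w η k).2).trans ?_,
    fun k => (hC3 z w η k).trans ?_, fun i k => (hKa i k () z).trans ?_,
    fun i k => (hKb i k () z _).trans ?_, ((hC2 s hs z w η).1).trans ?_,
    ((hC2 s hs z w η).2).trans ?_⟩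
  · gcongr; linarith
  · gcongr; linarith
  · gcongr; linarith
  · linarith [hKs i k]
  · exact mul_le_mul (by linarith [hKs i k]) hn (norm_nonneg _) (by positivity)
  · linarith
  · gcongr; linarith

/-- The exponent is quadratically small, with leading coefficient `sliceExpLead`. -/
lemma Admissible.exists_sliceExp_sub_lead_bound (h : Admissible B F)
    (hα : α ∈ Set.Icc (0 : ℝ) 1) (hβ : β ∈ Set.Icc (0 : ℝ) 1) :
    ∃ C, 0 ≤ C ∧ ∀ s, 0 ≤ s → s ≤ 1 → ∀ z w η,
      |sliceExp B F α β s z w η - s ^ 2 * sliceExpLead B F α β z w η|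
        ≤ C * (s ^ 3 * (1 + ‖η‖) ^ 3) := by
  obtain ⟨C, hCp, hC⟩ := h.exists_slice_bounds hα hβ
  refine ⟨d * (d * (2 * C ^ 2 + C ^ 3)) + C, by positivity, fun s hs hs1 z w η => ?_⟩
  have hr : 0 ≤ ‖η‖ := norm_nonneg η
  have hηi : ∀ i, |η i| ≤ ‖η‖ := fun i => by simpa using norm_le_pi_norm η i
  obtain ⟨b1, b2, b3, b4, b6, b7, b8⟩ := hC s hs z w η
  -- The bounds hold at every base point, so taking the interpolation point as base controls the
  -- inverse matrix there.
  have b5 := (hC 0 le_rfl (z + α • s • η) 0 0).2.2.2.1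
  set δ := driftShift B F α β z w (s • η) with hδ
  set δ' := driftShiftLin B F α β z w η with hδ'
  set Q := (B z)⁻¹ with hQ
  set Q' := (B (z + α • s • η))⁻¹ with hQ'
  set X := s ^ 3 * (1 + ‖η‖) ^ 3 with hX
  have hX0 : 0 ≤ X := by positivity
  have e : sliceExp B F α β s z w η - s ^ 2 * sliceExpLead B F α β z w η
      = (∑ i, ∑ k, ((s * (η i * Q' i k * δ k) - s ^ 2 * (η i * Q i k * δ' k))
        + (s * (η k * Q' i k * δ i) - s ^ 2 * (η k * Q i k * δ' i))
        - s ^ 2 * (δ i * Q' i k * δ k)) / 4)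
        - s ^ 2 * (slicePot B F α β (z + α • s • η) (w + β • s • η) - slicePot B F α β z w) := by
    rw [sliceExp, sliceExpLead, mul_sub, Finset.mul_sum]
    simp only [Finset.mul_sum]
    rw [sub_sub_sub_comm, ← Finset.sum_sub_distrib, mul_sub]
    congr 1
    refine Finset.sum_congr rfl fun i _ => ?_
    rw [← Finset.sum_sub_distrib]
    refine Finset.sum_congr rfl fun k _ => ?_
    ring
  have t : ∀ i k, |((s * (η i * Q' i k * δ k) - s ^ 2 * (η i * Q i k * δ' k))
        + (s * (η k * Q' i k * δ i) - s ^ 2 * (η k * Q i k * δ' i))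
        - s ^ 2 * (δ i * Q' i k * δ k)) / 4| ≤ (2 * C ^ 2 + C ^ 3) * X := by
    intro i k
    have t1 := abs_triple_sub_le hCp hs hr (hηi i) (b5 i k) (b6 i k) (b3 k) (b2 k)
    have t2 := abs_triple_sub_le hCp hs hr (hηi k) (b5 i k) (b6 i k) (b3 i) (b2 i)
    have t3 : |s ^ 2 * (δ i * Q' i k * δ k)| ≤ C ^ 3 * X := by
      rw [abs_mul, abs_mul, abs_mul, abs_of_nonneg (sq_nonneg s)]
      calc s ^ 2 * (|δ i| * |Q' i k| * |δ k|)
          ≤ s ^ 2 * (C * (s * ‖η‖) * C * (C * (s * ‖η‖))) := by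
            have := b1 i; have := b1 k; have := b5 i k
            gcongr
        _ = C ^ 3 * (s ^ 3 * (s * ‖η‖ ^ 2)) := by ring
        _ ≤ C ^ 3 * (s ^ 3 * (1 + ‖η‖) ^ 3) := by
            gcongr
            calc s * ‖η‖ ^ 2 ≤ 1 * (1 + ‖η‖) ^ 2 := by gcongr; linarith
              _ ≤ (1 + ‖η‖) ^ 3 := by rw [one_mul]; exact weight_mono η (by norm_num)
    have t4 : (s * ‖η‖) ^ 3 ≤ X := by
      rw [mul_pow, hX]; gcongr; linarith
    have t5 : 2 * C ^ 2 * (s * ‖η‖) ^ 3 ≤ 2 * C ^ 2 * X := by gcongr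
    have t6 : 0 ≤ C ^ 3 * X := by positivity
    have t8 : 0 ≤ 2 * C ^ 2 * X := by positivity
    have t9 : (2 * C ^ 2 + C ^ 3) * X * 4 = 4 * (2 * C ^ 2 * X) + 4 * (C ^ 3 * X) := by ring
    rw [abs_div, abs_of_pos (show (0 : ℝ) < 4 by norm_num), div_le_iff₀ (by norm_num), t9]
    refine (abs_sub _ _).trans ((add_le_add (abs_add_le _ _) t3).trans ?_)
    refine (add_le_add_left (add_le_add (t1.trans t5) (t2.trans t5)) _).trans ?_
    clear_value X
    linarith
  rw [e]
  refine (abs_sub _ _).trans ?_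
  have u1 : |∑ i, ∑ k, ((s * (η i * Q' i k * δ k) - s ^ 2 * (η i * Q i k * δ' k))
        + (s * (η k * Q' i k * δ i) - s ^ 2 * (η k * Q i k * δ' i))
        - s ^ 2 * (δ i * Q' i k * δ k)) / 4|
      ≤ ∑ _i : Fin d, ∑ _k : Fin d, (2 * C ^ 2 + C ^ 3) * X :=
    (Finset.abs_sum_le_sum_abs _ _).trans (Finset.sum_le_sum fun i _ =>
      (Finset.abs_sum_le_sum_abs _ _).trans (Finset.sum_le_sum fun k _ => t i k))
  have u2 : |s ^ 2 * (slicePot B F α β (z + α • s • η) (w + β • s • η) - slicePot B F α β z w)|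
      ≤ C * X := by
    rw [abs_mul, abs_of_nonneg (sq_nonneg s)]
    calc _ ≤ s ^ 2 * (C * (s * ‖η‖)) := by gcongr
      _ = C * (s ^ 3 * ‖η‖) := by ring
      _ ≤ C * (s ^ 3 * (1 + ‖η‖) ^ 3) := by
          gcongr
          calc ‖η‖ ≤ (1 + ‖η‖) ^ 1 := by linarith
            _ ≤ _ := weight_mono η (by norm_num)
  refine (add_le_add u1 u2).trans (le_of_eq ?_)
  simp only [Finset.sum_const, Finset.card_univ, Fintype.card_fin, nsmul_eq_mul]
  ring

lemma abs_triple_le {C r t a q δ : ℝ} (hC : 0 ≤ C) (ha : |a| ≤ r) (hq : |q| ≤ C)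
    (hδ : |δ| ≤ C * (t * r)) : |a * q * δ| ≤ C ^ 2 * (t * r ^ 2) := by
  have hr : 0 ≤ r := (abs_nonneg a).trans ha
  rw [abs_mul, abs_mul]
  calc |a| * |q| * |δ| ≤ r * C * (C * (t * r)) := by gcongr
    _ = _ := by ring

lemma Admissible.exists_sliceExpLead_bound (h : Admissible B F)
    (hα : α ∈ Set.Icc (0 : ℝ) 1) (hβ : β ∈ Set.Icc (0 : ℝ) 1) :
    ∃ C, 0 ≤ C ∧ ∀ z w η, |sliceExpLead B F α β z w η| ≤ C * (1 + ‖η‖) ^ 2 := by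
  obtain ⟨C, hCp, hC⟩ := h.exists_slice_bounds hα hβ
  refine ⟨d * (d * (C ^ 2)) + C, by positivity, fun z w η => ?_⟩
  have hr : 0 ≤ ‖η‖ := norm_nonneg η
  have hηi : ∀ i, |η i| ≤ ‖η‖ := fun i => by simpa using norm_le_pi_norm η i
  obtain ⟨-, -, b3, b4, -, b7, -⟩ := hC 0 le_rfl z w η
  rw [sliceExpLead]
  refine (abs_sub _ _).trans ?_
  set δ' := driftShiftLin B F α β z w η with hδ'
  set Q := (B z)⁻¹ with hQ
  have u1 : |∑ i, ∑ k, (η i * Q i k * δ' k + η k * Q i k * δ' i) / 4|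
      ≤ ∑ _i : Fin d, ∑ _k : Fin d, C ^ 2 * (1 + ‖η‖) ^ 2 := by
    refine (Finset.abs_sum_le_sum_abs _ _).trans (Finset.sum_le_sum fun i _ =>
      (Finset.abs_sum_le_sum_abs _ _).trans (Finset.sum_le_sum fun k _ => ?_))
    have p : ∀ a b : Fin d, |η a * Q i k * δ' b| ≤ C ^ 2 * (1 + ‖η‖) ^ 2 := fun a b => by
      refine (abs_triple_le (t := 1) hCp (hηi a) (b4 i k) (by simpa using b3 b)).trans ?_
      rw [one_mul]; gcongr; linarith
    rw [abs_div, abs_of_pos (show (0 : ℝ) < 4 by norm_num), div_le_iff₀ (by norm_num)]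
    refine (abs_add_le _ _).trans ((add_le_add (p i k) (p k i)).trans ?_)
    have q1 : 0 ≤ C ^ 2 * (1 + ‖η‖) ^ 2 := by positivity
    linarith
  have u2 : C ≤ C * (1 + ‖η‖) ^ 2 := le_mul_of_one_le_right hCp (one_le_weight η 2)
  refine (add_le_add u1 (b7.trans u2)).trans (le_of_eq ?_)
  simp only [Finset.sum_const, Finset.card_univ, Fintype.card_fin, nsmul_eq_mul]
  ring

lemma Admissible.exists_sliceExp_bound (h : Admissible B F)
    (hα : α ∈ Set.Icc (0 : ℝ) 1) (hβ : β ∈ Set.Icc (0 : ℝ) 1) :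
    ∃ C, 0 ≤ C ∧ ∀ s, 0 ≤ s → s ≤ 1 → ∀ z w η,
      |sliceExp B F α β s z w η| ≤ C * (s ^ 2 * (1 + ‖η‖) ^ 2) := by
  obtain ⟨C, hCp, hC⟩ := h.exists_slice_bounds hα hβ
  refine ⟨d * (d * (C ^ 2 + C ^ 3)) + C, by positivity, fun s hs hs1 z w η => ?_⟩
  have hr : 0 ≤ ‖η‖ := norm_nonneg η
  have hηi : ∀ i, |η i| ≤ ‖η‖ := fun i => by simpa using norm_le_pi_norm η i
  have b1 := (hC s hs z w η).1
  have b4 := (hC 0 le_rfl (z + α • s • η) (w + β • s • η) 0).2.2.2.1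
  have b7 := (hC 0 le_rfl (z + α • s • η) (w + β • s • η) 0).2.2.2.2.2.1
  rw [sliceExp]
  refine (abs_sub _ _).trans ?_
  set δ := driftShift B F α β z w (s • η) with hδ
  set Q := (B (z + α • s • η))⁻¹ with hQ
  set X := s ^ 2 * (1 + ‖η‖) ^ 2 with hX
  have hX0 : 0 ≤ X := by positivity
  have u1 : |∑ i, ∑ k, (s * (η i * Q i k * δ k) + s * (η k * Q i k * δ i)
      - s ^ 2 * (δ i * Q i k * δ k)) / 4| ≤ ∑ _i : Fin d, ∑ _k : Fin d, (C ^ 2 + C ^ 3) * X := by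
    refine (Finset.abs_sum_le_sum_abs _ _).trans (Finset.sum_le_sum fun i _ =>
      (Finset.abs_sum_le_sum_abs _ _).trans (Finset.sum_le_sum fun k _ => ?_))
    have p : ∀ a b : Fin d, |s * (η a * Q i k * δ b)| ≤ C ^ 2 * X := fun a b => by
      rw [abs_mul, abs_of_nonneg hs]
      calc s * |η a * Q i k * δ b| ≤ s * (C ^ 2 * (s * ‖η‖ ^ 2)) := by
            gcongr
            exact abs_triple_le hCp (hηi a) (b4 i k) (b1 b)
        _ = C ^ 2 * (s ^ 2 * ‖η‖ ^ 2) := by ring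
        _ ≤ _ := by rw [hX]; gcongr; linarith
    have p3 : |s ^ 2 * (δ i * Q i k * δ k)| ≤ C ^ 3 * X := by
      rw [abs_mul, abs_mul, abs_mul, abs_of_nonneg (sq_nonneg s)]
      calc s ^ 2 * (|δ i| * |Q i k| * |δ k|)
          ≤ s ^ 2 * (C * (s * ‖η‖) * C * (C * (s * ‖η‖))) := by
            have := b1 i; have := b1 k; have := b4 i k
            gcongr
        _ = C ^ 3 * (s ^ 2 * (s * ‖η‖) ^ 2) := by ring
        _ ≤ C ^ 3 * (s ^ 2 * (1 + ‖η‖) ^ 2) := by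
            gcongr
            nlinarith
    rw [abs_div, abs_of_pos (show (0 : ℝ) < 4 by norm_num), div_le_iff₀ (by norm_num)]
    refine (abs_sub _ _).trans ((add_le_add (abs_add_le _ _) p3).trans ?_)
    refine (add_le_add_left (add_le_add (p i k) (p k i)) _).trans ?_
    have q1 : 0 ≤ C ^ 2 * X := by positivity
    have q2 : 0 ≤ C ^ 3 * X := by positivity
    clear_value X
    linarith
  have u2 : |s ^ 2 * slicePot B F α β (z + α • s • η) (w + β • s • η)| ≤ C * X := by
    rw [abs_mul, abs_of_nonneg (sq_nonneg s), hX]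
    calc _ ≤ s ^ 2 * C := by gcongr
      _ = C * (s ^ 2 * 1) := by ring
      _ ≤ _ := by gcongr; exact one_le_weight η 2
  refine (add_le_add u1 u2).trans (le_of_eq ?_)
  simp only [Finset.sum_const, Finset.card_univ, Fintype.card_fin, nsmul_eq_mul]
  ring

end Slice

/-! ### Families of functions with Gaussian decay -/

/-- Families `v η` of smooth functions, bounded together with their derivatives by a Gaussian
in the parameter `η`. -/
structure GaussFamily (c : ℝ) (v : Coord d → Coord d → ℝ) : Prop where
  growth : Growth 0 (fun η z => Real.exp (c * ‖η‖ ^ 2) * v η z)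
  meas : ∀ z, AEStronglyMeasurable (fun η => v η z) volume

section Family

variable {c : ℝ} {v : Coord d → Coord d → ℝ}

lemma GaussFamily.smooth (hv : GaussFamily c v) (η : Coord d) : ContDiff ℝ ∞ (v η) := by
  have h := (contDiff_const (c := (Real.exp (c * ‖η‖ ^ 2))⁻¹)).mul (hv.growth.1 η)
  refine cast ?_ h
  congr 1
  ext z
  rw [← mul_assoc, inv_mul_cancel₀ (Real.exp_pos _).ne', one_mul]

lemma hasDerivAt_line {f : Coord d → ℝ} (hf : Differentiable ℝ f) (l : Fin d) (z : Coord d)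
    (τ : ℝ) : HasDerivAt (fun τ : ℝ => f (z + τ • Pi.single l 1))
      (pd l f (z + τ • Pi.single l 1)) τ := by
  have h1 : HasDerivAt (fun τ : ℝ => z + τ • (Pi.single l 1 : Coord d)) (Pi.single l 1) τ := by
    simpa using ((hasDerivAt_id τ).smul_const (Pi.single l 1 : Coord d)).const_add z
  exact (hf _).hasFDerivAt.comp_hasDerivAt τ h1

lemma GaussFamily.pd (hv : GaussFamily c v) (l : Fin d) :
    GaussFamily c (fun η => CovariantFP.pd l (v η)) where
  growth := by
    refine cast ?_ (hv.growth.pd l)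
    congr 1
    ext η z
    exact pd_const_mul ((hv.smooth η).differentiable (by norm_num) z) _ l
  meas z := by
    -- Smoothness is only in `z`. Measurability of the derivative in the parameter `η` comes from
    -- its being a limit of difference quotients.
    refine aestronglyMeasurable_of_tendsto_ae (𝓝[>] (0 : ℝ))
      (f := fun t η => t⁻¹ • (v η (z + t • Pi.single l 1) - v η z)) (fun t => ?_)
      (Eventually.of_forall fun η => ?_)
    · exact ((hv.meas (z + t • Pi.single l 1)).sub (hv.meas z)).const_smul t⁻¹
    · have := (hasDerivAt_line ((hv.smooth η).differentiable (by norm_num)) l z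
        0).tendsto_slope_zero_right
      simpa using this

lemma GaussFamily.exists_bounds (hv : GaussFamily c v) : ∃ K, 0 ≤ K ∧
    (∀ η z, |v η z| ≤ K * Real.exp (-(c * ‖η‖ ^ 2))) ∧
    (∀ η z y, |v η (z + y) - v η z| ≤ K * ‖y‖ * Real.exp (-(c * ‖η‖ ^ 2))) ∧
    (∀ η z y, |v η (z + y) - v η z - ∑ a, CovariantFP.pd a (v η) z * y a
      - (1 / 2) * ∑ a, ∑ b, CovariantFP.pd a (CovariantFP.pd b (v η)) z * y a * y b|
        ≤ K * ‖y‖ ^ 3 * Real.exp (-(c * ‖η‖ ^ 2))) := by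
  obtain ⟨K, hK0, h0, h1, h2, -⟩ := hv.growth.exists_uniform_taylor
  have key : ∀ (η : Coord d) (a A : ℝ), |Real.exp (c * ‖η‖ ^ 2) * a| ≤ A →
      |a| ≤ A * Real.exp (-(c * ‖η‖ ^ 2)) := fun η a A h => by
    rw [abs_mul, abs_of_pos (Real.exp_pos _)] at h
    rw [Real.exp_neg, ← div_eq_mul_inv, le_div_iff₀ (Real.exp_pos _), mul_comm]
    exact h
  refine ⟨K, hK0, fun η z => key _ _ _ (h0 η z), fun η z y => key _ _ _ ?_,
    fun η z y => key _ _ _ ?_⟩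
  · rw [mul_sub]; exact h1 η z y
  · have := h2 η z y
    have e1 : ∀ a, CovariantFP.pd a (fun z => Real.exp (c * ‖η‖ ^ 2) * v η z)
        = fun z => Real.exp (c * ‖η‖ ^ 2) * CovariantFP.pd a (v η) z := fun a => by
      ext z
      exact pd_const_mul ((hv.smooth η).differentiable (by norm_num) z) _ a
    have e2 : ∀ a b, CovariantFP.pd a
        (fun z => Real.exp (c * ‖η‖ ^ 2) * CovariantFP.pd b (v η) z) z
        = Real.exp (c * ‖η‖ ^ 2) * CovariantFP.pd a (CovariantFP.pd b (v η)) z := fun a b => by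
      rw [pd_const_mul (((hv.pd b).smooth η).differentiable (by norm_num) z)]
    simp only [e1, e2] at this
    refine le_of_eq_of_le ?_ this
    congr 1
    simp only [mul_sub, Finset.mul_sum]
    congr 1
    · congr 1
      exact Finset.sum_congr rfl fun a _ => by ring
    · exact Finset.sum_congr rfl fun a _ => Finset.sum_congr rfl fun b _ => by ring

/-- An integrable dominating function. -/
def gaussConst (d : ℕ) (c : ℝ) (n : ℕ) : ℝ :=
  ∫ η : Coord d, (1 + ‖η‖) ^ n * Real.exp (-(c * ‖η‖ ^ 2))

lemma gaussConst_nonneg (d : ℕ) (c : ℝ) (n : ℕ) : 0 ≤ gaussConst d c n :=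
  integral_nonneg fun η => by positivity

lemma integrable_of_gauss_bound (hc : 0 < c) {f : Coord d → ℝ}
    (hf : AEStronglyMeasurable f volume) {A : ℝ} {n : ℕ}
    (h : ∀ η, |f η| ≤ A * ((1 + ‖η‖) ^ n * Real.exp (-(c * ‖η‖ ^ 2)))) :
    Integrable f ∧ |∫ η, f η| ≤ A * gaussConst d c n := by
  have hi := (integrable_weight_mul_exp d n hc).const_mul A
  refine ⟨hi.mono' hf (Eventually.of_forall h), ?_⟩
  rw [gaussConst, ← integral_const_mul, ← Real.norm_eq_abs]
  exact norm_integral_le_of_norm_le hi (Eventually.of_forall h)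

lemma GaussFamily.integrable_mul (hc : 0 < c) (hv : GaussFamily c v) {f : Coord d → ℝ}
    (hf : Continuous f) {A : ℝ} {n : ℕ} (hA : ∀ η, |f η| ≤ A * (1 + ‖η‖) ^ n) (z : Coord d) :
    Integrable (fun η => f η * v η z) := by
  obtain ⟨K, hK0, hK, -⟩ := hv.exists_bounds
  refine (integrable_of_gauss_bound hc (hf.aestronglyMeasurable.mul (hv.meas z)) (A := A * K)
    (n := n) fun η => ?_).1
  rw [Pi.mul_apply, abs_mul]
  calc |f η| * |v η z| ≤ (A * (1 + ‖η‖) ^ n) * (K * Real.exp (-(c * ‖η‖ ^ 2))) := by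
        gcongr
        · exact (abs_nonneg _).trans (hA η)
        · exact hA η
        · exact hK η z
    _ = _ := by ring

/-- Differentiation under the integral sign. -/
lemma GaussFamily.integral_pd (hc : 0 < c) (hv : GaussFamily c v) {f : Coord d → ℝ}
    (hf : Continuous f) {A : ℝ} {n : ℕ} (hA : ∀ η, |f η| ≤ A * (1 + ‖η‖) ^ n) {g : Coord d → ℝ}
    (hg : Differentiable ℝ g) (h : ∀ z, ∫ η, f η * v η z = g z) (l : Fin d) (z : Coord d) :
    ∫ η, f η * CovariantFP.pd l (v η) z = CovariantFP.pd l g z := by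
  obtain ⟨K, hK0, hK, -⟩ := (hv.pd l).exists_bounds
  have key := hasDerivAt_integral_of_dominated_loc_of_deriv_le (μ := (volume : Measure (Coord d)))
    (𝕜 := ℝ) (x₀ := 0) (s := Set.univ) (F := fun τ η => f η * v η (z + τ • Pi.single l 1))
    (F' := fun τ η => f η * CovariantFP.pd l (v η) (z + τ • Pi.single l 1))
    (bound := fun η => A * K * ((1 + ‖η‖) ^ n * Real.exp (-(c * ‖η‖ ^ 2)))) univ_mem
    (Eventually.of_forall fun τ => hf.aestronglyMeasurable.mul (hv.meas _))
    (hv.integrable_mul hc hf hA _) (hf.aestronglyMeasurable.mul ((hv.pd l).meas _))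
    (Eventually.of_forall fun η τ _ => ?_)
    ((integrable_weight_mul_exp d n hc).const_mul _)
    (Eventually.of_forall fun η τ _ =>
      (hasDerivAt_line ((hv.smooth η).differentiable (by norm_num)) l z τ).const_mul _)
  · have h1 := key.2
    simp only [h, zero_smul, add_zero] at h1
    have h2 := hasDerivAt_line hg l z 0
    rw [zero_smul, add_zero] at h2
    exact h1.unique h2
  · rw [norm_mul, Real.norm_eq_abs, Real.norm_eq_abs]
    calc |f η| * |CovariantFP.pd l (v η) (z + τ • Pi.single l 1)|
        ≤ (A * (1 + ‖η‖) ^ n) * (K * Real.exp (-(c * ‖η‖ ^ 2))) := by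
          gcongr
          · exact (abs_nonneg _).trans (hA η)
          · exact hA η
          · exact hK η _
      _ = _ := by ring

end Family

lemma Admissible.gaussFamily {B : Coord d → Matrix (Fin d) (Fin d) ℝ} {F : Fin d → Coord d → ℝ}
    (h : Admissible B F) {c : ℝ} (hc : 0 < c)
    (hq : ∀ x (w : Fin d → ℝ), 2 * c * ‖w‖ ^ 2
      ≤ ∑ i, ∑ j, w i * ((B x)⁻¹ i j / (4 * 1)) * w j) :
    GaussFamily c (fun η z => gaussianDensity (B z) 1 η) where
  growth := h.growth_gaussianDensity hc hq
  meas z := (continuous_gaussianDensity (B z) 1).aestronglyMeasurable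

lemma abs_exp_sub_one_sub_id_le (x : ℝ) : |Real.exp x - 1 - x| ≤ x ^ 2 * Real.exp |x| := by
  have h1 := Real.add_one_le_exp x
  have h2 := Real.add_one_le_exp (-x)
  have h3 : Real.exp x * Real.exp (-x) = 1 := by rw [← Real.exp_add]; simp
  have h4 := Real.exp_pos x
  have h5 : Real.exp x - 1 ≤ x * Real.exp x := by nlinarith
  rw [abs_of_nonneg (by linarith)]
  rcases le_total 0 x with hx | hx
  · rw [abs_of_nonneg hx]
    nlinarith
  · have h6 := Real.one_le_exp (abs_nonneg x)
    have h7 : Real.exp x ≤ 1 := Real.exp_le_one_iff.2 hx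
    nlinarith [sq_nonneg x]

/-- The rescaled time-slice kernel. -/
def sliceDensity (B : Coord d → Matrix (Fin d) (Fin d) ℝ) (F : Fin d → Coord d → ℝ) (α β s : ℝ)
    (z w η : Coord d) : ℝ :=
  gaussianDensity (B (z + α • s • η)) 1 η * Real.exp (sliceExp B F α β s z w η)

/-- The second-order expansion of the rescaled time-slice kernel. -/
def sliceMain (B : Coord d → Matrix (Fin d) (Fin d) ℝ) (F : Fin d → Coord d → ℝ) (α β s : ℝ)
    (z w η : Coord d) : ℝ :=
  gaussianDensity (B z) 1 η + s * (α * ∑ l, η l * pd l (fun z => gaussianDensity (B z) 1 η) z)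
    + s ^ 2 * (sliceExpLead B F α β z w η * gaussianDensity (B z) 1 η + (α ^ 2 / 2) *
      ∑ l, ∑ m, η l * η m * pd l (pd m (fun z => gaussianDensity (B z) 1 η)) z)

section Slice

variable {B : Coord d → Matrix (Fin d) (Fin d) ℝ} {F : Fin d → Coord d → ℝ} {α β : ℝ}

/-- The covariance point moves by `αsη` and is Taylor expanded to second order. The exponent is of
order `s²`, so only its leading part contributes. Half of the Gaussian decay is spent on the
exponential of this exponent. -/
lemma Admissible.exists_sliceDensity_bound (h : Admissible B F) (hα : α ∈ Set.Icc (0 : ℝ) 1)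
    (hβ : β ∈ Set.Icc (0 : ℝ) 1) {c : ℝ} (hc : 0 < c)
    (hq : ∀ x (w : Fin d → ℝ), 2 * c * ‖w‖ ^ 2
      ≤ ∑ i, ∑ j, w i * ((B x)⁻¹ i j / (4 * 1)) * w j) :
    ∃ C s₀, 0 ≤ C ∧ 0 < s₀ ∧ s₀ ≤ 1 ∧ ∀ s, 0 ≤ s → s ≤ s₀ → ∀ z w η,
      |sliceDensity B F α β s z w η| ≤ C * Real.exp (-(c / 2 * ‖η‖ ^ 2)) ∧
      |sliceDensity B F α β s z w η - sliceMain B F α β s z w η|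
        ≤ C * s ^ 3 * ((1 + ‖η‖) ^ 4 * Real.exp (-(c / 2 * ‖η‖ ^ 2))) := by
  obtain ⟨K, hK0, hK1, hK2, hK3⟩ := (h.gaussFamily hc hq).exists_bounds
  obtain ⟨C1, hC10, hC1⟩ := h.exists_sliceExp_bound hα hβ
  obtain ⟨C2, hC20, hC2⟩ := h.exists_sliceExp_sub_lead_bound hα hβ
  -- For `s ≤ s₀` the quadratic growth of the exponent is at most `2 C1 + (c/2)‖η‖²`, which leaves
  -- decay at rate `c/2`.
  set s₀ := min 1 (c / (4 * (C1 + 1))) with hs₀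
  have hs₀p : 0 < s₀ := by positivity
  refine ⟨K * Real.exp (2 * C1) * (1 + C1 ^ 2) + K * (1 + C1 + C2), s₀, by positivity, hs₀p,
    min_le_left _ _, fun s hs hss z w η => ?_⟩
  have hs1 : s ≤ 1 := hss.trans (min_le_left _ _)
  have hsc : C1 * s ≤ c / 4 := by
    have h1 : s ≤ c / (4 * (C1 + 1)) := hss.trans (min_le_right _ _)
    rw [le_div_iff₀ (by positivity)] at h1
    nlinarith
  set r := ‖η‖ with hr
  have hr0 : 0 ≤ r := norm_nonneg η
  set E := sliceExp B F α β s z w η with hE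
  set L := sliceExpLead B F α β z w η with hL
  have hE1 : |E| ≤ C1 * (s ^ 2 * (1 + r) ^ 2) := hC1 s hs hs1 z w η
  have hE2 : |E - s ^ 2 * L| ≤ C2 * (s ^ 3 * (1 + r) ^ 3) := hC2 s hs hs1 z w η
  have hexp : Real.exp |E| ≤ Real.exp (2 * C1) * Real.exp (c / 2 * r ^ 2) := by
    rw [← Real.exp_add]
    refine Real.exp_le_exp.2 (hE1.trans ?_)
    have h1 : s ^ 2 ≤ 1 := pow_le_one₀ hs hs1
    have h2 : (1 + r) ^ 2 ≤ 2 + 2 * r ^ 2 := by nlinarith [sq_nonneg (r - 1)]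
    have h3 : C1 * s ^ 2 ≤ c / 4 := by nlinarith
    have h4 : C1 * s ^ 2 ≤ C1 := mul_le_of_le_one_right hC10 h1
    calc C1 * (s ^ 2 * (1 + r) ^ 2) = C1 * s ^ 2 * (1 + r) ^ 2 := by ring
      _ ≤ C1 * s ^ 2 * (2 + 2 * r ^ 2) := by gcongr
      _ = 2 * (C1 * s ^ 2) + 2 * (C1 * s ^ 2) * r ^ 2 := by ring
      _ ≤ 2 * C1 + 2 * (c / 4) * r ^ 2 := by gcongr
      _ = _ := by ring
  set y := α • s • η with hy
  have hyn : ‖y‖ ≤ s * r := by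
    refine (norm_smul_le_of_mem hα _).trans (le_of_eq ?_)
    rw [norm_smul, Real.norm_of_nonneg hs]
  set N : Coord d → ℝ := fun z => gaussianDensity (B z) 1 η with hN
  set G := Real.exp (-(c * r ^ 2)) with hG
  set g := Real.exp (-(c / 2 * r ^ 2)) with hg
  have hGg : G * Real.exp (c / 2 * r ^ 2) = g := by
    rw [hG, hg, ← Real.exp_add]; ring_nf
  have hGle : G ≤ g := by
    refine Real.exp_le_exp.2 ?_
    nlinarith [mul_nonneg hc.le (sq_nonneg r)]
  have hG0 : 0 ≤ G := (Real.exp_pos _).le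
  have hg0 : 0 ≤ g := (Real.exp_pos _).le
  have n1 : |N (z + y)| ≤ K * G := hK1 η (z + y)
  have n0 : |N z| ≤ K * G := hK1 η z
  have n2 : |N (z + y) - N z| ≤ K * ‖y‖ * G := hK2 η z y
  have n3 := hK3 η z y
  have tot : |N (z + y)| * Real.exp |E| ≤ K * Real.exp (2 * C1) * g := by
    calc |N (z + y)| * Real.exp |E|
        ≤ (K * G) * (Real.exp (2 * C1) * Real.exp (c / 2 * r ^ 2)) := by gcongr
      _ = K * Real.exp (2 * C1) * (G * Real.exp (c / 2 * r ^ 2)) := by ring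
      _ = _ := by rw [hGg]
  have hKe : 0 ≤ K * Real.exp (2 * C1) := by positivity
  constructor
  · rw [sliceDensity, abs_mul, abs_of_pos (Real.exp_pos _)]
    refine le_trans ?_ (tot.trans ?_)
    · change |N (z + y)| * Real.exp E ≤ _
      gcongr
      exact le_abs_self E
    · gcongr
      have : 0 ≤ K * (1 + C1 + C2) := by positivity
      nlinarith [mul_nonneg hKe (sq_nonneg C1)]
  · have hp : ∀ m : ℕ, m ≤ 4 → (1 + r) ^ m ≤ (1 + r) ^ 4 := fun m hm => weight_mono η hm
    -- Four errors: the second-order remainder of the exponential, the cubic Taylor remainder of the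
    -- density, the product of the two first increments, and the exponent minus its leading part.
    -- The first is of order `s⁴` and the others of order `s³`.
    have e : sliceDensity B F α β s z w η - sliceMain B F α β s z w η
        = N (z + y) * (Real.exp E - 1 - E)
          + (N (z + y) - N z - ∑ a, pd a N z * y a
            - (1 / 2) * ∑ a, ∑ b, pd a (pd b N) z * y a * y b)
          + (N (z + y) - N z) * E + N z * (E - s ^ 2 * L) := by
      have e1 : ∑ a, pd a N z * y a = s * (α * ∑ l, η l * pd l N z) := by
        rw [Finset.mul_sum, Finset.mul_sum]
        refine Finset.sum_congr rfl fun a _ => ?_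
        simp only [hy, Pi.smul_apply, smul_eq_mul]; ring
      have e2 : (1 / 2) * ∑ a, ∑ b, pd a (pd b N) z * y a * y b
          = s ^ 2 * ((α ^ 2 / 2) * ∑ l, ∑ m, η l * η m * pd l (pd m N) z) := by
        simp only [Finset.mul_sum]
        refine Finset.sum_congr rfl fun a _ => Finset.sum_congr rfl fun b _ => ?_
        simp only [hy, Pi.smul_apply, smul_eq_mul]; ring
      rw [e1, e2, sliceDensity, sliceMain]
      change N (z + y) * Real.exp E - _ = _
      ring
    have q1 : |N (z + y) * (Real.exp E - 1 - E)|
        ≤ K * Real.exp (2 * C1) * C1 ^ 2 * (s ^ 3 * ((1 + r) ^ 4 * g)) := by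
      rw [abs_mul]
      calc |N (z + y)| * |Real.exp E - 1 - E|
          ≤ |N (z + y)| * (|E| ^ 2 * Real.exp |E|) := by
            gcongr
            rw [sq_abs]
            exact abs_exp_sub_one_sub_id_le E
        _ = |E| ^ 2 * (|N (z + y)| * Real.exp |E|) := by ring
        _ ≤ (C1 * (s ^ 2 * (1 + r) ^ 2)) ^ 2 * (K * Real.exp (2 * C1) * g) := by gcongr
        _ = K * Real.exp (2 * C1) * C1 ^ 2 * (s ^ 4 * ((1 + r) ^ 4 * g)) := by ring
        _ ≤ _ := by
            gcongr ?_ * (?_ * ?_)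
            exact pow_le_pow_of_le_one hs hs1 (by norm_num)
    have q2 : |N (z + y) - N z - ∑ a, pd a N z * y a
            - (1 / 2) * ∑ a, ∑ b, pd a (pd b N) z * y a * y b|
        ≤ K * (s ^ 3 * ((1 + r) ^ 4 * g)) := by
      refine n3.trans ?_
      calc K * ‖y‖ ^ 3 * G ≤ K * (s * r) ^ 3 * g := by gcongr
        _ = K * (s ^ 3 * (r ^ 3 * g)) := by ring
        _ ≤ K * (s ^ 3 * ((1 + r) ^ 4 * g)) := by
            gcongr
            calc r ^ 3 ≤ (1 + r) ^ 3 := by gcongr; linarith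
              _ ≤ _ := hp 3 (by norm_num)
    have q3 : |(N (z + y) - N z) * E| ≤ K * C1 * (s ^ 3 * ((1 + r) ^ 4 * g)) := by
      rw [abs_mul]
      calc |N (z + y) - N z| * |E| ≤ (K * ‖y‖ * G) * (C1 * (s ^ 2 * (1 + r) ^ 2)) := by gcongr
        _ ≤ (K * (s * r) * g) * (C1 * (s ^ 2 * (1 + r) ^ 2)) := by gcongr
        _ = K * C1 * (s ^ 3 * (r * (1 + r) ^ 2 * g)) := by ring
        _ ≤ K * C1 * (s ^ 3 * ((1 + r) ^ 4 * g)) := by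
            gcongr
            calc r * (1 + r) ^ 2 ≤ (1 + r) * (1 + r) ^ 2 := by gcongr; linarith
              _ = (1 + r) ^ 3 := by ring
              _ ≤ _ := hp 3 (by norm_num)
    have q4 : |N z * (E - s ^ 2 * L)| ≤ K * C2 * (s ^ 3 * ((1 + r) ^ 4 * g)) := by
      rw [abs_mul]
      calc |N z| * |E - s ^ 2 * L| ≤ (K * g) * (C2 * (s ^ 3 * (1 + r) ^ 4)) := by
            gcongr
            · exact n0.trans (by gcongr)
            · refine hE2.trans ?_
              gcongr ?_ * (?_ * ?_)
              exact hp 3 (by norm_num)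
        _ = _ := by ring
    rw [e]
    refine (abs_add_le _ _).trans ((add_le_add ((abs_add_le _ _).trans (add_le_add
      ((abs_add_le _ _).trans (add_le_add q1 q2)) q3)) q4).trans ?_)
    set X := s ^ 3 * ((1 + r) ^ 4 * g) with hX
    have hX0 : 0 ≤ X := by positivity
    have : 0 ≤ K * Real.exp (2 * C1) * X := by positivity
    have e3 : (K * Real.exp (2 * C1) * (1 + C1 ^ 2) + K * (1 + C1 + C2)) * s ^ 3
        * ((1 + r) ^ 4 * g) = K * Real.exp (2 * C1) * X + K * Real.exp (2 * C1) * C1 ^ 2 * X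
          + K * X + K * C1 * X + K * C2 * X := by rw [hX]; ring
    rw [e3]
    linarith

end Slice

/-! ### Moments of the rescaled time-slice kernels -/

section Slice

variable {B : Coord d → Matrix (Fin d) (Fin d) ℝ} {F : Fin d → Coord d → ℝ} {α β : ℝ}

lemma Admissible.exists_slice_rate (h : Admissible B F) : ∃ c : ℝ, 0 < c ∧
    ∀ x (w : Fin d → ℝ), 2 * c * ‖w‖ ^ 2
      ≤ ∑ i, ∑ j, w i * ((B x)⁻¹ i j / (4 * 1)) * w j := by
  obtain ⟨κ, hκ, hq⟩ := h.exists_quadForm_ge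
  exact ⟨κ / 2, by positivity, fun x w => by rw [mul_div_cancel₀ κ two_ne_zero]; exact hq x w⟩

lemma Admissible.continuous_gaussianDensity_comp (h : Admissible B F) {X : Type*}
    [TopologicalSpace X] {a b : X → Coord d} (ha : Continuous a) (hb : Continuous b) (t : ℝ) :
    Continuous fun x => gaussianDensity (B (a x)) t (b x) := by
  have h1 : Continuous fun x => (B (a x)).det := (h.growth_det.1 ()).continuous.comp ha
  have h2 : ∀ i k, Continuous fun x => (B (a x))⁻¹ i k := fun i k =>
    ((h.growth_inv i k).1 ()).continuous.comp ha
  unfold gaussianDensity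
  refine Continuous.mul ?_ (Real.continuous_exp.comp (Continuous.neg ?_))
  · rcases le_or_gt ((4 * Real.pi * t) ^ d) 0 with ht | ht
    · have : ∀ x, Real.sqrt ((4 * Real.pi * t) ^ d * (B (a x)).det) = 0 := fun x =>
        Real.sqrt_eq_zero_of_nonpos (mul_nonpos_of_nonpos_of_nonneg ht (h.posDef _).det_pos.le)
      simp only [this]
      exact continuous_const
    · exact continuous_const.div (Real.continuous_sqrt.comp (h1.const_mul _)) fun x =>
        (Real.sqrt_pos.2 (mul_pos ht (h.posDef _).det_pos)).ne'
  · refine continuous_finsetSum _ fun i _ => continuous_finsetSum _ fun k _ => ?_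
    exact (((continuous_apply i).comp hb).mul ((h2 i k).div_const _)).mul
      ((continuous_apply k).comp hb)

lemma Admissible.continuous_slicePot_comp (h : Admissible B F) {X : Type*}
    [TopologicalSpace X] {a b : X → Coord d} (ha : Continuous a) (hb : Continuous b) :
    Continuous fun x => slicePot B F α β (a x) (b x) := by
  have h1 : ∀ i, Continuous (pd i (F i)) := fun i => ((h.growth_pd_F i i).1 ()).continuous
  have h2 : ∀ i k, Continuous (pd i (pd k (fun y => B y i k))) := fun i k =>
    (((h.growth_B i k).pd k).pd i |>.1 ()).continuous
  unfold slicePot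
  refine (continuous_const.mul (continuous_finsetSum _ fun i _ => (h1 i).comp hb)).sub
    (continuous_const.mul (continuous_finsetSum _ fun i _ => continuous_finsetSum _ fun k _ =>
      (h2 i k).comp ha))

lemma Admissible.continuous_driftShift_comp (h : Admissible B F) {X : Type*}
    [TopologicalSpace X] {a b y : X → Coord d} (ha : Continuous a) (hb : Continuous b)
    (hy : Continuous y) (k : Fin d) :
    Continuous fun x => driftShift B F α β (a x) (b x) (y x) k := by
  have h1 := (h.contDiff_F k).continuous
  have h2 := ((h.growth_divB k).1 ()).continuous
  have e1 : Continuous fun x => F k (b x + β • y x) := h1.comp (hb.add (hy.const_smul β))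
  have e2 : Continuous fun x => divB B k (a x + α • y x) := h2.comp (ha.add (hy.const_smul α))
  exact (e1.sub (h1.comp hb)).sub (continuous_const.mul (e2.sub (h2.comp ha)))

lemma Admissible.continuous_sliceDensity (h : Admissible B F) (s : ℝ) (z w : Coord d) :
    Continuous (sliceDensity B F α β s z w) := by
  unfold sliceDensity sliceExp
  have ha : Continuous fun η : Coord d => z + α • s • η := by fun_prop
  have hb : Continuous fun η : Coord d => w + β • s • η := by fun_prop
  refine (h.continuous_gaussianDensity_comp ha continuous_id 1).mul (Real.continuous_exp.comp
    (Continuous.sub ?_ ((h.continuous_slicePot_comp ha hb).const_mul _)))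
  refine continuous_finsetSum _ fun i _ => continuous_finsetSum _ fun k _ => ?_
  have h1 : Continuous fun η : Coord d => (B (z + α • s • η))⁻¹ i k :=
    ((h.growth_inv i k).1 ()).continuous.comp ha
  have h2 := fun k => h.continuous_driftShift_comp (α := α) (β := β)
    (a := fun _ : Coord d => z) (b := fun _ => w) (y := fun η => s • η) continuous_const
    continuous_const (by fun_prop) k
  have ci : Continuous fun η : Coord d => η i := continuous_apply i
  have ck : Continuous fun η : Coord d => η k := continuous_apply k
  exact ((((ci.mul h1).mul (h2 k)).const_mul s).add (((ck.mul h1).mul (h2 i)).const_mul s)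
    |>.sub ((((h2 i).mul h1).mul (h2 k)).const_mul _)).div_const _

lemma abs_coord_le (η : Coord d) (i : Fin d) : |η i| ≤ ‖η‖ := by
  simpa using norm_le_pi_norm η i

lemma abs_coord_le_weight (η : Coord d) (i : Fin d) : |η i| ≤ 1 * (1 + ‖η‖) ^ 1 := by
  have := abs_coord_le η i
  linarith

lemma abs_coord_mul_le_weight (η : Coord d) (i k : Fin d) : |η i * η k| ≤ 1 * (1 + ‖η‖) ^ 2 := by
  have h1 := abs_coord_le η i
  have h2 := abs_coord_le η k
  have := norm_nonneg η
  rw [one_mul, abs_mul, sq]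
  gcongr <;> linarith

variable {c : ℝ}

/-- Expansions of the rescaled kernel to first, second and third order. -/
lemma Admissible.exists_sliceDensity_expansions (h : Admissible B F)
    (hα : α ∈ Set.Icc (0 : ℝ) 1) (hβ : β ∈ Set.Icc (0 : ℝ) 1) (hc : 0 < c)
    (hq : ∀ x (w : Fin d → ℝ), 2 * c * ‖w‖ ^ 2
      ≤ ∑ i, ∑ j, w i * ((B x)⁻¹ i j / (4 * 1)) * w j) :
    ∃ C s₀, 0 ≤ C ∧ 0 < s₀ ∧ s₀ ≤ 1 ∧ ∀ s, 0 ≤ s → s ≤ s₀ → ∀ z w η,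
      |sliceDensity B F α β s z w η| ≤ C * Real.exp (-(c / 2 * ‖η‖ ^ 2)) ∧
      |sliceDensity B F α β s z w η - gaussianDensity (B z) 1 η|
        ≤ C * s * ((1 + ‖η‖) ^ 4 * Real.exp (-(c / 2 * ‖η‖ ^ 2))) ∧
      |sliceDensity B F α β s z w η - (gaussianDensity (B z) 1 η
          + s * (α * ∑ l, η l * pd l (fun z => gaussianDensity (B z) 1 η) z))|
        ≤ C * s ^ 2 * ((1 + ‖η‖) ^ 4 * Real.exp (-(c / 2 * ‖η‖ ^ 2))) ∧
      |sliceDensity B F α β s z w η - sliceMain B F α β s z w η|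
        ≤ C * s ^ 3 * ((1 + ‖η‖) ^ 4 * Real.exp (-(c / 2 * ‖η‖ ^ 2))) := by
  obtain ⟨C, s₀, hC0, hs₀, hs₁, hC⟩ := h.exists_sliceDensity_bound hα hβ hc hq
  have hN := h.gaussFamily hc hq
  obtain ⟨K0, hK00, hK0, -⟩ := hN.exists_bounds
  choose K1 hK10 hK1 _ _ using fun l => (hN.pd l).exists_bounds
  choose K2 hK20 hK2 _ _ using fun l m => ((hN.pd m).pd l).exists_bounds
  obtain ⟨D, hD0, hD⟩ := h.exists_sliceExpLead_bound hα hβ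
  have p1 : 0 ≤ ∑ l, K1 l := Finset.sum_nonneg fun l _ => hK10 l
  have p2 : 0 ≤ ∑ l, ∑ m, K2 l m :=
    Finset.sum_nonneg fun l _ => Finset.sum_nonneg fun m _ => hK20 l m
  set S1 := ∑ l, K1 l with hS1
  set S2 := ∑ l, ∑ m, K2 l m with hS2
  have hexp : ∀ r : ℝ, Real.exp (-(c * r ^ 2)) ≤ Real.exp (-(c / 2 * r ^ 2)) := fun r => by
    refine Real.exp_le_exp.2 ?_
    nlinarith [mul_nonneg hc.le (sq_nonneg r)]
  refine ⟨C + (D * K0 + S2) + S1, s₀, by positivity, hs₀, hs₁, fun s hs hss z w η => ?_⟩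
  obtain ⟨b0, b3⟩ := hC s hs hss z w η
  have hs1 : s ≤ 1 := hss.trans hs₁
  set g := Real.exp (-(c / 2 * ‖η‖ ^ 2)) with hg
  have hg0 : 0 ≤ g := (Real.exp_pos _).le
  set X := (1 + ‖η‖) ^ 4 * g with hX
  have hX0 : 0 ≤ X := by positivity
  set N := gaussianDensity (B z) 1 η with hNd
  set T1 := α * ∑ l, η l * pd l (fun z => gaussianDensity (B z) 1 η) z with hT1
  set T2 := sliceExpLead B F α β z w η * N + (α ^ 2 / 2) *
      ∑ l, ∑ m, η l * η m * pd l (pd m (fun z => gaussianDensity (B z) 1 η)) z with hT2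
  have hM : sliceMain B F α β s z w η = N + s * T1 + s ^ 2 * T2 := rfl
  have hη := norm_nonneg η
  have t1 : |T1| ≤ S1 * X := by
    rw [hT1, abs_mul, abs_of_nonneg hα.1]
    have u : |∑ l, η l * pd l (fun z => gaussianDensity (B z) 1 η) z| ≤ S1 * X := by
      rw [hS1, Finset.sum_mul]
      refine (Finset.abs_sum_le_sum_abs _ _).trans (Finset.sum_le_sum fun l _ => ?_)
      rw [abs_mul]
      calc |η l| * |pd l (fun z => gaussianDensity (B z) 1 η) z| ≤ (1 + ‖η‖) ^ 4 * (K1 l * g) := by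
            gcongr
            · have h1 := abs_coord_le_weight η l
              rw [one_mul] at h1
              exact h1.trans (weight_mono η (by norm_num))
            · exact (hK1 l η z).trans (mul_le_mul_of_nonneg_left (hexp _) (hK10 l))
        _ = _ := by ring
    calc α * _ ≤ 1 * (S1 * X) := by gcongr; exact hα.2
      _ = _ := one_mul _
  have t2 : |T2| ≤ (D * K0 + S2) * X := by
    rw [hT2]
    refine (abs_add_le _ _).trans ?_
    rw [add_mul]
    refine add_le_add ?_ ?_
    · rw [abs_mul]
      calc _ ≤ (D * (1 + ‖η‖) ^ 4) * (K0 * g) := by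
            gcongr
            · refine (hD z w η).trans ?_
              gcongr
              · linarith
              · norm_num
            · exact (hK0 η z).trans (mul_le_mul_of_nonneg_left (hexp _) hK00)
        _ = _ := by ring
    · rw [abs_mul, abs_of_nonneg (by positivity)]
      have u : |∑ l, ∑ m, η l * η m * pd l (pd m (fun z => gaussianDensity (B z) 1 η)) z|
          ≤ S2 * X := by
        rw [hS2, Finset.sum_mul]
        refine (Finset.abs_sum_le_sum_abs _ _).trans (Finset.sum_le_sum fun l _ => ?_)
        rw [Finset.sum_mul]
        refine (Finset.abs_sum_le_sum_abs _ _).trans (Finset.sum_le_sum fun m _ => ?_)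
        rw [abs_mul]
        calc |η l * η m| * |pd l (pd m (fun z => gaussianDensity (B z) 1 η)) z|
            ≤ (1 + ‖η‖) ^ 4 * (K2 l m * g) := by
              gcongr
              · have h1 := abs_coord_mul_le_weight η l m
                rw [one_mul] at h1
                exact h1.trans (weight_mono η (by norm_num))
              · exact (hK2 l m η z).trans (mul_le_mul_of_nonneg_left (hexp _) (hK20 l m))
          _ = _ := by ring
      have ha : α ^ 2 / 2 ≤ 1 := by have := pow_le_one₀ hα.1 hα.2 (n := 2); linarith
      calc α ^ 2 / 2 * _ ≤ 1 * (S2 * X) := by gcongr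
        _ = _ := one_mul _
  have hs2 : s ^ 3 ≤ s ^ 2 := pow_le_pow_of_le_one hs hs1 (by norm_num)
  have hs3 : s ^ 2 ≤ s := by nlinarith
  have b2 : |sliceDensity B F α β s z w η - (N + s * T1)| ≤ (C + (D * K0 + S2)) * s ^ 2 * X := by
    have e : sliceDensity B F α β s z w η - (N + s * T1)
        = (sliceDensity B F α β s z w η - sliceMain B F α β s z w η) + s ^ 2 * T2 := by
      rw [hM]; ring
    rw [e]
    refine (abs_add_le _ _).trans ?_
    rw [abs_mul, abs_of_nonneg (sq_nonneg s)]
    calc _ ≤ C * s ^ 2 * X + s ^ 2 * ((D * K0 + S2) * X) := by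
          gcongr
          exact b3.trans (by gcongr)
      _ = _ := by ring
  have b1 : |sliceDensity B F α β s z w η - N| ≤ (C + (D * K0 + S2) + S1) * s * X := by
    have e : sliceDensity B F α β s z w η - N
        = (sliceDensity B F α β s z w η - (N + s * T1)) + s * T1 := by ring
    rw [e]
    refine (abs_add_le _ _).trans ?_
    rw [abs_mul, abs_of_nonneg hs]
    calc _ ≤ (C + (D * K0 + S2)) * s * X + s * (S1 * X) := by
          gcongr
          exact b2.trans (by gcongr)
      _ = _ := by ring
  have hCle : C ≤ C + (D * K0 + S2) + S1 := by
    have : 0 ≤ D * K0 + S2 := by positivity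
    linarith
  refine ⟨b0.trans (by gcongr), b1, b2.trans ?_, b3.trans (by gcongr)⟩
  have : C + (D * K0 + S2) ≤ C + (D * K0 + S2) + S1 := by linarith
  exact mul_le_mul_of_nonneg_right (mul_le_mul_of_nonneg_right this (sq_nonneg s)) hX0

/-- Moments of the rescaled time-slice kernels. -/
lemma Admissible.exists_slice_moments (h : Admissible B F)
    (hα : α ∈ Set.Icc (0 : ℝ) 1) (hβ : β ∈ Set.Icc (0 : ℝ) 1) :
    ∃ C s₀, 0 ≤ C ∧ 0 < s₀ ∧ s₀ ≤ 1 ∧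
      (∀ s, 0 ≤ s → s ≤ s₀ → ∀ z w,
        |(∫ η, sliceDensity B F α β s z w η) - 1| ≤ C * s ^ 3 ∧
        (∀ i, |(∫ η, η i * sliceDensity B F α β s z w η) - s * (2 * α * divB B i z)|
          ≤ C * s ^ 2) ∧
        ∀ i k, |(∫ η, η i * η k * sliceDensity B F α β s z w η) - 2 * B z i k| ≤ C * s) ∧
      ∀ n : ℕ, ∃ J, 0 ≤ J ∧ ∀ s, 0 ≤ s → s ≤ s₀ → ∀ z w,
        Integrable (fun η => (1 + ‖η‖) ^ n * sliceDensity B F α β s z w η) ∧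
        ∫ η, (1 + ‖η‖) ^ n * sliceDensity B F α β s z w η ≤ J := by
  obtain ⟨c, hc, hq⟩ := h.exists_slice_rate
  obtain ⟨C, s₀, hC0, hs₀, hs₁, hC⟩ := h.exists_sliceDensity_expansions hα hβ hc hq
  have hc2 : 0 < c / 2 := by positivity
  have hN := h.gaussFamily hc hq
  have hcont := fun s z w => h.continuous_sliceDensity (α := α) (β := β) s z w
  have hint : ∀ s, 0 ≤ s → s ≤ s₀ → ∀ z w (f : Coord d → ℝ) (n : ℕ), Continuous f →
      (∀ η, |f η| ≤ 1 * (1 + ‖η‖) ^ n) →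
      Integrable (fun η => f η * sliceDensity B F α β s z w η) ∧
      |∫ η, f η * sliceDensity B F α β s z w η| ≤ C * gaussConst d (c / 2) n := by
    intro s hs hss z w f n hf hfn
    refine integrable_of_gauss_bound hc2 (hf.mul (hcont s z w)).aestronglyMeasurable fun η => ?_
    rw [Pi.mul_apply, abs_mul]
    have h1 := hfn η
    rw [one_mul] at h1
    calc _ ≤ (1 + ‖η‖) ^ n * (C * Real.exp (-(c / 2 * ‖η‖ ^ 2))) := by
          gcongr
          exact (hC s hs hss z w η).1
      _ = _ := by ring
  have hdiff : ∀ s, 0 ≤ s → s ≤ s₀ → ∀ z w (f m : Coord d → ℝ) (n : ℕ) (t : ℝ), Continuous f →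
      (∀ η, |f η| ≤ 1 * (1 + ‖η‖) ^ n) → Integrable (fun η => f η * m η) →
      (∀ η, |sliceDensity B F α β s z w η - m η|
        ≤ C * t * ((1 + ‖η‖) ^ 4 * Real.exp (-(c / 2 * ‖η‖ ^ 2)))) →
      |(∫ η, f η * sliceDensity B F α β s z w η) - ∫ η, f η * m η|
        ≤ C * t * gaussConst d (c / 2) (n + 4) := by
    intro s hs hss z w f m n t hf hfn hm hb
    have hi := (hint s hs hss z w f n hf hfn).1
    rw [← integral_sub hi hm]
    refine (integrable_of_gauss_bound hc2 (hi.sub hm).aestronglyMeasurable fun η => ?_).2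
    rw [Pi.sub_apply, ← mul_sub, abs_mul]
    have h1 := hfn η
    rw [one_mul] at h1
    calc _ ≤ (1 + ‖η‖) ^ n * (C * t * ((1 + ‖η‖) ^ 4 * Real.exp (-(c / 2 * ‖η‖ ^ 2)))) := by
          gcongr
          exact hb η
      _ = _ := by rw [pow_add]; ring
  have hmom := fun z => gaussianDensity_moments (h.posDef z) (by positivity : 0 < 2 * c) (hq z)
  have hBd : ∀ i k, Differentiable ℝ fun z => 2 * B z i k := fun i k =>
    ((h.contDiff_B i k).differentiable (by norm_num)).const_mul 2
  have hpB : ∀ i k l, pd l (fun z => 2 * B z i k) = fun z => 2 * pd l (fun z => B z i k) z :=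
    fun i k l => by
      ext z
      exact pd_const_mul ((h.contDiff_B i k).differentiable (by norm_num) z) _ _
  -- Moments of derivatives of the density in the base point are derivatives of its moments. The
  -- mean is zero for all `z` and the covariance is `2 B z`.
  have d1 : ∀ l z, ∫ η : Coord d, η l * pd l (fun z => gaussianDensity (B z) 1 η) z = 0 :=
    fun l z => by
      rw [hN.integral_pd hc (f := fun η => η l) (by fun_prop) (fun η => abs_coord_le_weight η l)
        (differentiable_const 0) (fun z => (hmom z).1 l) l z]
      exact pd_const 0 l z
  have d2 : ∀ i k l z, ∫ η : Coord d, η i * η k * pd l (fun z => gaussianDensity (B z) 1 η) z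
      = pd l (fun z => 2 * B z i k) z := fun i k l z =>
    hN.integral_pd hc (f := fun η => η i * η k) (by fun_prop)
      (fun η => abs_coord_mul_le_weight η i k) (hBd i k) (fun z => (hmom z).2 i k) l z
  have d3 : ∀ l m z, ∫ η : Coord d, η l * η m * pd l (pd m (fun z => gaussianDensity (B z) 1 η)) z
      = 2 * pd l (pd m (fun z => B z l m)) z := fun l m z => by
    have hs : ContDiff ℝ ∞ (pd m (fun z => B z l m)) := contDiff_pd (h.contDiff_B l m) m
    rw [(hN.pd m).integral_pd hc (f := fun η => η l * η m) (by fun_prop)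
      (fun η => abs_coord_mul_le_weight η l m) (g := pd m (fun z => 2 * B z l m))
      (by rw [hpB]; exact (hs.differentiable (by norm_num)).const_mul 2)
      (fun z => d2 l m m z) l z, hpB]
    exact pd_const_mul (hs.differentiable (by norm_num) z) _ _
  have i1 : ∀ l m z, Integrable fun η : Coord d =>
      η l * pd m (fun z => gaussianDensity (B z) 1 η) z := fun l m z =>
    (hN.pd m).integrable_mul hc (f := fun η => η l) (by fun_prop)
      (fun η => abs_coord_le_weight η l) z
  have i2 : ∀ i k l z, Integrable fun η : Coord d =>
      η i * η k * pd l (fun z => gaussianDensity (B z) 1 η) z := fun i k l z =>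
    (hN.pd l).integrable_mul hc (f := fun η => η i * η k) (by fun_prop)
      (fun η => abs_coord_mul_le_weight η i k) z
  have i3 : ∀ l m z, Integrable fun η : Coord d =>
      η l * η m * pd l (pd m (fun z => gaussianDensity (B z) 1 η)) z := fun l m z =>
    ((hN.pd m).pd l).integrable_mul hc (f := fun η => η l * η m) (by fun_prop)
      (fun η => abs_coord_mul_le_weight η l m) z
  have i4 : ∀ i k z, Integrable fun η : Coord d => η i * η k * gaussianDensity (B z) 1 η :=
    fun i k z => hN.integrable_mul hc (f := fun η => η i * η k) (by fun_prop)
      (fun η => abs_coord_mul_le_weight η i k) z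
  have i5 : ∀ i z, Integrable fun η : Coord d => η i * gaussianDensity (B z) 1 η :=
    fun i z => hN.integrable_mul hc (f := fun η => η i) (by fun_prop)
      (fun η => abs_coord_le_weight η i) z
  have i6 : ∀ z, Integrable fun η : Coord d => gaussianDensity (B z) 1 η := fun z => by
    simpa using hN.integrable_mul hc (f := fun _ => 1) (A := 1) (n := 0) continuous_const
      (by simp) z
  -- Against the covariance `2B`, the inverse matrix cancels and the linearized shift contributes
  -- its trace `β ∂F - 2α² ∂∂B`. Subtracting the potential `β ∂F - α² ∂∂B` removes the `F`-part and
  -- leaves `-α² ∂∂B`.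
  have lead : ∀ z w, Integrable (fun η => sliceExpLead B F α β z w η * gaussianDensity (B z) 1 η) ∧
      ∫ η, sliceExpLead B F α β z w η * gaussianDensity (B z) 1 η
        = -(α ^ 2 * ∑ i, ∑ j, pd i (pd j (fun y => B y i j)) z) := by
    intro z w
    set a : Fin d → Fin d → ℝ := fun k l => β * pd l (F k) w - 2 * α ^ 2 * pd l (divB B k) z
      with ha
    set Q := (B z)⁻¹ with hQ
    have e : ∀ η, sliceExpLead B F α β z w η * gaussianDensity (B z) 1 η
        = (∑ i, ∑ k, ∑ l, (Q i k * a k l / 4 * (η i * η l * gaussianDensity (B z) 1 η)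
          + Q i k * a i l / 4 * (η k * η l * gaussianDensity (B z) 1 η)))
          - slicePot B F α β z w * gaussianDensity (B z) 1 η := fun η => by
      rw [sliceExpLead, sub_mul, Finset.sum_mul]
      congr 1
      refine Finset.sum_congr rfl fun i _ => ?_
      rw [Finset.sum_mul]
      refine Finset.sum_congr rfl fun k _ => ?_
      simp only [driftShiftLin, Finset.mul_sum, ← Finset.sum_add_distrib, Finset.sum_div,
        Finset.sum_mul]
      refine Finset.sum_congr rfl fun l _ => ?_
      rw [ha]
      ring
    have hi : ∀ i k l, Integrable fun η : Coord d =>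
        (Q i k * a k l / 4 * (η i * η l * gaussianDensity (B z) 1 η)
          + Q i k * a i l / 4 * (η k * η l * gaussianDensity (B z) 1 η)) := fun i k l =>
      ((i4 i l z).const_mul _).add ((i4 k l z).const_mul _)
    have hiS : Integrable fun η : Coord d => ∑ i, ∑ k, ∑ l,
        (Q i k * a k l / 4 * (η i * η l * gaussianDensity (B z) 1 η)
          + Q i k * a i l / 4 * (η k * η l * gaussianDensity (B z) 1 η)) :=
      integrable_finsetSum _ fun i _ => integrable_finsetSum _ fun k _ =>
        integrable_finsetSum _ fun l _ => hi i k l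
    simp only [e]
    refine ⟨hiS.sub ((i6 z).const_mul _), ?_⟩
    rw [integral_sub hiS ((i6 z).const_mul _), integral_const_mul,
      integral_gaussianDensity (h.posDef z),
      integral_finsetSum _ fun i _ => integrable_finsetSum _ fun k _ =>
        integrable_finsetSum _ fun l _ => hi i k l]
    have e2 : ∀ i, ∫ η : Coord d, ∑ k, ∑ l,
        (Q i k * a k l / 4 * (η i * η l * gaussianDensity (B z) 1 η)
          + Q i k * a i l / 4 * (η k * η l * gaussianDensity (B z) 1 η))
        = ∑ k, ∑ l, (Q i k * a k l / 4 * (2 * B z i l) + Q i k * a i l / 4 * (2 * B z k l)) := by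
      intro i
      rw [integral_finsetSum _ fun k _ => integrable_finsetSum _ fun l _ => hi i k l]
      refine Finset.sum_congr rfl fun k _ => ?_
      rw [integral_finsetSum _ fun l _ => hi i k l]
      refine Finset.sum_congr rfl fun l _ => ?_
      rw [integral_add ((i4 i l z).const_mul _) ((i4 k l z).const_mul _), integral_const_mul,
        integral_const_mul, (hmom z).2, (hmom z).2]
    simp only [e2]
    have hu : IsUnit (B z).det := isUnit_iff_ne_zero.2 (h.posDef z).det_pos.ne'
    have hBQ : ∀ l k, ∑ i, B z i l * Q i k = if l = k then 1 else 0 := fun l k => by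
      have := congrFun (congrFun (Matrix.mul_nonsing_inv _ hu) l) k
      rw [Matrix.mul_apply, Matrix.one_apply] at this
      simpa only [h.symm z l] using this
    have hQB : ∀ i l, ∑ k, Q i k * B z k l = if i = l then 1 else 0 := fun i l => by
      have := congrFun (congrFun (Matrix.nonsing_inv_mul _ hu) i) l
      rwa [Matrix.mul_apply, Matrix.one_apply] at this
    have s1 : ∑ i, ∑ k, ∑ l, Q i k * a k l / 4 * (2 * B z i l) = (1 / 2) * ∑ k, a k k := by
      calc _ = ∑ k, ∑ l, ∑ i, Q i k * a k l / 4 * (2 * B z i l) := by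
            rw [Finset.sum_comm]
            exact Finset.sum_congr rfl fun k _ => Finset.sum_comm
        _ = ∑ k, ∑ l, a k l / 2 * ∑ i, B z i l * Q i k := by
            refine Finset.sum_congr rfl fun k _ => Finset.sum_congr rfl fun l _ => ?_
            rw [Finset.mul_sum]
            exact Finset.sum_congr rfl fun i _ => by ring
        _ = _ := by
            simp only [hBQ]
            simp [Finset.mul_sum]
            exact Finset.sum_congr rfl fun k _ => by ring
    have s2 : ∑ i, ∑ k, ∑ l, Q i k * a i l / 4 * (2 * B z k l) = (1 / 2) * ∑ k, a k k := by
      calc _ = ∑ i, ∑ l, ∑ k, Q i k * a i l / 4 * (2 * B z k l) :=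
            Finset.sum_congr rfl fun i _ => Finset.sum_comm
        _ = ∑ i, ∑ l, a i l / 2 * ∑ k, Q i k * B z k l := by
            refine Finset.sum_congr rfl fun k _ => Finset.sum_congr rfl fun l _ => ?_
            rw [Finset.mul_sum]
            exact Finset.sum_congr rfl fun i _ => by ring
        _ = _ := by
            simp only [hQB]
            simp [Finset.mul_sum]
            exact Finset.sum_congr rfl fun k _ => by ring
    simp only [Finset.sum_add_distrib]
    rw [s1, s2, slicePot]
    have s3 : ∑ k, a k k = β * (∑ i, pd i (F i) w)
        - 2 * α ^ 2 * ∑ i, ∑ k, pd i (pd k (fun y => B y i k)) z := by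
      simp only [ha, Finset.sum_sub_distrib, ← Finset.mul_sum]
      congr 2
      refine Finset.sum_congr rfl fun i _ => ?_
      exact pd_sum (f := fun k => pd k (fun y => B y i k)) _ (fun k _ =>
        (contDiff_pd (h.contDiff_B i k) k).differentiable (by norm_num) z) i
    rw [s3]
    ring
  refine ⟨C * gaussConst d (c / 2) (0 + 4) + C * gaussConst d (c / 2) (1 + 4)
    + C * gaussConst d (c / 2) (2 + 4), s₀, ?_, hs₀, hs₁, fun s hs hss z w => ⟨?_, fun i => ?_,
    fun i k => ?_⟩, fun n => ⟨C * gaussConst d (c / 2) n, ?_, fun s hs hss z w => ?_⟩⟩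
  · have := gaussConst_nonneg d (c / 2); have g0 := this (0 + 4); have g1 := this (1 + 4)
    have g2 := this (2 + 4)
    positivity
  · have hb := hdiff s hs hss z w (fun _ => 1) (sliceMain B F α β s z w) 0 (s ^ 3)
      continuous_const (by simp)
    have j1 : Integrable fun η : Coord d =>
        ∑ l, η l * pd l (fun z => gaussianDensity (B z) 1 η) z :=
      integrable_finsetSum _ fun l _ => i1 l l z
    have j2 : Integrable fun η : Coord d =>
        ∑ l, ∑ m, η l * η m * pd l (pd m (fun z => gaussianDensity (B z) 1 η)) z :=
      integrable_finsetSum _ fun l _ => integrable_finsetSum _ fun m _ => i3 l m z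
    have j5 : Integrable fun η => sliceExpLead B F α β z w η * gaussianDensity (B z) 1 η
        + (α ^ 2 / 2) * ∑ l, ∑ m, η l * η m * pd l (pd m (fun z => gaussianDensity (B z) 1 η)) z :=
      (lead z w).1.add (j2.const_mul _)
    have j3 := j5.const_mul (s ^ 2)
    have j4 : Integrable fun η : Coord d => gaussianDensity (B z) 1 η
        + s * (α * ∑ l, η l * pd l (fun z => gaussianDensity (B z) 1 η) z) := (i6 z).add ((j1.const_mul α).const_mul s)
    have hMi : Integrable (sliceMain B F α β s z w) := j4.add j3
    -- This cancellation fixes the correction terms of the action: the second-order Taylor term of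
    -- the moving covariance gives `+α² ∂∂B`, the opposite of the leading exponent, and the term of
    -- order `s` integrates to zero.
    have hMe : ∫ η, sliceMain B F α β s z w η = 1 := by
      have e1 : ∫ η : Coord d, ∑ l, η l * pd l (fun z => gaussianDensity (B z) 1 η) z = 0 := by
        rw [integral_finsetSum _ fun l _ => i1 l l z]
        exact Finset.sum_eq_zero fun l _ => d1 l z
      have e2 : ∫ η : Coord d, ∑ l, ∑ m, η l * η m
          * pd l (pd m (fun z => gaussianDensity (B z) 1 η)) z
          = 2 * ∑ l, ∑ m, pd l (pd m (fun z => B z l m)) z := by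
        rw [integral_finsetSum _ fun l _ => integrable_finsetSum _ fun m _ => i3 l m z,
          Finset.mul_sum]
        refine Finset.sum_congr rfl fun l _ => ?_
        rw [integral_finsetSum _ fun m _ => i3 l m z, Finset.mul_sum]
        exact Finset.sum_congr rfl fun m _ => d3 l m z
      calc ∫ η, sliceMain B F α β s z w η
          = ∫ η, ((gaussianDensity (B z) 1 η
            + s * (α * ∑ l, η l * pd l (fun z => gaussianDensity (B z) 1 η) z))
            + s ^ 2 * (sliceExpLead B F α β z w η * gaussianDensity (B z) 1 η + (α ^ 2 / 2) *
              ∑ l, ∑ m, η l * η m * pd l (pd m (fun z => gaussianDensity (B z) 1 η)) z)) := rfl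
        _ = (1 + s * (α * 0)) + s ^ 2 * (-(α ^ 2 * ∑ i, ∑ j, pd i (pd j (fun y => B y i j)) z)
            + α ^ 2 / 2 * (2 * ∑ l, ∑ m, pd l (pd m (fun z => B z l m)) z)) := by
            rw [integral_add j4 j3, integral_add (i6 z) ((j1.const_mul α).const_mul s),
              integral_const_mul, integral_const_mul, integral_const_mul,
              integral_add (lead z w).1 (j2.const_mul _), integral_const_mul, e1, e2,
              (lead z w).2, integral_gaussianDensity (h.posDef z)]
        _ = 1 := by ring
    simp only [one_mul] at hb
    have hb' := hb hMi fun η => (hC s hs hss z w η).2.2.2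
    rw [hMe] at hb'
    refine hb'.trans ?_
    have g1 := gaussConst_nonneg d (c / 2) (1 + 4)
    have g2 := gaussConst_nonneg d (c / 2) (2 + 4)
    have : 0 ≤ C * gaussConst d (c / 2) (1 + 4) + C * gaussConst d (c / 2) (2 + 4) := by positivity
    have hs3 : 0 ≤ s ^ 3 := by positivity
    nlinarith
  · have j1 : Integrable fun η : Coord d => η i * gaussianDensity (B z) 1 η
        + s * (α * ∑ l, η i * η l * pd l (fun z => gaussianDensity (B z) 1 η) z) :=
      (i5 i z).add (((integrable_finsetSum _ fun l _ => i2 i l l z).const_mul α).const_mul s)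
    have e : ∀ η : Coord d, η i * (gaussianDensity (B z) 1 η
          + s * (α * ∑ l, η l * pd l (fun z => gaussianDensity (B z) 1 η) z))
        = η i * gaussianDensity (B z) 1 η
        + s * (α * ∑ l, η i * η l * pd l (fun z => gaussianDensity (B z) 1 η) z) := fun η => by
      have : ∑ l, η i * η l * pd l (fun z => gaussianDensity (B z) 1 η) z
          = η i * ∑ l, η l * pd l (fun z => gaussianDensity (B z) 1 η) z := by
        rw [Finset.mul_sum]; exact Finset.sum_congr rfl fun l _ => by ring
      rw [this]; ring
    have hb := hdiff s hs hss z w (fun η => η i) (fun η => gaussianDensity (B z) 1 η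
          + s * (α * ∑ l, η l * pd l (fun z => gaussianDensity (B z) 1 η) z)) 1 (s ^ 2)
      (by fun_prop) (fun η => abs_coord_le_weight η i) (by simpa only [e] using j1)
      fun η => (hC s hs hss z w η).2.2.1
    -- The covariance evaluated at the moving point biases the mean by `2αs ∂ₖB^{ik}`. In the
    -- original variable this is `2αs² ∂ₖB^{ik}`, which cancels the shift in `sliceDrift`.
    have hv : ∫ η : Coord d, (η i * gaussianDensity (B z) 1 η
        + s * (α * ∑ l, η i * η l * pd l (fun z => gaussianDensity (B z) 1 η) z))
        = s * (2 * α * divB B i z) := by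
      rw [integral_add (i5 i z) (((integrable_finsetSum _ fun l _ =>
        i2 i l l z).const_mul α).const_mul s), integral_const_mul, integral_const_mul,
        integral_finsetSum _ fun l _ => i2 i l l z, (hmom z).1 i]
      simp only [d2, hpB, divB, ← Finset.mul_sum]
      ring
    simp only [e] at hb
    rw [hv] at hb
    refine hb.trans ?_
    have g1 := gaussConst_nonneg d (c / 2) (0 + 4)
    have g2 := gaussConst_nonneg d (c / 2) (2 + 4)
    have : 0 ≤ C * gaussConst d (c / 2) (0 + 4) + C * gaussConst d (c / 2) (2 + 4) := by positivity
    have hs3 : 0 ≤ s ^ 2 := by positivity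
    nlinarith
  · have hb := hdiff s hs hss z w (fun η => η i * η k) (fun η => gaussianDensity (B z) 1 η) 2 s
      (by fun_prop) (fun η => abs_coord_mul_le_weight η i k) (i4 i k z)
      fun η => (hC s hs hss z w η).2.1
    rw [(hmom z).2 i k] at hb
    refine hb.trans ?_
    have g1 := gaussConst_nonneg d (c / 2) (0 + 4)
    have g2 := gaussConst_nonneg d (c / 2) (1 + 4)
    have : 0 ≤ C * gaussConst d (c / 2) (0 + 4) + C * gaussConst d (c / 2) (1 + 4) := by positivity
    nlinarith
  · have := gaussConst_nonneg d (c / 2) n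
    positivity
  · have := hint s hs hss z w (fun η => (1 + ‖η‖) ^ n) n (by fun_prop) fun η => by
      rw [abs_of_nonneg (by positivity), one_mul]
    exact ⟨this.1, (le_abs_self _).trans this.2⟩

end Slice

/-! ### Time-slice kernels -/

/-- The two-parameter kernel with coefficients `B` and `F`. -/
def sliceKernel (B : Coord d → Matrix (Fin d) (Fin d) ℝ) (F : Fin d → Coord d → ℝ) (α β : ℝ) :
    SliceKernel d := fun t x₀ x =>
  gaussianDensity (B (interp α x₀ x)) t (fun i => (x i - x₀ i) - F i (interp β x₀ x) * t
    + 2 * α * divB B i (interp α x₀ x) * t)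
    * Real.exp (-(slicePot B F α β (interp α x₀ x) (interp β x₀ x) * t))

lemma twoAlphaKernel_eq (g L : Coord d → Matrix (Fin d) (Fin d) ℝ) (U : Coord d → ℝ) (α β : ℝ) :
    twoAlphaKernel g L U α β = sliceKernel (symPart L) (drift g L U) α β := by
  funext t x₀ x
  simp only [twoAlphaKernel, sliceKernel, prefactor, actionTwo, kinetic, gaussianDensity, slicePot,
    divB]
  rw [mul_assoc (1 / Real.sqrt _), ← Real.exp_add]
  congr 2
  ring

lemma alphaKernel_eq (g L : Coord d → Matrix (Fin d) (Fin d) ℝ) (U : Coord d → ℝ) (α : ℝ) :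
    alphaKernel g L U α = twoAlphaKernel g L U α α := by
  funext t x₀ x
  simp only [alphaKernel, twoAlphaKernel, actionOne, actionTwo]
  have : (fun i => (x i - x₀ i) - t * (drift g L U i (interp α x₀ x)
        - 2 * α * ∑ k, pd k (fun y => symPart L y i k) (interp α x₀ x)))
      = fun i => (x i - x₀ i) - drift g L U i (interp α x₀ x) * t
      + 2 * α * (∑ k, pd k (fun y => symPart L y i k) (interp α x₀ x)) * t := by
    funext i; ring
  rw [this]
  congr 2
  ring

lemma interp_zero (x₀ x : Coord d) : interp 0 x₀ x = x₀ := by simp [interp]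

lemma gaussianKernel_eq (g L : Coord d → Matrix (Fin d) (Fin d) ℝ) (U : Coord d → ℝ) :
    gaussianKernel g L U = twoAlphaKernel g L U 0 0 := by
  funext t x₀ x
  simp only [gaussianKernel, twoAlphaKernel, action0, actionTwo, interp_zero]
  have : (fun i => (x i - x₀ i) - t * drift g L U i x₀)
      = fun i => (x i - x₀ i) - drift g L U i x₀ * t
      + 2 * 0 * (∑ k, pd k (fun y => symPart L y i k) x₀) * t := by
    funext i; ring
  rw [this]
  congr 2
  ring

section Kernel

variable {B : Coord d → Matrix (Fin d) (Fin d) ℝ} {F : Fin d → Coord d → ℝ} {α β : ℝ}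

lemma sliceKernel_nonneg (t : ℝ) (x₀ x : Coord d) : 0 ≤ sliceKernel B F α β t x₀ x :=
  mul_nonneg (gaussianDensity_nonneg _ _ _) (Real.exp_pos _).le

lemma continuous_interp (α : ℝ) : Continuous fun z : Coord d × Coord d => interp α z.1 z.2 := by
  unfold interp
  fun_prop

lemma Admissible.continuous_sliceKernel (h : Admissible B F) (t : ℝ) :
    Continuous fun z : Coord d × Coord d => sliceKernel B F α β t z.1 z.2 := by
  have ha := continuous_interp (d := d) α
  have hb := continuous_interp (d := d) β
  refine (h.continuous_gaussianDensity_comp ha (continuous_pi fun i => ?_) t).mul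
    (Real.continuous_exp.comp ((h.continuous_slicePot_comp ha hb).mul_const t).neg)
  have h1 : Continuous fun z : Coord d × Coord d => F i (interp β z.1 z.2) :=
    (h.contDiff_F i).continuous.comp hb
  have h2 : Continuous fun z : Coord d × Coord d => divB B i (interp α z.1 z.2) :=
    ((h.growth_divB i).1 ()).continuous.comp ha
  have h3 : Continuous fun z : Coord d × Coord d => z.2 i - z.1 i := by fun_prop
  exact (h3.sub (h1.mul_const t)).add ((h2.const_mul (2 * α)).mul_const t)

/-- The drift of the time-slice kernel, `F - 2 α div B`. -/
def sliceDrift (B : Coord d → Matrix (Fin d) (Fin d) ℝ) (F : Fin d → Coord d → ℝ) (α : ℝ)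
    (k : Fin d) (x : Coord d) : ℝ := F k x - 2 * α * divB B k x

/-- The peak of the time-slice kernel. -/
lemma Admissible.exists_peak (h : Admissible B F) (hα : α ∈ Set.Icc (0 : ℝ) 1)
    (hβ : β ∈ Set.Icc (0 : ℝ) 1) : ∃ C s₀, 0 ≤ C ∧ 0 < s₀ ∧ s₀ ≤ 1 ∧ ∀ s x₀, 0 < s → s ≤ s₀ →
      ∃ m : Coord d, (∀ k, m k = s ^ 2 * (sliceDrift B F α k x₀ + driftShift B F α β x₀ x₀ m k)) ∧
        ‖m‖ ≤ C * s ^ 2 * (1 + ‖x₀‖) ∧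
        ∀ k, |m k - s ^ 2 * sliceDrift B F α k x₀| ≤ C * s ^ 4 * (1 + ‖x₀‖) := by
  obtain ⟨D, hD0, hD⟩ := h.exists_driftShift_bound hα hβ
  have hD1 : ∀ z w y k, |driftShift B F α β z w y k| ≤ D * ‖y‖ := fun z w y k => by
    simpa using (hD 1 zero_le_one z w y k).1
  obtain ⟨K, hK0, hK⟩ := h.linear_F
  choose E hE0 hE using fun k => (h.growth_divB k).exists_bound
  set E' := ∑ k, E k with hE'
  have hE'0 : 0 ≤ E' := Finset.sum_nonneg fun k _ => hE0 k
  have hb : ∀ k x, |sliceDrift B F α k x| ≤ (K + 2 * E') * (1 + ‖x‖) := fun k x => by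
    have h1 := hK k x
    have h2 : |divB B k x| ≤ E' :=
      (hE k () x).trans (Finset.single_le_sum (fun k _ => hE0 k) (Finset.mem_univ k))
    have h3 : |2 * α * divB B k x| ≤ 2 * E' := by
      rw [abs_mul, abs_mul, abs_of_nonneg hα.1, abs_two]
      calc _ ≤ 2 * 1 * E' := by gcongr; exact hα.2
        _ = _ := by ring
    have h4 := norm_nonneg x
    calc _ ≤ |F k x| + |2 * α * divB B k x| := abs_sub _ _
      _ ≤ K * (1 + ‖x‖) + 2 * E' * 1 := by linarith
      _ ≤ K * (1 + ‖x‖) + 2 * E' * (1 + ‖x‖) := by gcongr; linarith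
      _ = _ := by ring
  set M := K + 2 * E' with hM
  have hM0 : 0 ≤ M := by positivity
  refine ⟨2 * M + D * (2 * M), min 1 (1 / (2 * (D + 1))), by positivity, by positivity,
    min_le_left _ _, fun s x₀ hs hss => ?_⟩
  have hs1 : s ≤ 1 := hss.trans (min_le_left _ _)
  have hsD : s ^ 2 * D ≤ 1 / 2 := by
    have h1 : s ≤ 1 / (2 * (D + 1)) := hss.trans (min_le_right _ _)
    calc s ^ 2 * D ≤ s * (D + 1) := by
          have h2 : s ^ 2 ≤ s := by nlinarith
          have h3 := mul_le_mul_of_nonneg_right h2 hD0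
          linarith
      _ ≤ 1 / (2 * (D + 1)) * (D + 1) := by gcongr
      _ = 1 / 2 := by field_simp
  -- The equation for the zero of the displacement vector is a fixed-point problem. The prefactor
  -- `s²` makes it a contraction, with the same `s₀` for all `x₀` because the shift is Lipschitz
  -- uniformly in its base points.
  let T : Coord d → Coord d := fun m k =>
    s ^ 2 * (sliceDrift B F α k x₀ + driftShift B F α β x₀ x₀ m k)
  have hT : ContractingWith (1 / 2) T := by
    refine ⟨by norm_num, LipschitzWith.of_dist_le_mul fun m m' => ?_⟩
    refine (dist_pi_le_iff (by positivity)).2 fun k => ?_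
    -- Rebasing at the interpolation points of `m'` turns the difference of two shifts into a single
    -- shift along `m - m'`.
    have e : T m k - T m' k
        = s ^ 2 * driftShift B F α β (x₀ + α • m') (x₀ + β • m') (m - m') k := by
      have e1 : x₀ + α • m' + α • (m - m') = x₀ + α • m := by module
      have e2 : x₀ + β • m' + β • (m - m') = x₀ + β • m := by module
      simp only [T, driftShift, e1, e2]
      ring
    rw [Real.dist_eq, e, abs_mul, abs_of_nonneg (sq_nonneg s), dist_eq_norm]
    calc _ ≤ s ^ 2 * (D * ‖m - m'‖) := by gcongr; exact hD1 _ _ _ _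
      _ = s ^ 2 * D * ‖m - m'‖ := by ring
      _ ≤ 1 / 2 * ‖m - m'‖ := by gcongr
      _ = _ := by simp
  obtain ⟨m, hm⟩ : ∃ m, T m = m := ⟨_, hT.fixedPoint_isFixedPt⟩
  have hmk : ∀ k, m k = s ^ 2 * (sliceDrift B F α k x₀ + driftShift B F α β x₀ x₀ m k) :=
    fun k => (congrFun hm k).symm
  have hn : ‖m‖ ≤ 2 * M * s ^ 2 * (1 + ‖x₀‖) := by
    have : ‖m‖ ≤ s ^ 2 * (M * (1 + ‖x₀‖)) + 1 / 2 * ‖m‖ := by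
      refine (pi_norm_le_iff_of_nonneg (by positivity)).2 fun k => ?_
      rw [Real.norm_eq_abs, hmk k, mul_add]
      refine (abs_add_le _ _).trans ?_
      rw [abs_mul, abs_mul, abs_of_nonneg (sq_nonneg s)]
      refine add_le_add (mul_le_mul_of_nonneg_left (hb k x₀) (sq_nonneg s)) ?_
      calc _ ≤ s ^ 2 * (D * ‖m‖) := by gcongr; exact hD1 _ _ _ _
        _ = s ^ 2 * D * ‖m‖ := by ring
        _ ≤ _ := by gcongr
    linarith
  refine ⟨m, hmk, hn.trans ?_, fun k => ?_⟩
  · have : 0 ≤ D * (2 * M) := by positivity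
    gcongr
    linarith
  · have e : m k - s ^ 2 * sliceDrift B F α k x₀ = s ^ 2 * driftShift B F α β x₀ x₀ m k := by
      rw [sub_eq_iff_eq_add, add_comm, ← mul_add]
      exact hmk k
    rw [e, abs_mul, abs_of_nonneg (sq_nonneg s)]
    calc _ ≤ s ^ 2 * (D * (2 * M * s ^ 2 * (1 + ‖x₀‖))) := by
          gcongr
          exact (hD1 _ _ _ _).trans (by gcongr)
      _ = D * (2 * M) * s ^ 4 * (1 + ‖x₀‖) := by ring
      _ ≤ _ := by gcongr; linarith

/-- Around its peak, the time-slice kernel is a rescaled `sliceDensity`. -/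
lemma sliceKernel_peak {s : ℝ} (hs : 0 < s) {x₀ m : Coord d}
    (hm : ∀ k, m k = s ^ 2 * (sliceDrift B F α k x₀ + driftShift B F α β x₀ x₀ m k))
    (η : Coord d) :
    s ^ d * sliceKernel B F α β (s ^ 2) x₀ (x₀ + m + s • η)
      = sliceDensity B F α β s (x₀ + α • m) (x₀ + β • m) η := by
  have hi : ∀ a : ℝ, interp a x₀ (x₀ + m + s • η) = x₀ + a • m + a • s • η := fun a => by
    unfold interp; module
  -- The equation for `m` cancels the drift at the peak, which may be large. What remains is the
  -- bounded-slope variation around the peak, so the estimates on `sliceDensity` are uniform in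
  -- `x₀`.
  have hw : (fun i => ((x₀ + m + s • η) i - x₀ i) - F i (x₀ + β • m + β • s • η) * s ^ 2
      + 2 * α * divB B i (x₀ + α • m + α • s • η) * s ^ 2)
      = s • fun i => η i - s * driftShift B F α β (x₀ + α • m) (x₀ + β • m) (s • η) i := by
    funext i
    have := hm i
    simp only [sliceDrift, driftShift] at this
    simp only [Pi.add_apply, Pi.smul_apply, smul_eq_mul, driftShift]
    linear_combination this
  simp only [sliceKernel, hi, sliceDensity]
  rw [hw, ← mul_assoc, gaussianDensity_smul _ hs]
  simp only [gaussianDensity]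
  rw [mul_assoc (1 / Real.sqrt _), ← Real.exp_add, mul_assoc (1 / Real.sqrt _), ← Real.exp_add,
    sliceExp]
  congr 2
  set Q := (B (x₀ + α • m + α • s • η))⁻¹
  set δ := driftShift B F α β (x₀ + α • m) (x₀ + β • m) (s • η)
  have : ∑ i, ∑ j, (η i - s * δ i) * (Q i j / (4 * 1)) * (η j - s * δ j)
      = ∑ i, ∑ j, η i * (Q i j / (4 * 1)) * η j
      - ∑ i, ∑ j, (s * (η i * Q i j * δ j) + s * (η j * Q i j * δ i)
        - s ^ 2 * (δ i * Q i j * δ j)) / 4 := by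
    simp only [← Finset.sum_sub_distrib]
    exact Finset.sum_congr rfl fun i _ => Finset.sum_congr rfl fun k _ => by ring
  rw [this]
  ring

end Kernel

/-! ### Consistent kernels -/

/-- A nonnegative continuous kernel whose moments of order at most two over the time step `s ^ 2`,
`s ≤ s₀`, agree up to `s ^ 3` with those of the diffusion with coefficients `B` and `F`. -/
structure IsConsistent (B : Coord d → Matrix (Fin d) (Fin d) ℝ) (F : Fin d → Coord d → ℝ)
    (p : SliceKernel d) (s₀ : ℝ) : Prop where
  pos : 0 < s₀
  le_one : s₀ ≤ 1
  nonneg : ∀ t x₀ x, 0 ≤ p t x₀ x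
  continuous : ∀ t, Continuous fun z : Coord d × Coord d => p t z.1 z.2
  exists_moments : ∃ C, 0 ≤ C ∧ ∀ s x₀, 0 < s → s ≤ s₀ →
    |(∫ x, p (s ^ 2) x₀ x) - 1| ≤ C * s ^ 3 ∧
    (∀ i, |(∫ x, (x i - x₀ i) * p (s ^ 2) x₀ x) - s ^ 2 * F i x₀|
      ≤ C * s ^ 3 * (1 + ‖x₀‖)) ∧
    ∀ i k, |(∫ x, (x i - x₀ i) * (x k - x₀ k) * p (s ^ 2) x₀ x) - 2 * s ^ 2 * B x₀ i k|
      ≤ C * s ^ 3 * (1 + ‖x₀‖) ^ 2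
  exists_weights : ∀ a n : ℕ, ∃ J, 0 ≤ J ∧ ∀ s x₀, 0 < s → s ≤ s₀ →
    Integrable (fun x => ‖x - x₀‖ ^ a * (1 + ‖x - x₀‖) ^ n * p (s ^ 2) x₀ x) ∧
    ∫ x, ‖x - x₀‖ ^ a * (1 + ‖x - x₀‖) ^ n * p (s ^ 2) x₀ x ≤ J * s ^ a * (1 + ‖x₀‖) ^ (a + n)

lemma integral_comp_affine {s : ℝ} (hs : 0 < s) (c : Coord d) (f : Coord d → ℝ) :
    ∫ η, s ^ d * f (c + s • η) = ∫ x, f x := by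
  rw [integral_const_mul, Measure.integral_comp_smul volume (fun y => f (c + y)) s,
    integral_add_left_eq_self f c]
  simp only [Module.finrank_fintype_fun_eq_card, Fintype.card_fin, smul_eq_mul]
  rw [abs_of_pos (by positivity), mul_inv_cancel_left₀ (by positivity)]

lemma integrable_comp_affine {s : ℝ} (hs : 0 < s) (c : Coord d) {f : Coord d → ℝ}
    (hf : Integrable fun η => s ^ d * f (c + s • η)) : Integrable f := by
  have h1 : Integrable fun η => f (c + s • η) := by
    refine (hf.const_mul (s ^ d)⁻¹).congr (Eventually.of_forall fun η => ?_)
    exact inv_mul_cancel_left₀ (by positivity) _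
  have h2 := (integrable_comp_smul_iff volume (fun y => f (c + y)) hs.ne').1 h1
  simpa using h2.comp_add_left (-c)

section Kernel

variable {B : Coord d → Matrix (Fin d) (Fin d) ℝ} {F : Fin d → Coord d → ℝ} {α β : ℝ}

lemma sliceDensity_nonneg (s : ℝ) (z w η : Coord d) : 0 ≤ sliceDensity B F α β s z w η :=
  mul_nonneg (gaussianDensity_nonneg _ _ _) (Real.exp_pos _).le

/-- The substitution `x = x₀ + m + sη` transfers the moments of `sliceDensity` to the kernel. The
weights in `x₀` enter through the peak `m`, which is of order `s² (1 + ‖x₀‖)`. -/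
lemma Admissible.exists_isConsistent_sliceKernel (h : Admissible B F) (hα : α ∈ Set.Icc (0 : ℝ) 1)
    (hβ : β ∈ Set.Icc (0 : ℝ) 1) : ∃ s₀, IsConsistent B F (sliceKernel B F α β) s₀ := by
  obtain ⟨C, s₁, hC0, hs₁, hs₁1, hC, hJ⟩ := h.exists_slice_moments hα hβ
  obtain ⟨P, s₂, hP0, hs₂, -, hP⟩ := h.exists_peak hα hβ
  obtain ⟨J, hJ0, hJ1⟩ := hJ 1
  choose K hK0 _ hK _ _ _ using fun i => (h.growth_divB i).exists_uniform_taylor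
  choose E hE0 _ hE _ _ _ using fun i k => (h.growth_B i k).exists_uniform_taylor
  set K' := ∑ i, K i with hK'
  set E' := ∑ i, ∑ k, E i k with hE'
  have hK'0 : 0 ≤ K' := Finset.sum_nonneg fun i _ => hK0 i
  have hE'0 : 0 ≤ E' := Finset.sum_nonneg fun i _ => Finset.sum_nonneg fun k _ => hE0 i k
  have hKle : ∀ i, K i ≤ K' := fun i =>
    Finset.single_le_sum (fun i _ => hK0 i) (Finset.mem_univ i)
  have hEle : ∀ i k, E i k ≤ E' := fun i k =>
    (Finset.single_le_sum (fun k _ => hE0 i k) (Finset.mem_univ k)).trans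
      (Finset.single_le_sum (f := fun i => ∑ k, E i k)
        (fun i _ => Finset.sum_nonneg fun k _ => hE0 i k) (Finset.mem_univ i))
  refine ⟨min s₁ s₂, lt_min hs₁ hs₂, (min_le_left _ _).trans hs₁1, sliceKernel_nonneg,
    h.continuous_sliceKernel,
    ⟨C + (P * C + P + C + 2 * K' * P) + (P ^ 2 * J + 2 * (P * J) + C + 2 * (E' * P)),
    by positivity, fun s x₀ hs hss => ?_⟩, fun a n => ?_⟩
  · have hs1 : s ≤ s₁ := hss.trans (min_le_left _ _)
    have hs11 : s ≤ 1 := hs1.trans hs₁1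
    obtain ⟨m, hm, hmn, hmk⟩ := hP s x₀ hs (hss.trans (min_le_right _ _))
    obtain ⟨c0, c1, c2⟩ := hC s hs.le hs1 (x₀ + α • m) (x₀ + β • m)
    obtain ⟨hi, hb⟩ := hJ1 s hs.le hs1 (x₀ + α • m) (x₀ + β • m)
    obtain ⟨J2, -, hJ2⟩ := hJ 2
    have hi2 := (hJ2 s hs.le hs1 (x₀ + α • m) (x₀ + β • m)).1
    set Ψ := sliceDensity B F α β s (x₀ + α • m) (x₀ + β • m) with hΨ
    have hΨ0 : ∀ η, 0 ≤ Ψ η := sliceDensity_nonneg s _ _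
    have hΨc : Continuous Ψ := h.continuous_sliceDensity s _ _
    have hcv : ∀ f : Coord d → ℝ, ∫ x, f x * sliceKernel B F α β (s ^ 2) x₀ x
        = ∫ η, f (x₀ + m + s • η) * Ψ η := fun f => by
      rw [← integral_comp_affine hs (x₀ + m)]
      refine integral_congr_ae (Eventually.of_forall fun η => ?_)
      change _ = f (x₀ + m + s • η) * sliceDensity B F α β s (x₀ + α • m) (x₀ + β • m) η
      rw [← sliceKernel_peak hs hm η]
      ring
    have hint : ∀ (f : Coord d → ℝ) (n : ℕ), Continuous f → (∀ η, |f η| ≤ 1 * (1 + ‖η‖) ^ n) →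
        Integrable (fun η => (1 + ‖η‖) ^ n * Ψ η) →
        Integrable (fun η => f η * Ψ η) ∧
        |∫ η, f η * Ψ η| ≤ ∫ η, (1 + ‖η‖) ^ n * Ψ η := by
      intro f n hf hfn hin
      have hle : ∀ η, ‖f η * Ψ η‖ ≤ (1 + ‖η‖) ^ n * Ψ η := fun η => by
        rw [Real.norm_eq_abs, abs_mul, abs_of_nonneg (hΨ0 η)]
        have := hfn η
        rw [one_mul] at this
        exact mul_le_mul_of_nonneg_right this (hΨ0 η)
      refine ⟨hin.mono' (hf.mul hΨc).aestronglyMeasurable (Eventually.of_forall hle), ?_⟩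
      rw [← Real.norm_eq_abs]
      exact norm_integral_le_of_norm_le hin (Eventually.of_forall hle)
    have f0 : Integrable Ψ ∧ |∫ η, Ψ η| ≤ J := by
      have := hint (fun _ => 1) 1 continuous_const (fun η => by
        have := norm_nonneg η; rw [abs_one]; linarith) hi
      simp only [one_mul] at this
      exact ⟨this.1, this.2.trans hb⟩
    have f1 : ∀ i, Integrable (fun η : Coord d => η i * Ψ η) ∧ |∫ η : Coord d, η i * Ψ η| ≤ J :=
      fun i => by
        have := hint (fun η => η i) 1 (continuous_apply i) (fun η => abs_coord_le_weight η i) hi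
        exact ⟨this.1, this.2.trans hb⟩
    have f2 : ∀ i k, Integrable (fun η : Coord d => η i * η k * Ψ η) := fun i k =>
      (hint (fun η => η i * η k) 2 (by fun_prop) (fun η => abs_coord_mul_le_weight η i k) hi2).1
    have hW : 1 ≤ 1 + ‖x₀‖ := one_le_one_add_norm x₀
    set W := 1 + ‖x₀‖ with hWd
    have hWW : W ≤ W ^ 2 := by nlinarith
    have h1W : 1 ≤ W ^ 2 := hW.trans hWW
    have hs43 : s ^ 4 ≤ s ^ 3 := pow_le_pow_of_le_one hs.le hs11 (by norm_num)
    have hs53 : s ^ 5 ≤ s ^ 3 := pow_le_pow_of_le_one hs.le hs11 (by norm_num)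
    have hmi : ∀ i, |m i| ≤ P * s ^ 2 * W := fun i => (abs_coord_le m i).trans hmn
    have hαm : ‖α • m‖ ≤ P * s ^ 2 * W := (norm_smul_le_of_mem hα m).trans hmn
    have hY : ∀ (η : Coord d) i, (x₀ + m + s • η) i - x₀ i = m i + s * η i := fun η i => by
      simp only [Pi.add_apply, Pi.smul_apply, smul_eq_mul]; ring
    refine ⟨?_, fun i => ?_, fun i k => ?_⟩
    · have := hcv fun _ => 1
      simp only [one_mul] at this
      rw [this]
      refine c0.trans ?_
      have e : 0 ≤ (P * C + P + C + 2 * K' * P)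
        + (P ^ 2 * J + 2 * (P * J) + C + 2 * (E' * P)) := by positivity
      gcongr
      linarith
    · rw [hcv fun x => x i - x₀ i]
      have e1 : ∫ η : Coord d, ((x₀ + m + s • η) i - x₀ i) * Ψ η
          = m i * (∫ η, Ψ η) + s * ∫ η : Coord d, η i * Ψ η := by
        rw [← integral_const_mul, ← integral_const_mul,
          ← integral_add (f0.1.const_mul _) ((f1 i).1.const_mul _)]
        refine integral_congr_ae (Eventually.of_forall fun η => ?_)
        simp only [hY]
        ring
      rw [e1]
      set I0 := ∫ η, Ψ η
      set I1 := ∫ η : Coord d, η i * Ψ η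
      have hc1 := c1 i
      -- The peak contributes `s²(F - 2α div B)` and the rescaled mean contributes `s · s · 2α div
      -- B`, so their sum is `s² F`. The last term moves `div B` from the interpolation point back
      -- to `x₀`.
      have e2 : m i * I0 + s * I1 - s ^ 2 * F i x₀ = m i * (I0 - 1)
          + (m i - s ^ 2 * sliceDrift B F α i x₀)
          + s * (I1 - s * (2 * α * divB B i (x₀ + α • m)))
          + s ^ 2 * (2 * α) * (divB B i (x₀ + α • m) - divB B i x₀) := by
        simp only [sliceDrift]; ring
      have g1 : |m i * (I0 - 1)| ≤ P * C * (s ^ 3 * W) := by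
        rw [abs_mul]
        calc _ ≤ (P * s ^ 2 * W) * (C * s ^ 3) := mul_le_mul (hmi i) c0 (abs_nonneg _) (by positivity)
          _ = P * C * (s ^ 5 * W) := by ring
          _ ≤ _ := by gcongr
      have g2 : |m i - s ^ 2 * sliceDrift B F α i x₀| ≤ P * (s ^ 3 * W) := by
        calc _ ≤ P * s ^ 4 * W := hmk i
          _ = P * (s ^ 4 * W) := by ring
          _ ≤ _ := by gcongr
      have g3 : |s * (I1 - s * (2 * α * divB B i (x₀ + α • m)))| ≤ C * (s ^ 3 * W) := by
        rw [abs_mul, abs_of_pos hs]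
        calc _ ≤ s * (C * s ^ 2) := by gcongr
          _ = C * (s ^ 3 * 1) := by ring
          _ ≤ _ := by gcongr
      have g4 : |s ^ 2 * (2 * α) * (divB B i (x₀ + α • m) - divB B i x₀)|
          ≤ 2 * K' * P * (s ^ 3 * W) := by
        have ha := hα.1
        rw [abs_mul, abs_of_nonneg (by positivity)]
        calc _ ≤ s ^ 2 * (2 * 1) * (K' * (P * s ^ 2 * W)) := by
              gcongr
              · exact hα.2
              · exact (hK i () x₀ (α • m)).trans
                  (mul_le_mul (hKle i) hαm (norm_nonneg _) hK'0)
          _ = 2 * K' * P * (s ^ 4 * W) := by ring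
          _ ≤ _ := by gcongr
      rw [e2]
      have hX : 0 ≤ s ^ 3 * W := by positivity
      have e : 0 ≤ C + (P ^ 2 * J + 2 * (P * J) + C + 2 * (E' * P)) := by positivity
      calc _ ≤ _ := (abs_add_le _ _).trans (add_le_add ((abs_add_le _ _).trans
            (add_le_add ((abs_add_le _ _).trans (add_le_add g1 g2)) g3)) g4)
        _ = (P * C + P + C + 2 * K' * P) * (s ^ 3 * W) := by ring
        _ ≤ (C + (P * C + P + C + 2 * K' * P)
            + (P ^ 2 * J + 2 * (P * J) + C + 2 * (E' * P))) * (s ^ 3 * W) :=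
          mul_le_mul_of_nonneg_right (by linarith) hX
        _ = _ := by ring
    · rw [hcv fun x => (x i - x₀ i) * (x k - x₀ k)]
      have e1 : ∫ η : Coord d, ((x₀ + m + s • η) i - x₀ i) * ((x₀ + m + s • η) k - x₀ k) * Ψ η
          = m i * m k * (∫ η, Ψ η) + s * m i * (∫ η : Coord d, η k * Ψ η)
            + s * m k * (∫ η : Coord d, η i * Ψ η)
            + s ^ 2 * ∫ η : Coord d, η i * η k * Ψ η := by
        have j1 : Integrable fun η : Coord d => m i * m k * Ψ η + s * m i * (η k * Ψ η) :=
          (f0.1.const_mul _).add ((f1 k).1.const_mul _)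
        have j2 : Integrable fun η : Coord d => m i * m k * Ψ η + s * m i * (η k * Ψ η)
            + s * m k * (η i * Ψ η) := j1.add ((f1 i).1.const_mul _)
        rw [← integral_const_mul, ← integral_const_mul, ← integral_const_mul, ← integral_const_mul,
          ← integral_add (f0.1.const_mul _) ((f1 k).1.const_mul _),
          ← integral_add j1 ((f1 i).1.const_mul _), ← integral_add j2 ((f2 i k).const_mul _)]
        refine integral_congr_ae (Eventually.of_forall fun η => ?_)
        simp only [hY]
        ring
      rw [e1]
      have hI0 := f0.2
      have hIk := (f1 k).2
      have hIi := (f1 i).2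
      have hc2 := c2 i k
      set I0 := ∫ η, Ψ η
      set Ii := ∫ η : Coord d, η i * Ψ η
      set Ik := ∫ η : Coord d, η k * Ψ η
      set I2 := ∫ η : Coord d, η i * η k * Ψ η
      have e2 : m i * m k * I0 + s * m i * Ik + s * m k * Ii + s ^ 2 * I2 - 2 * s ^ 2 * B x₀ i k
          = m i * m k * I0 + s * m i * Ik + s * m k * Ii
          + s ^ 2 * (I2 - 2 * B (x₀ + α • m) i k)
          + 2 * s ^ 2 * (B (x₀ + α • m) i k - B x₀ i k) := by ring
      have g1 : |m i * m k * I0| ≤ P ^ 2 * J * (s ^ 3 * W ^ 2) := by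
        rw [abs_mul, abs_mul]
        calc _ ≤ (P * s ^ 2 * W) * (P * s ^ 2 * W) * J :=
              mul_le_mul (mul_le_mul (hmi i) (hmi k) (abs_nonneg _) (by positivity)) hI0
                (abs_nonneg _) (by positivity)
          _ = P ^ 2 * J * (s ^ 4 * W ^ 2) := by ring
          _ ≤ _ := by gcongr
      have g2 : ∀ i I, |I| ≤ J → |s * m i * I| ≤ P * J * (s ^ 3 * W ^ 2) := fun i I hI => by
        rw [abs_mul, abs_mul, abs_of_pos hs]
        calc _ ≤ s * (P * s ^ 2 * W) * J := by gcongr; exact hmi i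
          _ = P * J * (s ^ 3 * W) := by ring
          _ ≤ _ := by gcongr
      have g3 : |s ^ 2 * (I2 - 2 * B (x₀ + α • m) i k)| ≤ C * (s ^ 3 * W ^ 2) := by
        rw [abs_mul, abs_of_nonneg (sq_nonneg s)]
        calc _ ≤ s ^ 2 * (C * s) := by gcongr
          _ = C * (s ^ 3 * 1) := by ring
          _ ≤ _ := by gcongr
      have g4 : |2 * s ^ 2 * (B (x₀ + α • m) i k - B x₀ i k)| ≤ 2 * (E' * P) * (s ^ 3 * W ^ 2) := by
        rw [abs_mul, abs_of_nonneg (by positivity)]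
        calc _ ≤ 2 * s ^ 2 * (E' * (P * s ^ 2 * W)) := by
              gcongr
              exact (hE i k () x₀ (α • m)).trans
                (mul_le_mul (hEle i k) hαm (norm_nonneg _) hE'0)
          _ = 2 * (E' * P) * (s ^ 4 * W) := by ring
          _ ≤ _ := by gcongr
      rw [e2]
      have hX : 0 ≤ s ^ 3 * W ^ 2 := by positivity
      have e : 0 ≤ C + (P * C + P + C + 2 * K' * P) := by positivity
      calc _ ≤ _ := (abs_add_le _ _).trans (add_le_add ((abs_add_le _ _).trans
            (add_le_add ((abs_add_le _ _).trans (add_le_add ((abs_add_le _ _).trans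
            (add_le_add g1 (g2 i Ik hIk))) (g2 k Ii hIi))) g3)) g4)
        _ = (P ^ 2 * J + 2 * (P * J) + C + 2 * (E' * P)) * (s ^ 3 * W ^ 2) := by ring
        _ ≤ (C + (P * C + P + C + 2 * K' * P)
            + (P ^ 2 * J + 2 * (P * J) + C + 2 * (E' * P))) * (s ^ 3 * W ^ 2) :=
          mul_le_mul_of_nonneg_right (by linarith) hX
        _ = _ := by ring
  · obtain ⟨N, hN0, hN⟩ := hJ (a + n)
    refine ⟨(P + 2) ^ (a + n) * N, by positivity, fun s x₀ hs hss => ?_⟩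
    have hs1 : s ≤ s₁ := hss.trans (min_le_left _ _)
    have hs11 : s ≤ 1 := hs1.trans hs₁1
    obtain ⟨m, hm, hmn, -⟩ := hP s x₀ hs (hss.trans (min_le_right _ _))
    obtain ⟨hi, hb⟩ := hN s hs.le hs1 (x₀ + α • m) (x₀ + β • m)
    set Ψ := sliceDensity B F α β s (x₀ + α • m) (x₀ + β • m) with hΨ
    have hΨ0 : ∀ η, 0 ≤ Ψ η := sliceDensity_nonneg s _ _
    have hΨc : Continuous Ψ := h.continuous_sliceDensity s _ _
    set W := 1 + ‖x₀‖ with hWd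
    have hW : 1 ≤ W := one_le_one_add_norm x₀
    have hY : ∀ η : Coord d, x₀ + m + s • η - x₀ = m + s • η := fun η => by abel
    have hYn : ∀ η : Coord d, ‖m + s • η‖ ≤ (P + 2) * s * W * (1 + ‖η‖) := fun η => by
      have h1 : ‖m‖ ≤ P * s * W * (1 + ‖η‖) := by
        have h0 : 1 ≤ 1 + ‖η‖ := one_le_one_add_norm η
        calc ‖m‖ ≤ P * s ^ 2 * W := hmn
          _ ≤ P * s * W * 1 := by
            have : s ^ 2 ≤ s := by nlinarith
            rw [mul_one]; gcongr
          _ ≤ _ := by gcongr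
      have h2 : ‖s • η‖ ≤ 2 * s * W * (1 + ‖η‖) := by
        rw [norm_smul, Real.norm_of_nonneg hs.le]
        have := norm_nonneg η
        calc s * ‖η‖ ≤ s * (2 * 1 * (1 + ‖η‖)) := by gcongr; linarith
          _ ≤ s * (2 * W * (1 + ‖η‖)) := by gcongr
          _ = _ := by ring
      calc _ ≤ _ := norm_add_le _ _
        _ ≤ _ := add_le_add h1 h2
        _ = _ := by ring
    have hYn1 : ∀ η : Coord d, 1 + ‖m + s • η‖ ≤ (P + 2) * W * (1 + ‖η‖) := fun η => by
      have h0 : 1 ≤ 1 + ‖η‖ := one_le_one_add_norm η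
      have h1 : ‖m‖ ≤ P * W * (1 + ‖η‖) := by
        calc ‖m‖ ≤ P * s ^ 2 * W := hmn
          _ ≤ P * 1 * W := by gcongr; exact pow_le_one₀ hs.le hs11
          _ = P * W * 1 := by ring
          _ ≤ _ := by gcongr
      have h2 : ‖s • η‖ ≤ ‖η‖ := norm_smul_le_of_mem ⟨hs.le, hs11⟩ η
      have h3 : 1 + ‖η‖ ≤ W * (1 + ‖η‖) := le_mul_of_one_le_left (by positivity) hW
      have h4 : 0 ≤ W * (1 + ‖η‖) := by positivity
      calc _ ≤ 1 + (‖m‖ + ‖s • η‖) := by gcongr; exact norm_add_le _ _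
        _ ≤ P * W * (1 + ‖η‖) + W * (1 + ‖η‖) := by linarith
        _ ≤ P * W * (1 + ‖η‖) + (W * (1 + ‖η‖) + W * (1 + ‖η‖)) := by linarith
        _ = _ := by ring
    have hle : ∀ η : Coord d, ‖‖m + s • η‖ ^ a * (1 + ‖m + s • η‖) ^ n * Ψ η‖
        ≤ (P + 2) ^ (a + n) * s ^ a * W ^ (a + n) * ((1 + ‖η‖) ^ (a + n) * Ψ η) := fun η => by
      have hp := hΨ0 η
      rw [Real.norm_of_nonneg (by positivity)]
      calc _ ≤ ((P + 2) * s * W * (1 + ‖η‖)) ^ a * ((P + 2) * W * (1 + ‖η‖)) ^ n * Ψ η := by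
            gcongr
            · exact hYn η
            · exact hYn1 η
        _ = _ := by simp only [mul_pow, pow_add]; ring
    have hii := hi.const_mul ((P + 2) ^ (a + n) * s ^ a * W ^ (a + n))
    have hmeas : Continuous fun η : Coord d => ‖m + s • η‖ ^ a * (1 + ‖m + s • η‖) ^ n * Ψ η := by
      fun_prop
    have heq : ∀ η : Coord d, s ^ d * (‖x₀ + m + s • η - x₀‖ ^ a * (1 + ‖x₀ + m + s • η - x₀‖) ^ n
        * sliceKernel B F α β (s ^ 2) x₀ (x₀ + m + s • η))
        = ‖m + s • η‖ ^ a * (1 + ‖m + s • η‖) ^ n * Ψ η := fun η => by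
      rw [hY, hΨ, ← sliceKernel_peak hs hm η]
      ring
    refine ⟨integrable_comp_affine hs (x₀ + m) ?_, ?_⟩
    · simp only [heq]
      exact hii.mono' hmeas.aestronglyMeasurable (Eventually.of_forall hle)
    · rw [← integral_comp_affine hs (x₀ + m)]
      simp only [heq]
      refine (le_abs_self _).trans ?_
      rw [← Real.norm_eq_abs]
      refine (norm_integral_le_of_norm_le hii (Eventually.of_forall hle)).trans ?_
      rw [integral_const_mul]
      calc _ ≤ (P + 2) ^ (a + n) * s ^ a * W ^ (a + n) * N := by gcongr
        _ = _ := by ring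

end Kernel

/-! ### The transition operator of a consistent kernel -/

/-- Measurable functions of polynomial growth. -/
def PolyBounded (f : Coord d → ℝ) : Prop :=
  Measurable f ∧ ∃ (A : ℝ) (n : ℕ), 0 ≤ A ∧ ∀ x, |f x| ≤ A * (1 + ‖x‖) ^ n

/-- The transition operator of a kernel over the time step `t`. -/
def stepOp (p : SliceKernel d) (t : ℝ) (f : Coord d → ℝ) (x₀ : Coord d) : ℝ := ∫ x, f x * p t x₀ x

lemma PolyBounded.abs {f : Coord d → ℝ} (hf : PolyBounded f) : PolyBounded fun x => |f x| := by
  obtain ⟨hm, A, n, hA, h⟩ := hf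
  exact ⟨hm.abs, A, n, hA, fun x => by rw [abs_abs]; exact h x⟩

lemma Growth.polyBounded {u : ι → Coord d → ℝ} (hu : Growth 1 u) (i : ι) : PolyBounded (u i) := by
  obtain ⟨C, k, hC, h⟩ := hu.abs_le
  exact ⟨(hu.1 i).continuous.measurable, C, 1 * k, hC, h i⟩

lemma polyBounded_evenWeight (q : ℕ) : PolyBounded (evenWeight (d := d) q) := by
  refine ⟨?_, 1 + d, 2 * q, by positivity, fun x => ?_⟩
  · have : Continuous (evenWeight (d := d) q) := by unfold evenWeight; fun_prop
    exact this.measurable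
  · rw [abs_of_nonneg (zero_le_one.trans (one_le_evenWeight q x))]
    exact evenWeight_le q x

section Kernel

variable {B : Coord d → Matrix (Fin d) (Fin d) ℝ} {F : Fin d → Coord d → ℝ} {p : SliceKernel d}
  {s₀ : ℝ}

lemma IsConsistent.continuous_left (hp : IsConsistent B F p s₀) (t : ℝ) (x₀ : Coord d) :
    Continuous (p t x₀) :=
  (hp.continuous t).comp (by fun_prop : Continuous fun x : Coord d => (x₀, x))

/-- Functions of polynomial growth are integrable, with bounds, against a consistent kernel. -/
lemma IsConsistent.exists_integral_bound (hp : IsConsistent B F p s₀) (n : ℕ) :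
    ∃ J, 0 ≤ J ∧ ∀ s x₀, 0 < s → s ≤ s₀ → ∀ (f : Coord d → ℝ) (A : ℝ), Measurable f → 0 ≤ A →
      (∀ x, |f x| ≤ A * (1 + ‖x‖) ^ n) →
      Integrable (fun x => f x * p (s ^ 2) x₀ x) ∧
      |∫ x, f x * p (s ^ 2) x₀ x| ≤ A * J * (1 + ‖x₀‖) ^ (n + n) := by
  obtain ⟨J, hJ0, hJ⟩ := hp.exists_weights 0 n
  refine ⟨J, hJ0, fun s x₀ hs hss f A hf hA hfA => ?_⟩
  obtain ⟨hi, hb⟩ := hJ s x₀ hs hss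
  simp only [pow_zero, one_mul, mul_one, zero_add] at hi hb
  -- The weight at `x` is split into a weight at `x₀` and one in the displacement; only the latter
  -- is integrated.
  have hle : ∀ x, ‖f x * p (s ^ 2) x₀ x‖
      ≤ A * (1 + ‖x₀‖) ^ n * ((1 + ‖x - x₀‖) ^ n * p (s ^ 2) x₀ x) := fun x => by
    have hp0 := hp.nonneg (s ^ 2) x₀ x
    rw [Real.norm_eq_abs, abs_mul, abs_of_nonneg hp0]
    have h1 := weight_add_le x₀ (x - x₀) n
    rw [add_sub_cancel] at h1
    calc _ ≤ A * ((1 + ‖x₀‖) ^ n * (1 + ‖x - x₀‖) ^ n) * p (s ^ 2) x₀ x := by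
          gcongr
          exact (hfA x).trans (by gcongr)
      _ = _ := by ring
  have hii := hi.const_mul (A * (1 + ‖x₀‖) ^ n)
  refine ⟨hii.mono' (hf.mul (hp.continuous_left _ _).measurable).aestronglyMeasurable
    (Eventually.of_forall hle), ?_⟩
  rw [← Real.norm_eq_abs]
  refine (norm_integral_le_of_norm_le hii (Eventually.of_forall hle)).trans ?_
  rw [integral_const_mul]
  calc _ ≤ A * (1 + ‖x₀‖) ^ n * (J * (1 + ‖x₀‖) ^ n) := by gcongr
    _ = _ := by rw [pow_add]; ring

lemma IsConsistent.integrable_mul (hp : IsConsistent B F p s₀) {s : ℝ} (hs : 0 < s) (hss : s ≤ s₀)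
    (x₀ : Coord d) {f : Coord d → ℝ} (hf : PolyBounded f) :
    Integrable (fun x => f x * p (s ^ 2) x₀ x) := by
  obtain ⟨hm, A, n, hA, h⟩ := hf
  obtain ⟨J, -, hJ⟩ := hp.exists_integral_bound n
  exact (hJ s x₀ hs hss f A hm hA h).1

lemma IsConsistent.polyBounded_stepOp (hp : IsConsistent B F p s₀) {s : ℝ} (hs : 0 < s)
    (hss : s ≤ s₀) {f : Coord d → ℝ} (hf : PolyBounded f) : PolyBounded (stepOp p (s ^ 2) f) := by
  obtain ⟨hm, A, n, hA, h⟩ := hf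
  obtain ⟨J, hJ0, hJ⟩ := hp.exists_integral_bound n
  refine ⟨?_, A * J, n + n, by positivity, fun x₀ => (hJ s x₀ hs hss f A hm hA h).2⟩
  have h1 : StronglyMeasurable fun z : Coord d × Coord d => f z.2 * p (s ^ 2) z.1 z.2 :=
    ((hm.comp measurable_snd).mul (hp.continuous (s ^ 2)).measurable).stronglyMeasurable
  exact h1.integral_prod_right.measurable

lemma IsConsistent.polyBounded_stepOp_iterate (hp : IsConsistent B F p s₀) {s : ℝ} (hs : 0 < s)
    (hss : s ≤ s₀) {f : Coord d → ℝ} (hf : PolyBounded f) (n : ℕ) :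
    PolyBounded ((stepOp p (s ^ 2))^[n] f) := by
  induction n with
  | zero => exact hf
  | succ n ih =>
    rw [Function.iterate_succ_apply']
    exact hp.polyBounded_stepOp hs hss ih

lemma polyBounded_coord (i : Fin d) (x₀ : Coord d) : PolyBounded fun x : Coord d => x i - x₀ i :=
  ((Growth.coord (ι := Unit) i).sub (Growth.const (x₀ i))).polyBounded ()

lemma polyBounded_coord_mul (i k : Fin d) (x₀ : Coord d) :
    PolyBounded fun x : Coord d => (x i - x₀ i) * (x k - x₀ k) :=
  (((Growth.coord (ι := Unit) i).sub (Growth.const (x₀ i))).mul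
    ((Growth.coord k).sub (Growth.const (x₀ k)))).polyBounded ()

lemma polyBounded_const (c : ℝ) : PolyBounded fun _ : Coord d => c :=
  (Growth.const (ι := Unit) c).polyBounded ()

/-- The transition operator is consistent with the backward operator. -/
lemma IsConsistent.stepOp_sub_gen_bound (hp : IsConsistent B F p s₀) {u : ι → Coord d → ℝ}
    (hu : Growth 1 u) : ∃ (C : ℝ) (k : ℕ), 0 ≤ C ∧ ∀ i s x₀, 0 < s → s ≤ s₀ →
      |stepOp p (s ^ 2) (u i) x₀ - u i x₀ - s ^ 2 * gen B F (u i) x₀|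
        ≤ C * s ^ 3 * (1 + ‖x₀‖) ^ k := by
  obtain ⟨C, hC0, hC⟩ := hp.exists_moments
  obtain ⟨D, l, hD0, hD⟩ := hu.taylor_two
  obtain ⟨K, m, hK0, hK⟩ := hu.bound 2
  obtain ⟨J, hJ0, hJ⟩ := hp.exists_weights 3 l
  have k0 : ∀ i x, |u i x| ≤ K * (1 + ‖x‖) ^ m := fun i x => by
    have := hK 0 (by norm_num) i x
    rwa [norm_iteratedFDeriv_zero, Real.norm_eq_abs, one_mul] at this
  have k1 : ∀ i a x, |pd a (u i) x| ≤ K * (1 + ‖x‖) ^ m := fun i a x => by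
    have := (norm_iteratedFDeriv_pd_le (hu.1 i) a 0 x).trans (hK 1 (by norm_num) i x)
    rwa [norm_iteratedFDeriv_zero, Real.norm_eq_abs, one_mul] at this
  have k2 : ∀ i a b x, |pd a (pd b (u i)) x| ≤ K * (1 + ‖x‖) ^ m := fun i a b x => by
    have := (norm_iteratedFDeriv_pd_le (contDiff_pd (hu.1 i) b) a 0 x).trans
      ((norm_iteratedFDeriv_pd_le (hu.1 i) b 1 x).trans (hK 2 le_rfl i x))
    rwa [norm_iteratedFDeriv_zero, Real.norm_eq_abs, one_mul] at this
  refine ⟨K * C + d * (K * C) + d * (d * (K * C)) + D * J, l + (3 + l) + (m + 2), by positivity,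
    fun i s x₀ hs hss => ?_⟩
  obtain ⟨c0, c1, c2⟩ := hC s x₀ hs hss
  obtain ⟨hi, hb⟩ := hJ s x₀ hs hss
  have j0 : Integrable fun x => p (s ^ 2) x₀ x := by
    simpa using hp.integrable_mul hs hss x₀ (polyBounded_const 1)
  have j1 := fun a => hp.integrable_mul hs hss x₀ (polyBounded_coord a x₀)
  have j2 := fun a b => hp.integrable_mul hs hss x₀ (polyBounded_coord_mul a b x₀)
  have ju := hp.integrable_mul hs hss x₀ (hu.polyBounded i)
  set W := 1 + ‖x₀‖ with hW
  set I0 := ∫ x, p (s ^ 2) x₀ x with hI0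
  set I1 : Fin d → ℝ := fun a => ∫ x, (x a - x₀ a) * p (s ^ 2) x₀ x with hI1
  set I2 : Fin d → Fin d → ℝ := fun a b => ∫ x, (x a - x₀ a) * (x b - x₀ b) * p (s ^ 2) x₀ x
    with hI2
  set P : Coord d → ℝ := fun x => u i x₀ * p (s ^ 2) x₀ x
    + ∑ a, pd a (u i) x₀ * ((x a - x₀ a) * p (s ^ 2) x₀ x)
    + (1 / 2) * ∑ a, ∑ b, pd a (pd b (u i)) x₀ * ((x a - x₀ a) * (x b - x₀ b) * p (s ^ 2) x₀ x)
    with hP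
  have e1 : Integrable fun x => ∑ a, pd a (u i) x₀ * ((x a - x₀ a) * p (s ^ 2) x₀ x) :=
    integrable_finsetSum _ fun a _ => (j1 a).const_mul _
  have e2 : Integrable fun x => ∑ a, ∑ b, pd a (pd b (u i)) x₀
      * ((x a - x₀ a) * (x b - x₀ b) * p (s ^ 2) x₀ x) :=
    integrable_finsetSum _ fun a _ => integrable_finsetSum _ fun b _ => (j2 a b).const_mul _
  have e3 : Integrable fun x => u i x₀ * p (s ^ 2) x₀ x
      + ∑ a, pd a (u i) x₀ * ((x a - x₀ a) * p (s ^ 2) x₀ x) := (j0.const_mul _).add e1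
  have hPi : Integrable P := e3.add (e2.const_mul _)
  have hPe : ∫ x, P x = u i x₀ * I0 + ∑ a, pd a (u i) x₀ * I1 a
      + (1 / 2) * ∑ a, ∑ b, pd a (pd b (u i)) x₀ * I2 a b := by
    rw [hP, integral_add e3 (e2.const_mul _), integral_add (j0.const_mul _) e1,
      integral_const_mul, integral_const_mul,
      integral_finsetSum _ fun a _ => (j1 a).const_mul _,
      integral_finsetSum _ fun a _ => integrable_finsetSum _ fun b _ => (j2 a b).const_mul _]
    congr 2
    · exact Finset.sum_congr rfl fun a _ => integral_const_mul _ _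
    · refine Finset.sum_congr rfl fun a _ => ?_
      rw [integral_finsetSum _ fun b _ => (j2 a b).const_mul _]
      exact Finset.sum_congr rfl fun b _ => integral_const_mul _ _
  have hrem : |stepOp p (s ^ 2) (u i) x₀ - ∫ x, P x| ≤ D * J * (s ^ 3 * W ^ (l + (3 + l))) := by
    rw [stepOp, ← integral_sub ju hPi, ← Real.norm_eq_abs]
    have hii := hi.const_mul (D * W ^ l)
    refine (norm_integral_le_of_norm_le hii (Eventually.of_forall fun x => ?_)).trans ?_
    · have := hD i x₀ (x - x₀)
      rw [add_sub_cancel] at this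
      have hp0 := hp.nonneg (s ^ 2) x₀ x
      have e : u i x * p (s ^ 2) x₀ x - P x = (u i x - u i x₀
          - ∑ a, pd a (u i) x₀ * (x - x₀) a
          - 1 / 2 * ∑ a, ∑ b, pd a (pd b (u i)) x₀ * (x - x₀) a * (x - x₀) b) * p (s ^ 2) x₀ x := by
        have r1 : ∑ a, pd a (u i) x₀ * ((x a - x₀ a) * p (s ^ 2) x₀ x)
            = (∑ a, pd a (u i) x₀ * (x - x₀) a) * p (s ^ 2) x₀ x := by
          rw [Finset.sum_mul]
          exact Finset.sum_congr rfl fun a _ => by rw [Pi.sub_apply]; ring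
        have r2 : ∑ a, ∑ b, pd a (pd b (u i)) x₀
              * ((x a - x₀ a) * (x b - x₀ b) * p (s ^ 2) x₀ x)
            = (∑ a, ∑ b, pd a (pd b (u i)) x₀ * (x - x₀) a * (x - x₀) b) * p (s ^ 2) x₀ x := by
          rw [Finset.sum_mul]
          refine Finset.sum_congr rfl fun a _ => ?_
          rw [Finset.sum_mul]
          exact Finset.sum_congr rfl fun b _ => by rw [Pi.sub_apply, Pi.sub_apply]; ring
        simp only [hP]
        rw [r1, r2]
        ring
      rw [e, norm_mul, Real.norm_of_nonneg hp0, Real.norm_eq_abs]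
      calc _ ≤ D * W ^ l * (1 + ‖x - x₀‖) ^ l * ‖x - x₀‖ ^ 3 * p (s ^ 2) x₀ x := by gcongr
        _ = _ := by ring
    · rw [integral_const_mul]
      calc _ ≤ D * W ^ l * (J * s ^ 3 * W ^ (3 + l)) := by gcongr
        _ = _ := by rw [pow_add W l]; ring
  -- Mass, mean and second moments multiply the value, the gradient and the Hessian of the test
  -- function. Each deviates by `O(s³)`, as does the cubic Taylor remainder. The `2B` in the second
  -- moments meets the `1/2` of Taylor's formula.
  have hgen : stepOp p (s ^ 2) (u i) x₀ - u i x₀ - s ^ 2 * gen B F (u i) x₀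
      = u i x₀ * (I0 - 1) + ∑ a, pd a (u i) x₀ * (I1 a - s ^ 2 * F a x₀)
      + (1 / 2) * ∑ a, ∑ b, pd a (pd b (u i)) x₀ * (I2 a b - 2 * s ^ 2 * B x₀ a b)
      + (stepOp p (s ^ 2) (u i) x₀ - ∫ x, P x) := by
    have r1 : ∑ a, pd a (u i) x₀ * (I1 a - s ^ 2 * F a x₀)
        = ∑ a, pd a (u i) x₀ * I1 a - s ^ 2 * ∑ a, F a x₀ * pd a (u i) x₀ := by
      rw [Finset.mul_sum, ← Finset.sum_sub_distrib]
      exact Finset.sum_congr rfl fun a _ => by ring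
    have r2 : ∑ a, ∑ b, pd a (pd b (u i)) x₀ * (I2 a b - 2 * s ^ 2 * B x₀ a b)
        = ∑ a, ∑ b, pd a (pd b (u i)) x₀ * I2 a b
          - 2 * s ^ 2 * ∑ a, ∑ b, B x₀ a b * pd a (pd b (u i)) x₀ := by
      simp only [Finset.mul_sum, ← Finset.sum_sub_distrib]
      exact Finset.sum_congr rfl fun a _ => Finset.sum_congr rfl fun b _ => by ring
    rw [hPe, r1, r2, gen]
    ring
  have hW1 : 1 ≤ W := one_le_one_add_norm x₀
  set X := s ^ 3 * W ^ (l + (3 + l) + (m + 2)) with hX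
  have w1 : s ^ 3 * W ^ (m + 2) ≤ X := by
    have := weight_mono x₀ (show m + 2 ≤ l + (3 + l) + (m + 2) by omega)
    rw [hX]; gcongr
  have w2 : s ^ 3 * W ^ (l + (3 + l)) ≤ X := by
    have := weight_mono x₀ (show l + (3 + l) ≤ l + (3 + l) + (m + 2) by omega)
    rw [hX]; gcongr
  have hKC : 0 ≤ K * C := by positivity
  have c1' : ∀ a, |I1 a - s ^ 2 * F a x₀| ≤ C * s ^ 3 * W ^ 2 := fun a =>
    (c1 a).trans (mul_le_mul_of_nonneg_left (le_self_pow₀ hW1 two_ne_zero) (by positivity))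
  have g0 : |u i x₀ * (I0 - 1)| ≤ K * C * X := by
    rw [abs_mul]
    calc _ ≤ K * W ^ m * (C * s ^ 3) :=
          mul_le_mul (k0 i x₀) c0 (abs_nonneg _) (by positivity)
      _ = K * C * (s ^ 3 * W ^ m) := by ring
      _ ≤ K * C * (s ^ 3 * W ^ (m + 2)) := by
          have := weight_mono x₀ (show m ≤ m + 2 by omega)
          gcongr
      _ ≤ _ := by gcongr
  have gen1 : ∀ a b : ℝ, |a| ≤ K * W ^ m → |b| ≤ C * s ^ 3 * W ^ 2 → |a * b| ≤ K * C * X := by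
    intro a b ha hb
    rw [abs_mul]
    calc _ ≤ K * W ^ m * (C * s ^ 3 * W ^ 2) := mul_le_mul ha hb (abs_nonneg _) (by positivity)
      _ = K * C * (s ^ 3 * W ^ (m + 2)) := by rw [pow_add]; ring
      _ ≤ _ := by gcongr
  have g1 : |∑ a, pd a (u i) x₀ * (I1 a - s ^ 2 * F a x₀)| ≤ d * (K * C) * X := by
    refine (Finset.abs_sum_le_sum_abs _ _).trans ?_
    calc _ ≤ ∑ _a : Fin d, K * C * X := Finset.sum_le_sum fun a _ => gen1 _ _ (k1 i a x₀) (c1' a)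
      _ = _ := by simp; ring
  have g2 : |(1 / 2) * ∑ a, ∑ b, pd a (pd b (u i)) x₀ * (I2 a b - 2 * s ^ 2 * B x₀ a b)|
      ≤ d * (d * (K * C)) * X := by
    rw [abs_mul, abs_of_pos (by norm_num : (0 : ℝ) < 1 / 2)]
    have : |∑ a, ∑ b, pd a (pd b (u i)) x₀ * (I2 a b - 2 * s ^ 2 * B x₀ a b)|
        ≤ d * (d * (K * C)) * X := by
      refine (Finset.abs_sum_le_sum_abs _ _).trans ?_
      calc _ ≤ ∑ _a : Fin d, ∑ _b : Fin d, K * C * X := Finset.sum_le_sum fun a _ =>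
            (Finset.abs_sum_le_sum_abs _ _).trans
              (Finset.sum_le_sum fun b _ => gen1 _ _ (k2 i a b x₀) (c2 a b))
        _ = _ := by simp; ring
    have h0 := abs_nonneg (∑ a, ∑ b, pd a (pd b (u i)) x₀ * (I2 a b - 2 * s ^ 2 * B x₀ a b))
    linarith
  rw [hgen]
  calc _ ≤ _ := (abs_add_le _ _).trans (add_le_add ((abs_add_le _ _).trans
        (add_le_add ((abs_add_le _ _).trans (add_le_add g0 g1)) g2)) hrem)
    _ ≤ K * C * X + d * (K * C) * X + d * (d * (K * C)) * X + D * J * X := by gcongr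
    _ = _ := by rw [hX]; ring

/-- A Lyapunov estimate for the transition operator. -/
lemma IsConsistent.stepOp_evenWeight_le (h : Admissible B F) (hp : IsConsistent B F p s₀) {q : ℕ}
    (hq : 1 ≤ q) : ∃ C, 0 ≤ C ∧ ∀ s x₀, 0 < s → s ≤ s₀ →
      stepOp p (s ^ 2) (evenWeight q) x₀ ≤ (1 + C * s ^ 2) * evenWeight q x₀ := by
  obtain ⟨C, hC0, hC⟩ := hp.exists_moments
  obtain ⟨K, hK0, hK⟩ := h.linear_F
  obtain ⟨J, hJ0, hJ⟩ := hp.exists_weights 2 (2 * q - 2)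
  obtain ⟨J', hJ'0, hJ'⟩ := hp.exists_weights 2 0
  obtain ⟨n, hn⟩ : ∃ n, n = 2 * q - 2 := ⟨_, rfl⟩
  rw [← hn] at hJ
  set D := C + d * ((2 * q : ℕ) * (K + C)) * 2 ^ (2 * q)
    + d * ((2 * q : ℕ) ^ 2 * 2 ^ n * (J + J')) * 2 ^ (2 * q) with hD
  refine ⟨D, by positivity, fun s x₀ hs hss => ?_⟩
  have hs1 : s ≤ 1 := hss.trans hp.le_one
  have hs32 : s ^ 3 ≤ s ^ 2 := pow_le_pow_of_le_one hs.le hs1 (by norm_num)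
  obtain ⟨c0, c1, -⟩ := hC s x₀ hs hss
  obtain ⟨hi, hb⟩ := hJ s x₀ hs hss
  obtain ⟨hi', hb'⟩ := hJ' s x₀ hs hss
  simp only [pow_zero, mul_one, add_zero] at hi' hb'
  have j0 : Integrable fun x => p (s ^ 2) x₀ x := by
    simpa using hp.integrable_mul hs hss x₀ (polyBounded_const 1)
  have j1 := fun a => hp.integrable_mul hs hss x₀ (polyBounded_coord a x₀)
  have jE := hp.integrable_mul hs hss x₀ (polyBounded_evenWeight q)
  have hW1 : 1 ≤ 1 + ‖x₀‖ := one_le_one_add_norm x₀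
  have hE := weight_le_evenWeight q x₀
  have hE1 := one_le_evenWeight q x₀
  set W := 1 + ‖x₀‖ with hW
  set E := evenWeight q x₀ with hEd
  -- The term linear in the displacement is kept exact: its integral is the mean, of order `s²`,
  -- whereas its absolute value would only be of order `s`. The remainder is quadratic in the
  -- displacement.
  have hpt : ∀ x, evenWeight q x ≤ E + ∑ c, ((2 * q : ℕ) * x₀ c ^ (2 * q - 1)) * (x c - x₀ c)
      + d * ((2 * q : ℕ) ^ 2 * 2 ^ n) * (W ^ n * ‖x - x₀‖ ^ 2
        + ‖x - x₀‖ ^ 2 * (1 + ‖x - x₀‖) ^ n) := fun x => by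
    have hc : ∀ c, x c ^ (2 * q) ≤ x₀ c ^ (2 * q)
        + ((2 * q : ℕ) * x₀ c ^ (2 * q - 1)) * (x c - x₀ c)
        + (2 * q : ℕ) ^ 2 * 2 ^ n * (W ^ n * ‖x - x₀‖ ^ 2
        + ‖x - x₀‖ ^ 2 * (1 + ‖x - x₀‖) ^ n) := fun c => by
      have h1 := (abs_le.1 (abs_add_pow_sub_le (x₀ c) (x c - x₀ c) (n := 2 * q) (by omega))).2
      rw [add_sub_cancel, ← hn] at h1
      have h2 : |x c - x₀ c| ≤ ‖x - x₀‖ := abs_coord_le (x - x₀) c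
      have h3 : |x₀ c| ≤ W := (abs_coord_le x₀ c).trans (by linarith)
      have h4 : (|x₀ c| + |x c - x₀ c|) ^ n ≤ 2 ^ n * (W ^ n + (1 + ‖x - x₀‖) ^ n) := by
        calc _ ≤ (W + (1 + ‖x - x₀‖)) ^ n := by gcongr; linarith
          _ ≤ 2 ^ (n - 1) * (W ^ n + (1 + ‖x - x₀‖) ^ n) :=
            add_pow_le (by positivity) (by positivity) n
          _ ≤ _ := by gcongr <;> norm_num
      have h5 : (x c - x₀ c) ^ 2 ≤ ‖x - x₀‖ ^ 2 := by
        rw [← sq_abs]; gcongr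
      have h6 : ((2 * q : ℕ) : ℝ) ^ 2 * (x c - x₀ c) ^ 2 * (|x₀ c| + |x c - x₀ c|) ^ n
          ≤ (2 * q : ℕ) ^ 2 * ‖x - x₀‖ ^ 2 * (2 ^ n * (W ^ n + (1 + ‖x - x₀‖) ^ n)) := by
        gcongr
      linarith
    calc evenWeight q x = 1 + ∑ c, x c ^ (2 * q) := rfl
      _ ≤ 1 + ∑ c, (x₀ c ^ (2 * q) + ((2 * q : ℕ) * x₀ c ^ (2 * q - 1)) * (x c - x₀ c)
        + (2 * q : ℕ) ^ 2 * 2 ^ n * (W ^ n * ‖x - x₀‖ ^ 2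
        + ‖x - x₀‖ ^ 2 * (1 + ‖x - x₀‖) ^ n)) := by
          gcongr with c; exact hc c
      _ = _ := by
          rw [Finset.sum_add_distrib, Finset.sum_add_distrib, hEd, evenWeight]
          simp only [Finset.sum_const, Finset.card_univ, Fintype.card_fin, nsmul_eq_mul]
          ring
  set M : ℝ := d * ((2 * q : ℕ) ^ 2 * 2 ^ n) with hM
  have m1 : Integrable fun x => ∑ c, ((2 * q : ℕ) * x₀ c ^ (2 * q - 1))
      * ((x c - x₀ c) * p (s ^ 2) x₀ x) :=
    integrable_finsetSum _ fun c _ => (j1 c).const_mul _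
  have m2 : Integrable fun x => W ^ n * (‖x - x₀‖ ^ 2 * p (s ^ 2) x₀ x)
      + ‖x - x₀‖ ^ 2 * (1 + ‖x - x₀‖) ^ n * p (s ^ 2) x₀ x := (hi'.const_mul _).add hi
  have m3 : Integrable fun x => E * p (s ^ 2) x₀ x + ∑ c, ((2 * q : ℕ) * x₀ c ^ (2 * q - 1))
      * ((x c - x₀ c) * p (s ^ 2) x₀ x) := (j0.const_mul _).add m1
  have hint : stepOp p (s ^ 2) (evenWeight q) x₀ ≤ E * (∫ x, p (s ^ 2) x₀ x)
      + ∑ c, ((2 * q : ℕ) * x₀ c ^ (2 * q - 1)) * (∫ x, (x c - x₀ c) * p (s ^ 2) x₀ x)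
      + M * (W ^ n * (∫ x, ‖x - x₀‖ ^ 2 * p (s ^ 2) x₀ x)
        + ∫ x, ‖x - x₀‖ ^ 2 * (1 + ‖x - x₀‖) ^ n * p (s ^ 2) x₀ x) := by
    calc stepOp p (s ^ 2) (evenWeight q) x₀
        ≤ ∫ x, (E * p (s ^ 2) x₀ x + ∑ c, ((2 * q : ℕ) * x₀ c ^ (2 * q - 1))
          * ((x c - x₀ c) * p (s ^ 2) x₀ x)) + M * (W ^ n * (‖x - x₀‖ ^ 2 * p (s ^ 2) x₀ x)
          + ‖x - x₀‖ ^ 2 * (1 + ‖x - x₀‖) ^ n * p (s ^ 2) x₀ x) := by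
          refine integral_mono jE (m3.add (m2.const_mul M)) fun x => ?_
          refine (mul_le_mul_of_nonneg_right (hpt x) (hp.nonneg _ _ x)).trans (le_of_eq ?_)
          simp only [add_mul, Finset.sum_mul]
          have : ∑ c, ((2 * q : ℕ) * x₀ c ^ (2 * q - 1)) * (x c - x₀ c) * p (s ^ 2) x₀ x
              = ∑ c, ((2 * q : ℕ) * x₀ c ^ (2 * q - 1)) * ((x c - x₀ c) * p (s ^ 2) x₀ x) :=
            Finset.sum_congr rfl fun c _ => by ring
          rw [this]
          ring
      _ = _ := by
          rw [integral_add m3 (m2.const_mul M), integral_add (j0.const_mul _) m1,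
            integral_const_mul, integral_const_mul, integral_add (hi'.const_mul _) hi,
            integral_const_mul, integral_finsetSum _ fun c _ => (j1 c).const_mul _]
          simp only [integral_const_mul]
  have hE0 : 0 ≤ E := by linarith
  have t0 : E * (∫ x, p (s ^ 2) x₀ x) ≤ E + C * s ^ 2 * E := by
    have h1 := (abs_le.1 c0).2
    have h2 : C * s ^ 3 ≤ C * s ^ 2 := by gcongr
    have h3 : (∫ x, p (s ^ 2) x₀ x) ≤ 1 + C * s ^ 2 := by linarith
    calc _ ≤ E * (1 + C * s ^ 2) := by gcongr
      _ = _ := by ring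
  have t1 : ∑ c, ((2 * q : ℕ) * x₀ c ^ (2 * q - 1)) * (∫ x, (x c - x₀ c) * p (s ^ 2) x₀ x)
      ≤ d * ((2 * q : ℕ) * (K + C)) * s ^ 2 * W ^ (2 * q) := by
    calc _ ≤ ∑ _c : Fin d, (2 * q : ℕ) * (K + C) * s ^ 2 * W ^ (2 * q) := by
          refine Finset.sum_le_sum fun c _ => (le_abs_self _).trans ?_
          have h1 : |∫ x, (x c - x₀ c) * p (s ^ 2) x₀ x| ≤ (K + C) * s ^ 2 * W := by
            have h2 : |s ^ 2 * F c x₀| ≤ s ^ 2 * (K * W) := by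
              rw [abs_mul, abs_of_nonneg (sq_nonneg s)]
              gcongr
              exact hK c x₀
            have h3 : C * s ^ 3 * W ≤ C * s ^ 2 * W := by gcongr
            have h4 := abs_add_le ((∫ x, (x c - x₀ c) * p (s ^ 2) x₀ x) - s ^ 2 * F c x₀)
              (s ^ 2 * F c x₀)
            rw [sub_add_cancel] at h4
            linarith [c1 c]
          have h5 : |x₀ c| ≤ W := (abs_coord_le x₀ c).trans (by linarith)
          rw [abs_mul, abs_mul, abs_pow, Nat.abs_cast]
          calc _ ≤ ((2 * q : ℕ) * W ^ (2 * q - 1)) * ((K + C) * s ^ 2 * W) := by gcongr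
            _ = (2 * q : ℕ) * (K + C) * s ^ 2 * (W ^ (2 * q - 1) * W) := by ring
            _ = _ := by rw [pow_sub_one_mul (by omega)]
      _ = _ := by
          simp only [Finset.sum_const, Finset.card_univ, Fintype.card_fin, nsmul_eq_mul]
          ring
  have t2 : M * (W ^ n * (∫ x, ‖x - x₀‖ ^ 2 * p (s ^ 2) x₀ x)
        + ∫ x, ‖x - x₀‖ ^ 2 * (1 + ‖x - x₀‖) ^ n * p (s ^ 2) x₀ x)
      ≤ M * (J + J') * s ^ 2 * W ^ (2 * q) := by
    have h2 : 2 * q = 2 + n := by omega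
    calc _ ≤ M * (W ^ n * (J' * s ^ 2 * W ^ 2) + J * s ^ 2 * W ^ (2 + n)) := by
          have hM0 : 0 ≤ M := by positivity
          gcongr
      _ = _ := by rw [h2, pow_add]; ring
  calc _ ≤ _ := hint
    _ ≤ (E + C * s ^ 2 * E) + d * ((2 * q : ℕ) * (K + C)) * s ^ 2 * W ^ (2 * q)
      + M * (J + J') * s ^ 2 * W ^ (2 * q) := add_le_add (add_le_add t0 t1) t2
    _ ≤ (E + C * s ^ 2 * E) + d * ((2 * q : ℕ) * (K + C)) * s ^ 2 * (2 ^ (2 * q) * E)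
      + M * (J + J') * s ^ 2 * (2 ^ (2 * q) * E) := by gcongr
    _ = _ := by rw [hD, hM]; ring

end Kernel

/-! ### Convergence of the iterated transition operators -/

section Kernel

variable {B : Coord d → Matrix (Fin d) (Fin d) ℝ} {F : Fin d → Coord d → ℝ} {p : SliceKernel d}
  {s₀ : ℝ}

/-- The iterates of the transition operator of a consistent kernel are close to those of any stable
consistent scheme. -/
lemma IsConsistent.exists_iterate_sub_bound (h : Admissible B F) (hp : IsConsistent B F p s₀)
    {R : ℝ → (Coord d → ℝ) → Coord d → ℝ} {f : Coord d → ℝ} {T : ℝ}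
    (hR : Growth 1 (fun (p : {p : ℝ × ℕ // 0 ≤ p.1 ∧ p.1 ≤ 1 ∧ p.2 * p.1 ≤ T}) =>
      (R p.1.1)^[p.1.2] f))
    (hRc : ∀ (ι : Type) (u : ι → Coord d → ℝ), Growth 1 u → ∃ (C : ℝ) (k : ℕ), 0 ≤ C ∧
      ∀ i h x, 0 ≤ h → h ≤ 1 → |R h (u i) x - u i x - h * gen B F (u i) x|
        ≤ C * (h * Real.sqrt h) * (1 + ‖x‖) ^ k) (x₀ : Coord d) :
    ∃ C, 0 ≤ C ∧ ∀ s (n : ℕ), 0 < s → s ≤ s₀ → n * s ^ 2 ≤ T →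
      |(stepOp p (s ^ 2))^[n] f x₀ - (R (s ^ 2))^[n] f x₀| ≤ C * (n * s ^ 3) := by
  obtain ⟨C1, k1, hC10, hC1⟩ := hp.stepOp_sub_gen_bound hR
  obtain ⟨C2, k2, hC20, hC2⟩ := hRc _ _ hR
  -- One even weight dominates both local error weights; the extra `1` guarantees `q ≥ 1`.
  set q := k1 + k2 + 1 with hq
  obtain ⟨D, hD0, hD⟩ := hp.stepOp_evenWeight_le h (q := q) (by omega)
  set A := (C1 + C2) * 2 ^ (2 * q) with hA
  have hA0 : 0 ≤ A := by positivity
  have hE0 : ∀ x : Coord d, 0 ≤ evenWeight q x := fun x => zero_le_one.trans (one_le_evenWeight q x)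
  refine ⟨A * Real.exp (D * T) * evenWeight q x₀, by have := hE0 x₀; positivity,
    fun s n hs hss hn => ?_⟩
  have hs1 : s ≤ 1 := hss.trans hp.le_one
  have hs2 : s ^ 2 ≤ 1 := pow_le_one₀ hs.le hs1
  have hle : ∀ m : ℕ, m ≤ n → (m : ℝ) * s ^ 2 ≤ T := fun m hm => by
    refine le_trans ?_ hn
    gcongr
  let idx : ∀ m : ℕ, m ≤ n → {p : ℝ × ℕ // 0 ≤ p.1 ∧ p.1 ≤ 1 ∧ p.2 * p.1 ≤ T} := fun m hm =>
    ⟨(s ^ 2, m), sq_nonneg s, hs2, hle m hm⟩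
  have hpb : ∀ m ≤ n, PolyBounded ((R (s ^ 2))^[m] f) := fun m hm => hR.polyBounded (idx m hm)
  have hf : PolyBounded f := hpb 0 (Nat.zero_le _)
  -- Both schemes are expanded on iterates of the smooth scheme only. No regularity of the kernel's
  -- own iterates is used.
  have hloc : ∀ m, m + 1 ≤ n → ∀ x, |stepOp p (s ^ 2) ((R (s ^ 2))^[m] f) x
      - (R (s ^ 2))^[m + 1] f x| ≤ A * s ^ 3 * evenWeight q x := fun m hm x => by
    have a1 := hC1 (idx m (by omega)) s x hs hss
    have a2 := hC2 (idx m (by omega)) (s ^ 2) x (sq_nonneg s) hs2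
    rw [Real.sqrt_sq hs.le] at a2
    simp only [idx] at a1 a2
    rw [Function.iterate_succ_apply']
    set v := (R (s ^ 2))^[m] f
    have e : stepOp p (s ^ 2) v x - R (s ^ 2) v x = (stepOp p (s ^ 2) v x - v x
        - s ^ 2 * gen B F v x) - (R (s ^ 2) v x - v x - s ^ 2 * gen B F v x) := by ring
    rw [e]
    have w1 := weight_mono x (show k1 ≤ 2 * q by omega)
    have w2 := weight_mono x (show k2 ≤ 2 * q by omega)
    calc _ ≤ _ := (abs_sub _ _).trans (add_le_add a1 a2)
      _ ≤ C1 * s ^ 3 * (1 + ‖x‖) ^ (2 * q) + C2 * (s ^ 2 * s) * (1 + ‖x‖) ^ (2 * q) := by gcongr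
      _ = (C1 + C2) * s ^ 3 * (1 + ‖x‖) ^ (2 * q) := by ring
      _ ≤ (C1 + C2) * s ^ 3 * (2 ^ (2 * q) * evenWeight q x) := by
          gcongr; exact weight_le_evenWeight q x
      _ = _ := by rw [hA]; ring
  have key : ∀ m ≤ n, ∀ x, |(stepOp p (s ^ 2))^[m] f x - (R (s ^ 2))^[m] f x|
      ≤ A * (m * s ^ 3) * (1 + D * s ^ 2) ^ m * evenWeight q x := by
    intro m
    induction m with
    | zero => intro _ x; simp
    | succ m ih =>
      intro hm x
      have hm' : m ≤ n := by omega
      rw [Function.iterate_succ_apply' (stepOp p (s ^ 2))]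
      set v := (R (s ^ 2))^[m] f with hv
      set w := (stepOp p (s ^ 2))^[m] f with hw
      have pw : PolyBounded w := hp.polyBounded_stepOp_iterate hs hss hf m
      have pv : PolyBounded v := hpb m hm'
      have h1 : stepOp p (s ^ 2) w x - stepOp p (s ^ 2) v x
          = ∫ y, (w y - v y) * p (s ^ 2) x y := by
        rw [stepOp, stepOp, ← integral_sub (hp.integrable_mul hs hss x pw)
          (hp.integrable_mul hs hss x pv)]
        simp only [sub_mul]
      set b := A * (m * s ^ 3) * (1 + D * s ^ 2) ^ m with hb
      have hb0 : 0 ≤ b := by positivity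
      have h2 : |stepOp p (s ^ 2) w x - stepOp p (s ^ 2) v x|
          ≤ b * ((1 + D * s ^ 2) * evenWeight q x) := by
        rw [h1, ← Real.norm_eq_abs]
        have hi := (hp.integrable_mul hs hss x (polyBounded_evenWeight q)).const_mul b
        refine (norm_integral_le_of_norm_le hi (Eventually.of_forall fun y => ?_)).trans ?_
        · rw [norm_mul, Real.norm_of_nonneg (hp.nonneg _ _ _), Real.norm_eq_abs, ← mul_assoc]
          exact mul_le_mul_of_nonneg_right (ih hm' y) (hp.nonneg _ _ _)
        · rw [integral_const_mul]
          exact mul_le_mul_of_nonneg_left (hD s x hs hss) hb0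
      have h3 := hloc m hm x
      have h4 : A * s ^ 3 * evenWeight q x
          ≤ A * s ^ 3 * (1 + D * s ^ 2) ^ (m + 1) * evenWeight q x := by
        have := one_le_pow₀ (n := m + 1) (show 1 ≤ 1 + D * s ^ 2 by
          have : 0 ≤ D * s ^ 2 := by positivity
          linarith)
        have h5 := hE0 x
        calc _ = A * s ^ 3 * 1 * evenWeight q x := by ring
          _ ≤ _ := by gcongr
      -- Telescoping: the old error is propagated by the positive operator of the kernel, which
      -- enlarges the weight by a factor `1 + D s²`, and one new local error is added.
      have e : stepOp p (s ^ 2) w x - (R (s ^ 2))^[m + 1] f x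
          = (stepOp p (s ^ 2) w x - stepOp p (s ^ 2) v x)
          + (stepOp p (s ^ 2) v x - (R (s ^ 2))^[m + 1] f x) := by ring
      rw [e]
      calc _ ≤ _ := (abs_add_le _ _).trans (add_le_add h2 (h3.trans h4))
        _ = _ := by rw [hb]; push_cast; ring
  refine (key n le_rfl x₀).trans ?_
  have hexp : (1 + D * s ^ 2) ^ n ≤ Real.exp (D * T) := by
    calc _ ≤ Real.exp (D * s ^ 2) ^ n := by
          gcongr
          rw [add_comm]
          exact Real.add_one_le_exp _
      _ = Real.exp (D * (n * s ^ 2)) := by rw [← Real.exp_nat_mul]; congr 1; ring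
      _ ≤ _ := by gcongr
  have h5 := hE0 x₀
  calc _ ≤ A * (n * s ^ 3) * Real.exp (D * T) * evenWeight q x₀ := by gcongr
    _ = _ := by ring

/-- Expectations with respect to a weak solution are close to the iterates of any stable consistent
scheme. -/
lemma WeakSolution.exists_iterate_sub_bound (h : Admissible B F) {x₀ : Coord d}
    {q : ℝ → Coord d → ℝ} (hq : WeakSolution B F x₀ q)
    {R : ℝ → (Coord d → ℝ) → Coord d → ℝ} {f : Coord d → ℝ} {T : ℝ}
    (hR : Growth 1 (fun (p : {p : ℝ × ℕ // 0 ≤ p.1 ∧ p.1 ≤ 1 ∧ p.2 * p.1 ≤ T}) =>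
      (R p.1.1)^[p.1.2] f))
    (hRc : ∀ (ι : Type) (u : ι → Coord d → ℝ), Growth 1 u → ∃ (C : ℝ) (k : ℕ), 0 ≤ C ∧
      ∀ i h x, 0 ≤ h → h ≤ 1 → |R h (u i) x - u i x - h * gen B F (u i) x|
        ≤ C * (h * Real.sqrt h) * (1 + ‖x‖) ^ k) :
    ∃ C, 0 ≤ C ∧ ∀ s (n : ℕ), 0 < s → s ≤ 1 → (n + 1 : ℕ) * s ^ 2 ≤ T →
      |(∫ x, f x * q ((n + 1 : ℕ) * s ^ 2) x) - (R (s ^ 2))^[n + 1] f x₀|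
        ≤ C * ((n + 1 : ℕ) * s ^ 3) := by
  obtain ⟨C1, hC10, hC1⟩ := hq.expansion h hR T
  obtain ⟨C2, k2, hC20, hC2⟩ := hRc _ _ hR
  obtain ⟨D, hD0, hD⟩ := hq.exists_abs_integral_le h k2 T
  have hW0 : 0 ≤ (1 + ‖x₀‖) ^ k2 := by positivity
  set A := C1 + C2 * (1 + ‖x₀‖) ^ k2 + C2 * D with hA
  have hA0 : 0 ≤ A := by positivity
  refine ⟨A, hA0, fun s N hs hs1 hN => ?_⟩
  have hs2 : s ^ 2 ≤ 1 := pow_le_one₀ hs.le hs1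
  have hs20 : 0 < s ^ 2 := by positivity
  have hs43 : (s ^ 2) ^ 2 ≤ s ^ 3 := by
    rw [← pow_mul]; exact pow_le_pow_of_le_one hs.le hs1 (by norm_num)
  have hle : ∀ m : ℕ, m ≤ N + 1 → (m : ℝ) * s ^ 2 ≤ T := fun m hm => by
    refine le_trans ?_ hN
    gcongr
  let idx : ∀ m : ℕ, m ≤ N + 1 → {p : ℝ × ℕ // 0 ≤ p.1 ∧ p.1 ≤ 1 ∧ p.2 * p.1 ≤ T} := fun m hm =>
    ⟨(s ^ 2, m), sq_nonneg s, hs2, hle m hm⟩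
  have hcons : ∀ m, m ≤ N + 1 → ∀ x, |(R (s ^ 2))^[m + 1] f x - (R (s ^ 2))^[m] f x
      - s ^ 2 * gen B F ((R (s ^ 2))^[m] f) x| ≤ C2 * s ^ 3 * (1 + ‖x‖) ^ k2 := fun m hm x => by
    have a2 := hC2 (idx m hm) (s ^ 2) x (sq_nonneg s) hs2
    rw [Real.sqrt_sq hs.le] at a2
    rw [Function.iterate_succ_apply']
    exact a2.trans (le_of_eq (by ring))
  obtain ⟨CR, kR, -, hCR⟩ := hR.abs_le
  obtain ⟨CG, kG, -, hCG⟩ := (h.growth_gen hR).abs_le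
  -- Time is traded for iterations of the scheme: one time step of `q` against the `m`-th iterate is
  -- replaced by the `(m+1)`-st iterate at the earlier time. The base case is a single step from the
  -- point mass at `x₀`, since `q` is only available at positive times.
  have key : ∀ n m : ℕ, m + n ≤ N → |(∫ x, (R (s ^ 2))^[m] f x * q ((n + 1 : ℕ) * s ^ 2) x)
      - (R (s ^ 2))^[m + (n + 1)] f x₀| ≤ A * ((n + 1 : ℕ) * s ^ 3) := by
    intro n
    induction n with
    | zero =>
      intro m hm
      have b1 := (hC1 (idx m (by omega))).1 (s ^ 2) hs20 (by simpa using hle 1 (by omega))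
      have b2 := hcons m (by omega) x₀
      simp only [idx] at b1
      simp only [zero_add, Nat.cast_one, one_mul]
      set v := (R (s ^ 2))^[m] f
      have e : (∫ x, v x * q (s ^ 2) x) - (R (s ^ 2))^[m + 1] f x₀
          = ((∫ x, v x * q (s ^ 2) x) - v x₀ - s ^ 2 * gen B F v x₀)
          - ((R (s ^ 2))^[m + 1] f x₀ - v x₀ - s ^ 2 * gen B F v x₀) := by ring
      rw [e]
      have : 0 ≤ C2 * D := by positivity
      have hs3 : 0 ≤ s ^ 3 := by positivity
      calc _ ≤ _ := (abs_sub _ _).trans (add_le_add b1 b2)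
        _ ≤ C1 * s ^ 3 + C2 * s ^ 3 * (1 + ‖x₀‖) ^ k2 := by gcongr
        _ = (C1 + C2 * (1 + ‖x₀‖) ^ k2) * s ^ 3 := by ring
        _ ≤ A * s ^ 3 := by gcongr; linarith
    | succ n ih =>
      intro m hm
      have hr0 : 0 < ((n + 1 : ℕ) : ℝ) * s ^ 2 := by positivity
      have hrT : ((n + 1 : ℕ) : ℝ) * s ^ 2 ≤ T := hle _ (by omega)
      have er : ((n + 1 + 1 : ℕ) : ℝ) * s ^ 2 = (n + 1 : ℕ) * s ^ 2 + s ^ 2 := by push_cast; ring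
      have b1 := (hC1 (idx m (by omega))).2 ((n + 1 : ℕ) * s ^ 2) (s ^ 2) hr0 hs20
        (by rw [← er]; exact hle _ (by omega))
      have b2 := hcons m (by omega)
      have b3 := ih (m + 1) (by omega)
      rw [show m + 1 + (n + 1) = m + (n + 1 + 1) by omega] at b3
      rw [er]
      have i1 := hq.integrable_mul h (hR.1 (idx m (by omega))).continuous
        (hCR (idx m (by omega))) hr0
      have i2 := hq.integrable_mul h (hR.1 (idx (m + 1) (by omega))).continuous
        (hCR (idx (m + 1) (by omega))) hr0
      have i3 := hq.integrable_mul h ((h.growth_gen hR).1 (idx m (by omega))).continuous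
        (hCG (idx m (by omega))) hr0
      simp only [idx] at b1 i1 i2 i3
      set v := (R (s ^ 2))^[m] f
      set v' := (R (s ^ 2))^[m + 1] f
      set r := ((n + 1 : ℕ) : ℝ) * s ^ 2
      -- The local error of the scheme is polynomially bounded, and its expectation is therefore
      -- controlled by the uniform moment bounds of the weak solution.
      have e1 : (∫ x, (v' x - v x - s ^ 2 * gen B F v x) * q r x)
          = (∫ x, v' x * q r x) - (∫ x, v x * q r x) - s ^ 2 * ∫ x, gen B F v x * q r x := by
        have i4 : Integrable fun x => v' x * q r x - v x * q r x := i2.sub i1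
        rw [← integral_const_mul, ← integral_sub i2 i1, ← integral_sub i4 (i3.const_mul _)]
        exact integral_congr_ae (Eventually.of_forall fun x => by ring_nf)
      have b4 := hD (fun x => v' x - v x - s ^ 2 * gen B F v x) (C2 * s ^ 3) (by positivity) b2 r
        hr0 hrT
      rw [e1] at b4
      have e : (∫ x, v x * q (r + s ^ 2) x) - (R (s ^ 2))^[m + (n + 1 + 1)] f x₀
          = ((∫ x, v x * q (r + s ^ 2) x) - (∫ x, v x * q r x)
            - s ^ 2 * ∫ x, gen B F v x * q r x)
          - ((∫ x, v' x * q r x) - (∫ x, v x * q r x) - s ^ 2 * ∫ x, gen B F v x * q r x)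
          + ((∫ x, v' x * q r x) - (R (s ^ 2))^[m + (n + 1 + 1)] f x₀) := by ring
      rw [e]
      have : 0 ≤ C2 * (1 + ‖x₀‖) ^ k2 := by positivity
      calc _ ≤ _ := (abs_add_le _ _).trans (add_le_add ((abs_sub _ _).trans (add_le_add b1 b4)) b3)
        _ ≤ C1 * s ^ 3 + C2 * s ^ 3 * D + A * ((n + 1 : ℕ) * s ^ 3) := by gcongr
        _ = (C1 + C2 * D) * s ^ 3 + A * ((n + 1 : ℕ) * s ^ 3) := by ring
        _ ≤ A * s ^ 3 + A * ((n + 1 : ℕ) * s ^ 3) := by gcongr; linarith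
        _ = _ := by push_cast; ring
  simpa using key N 0 (by omega)

/-- The iterated transition operators of a consistent kernel converge to the expectations with
respect to the weak solution. -/
lemma IsConsistent.tendsto_iterate (h : Admissible B F) (hp : IsConsistent B F p s₀) {x₀ : Coord d}
    {q : ℝ → Coord d → ℝ} (hq : WeakSolution B F x₀ q) {f : Coord d → ℝ}
    (hf : Growth 1 (fun _ : Unit => f)) {t : ℝ} (ht : 0 < t) :
    Tendsto (fun N : ℕ => (stepOp p (t / (N + 1)))^[N + 1] f x₀) atTop (𝓝 (∫ x, f x * q t x)) := by
  obtain ⟨R, hR, hRc⟩ := h.exists_scheme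
  obtain ⟨C1, hC10, hC1⟩ := hp.exists_iterate_sub_bound h (hR f hf t) hRc x₀
  obtain ⟨C2, hC20, hC2⟩ := hq.exists_iterate_sub_bound h (hR f hf t) hRc
  have h0 : Tendsto (fun N : ℕ => t / ((N : ℝ) + 1)) atTop (𝓝 0) := by
    simpa [div_eq_mul_inv] using
      (tendsto_one_div_add_atTop_nhds_zero_nat (𝕜 := ℝ)).const_mul t
  have h1 : Tendsto (fun N : ℕ => Real.sqrt (t / ((N : ℝ) + 1))) atTop (𝓝 0) := by
    have := (Real.continuous_sqrt.tendsto 0).comp h0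
    rwa [Real.sqrt_zero] at this
  have h2 : Tendsto (fun N : ℕ => (C1 + C2) * t * Real.sqrt (t / ((N : ℝ) + 1))) atTop (𝓝 0) := by
    simpa using h1.const_mul ((C1 + C2) * t)
  rw [tendsto_iff_norm_sub_tendsto_zero]
  refine squeeze_zero' (Eventually.of_forall fun N => norm_nonneg _) ?_ h2
  filter_upwards [h1.eventually (ge_mem_nhds hp.pos)] with N hN
  set s := Real.sqrt (t / ((N : ℝ) + 1)) with hs
  have hpos : 0 < t / ((N : ℝ) + 1) := by positivity
  have hs0 : 0 < s := Real.sqrt_pos.2 hpos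
  have hss : s ^ 2 = t / ((N : ℝ) + 1) := Real.sq_sqrt hpos.le
  have hNt : ((N + 1 : ℕ) : ℝ) * s ^ 2 = t := by
    rw [hss]; push_cast; field_simp
  have a1 := hC1 s (N + 1) hs0 hN hNt.le
  have a2 := hC2 s N hs0 (hN.trans hp.le_one) hNt.le
  rw [hNt] at a2
  rw [← hss, Real.norm_eq_abs]
  -- The number of steps times the local error: `t/s²` errors of size `s³` amount to `t s`, which
  -- tends to zero.
  have e3 : ((N + 1 : ℕ) : ℝ) * s ^ 3 = t * s := by rw [← hNt]; ring
  rw [e3] at a1 a2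
  rw [abs_sub_comm] at a2
  calc _ ≤ _ := abs_sub_le _ ((R (s ^ 2))^[N + 1] f x₀) _
    _ ≤ _ := add_le_add a1 a2
    _ = _ := by ring

end Kernel

/-! ### Path integrals -/

section Path

variable {B : Coord d → Matrix (Fin d) (Fin d) ℝ} {F : Fin d → Coord d → ℝ} {p : SliceKernel d}
  {s₀ : ℝ}

lemma pathWeight_cons (p : SliceKernel d) (N : ℕ) (t : ℝ) (x₀ y : Coord d)
    (γ : Fin (N + 1) → Coord d) :
    pathWeight p (N + 1) t x₀ (Fin.cons y γ : Fin (N + 2) → Coord d)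
      = p t x₀ y * pathWeight p N t y γ := by
  rw [pathWeight, Fin.prod_univ_succ]
  rfl

lemma IsConsistent.pathWeight_nonneg (hp : IsConsistent B F p s₀) (N : ℕ) (t : ℝ) (x₀ : Coord d)
    (γ : Fin (N + 1) → Coord d) : 0 ≤ pathWeight p N t x₀ γ :=
  Finset.prod_nonneg fun _ _ => hp.nonneg _ _ _

lemma IsConsistent.continuous_pathWeight (hp : IsConsistent B F p s₀) (N : ℕ) (t : ℝ) :
    Continuous fun z : Coord d × (Fin (N + 1) → Coord d) => pathWeight p N t z.1 z.2 := by
  unfold pathWeight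
  refine continuous_finsetProd _ fun k _ => (hp.continuous t).comp (Continuous.prodMk ?_ ?_)
  · refine Fin.cases ?_ (fun i => ?_) k
    · exact continuous_fst
    · exact (continuous_apply _).comp continuous_snd
  · exact (continuous_apply k).comp continuous_snd

/-- The time-slicing path integral is an iterated transition operator. -/
lemma IsConsistent.integral_path (hp : IsConsistent B F p s₀) {s : ℝ} (hs : 0 < s) (hss : s ≤ s₀)
    (N : ℕ) : ∀ (f : Coord d → ℝ), PolyBounded f → ∀ x₀ : Coord d,
      Integrable (fun γ : Fin (N + 1) → Coord d =>
        f (γ (Fin.last N)) * pathWeight p N (s ^ 2) x₀ γ) ∧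
      ∫ γ : Fin (N + 1) → Coord d, f (γ (Fin.last N)) * pathWeight p N (s ^ 2) x₀ γ
        = (stepOp p (s ^ 2))^[N + 1] f x₀ := by
  induction N with
  | zero =>
    intro f hf x₀
    have mp := volume_preserving_funUnique (Fin 1) (Coord d)
    have e : (fun γ : Fin 1 → Coord d => f (γ (Fin.last 0)) * pathWeight p 0 (s ^ 2) x₀ γ)
        = (fun x => f x * p (s ^ 2) x₀ x) ∘ MeasurableEquiv.funUnique (Fin 1) (Coord d) := by
      funext γ
      simp [pathWeight, MeasurableEquiv.funUnique]
    refine ⟨?_, ?_⟩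
    · rw [e]
      exact (mp.integrable_comp_emb (MeasurableEquiv.measurableEmbedding _)).2
        (hp.integrable_mul hs hss x₀ hf)
    · rw [e]
      exact mp.integral_comp' fun x => f x * p (s ^ 2) x₀ x
  | succ N ih =>
    intro f hf x₀
    -- The first slice is separated. The remaining path starts at a varying point, which is why the
    -- induction quantifies over the starting point.
    set e := MeasurableEquiv.piFinSuccAbove (fun _ : Fin (N + 2) => Coord d) 0 with he
    have mp : MeasurePreserving e := volume_preserving_piFinSuccAbove _ 0
    set H : Coord d × (Fin (N + 1) → Coord d) → ℝ := fun z =>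
      p (s ^ 2) x₀ z.1 * (f (z.2 (Fin.last N)) * pathWeight p N (s ^ 2) z.1 z.2) with hH
    have hHe : (fun γ : Fin (N + 2) → Coord d =>
        f (γ (Fin.last (N + 1))) * pathWeight p (N + 1) (s ^ 2) x₀ γ) = H ∘ e := by
      funext γ
      have h1 : γ = Fin.cons (γ 0) (fun i => γ i.succ) := (Fin.cons_self_tail γ).symm
      have h2 : e γ = (γ 0, fun i => γ i.succ) := rfl
      rw [Function.comp_apply, h2]
      conv_lhs => rw [h1, pathWeight_cons]
      simp only [hH, ← Fin.succ_last, Fin.cons_succ]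
      ring
    have hHm : AEStronglyMeasurable H (volume.prod volume) := by
      have m1 : Measurable fun z : Coord d × (Fin (N + 1) → Coord d) => f (z.2 (Fin.last N)) :=
        hf.1.comp ((measurable_pi_apply _).comp measurable_snd)
      have m2 : Measurable fun z : Coord d × (Fin (N + 1) → Coord d) => p (s ^ 2) x₀ z.1 :=
        (hp.continuous_left _ _).measurable.comp measurable_fst
      exact (m2.mul (m1.mul (hp.continuous_pathWeight N _).measurable)).aestronglyMeasurable
    have hHi : Integrable H (volume.prod volume) := by
      rw [integrable_prod_iff hHm]
      refine ⟨Eventually.of_forall fun y => (ih f hf y).1.const_mul (p (s ^ 2) x₀ y), ?_⟩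
      -- Absolute convergence: by nonnegativity of the kernel, the inner integral of the absolute
      -- value is the same iterated operator applied to `|f|`, which is again polynomially bounded.
      have h1 : ∀ y, ∫ γ : Fin (N + 1) → Coord d, ‖H (y, γ)‖
          = (stepOp p (s ^ 2))^[N + 1] (fun x => |f x|) y * p (s ^ 2) x₀ y := fun y => by
        rw [← (ih _ hf.abs y).2, mul_comm, ← integral_const_mul]
        refine integral_congr_ae (Eventually.of_forall fun γ => ?_)
        simp only [hH, norm_mul, Real.norm_of_nonneg (hp.nonneg _ _ _),
          Real.norm_of_nonneg (hp.pathWeight_nonneg _ _ _ _), Real.norm_eq_abs]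
      simp only [h1]
      exact hp.integrable_mul hs hss x₀ (hp.polyBounded_stepOp_iterate hs hss hf.abs _)
    refine ⟨?_, ?_⟩
    · rw [hHe]
      exact (mp.integrable_comp_emb (MeasurableEquiv.measurableEmbedding _)).2 hHi
    · rw [hHe, Function.iterate_succ_apply']
      refine (mp.integral_comp' H).trans ?_
      rw [Measure.volume_eq_prod, integral_prod H hHi, stepOp]
      refine integral_congr_ae (Eventually.of_forall fun y => ?_)
      simp only [hH, integral_const_mul]
      rw [(ih f hf y).2, mul_comm]

/-- A consistent kernel represents the weak solutions. -/
lemma IsConsistent.isRepresentation (h : Admissible B F) (hp : IsConsistent B F p s₀)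
    {q : SliceKernel d} (hq : ∀ x₀, WeakSolution B F x₀ fun t => q t x₀) :
    IsRepresentation p q := by
  intro x₀ t ht M I
  have hf := growth_monomial I x₀
  have hpf := hf.polyBounded ()
  obtain ⟨C, k, -, hC⟩ := hf.abs_le
  have hev : ∀ᶠ N : ℕ in atTop, 0 < Real.sqrt (t / ((N : ℝ) + 1)) ∧
      Real.sqrt (t / ((N : ℝ) + 1)) ≤ s₀ ∧ Real.sqrt (t / ((N : ℝ) + 1)) ^ 2 = t / (N + 1) := by
    have h0 : Tendsto (fun N : ℕ => t / ((N : ℝ) + 1)) atTop (𝓝 0) := by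
      simpa [div_eq_mul_inv] using
        (tendsto_one_div_add_atTop_nhds_zero_nat (𝕜 := ℝ)).const_mul t
    have h1 := (Real.continuous_sqrt.tendsto 0).comp h0
    rw [Real.sqrt_zero] at h1
    filter_upwards [h1.eventually (ge_mem_nhds hp.pos)] with N hN
    have hpos : 0 < t / ((N : ℝ) + 1) := by positivity
    exact ⟨Real.sqrt_pos.2 hpos, hN, Real.sq_sqrt hpos.le⟩
  refine ⟨(hq x₀).integrable_mul h (hf.1 ()).continuous (hC ()) ht, ?_, ?_⟩
  · filter_upwards [hev] with N hN
    rw [← hN.2.2]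
    exact (hp.integral_path hN.1 hN.2.1 N _ hpf x₀).1
  · refine (hp.tendsto_iterate h (hq x₀) hf ht).congr' ?_
    filter_upwards [hev] with N hN
    rw [← hN.2.2]
    exact (hp.integral_path hN.1 hN.2.1 N _ hpf x₀).2.symm

/-- The moments of a consistent kernel. -/
lemma IsConsistent.moment_expansion (hp : IsConsistent B F p s₀) (x₀ : Coord d) {M : ℕ}
    (I : Fin M → Fin d) :
    (∀ᶠ t in 𝓝[>] (0 : ℝ), Integrable fun x => monomial I x₀ x * p t x₀ x) ∧
    (fun t => moment p t x₀ I - monomial I x₀ x₀ - t * gen B F (monomial I x₀) x₀)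
      =o[𝓝[>] (0 : ℝ)] (fun t => t) := by
  have hf := growth_monomial I x₀
  have hsq : Tendsto Real.sqrt (𝓝[>] (0 : ℝ)) (𝓝 0) := by
    have := Real.continuous_sqrt.tendsto 0
    rw [Real.sqrt_zero] at this
    exact this.mono_left nhdsWithin_le_nhds
  have hev : ∀ᶠ t : ℝ in 𝓝[>] (0 : ℝ), 0 < t ∧ Real.sqrt t ≤ s₀ := by
    filter_upwards [self_mem_nhdsWithin, hsq.eventually (ge_mem_nhds hp.pos)] with t ht hts
    exact ⟨ht, hts⟩
  refine ⟨?_, ?_⟩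
  · filter_upwards [hev] with t ht
    have := hp.integrable_mul (Real.sqrt_pos.2 ht.1) ht.2 x₀ (hf.polyBounded ())
    rwa [Real.sq_sqrt ht.1.le] at this
  · obtain ⟨C, k, hC0, hC⟩ := hp.stepOp_sub_gen_bound hf
    -- With `s = √t` the error `s³` is `t√t`, hence `o(t)`.
    have hO : (fun t => moment p t x₀ I - monomial I x₀ x₀ - t * gen B F (monomial I x₀) x₀)
        =O[𝓝[>] (0 : ℝ)] (fun t => Real.sqrt t * t) := by
      refine IsBigO.of_bound (C * (1 + ‖x₀‖) ^ k) ?_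
      filter_upwards [hev] with t ht
      have h1 := hC () (Real.sqrt t) x₀ (Real.sqrt_pos.2 ht.1) ht.2
      have h2 := Real.sq_sqrt ht.1.le
      rw [pow_succ _ 2, h2] at h1
      rw [Real.norm_eq_abs, Real.norm_of_nonneg (mul_nonneg (Real.sqrt_nonneg t) ht.1.le)]
      exact h1.trans (le_of_eq (by ring))
    refine hO.trans_isLittleO ?_
    have : (fun t : ℝ => Real.sqrt t * t) =o[𝓝[>] (0 : ℝ)] fun t => (1 : ℝ) * t :=
      ((isLittleO_one_iff ℝ).2 hsq).mul_isBigO (isBigO_refl _ _)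
    simpa only [one_mul] using this

/-- Consistent kernels are equivalent. -/
lemma IsConsistent.momentEquivalent (hp : IsConsistent B F p s₀) {p' : SliceKernel d} {s₁ : ℝ}
    (hp' : IsConsistent B F p' s₁) : MomentEquivalent p p' := by
  intro x₀ M I
  obtain ⟨a1, a2⟩ := hp.moment_expansion x₀ I
  obtain ⟨b1, b2⟩ := hp'.moment_expansion x₀ I
  refine ⟨a1.and b1, (a2.sub b2).congr_left fun t => ?_⟩
  ring

/-- A consistent kernel is equivalent to the exact kernel. -/
lemma IsConsistent.momentEquivalent_weakSolution (h : Admissible B F) (hp : IsConsistent B F p s₀)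
    {q : SliceKernel d} (hq : ∀ x₀, WeakSolution B F x₀ fun t => q t x₀) :
    MomentEquivalent p q := by
  intro x₀ M I
  obtain ⟨a1, a2⟩ := hp.moment_expansion x₀ I
  have b2 := (hq x₀).moment_expansion h I
  have hf := growth_monomial I x₀
  obtain ⟨C, k, -, hC⟩ := hf.abs_le
  refine ⟨a1.and ?_, ?_⟩
  · filter_upwards [self_mem_nhdsWithin] with t ht
    exact (hq x₀).integrable_mul h (hf.1 ()).continuous (hC ()) ht
  · have hO : (fun t : ℝ => t ^ 2) =o[𝓝[>] (0 : ℝ)] fun t => t := by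
      have := (isLittleO_pow_id (𝕜 := ℝ) (n := 2) (by norm_num)).mono
        (nhdsWithin_le_nhds (s := Set.Ioi (0 : ℝ)))
      exact this
    refine (a2.sub (b2.trans_isLittleO hO)).congr_left fun t => ?_
    simp only [moment]
    ring

end Path

/-! ### The Gaussian kernel -/

lemma moment_eq_integral_one (p : SliceKernel d) (t : ℝ) (x₀ : Coord d) :
    moment p t x₀ ![] = ∫ x, p t x₀ x := by
  simp [moment, monomial]

/-- The Gaussian kernel, centred and rescaled. -/
lemma gaussianKernel_rescale (g L : Coord d → Matrix (Fin d) (Fin d) ℝ) (U : Coord d → ℝ) {s : ℝ}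
    (hs : 0 < s) (x₀ c : Coord d) (hc : ∀ i, c i = x₀ i + s ^ 2 * drift g L U i x₀) (η : Coord d) :
    s ^ d * gaussianKernel g L U (s ^ 2) x₀ (c + s • η) = gaussianDensity (symPart L x₀) 1 η := by
  rw [← gaussianDensity_smul _ hs]
  have : (fun i => ((c + s • η) i - x₀ i) - s ^ 2 * drift g L U i x₀) = s • η := by
    funext i
    simp only [Pi.add_apply, Pi.smul_apply, smul_eq_mul, hc]
    ring
  have key : gaussianKernel g L U (s ^ 2) x₀ (c + s • η) = gaussianDensity (symPart L x₀) (s ^ 2)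
    (fun i => ((c + s • η) i - x₀ i) - s ^ 2 * drift g L U i x₀) := rfl
  rw [key, this]

/-- Covariance and drift are frozen at `x₀`, so centring at `x₀ + tF` and rescaling by `√t` produces
a fixed Gaussian. The identities are exact for every `t > 0`. -/
theorem gaussianKernel_moments {g L : Coord d → Matrix (Fin d) (Fin d) ℝ} {U : Coord d → ℝ}
    (hreg : RegularCoefficients g L U) (x₀ : Coord d) {t : ℝ} (ht : 0 < t) :
    (∀ (M : ℕ) (I : Fin M → Fin d), Integrable (fun x =>
      monomial I x₀ x * gaussianKernel g L U t x₀ x)) ∧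
    moment (gaussianKernel g L U) t x₀ ![] = 1 ∧
    (∀ i, moment (gaussianKernel g L U) t x₀ ![i] = t * drift g L U i x₀) ∧
    (∀ i j, ∫ x, (x i - x₀ i - t * drift g L U i x₀) * (x j - x₀ j - t * drift g L U j x₀)
      * gaussianKernel g L U t x₀ x = 2 * t * symPart L x₀ i j) := by
  have h := hreg.admissible
  obtain ⟨c, hc, hq⟩ := h.exists_quadForm_ge
  have hA := h.posDef x₀
  obtain ⟨m1, m2⟩ := gaussianDensity_moments hA hc (hq x₀)
  obtain ⟨s, hs, rfl⟩ : ∃ s, 0 < s ∧ t = s ^ 2 :=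
    ⟨Real.sqrt t, Real.sqrt_pos.2 ht, (Real.sq_sqrt ht.le).symm⟩
  set b : Coord d := fun i => x₀ i + s ^ 2 * drift g L U i x₀ with hb
  set Γ := gaussianDensity (symPart L x₀) 1 with hΓ
  have hk := gaussianKernel_rescale g L U hs x₀ b fun i => rfl
  have hk' : ∀ (f : Coord d → ℝ) η, s ^ d * (f (b + s • η)
      * gaussianKernel g L U (s ^ 2) x₀ (b + s • η)) = f (b + s • η) * Γ η := fun f η => by
    rw [hΓ, ← hk η]; ring
  have hcv : ∀ f : Coord d → ℝ, ∫ x, f x * gaussianKernel g L U (s ^ 2) x₀ x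
      = ∫ η, f (b + s • η) * Γ η := fun f => by
    rw [← integral_comp_affine hs b]
    simp only [hk' f]
  have hi : ∀ f : Coord d → ℝ, Continuous f → PolyBounded f →
      Integrable (fun η => f (b + s • η) * Γ η) := fun f hf hp => by
    obtain ⟨-, A, n, hA0, hfn⟩ := hp
    have hfb : Continuous fun η : Coord d => f (b + s • η) := hf.comp (by fun_prop)
    refine integrable_mul_gaussianDensity hc (hq x₀) hfb
      (C := A * (1 + ‖b‖) ^ n * (1 + s) ^ n) (k := n) fun η => (hfn _).trans ?_
    have h1 := weight_add_le b (s • η) n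
    have h2 : (1 + ‖s • η‖) ^ n ≤ (1 + s) ^ n * (1 + ‖η‖) ^ n := by
      rw [← mul_pow]
      gcongr
      rw [norm_smul, Real.norm_of_nonneg hs.le]
      have := norm_nonneg η
      linarith
    calc _ ≤ A * ((1 + ‖b‖) ^ n * ((1 + s) ^ n * (1 + ‖η‖) ^ n)) := by
          gcongr
          exact h1.trans (by gcongr)
      _ = _ := by ring
  have hΓi : Integrable Γ := by simpa using hi (fun _ => 1) continuous_const (polyBounded_const 1)
  have hmass : ∫ x, gaussianKernel g L U (s ^ 2) x₀ x = 1 := by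
    have := hcv fun _ => 1
    simp only [one_mul] at this
    rw [this, hΓ, integral_gaussianDensity hA]
  have hcoord : ∀ i, Integrable fun η : Coord d => η i * Γ η := fun i =>
    integrable_mul_gaussianDensity hc (hq x₀) (continuous_apply i) fun η => abs_coord_le_weight η i
  refine ⟨fun M I => ?_, ?_, fun i => ?_, fun i k => ?_⟩
  · have hf := growth_monomial I x₀
    refine integrable_comp_affine hs b ?_
    have := hk' (monomial I x₀)
    simp only [this]
    exact hi _ (hf.1 ()).continuous (hf.polyBounded ())
  · rw [moment_eq_integral_one, hmass]
  · have e : ∀ η : Coord d, monomial ![i] x₀ (b + s • η) * Γ η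
        = s ^ 2 * drift g L U i x₀ * Γ η + s * (η i * Γ η) := fun η => by
      simp only [monomial, Finset.univ_unique, Finset.prod_singleton, hb, Pi.add_apply,
        Pi.smul_apply, smul_eq_mul, Matrix.cons_val_fin_one]
      ring
    rw [moment, hcv]
    simp only [e]
    rw [integral_add (hΓi.const_mul _) ((hcoord i).const_mul _), integral_const_mul,
      integral_const_mul, m1 i, hΓ, integral_gaussianDensity hA]
    ring
  · rw [hcv fun x => (x i - x₀ i - s ^ 2 * drift g L U i x₀)
      * (x k - x₀ k - s ^ 2 * drift g L U k x₀)]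
    have e : ∀ η : Coord d, ((b + s • η) i - x₀ i - s ^ 2 * drift g L U i x₀)
        * ((b + s • η) k - x₀ k - s ^ 2 * drift g L U k x₀) * Γ η
        = s ^ 2 * (η i * η k * Γ η) := fun η => by
      simp only [hb, Pi.add_apply, Pi.smul_apply, smul_eq_mul]
      ring
    simp only [e]
    rw [integral_const_mul, m2 i k]
    ring

end CovariantFP

end

/-! ### Assembly: every kernel is consistent -/

theorem mainTheorem7 {d : ℕ}
    (g L : CovariantFP.Coord d → Matrix (Fin d) (Fin d) ℝ) (U : CovariantFP.Coord d → ℝ)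
    (hreg : CovariantFP.RegularCoefficients g L U)
    (G : ℝ → CovariantFP.Coord d → CovariantFP.Coord d → ℝ)
    (hG : CovariantFP.IsGreenFunction g L U G) :
    -- moments of the exact transition probability over a time step
    (∀ x₀ : CovariantFP.Coord d,
      (fun t => CovariantFP.moment (CovariantFP.exactKernel g G) t x₀ ![] - 1)
        =O[𝓝[>] (0 : ℝ)] (fun t => t ^ 2) ∧
      (∀ i, (fun t => CovariantFP.moment (CovariantFP.exactKernel g G) t x₀ ![i]
          - t * CovariantFP.drift g L U i x₀) =O[𝓝[>] (0 : ℝ)] (fun t => t ^ 2)) ∧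
      (∀ i j, (fun t => CovariantFP.moment (CovariantFP.exactKernel g G) t x₀ ![i, j]
          - 2 * t * CovariantFP.symPart L x₀ i j) =O[𝓝[>] (0 : ℝ)] (fun t => t ^ 2)) ∧
      (∀ M : ℕ, 3 ≤ M → ∀ I : Fin M → Fin d,
        (fun t => CovariantFP.moment (CovariantFP.exactKernel g G) t x₀ I)
          =O[𝓝[>] (0 : ℝ)] (fun t => t ^ 2))) ∧
    -- the Gaussian kernel: a probability density with drift `F` and covariance `2 B`
    (∀ (x₀ : CovariantFP.Coord d) (t : ℝ), 0 < t →
      (∀ (M : ℕ) (I : Fin M → Fin d), Integrable (fun x =>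
        CovariantFP.monomial I x₀ x * CovariantFP.gaussianKernel g L U t x₀ x)) ∧
      CovariantFP.moment (CovariantFP.gaussianKernel g L U) t x₀ ![] = 1 ∧
      (∀ i, CovariantFP.moment (CovariantFP.gaussianKernel g L U) t x₀ ![i]
        = t * CovariantFP.drift g L U i x₀) ∧
      (∀ i j, ∫ x, (x i - x₀ i - t * CovariantFP.drift g L U i x₀)
          * (x j - x₀ j - t * CovariantFP.drift g L U j x₀)
          * CovariantFP.gaussianKernel g L U t x₀ x
        = 2 * t * CovariantFP.symPart L x₀ i j)) ∧
    -- the Gaussian representation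
    (CovariantFP.IsRepresentation (CovariantFP.gaussianKernel g L U)
        (CovariantFP.exactKernel g G) ∧
      CovariantFP.MomentEquivalent (CovariantFP.gaussianKernel g L U)
        (CovariantFP.exactKernel g G)) ∧
    -- the one-parameter family
    (∀ α ∈ Set.Icc (0 : ℝ) 1,
      CovariantFP.IsRepresentation (CovariantFP.alphaKernel g L U α)
        (CovariantFP.exactKernel g G) ∧
      CovariantFP.MomentEquivalent (CovariantFP.alphaKernel g L U α)
        (CovariantFP.exactKernel g G) ∧
      CovariantFP.MomentEquivalent (CovariantFP.alphaKernel g L U α)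
        (CovariantFP.gaussianKernel g L U)) ∧
    -- the two-parameter family
    (∀ α₁ ∈ Set.Icc (0 : ℝ) 1, ∀ α₂ ∈ Set.Icc (0 : ℝ) 1,
      CovariantFP.IsRepresentation (CovariantFP.twoAlphaKernel g L U α₁ α₂)
        (CovariantFP.exactKernel g G) ∧
      CovariantFP.MomentEquivalent (CovariantFP.twoAlphaKernel g L U α₁ α₂)
        (CovariantFP.exactKernel g G) ∧
      CovariantFP.MomentEquivalent (CovariantFP.twoAlphaKernel g L U α₁ α₂)
        (CovariantFP.gaussianKernel g L U)) ∧
    -- any two members of the families are equivalent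
    (∀ α ∈ Set.Icc (0 : ℝ) 1, ∀ β ∈ Set.Icc (0 : ℝ) 1,
      CovariantFP.MomentEquivalent (CovariantFP.alphaKernel g L U α)
        (CovariantFP.alphaKernel g L U β)) ∧
    (∀ α₁ ∈ Set.Icc (0 : ℝ) 1, ∀ α₂ ∈ Set.Icc (0 : ℝ) 1,
      ∀ β₁ ∈ Set.Icc (0 : ℝ) 1, ∀ β₂ ∈ Set.Icc (0 : ℝ) 1,
      CovariantFP.MomentEquivalent (CovariantFP.twoAlphaKernel g L U α₁ α₂)
        (CovariantFP.twoAlphaKernel g L U β₁ β₂)) := by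
  have h := hreg.admissible
  have hq := fun x₀ => hG.weakSolution hreg x₀
  have two : ∀ α₁ ∈ Set.Icc (0 : ℝ) 1, ∀ α₂ ∈ Set.Icc (0 : ℝ) 1, ∃ s₀,
      CovariantFP.IsConsistent (CovariantFP.symPart L) (CovariantFP.drift g L U)
        (CovariantFP.twoAlphaKernel g L U α₁ α₂) s₀ := fun α₁ h₁ α₂ h₂ => by
    rw [CovariantFP.twoAlphaKernel_eq]
    exact h.exists_isConsistent_sliceKernel h₁ h₂
  have h0 : (0 : ℝ) ∈ Set.Icc (0 : ℝ) 1 := ⟨le_rfl, zero_le_one⟩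
  -- At parameters `(0, 0)` all coefficients are evaluated at the initial point and the corrections
  -- vanish, which is the Gaussian kernel.
  obtain ⟨r, gauss⟩ := two 0 h0 0 h0
  rw [← CovariantFP.gaussianKernel_eq] at gauss
  have one : ∀ α ∈ Set.Icc (0 : ℝ) 1, ∃ s₀,
      CovariantFP.IsConsistent (CovariantFP.symPart L) (CovariantFP.drift g L U)
        (CovariantFP.alphaKernel g L U α) s₀ := fun α hα => by
    rw [CovariantFP.alphaKernel_eq]
    exact two α hα α hα
  refine ⟨fun x₀ => CovariantFP.exactKernel_moments hreg hG x₀,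
    fun x₀ t ht => CovariantFP.gaussianKernel_moments hreg x₀ ht,
    ⟨gauss.isRepresentation h hq, gauss.momentEquivalent_weakSolution h hq⟩,
    fun α hα => ?_, fun α₁ h₁ α₂ h₂ => ?_, fun α hα β hβ => ?_,
    fun α₁ h₁ α₂ h₂ β₁ k₁ β₂ k₂ => ?_⟩
  · obtain ⟨s, hs⟩ := one α hα
    exact ⟨hs.isRepresentation h hq, hs.momentEquivalent_weakSolution h hq,
      hs.momentEquivalent gauss⟩
  · obtain ⟨s, hs⟩ := two α₁ h₁ α₂ h₂
    exact ⟨hs.isRepresentation h hq, hs.momentEquivalent_weakSolution h hq,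
      hs.momentEquivalent gauss⟩
  · obtain ⟨s, hs⟩ := one α hα
    obtain ⟨s', hs'⟩ := one β hβ
    exact hs.momentEquivalent hs'
  · obtain ⟨s, hs⟩ := two α₁ h₁ α₂ h₂
    obtain ⟨s', hs'⟩ := two β₁ k₁ β₂ k₂
    exact hs.momentEquivalent hs'
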